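/- **Problem (Generalized Binary $\ell_0$-Rank-$k$).** Given integers $n\ge d\ge 1$ and $k\ge 1$, a matrix $A\in\{0,1\}^{n\times d}$ and an arbitrary function $\langle\cdot,\cdot\rangle\colon\{0,1\}^k\times\{0,1\}^k\to\mathbb R$, find $U\in\{0,1\}^{n\times k}$ and $V\in\{0,1\}^{k\times d}$ minimizing $\|A-U\cdot V\|_0$. Here $U\cdot V$ is the $n\times d$ matrix with entries $(U\cdot V)_{i,j}=\langle U_{i,:},V_{:,j}\rangle$, and $\|B\|_0$ is the number of nonzero entries of $B$. A pair $(U,V)$ is $\alpha$-approximate if $\|A-U\cdot V\|_0\le\alpha\cdot\min_{U',V'}\|A-U'\cdot V'\|_0$, the minimum being over all $U'\in\{0,1\}^{n\times k}$, $V'\in\{0,1\}^{k\times d}$. **Computational model.** Algorithms are randomized unit-cost RAM programs with the usual instructions on words (natural numbers): constants, $+$, truncated $-$, $\times$, integer division with remainder, comparisons, indirect loads and stores, and control flow. One further instruction draws a uniformly random element of $\{0,\dots,m-1\}$ for a word $m\geq 1$. The function $\langle\cdot,\cdot\rangle$ is accessible only through queries that test whether $\langle x,y\rangle=v$ for given $x,y\in\{0,1\}^k$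 and a given word $v$. One evaluation of $\langle\cdot,\cdot\rangle$ is assumed to take time $2^{O(k)}$, that is, at most $2^{ck}$ for a fixed constant $c$. Every other instruction takes one unit of time. **Theorem (PTAS for $p=0$).** For every constant $c$ there is a constant $C>0$ such that for every $\varepsilon\in(0,\tfrac12)$ there is a randomized algorithm (a single program for all $n\ge d\ge1$, all $k\ge1$, all $A\in\{0,1\}^{n\times d}$ and all functions $\langle\cdot,\cdot\rangle$ that can be evaluated in time at most $2^{ck}$) with the following properties. On every input and for every outcome of its random choices it halts within time $$T=(1/\varepsilon)^{2^{Ck}/\varepsilon^2}\cdot n\cdot d^{\,1+C(\log\log d)^{1.1}/\log d}$$ and uses only words smaller than $\lfloor T\rfloor$. With probability at least $2/3$ it outputs a $(1+\varepsilon)$-approximate pair $(U,V)$. (Logarithms are to base $2$; for $d=1$ the last factor of $T$ is read as $1$.) In other words, there is a $(1+\varepsilon)$-approximation algorithm for Generalized Binary $\ell_0$-Rank-$k$ that runs in time $(1/\varepsilon)^{2^{O(k)}/\varepsilon^2}\cdot n\,d^{1+o(1)}$ and succeeds with constant probability, where $o(1)$ is $O\big((\log\log d)^{1.1}/\log d\big)$.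 -/

import Mathlib

/-! ### The optimization problem -/

namespace GenBinary

/-- The number `0` or `1` that a bit stands for. -/
def bitVal (b : Bool) : ℝ := if b then 1 else 0

/-- `‖B‖₀`, the number of nonzero entries of a real matrix. -/
noncomputable def nnz {n d : ℕ} (B : Matrix (Fin n) (Fin d) ℝ) : ℕ :=
  {p : Fin n × Fin d | B p.1 p.2 ≠ 0}.ncard

/-- The product of binary matrices with respect to an arbitrary function
`ip : {0,1}^k × {0,1}^k → ℝ`: entry `(i, j)` is `ip` of row `i` of `U` and column `j` of `V`. -/
def genMul {n d k : ℕ} (ip : (Fin k → Bool) → (Fin k → Bool) → ℝ)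
    (U : Matrix (Fin n) (Fin k) Bool) (V : Matrix (Fin k) (Fin d) Bool) :
    Matrix (Fin n) (Fin d) ℝ :=
  fun i j => ip (U i) (fun l => V l j)

/-- The objective `‖A - U V‖₀`. -/
noncomputable def cost {n d k : ℕ} (ip : (Fin k → Bool) → (Fin k → Bool) → ℝ)
    (A : Matrix (Fin n) (Fin d) Bool)
    (U : Matrix (Fin n) (Fin k) Bool) (V : Matrix (Fin k) (Fin d) Bool) : ℕ :=
  nnz (A.map bitVal - genMul ip U V)

/-- The optimal value, a minimum over the finite nonempty set of all pairs `(U, V)`. -/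
noncomputable def opt {n d k : ℕ} (ip : (Fin k → Bool) → (Fin k → Bool) → ℝ)
    (A : Matrix (Fin n) (Fin d) Bool) : ℕ :=
  ⨅ UV : Matrix (Fin n) (Fin k) Bool × Matrix (Fin k) (Fin d) Bool, cost ip A UV.1 UV.2

/-! ### Randomized unit-cost RAM

A program is a finite piece of syntax.  It works on registers and on a memory, both of which hold
natural numbers below a word bound, and it may draw uniform random numbers and query the
function `ip`. -/

/-- Binary word operations; comparisons return `1` for true and `0` for false. -/
inductive Op
  | add | sub | mul | div | mod | lt | eq

/-- The value of a word operation (truncated subtraction, division rounding down). -/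
def Op.eval : Op → ℕ → ℕ → ℕ
  | .add, a, b => a + b
  | .sub, a, b => a - b
  | .mul, a, b => a * b
  | .div, a, b => a / b
  | .mod, a, b => a % b
  | .lt, a, b => if a < b then 1 else 0
  | .eq, a, b => if a = b then 1 else 0

/-- Programs.  All the arguments are names of registers, except for the literal `v` of `const`. -/
inductive Prog
  /-- `R[dst] := v` -/
  | const (dst v : ℕ)
  /-- `R[dst] := R[a] op R[b]` -/
  | arith (op : Op) (dst a b : ℕ)
  /-- `R[dst] := Mem[R[addr]]` -/
  | load (dst addr : ℕ)
  /-- `Mem[R[addr]] := R[src]` -/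
  | store (addr src : ℕ)
  /-- `R[dst] :=` a uniformly random element of `{0, …, R[a] - 1}`, independent of the past -/
  | rand (dst a : ℕ)
  /-- `R[dst] := 1` if `⟨x, y⟩ = R[v]` and `R[dst] := 0` otherwise, where `x` and `y` are the
  vectors of `{0,1}^k` whose bits are the binary digits of `R[x]` and `R[y]` -/
  | query (dst x y v : ℕ)
  /-- first `p`, then `q` -/
  | seq (p q : Prog)
  /-- `p` if `R[r] ≠ 0`, otherwise `q` -/
  | ite (r : ℕ) (p q : Prog)
  /-- while `R[r] ≠ 0` do `p` -/
  | loop (r : ℕ) (p : Prog)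

/-- The contents of the registers and of the memory. -/
structure State where
  reg : ℕ → ℕ
  mem : ℕ → ℕ

/-- Assignment to a register. -/
def State.setReg (σ : State) (r v : ℕ) : State := ⟨Function.update σ.reg r v, σ.mem⟩

/-- Assignment to a memory cell. -/
def State.setMem (σ : State) (a v : ℕ) : State := ⟨σ.reg, Function.update σ.mem a v⟩

/-- What a run depends on besides the program and the initial state: words are the numbers below
`word`; `ip` is the function answering the queries, and one evaluation of it takes time
`queryTime`. -/
structure Machine (k : ℕ) where
  word : ℕ
  ip : (Fin k → Bool) → (Fin k → Bool) → ℝ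
  queryTime : ℕ

/-- The vector in `{0,1}^k` given by the binary digits of a number below `2 ^ k`. -/
def bitVec (k m : ℕ) : Fin k → Bool := fun l => m.testBit l

open Classical in
/-- The answer to a query. -/
noncomputable def Machine.answer {k : ℕ} (M : Machine k) (x y v : ℕ) : ℕ :=
  if M.ip (bitVec k x) (bitVec k y) = (v : ℝ) then 1 else 0

/-- `Exec M p σ μ`: started in the state `σ`, the program `p` halts for every outcome of its random
choices, without ever producing a number that is not a word, and `μ` is the joint
distribution of the final state and the running time.  Every instruction and every test of a
condition takes one unit of time, and a query takes `M.queryTime` units in addition. -/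
inductive Exec {k : ℕ} (M : Machine k) : Prog → State → PMF (State × ℕ) → Prop
  | const {σ : State} {dst v : ℕ} (h : v < M.word) :
      Exec M (.const dst v) σ (PMF.pure (σ.setReg dst v, 1))
  | arith {σ : State} {op : Op} {dst a b : ℕ} (h : op.eval (σ.reg a) (σ.reg b) < M.word) :
      Exec M (.arith op dst a b) σ
        (PMF.pure (σ.setReg dst (op.eval (σ.reg a) (σ.reg b)), 1))
  | load {σ : State} {dst addr : ℕ} :
      Exec M (.load dst addr) σ (PMF.pure (σ.setReg dst (σ.mem (σ.reg addr)), 1))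
  | store {σ : State} {addr src : ℕ} :
      Exec M (.store addr src) σ (PMF.pure (σ.setMem (σ.reg addr) (σ.reg src), 1))
  | rand {σ : State} {dst a : ℕ} (h : (Finset.range (σ.reg a)).Nonempty) :
      Exec M (.rand dst a) σ
        ((PMF.uniformOfFinset (Finset.range (σ.reg a)) h).map fun v => (σ.setReg dst v, 1))
  | query {σ : State} {dst x y v : ℕ} (hx : σ.reg x < 2 ^ k) (hy : σ.reg y < 2 ^ k) :
      Exec M (.query dst x y v) σ
        (PMF.pure (σ.setReg dst (M.answer (σ.reg x) (σ.reg y) (σ.reg v)), 1 + M.queryTime))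
  | seq {σ : State} {p q : Prog} {μ : PMF (State × ℕ)} {ν : State × ℕ → PMF (State × ℕ)}
      (hp : Exec M p σ μ) (hq : ∀ s ∈ μ.support, Exec M q s.1 (ν s)) :
      Exec M (.seq p q) σ (μ.bind fun s => (ν s).map fun s' => (s'.1, s.2 + s'.2))
  | ite_true {σ : State} {r : ℕ} {p q : Prog} {μ : PMF (State × ℕ)}
      (h : σ.reg r ≠ 0) (hp : Exec M p σ μ) :
      Exec M (.ite r p q) σ (μ.map fun s => (s.1, 1 + s.2))
  | ite_false {σ : State} {r : ℕ} {p q : Prog} {μ : PMF (State × ℕ)}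
      (h : σ.reg r = 0) (hq : Exec M q σ μ) :
      Exec M (.ite r p q) σ (μ.map fun s => (s.1, 1 + s.2))
  | loop_stop {σ : State} {r : ℕ} {p : Prog} (h : σ.reg r = 0) :
      Exec M (.loop r p) σ (PMF.pure (σ, 1))
  | loop_step {σ : State} {r : ℕ} {p : Prog} {μ : PMF (State × ℕ)}
      {ν : State × ℕ → PMF (State × ℕ)}
      (h : σ.reg r ≠ 0) (hp : Exec M p σ μ)
      (hl : ∀ s ∈ μ.support, Exec M (.loop r p) s.1 (ν s)) :
      Exec M (.loop r p) σ (μ.bind fun s => (ν s).map fun s' => (s'.1, 1 + s.2 + s'.2))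

/-- The initial state: `n`, `d`, `k` are in the registers `0`, `1`, `2`, and the entries of `A` are
in the memory cells `0, …, n * d - 1`, row by row.  Everything else is `0`. -/
def inputState {n d : ℕ} (k : ℕ) (A : Matrix (Fin n) (Fin d) Bool) : State where
  reg := fun r => if r = 0 then n else if r = 1 then d else if r = 2 then k else 0
  mem := fun a =>
    if h : a / d < n ∧ 0 < d then
      (A ⟨a / d, h.1⟩ ⟨a % d, Nat.mod_lt a h.2⟩).toNat
    else 0

/-- The matrix `U` that a final state holds: row by row, from the address in register `0` on. -/
def outputU (n k : ℕ) (σ : State) : Matrix (Fin n) (Fin k) Bool :=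
  fun i l => decide (σ.mem (σ.reg 0 + i * k + l) ≠ 0)

/-- The matrix `V` that a final state holds: row by row, from the address in register `1` on. -/
def outputV (d k : ℕ) (σ : State) : Matrix (Fin k) (Fin d) Bool :=
  fun l j => decide (σ.mem (σ.reg 1 + l * d + j) ≠ 0)

/-- The output of a final state is an `α`-approximate solution. -/
def IsApprox {n d k : ℕ} (α : ℝ) (ip : (Fin k → Bool) → (Fin k → Bool) → ℝ)
    (A : Matrix (Fin n) (Fin d) Bool) (σ : State) : Prop :=
  (cost ip A (outputU n k σ) (outputV d k σ) : ℝ) ≤ α * (opt ip A : ℝ)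

/-- `(1/ε)^(2^(C k) / ε²) · n · d^(1 + C (log log d)^1.1 / log d)`, with logarithms to base `2`
(for `d = 1` the last factor is `1`). -/
noncomputable def timeBound (C ε : ℝ) (k n d : ℕ) : ℝ :=
  (1 / ε) ^ ((2 : ℝ) ^ (C * k) / ε ^ 2) * n *
    (d : ℝ) ^ (1 + C * (Real.logb 2 (Real.logb 2 d)) ^ (1.1 : ℝ) / Real.logb 2 d)

end GenBinary

namespace GenBinary

open Finset

/-! ### Averages over product sets -/

/-! Fix an optimal pair; it is used in the analysis only. With `K = 2 ^ k`, rows of `U` and columns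
of `V` are labels below `K`, and the columns of `A` fall into at most `K` clusters according to the
label that the optimum gives them. Once `U` and a list of labels are known, every column simply
takes the nearest label of the list. So the task is to find labels, and a `U` that is good on the
clusters.

Sampling. Suppose `t = 12 K m²` uniform columns of each cluster are available, weighted by roughly
the size of the cluster, and every row takes the label that is best on the weighted sample. The loss
of a label on an entry depends on one bit and cannot vanish for both values of the bit, so the
variance of the difference of two losses is bounded by a product of mean losses
(`binary_variance_le`). Chebyshev's inequality and a sum over the `K` labels show that the expected
excess of a row is at most `2 / m` times its target loss (`row_excess`). Adding the rows and
applying Markov's inequality gives a good `U` with probability at least one half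
(`half_le_mav_good`).

Peeling. The clusters are unknown, and uniform samples from a list of columns hit only clusters that
are dense in it. The clusters are therefore found one at a time. After each stage the current list
is sorted by decreasing distance from the labels found so far, and the next cluster is looked for in
a prefix whose length is a power of two (or `d`). Take the longest admissible prefix in which the
columns with labels not yet found have density at least `Q ^ (-(l + 1))`; a popular label there is
the next one. In every longer prefix of the list these columns are rare. Since the list is sorted,
each level set of the distance is a prefix, so the cost of serving the left-over columns by the
found labels can be charged to columns with found labels and is a small fraction of the optimum. A
triangle inequality through the sampled clusters carries this bound over to every later `U`. If no
dense prefix exists, the found labels already suffice (`Inst.Valid.advance`). Each stage adds a new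
label, so there are at most `K` stages.

Success probability. A stage guesses a prefix length (`I1`, about `log d`, possibilities), a label
(`K`) and a weight (`G`), and its samples all land in the intended clusters with probability at
least `B ^ (-K t)` (`Inst.Valid.sampling`). A stage thus succeeds with probability at least `1 /
stageInv`, a trial with `stageInv ^ (-K)`, and `2 stageInv ^ K` trials, of which the best solution
is kept, reach `2 / 3` (`two_thirds_le`). The dimension `d` enters the number of trials only through
a power of `log d`, which `mul_le_rpow_add_pow` and `log_pow_le` absorb into the exponent of `d`.

Implementation. Programs are built from arithmetic expressions, compiled once and for all
(`Ex.comp_ok`), and from a few loops. The triples `Tri` bound the running time, keep an invariant,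
and give a lower bound for the expectation of a function of the final state. With indicator
functions such as "won, or the guesses can be continued" these bounds compose backwards through the
program. -/

/-- The average of `f` over a finite set. -/
noncomputable def avg (D : Finset ℕ) (f : ℕ → ℝ) : ℝ := (∑ s ∈ D, f s) / D.card

theorem avg_nonneg {D : Finset ℕ} {f : ℕ → ℝ} (h : ∀ s ∈ D, 0 ≤ f s) : 0 ≤ avg D f :=
  div_nonneg (sum_nonneg h) (Nat.cast_nonneg _)

theorem avg_mono {D : Finset ℕ} {f g : ℕ → ℝ} (h : ∀ s ∈ D, f s ≤ g s) : avg D f ≤ avg D g := by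
  unfold avg; gcongr with s hs; exact h s hs

theorem avg_add (D : Finset ℕ) (f g : ℕ → ℝ) :
    avg D (fun s => f s + g s) = avg D f + avg D g := by
  unfold avg; rw [sum_add_distrib, add_div]

theorem avg_sub (D : Finset ℕ) (f g : ℕ → ℝ) :
    avg D (fun s => f s - g s) = avg D f - avg D g := by
  unfold avg; rw [sum_sub_distrib, sub_div]

theorem avg_const_mul (D : Finset ℕ) (c : ℝ) (f : ℕ → ℝ) :
    avg D (fun s => c * f s) = c * avg D f := by
  unfold avg; rw [← mul_sum, mul_div_assoc]

theorem avg_const {D : Finset ℕ} (hD : D.Nonempty) (c : ℝ) : avg D (fun _ => c) = c := by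
  have : (D.card : ℝ) ≠ 0 := by exact_mod_cast hD.card_pos.ne'
  unfold avg; rw [sum_const, nsmul_eq_mul]; field_simp

/-- The average of `F` when the coordinates `v, …, v + c - 1` range over the sets `D`. -/
noncomputable def mav (D : ℕ → Finset ℕ) (F : (ℕ → ℕ) → ℝ) : ℕ → ℕ → (ℕ → ℕ) → ℝ
  | 0, _, x => F x
  | c + 1, v, x => avg (D v) fun u => mav D F c (v + 1) (Function.update x v u)

theorem mav_mono {D : ℕ → Finset ℕ} {F G : (ℕ → ℕ) → ℝ} {c v : ℕ} {x : ℕ → ℕ}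
    (h : ∀ x', (∀ u, v ≤ u → u < v + c → x' u ∈ D u) → (∀ u, u < v → x' u = x u) →
      F x' ≤ G x') : mav D F c v x ≤ mav D G c v x := by
  induction c generalizing v x with
  | zero => exact h x (fun u h1 h2 => by omega) (fun _ _ => rfl)
  | succ c ih =>
    refine avg_mono fun s hs => ih fun x' h1 h2 => h x' (fun u hu hu' => ?_) fun u hu => ?_
    · rcases eq_or_lt_of_le hu with rfl | hlt
      · rw [h2 v (by omega)]; simpa using hs
      · exact h1 u hlt (by omega)
    · rw [h2 u (by omega), Function.update_of_ne (by omega)]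

theorem mav_add (D : ℕ → Finset ℕ) (F G : (ℕ → ℕ) → ℝ) (c v : ℕ) (x : ℕ → ℕ) :
    mav D (fun x => F x + G x) c v x = mav D F c v x + mav D G c v x := by
  induction c generalizing v x with
  | zero => rfl
  | succ c ih => simp only [mav, ih, avg_add]

theorem mav_const_mul (D : ℕ → Finset ℕ) (a : ℝ) (F : (ℕ → ℕ) → ℝ) (c v : ℕ) (x : ℕ → ℕ) :
    mav D (fun x => a * F x) c v x = a * mav D F c v x := by
  induction c generalizing v x with
  | zero => rfl
  | succ c ih => simp only [mav, ih, avg_const_mul]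

theorem mav_const {D : ℕ → Finset ℕ} (a : ℝ) {c v : ℕ} (x : ℕ → ℕ)
    (hD : ∀ u, v ≤ u → u < v + c → (D u).Nonempty) : mav D (fun _ => a) c v x = a := by
  induction c generalizing v x with
  | zero => rfl
  | succ c ih =>
    have h : ∀ y, mav D (fun _ => a) c (v + 1) y = a :=
      fun y => ih y fun u h1 h2 => hD u (by omega) (by omega)
    simp only [mav, h]
    exact avg_const (hD v le_rfl (by omega)) a

theorem mav_sum {D : ℕ → Finset ℕ} {β : Type*} (S : Finset β) (F : β → (ℕ → ℕ) → ℝ) {c v : ℕ}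
    (x : ℕ → ℕ) (hD : ∀ u, v ≤ u → u < v + c → (D u).Nonempty) :
    mav D (fun x => ∑ b ∈ S, F b x) c v x = ∑ b ∈ S, mav D (F b) c v x := by
  classical
  induction S using Finset.induction_on with
  | empty => simpa using mav_const 0 x hD
  | insert a S ha ih =>
    simp only [sum_insert ha]
    rw [mav_add, ih]

/-- The second moment of a sum of independent terms, those not yet fixed being centered. -/
theorem mav_sq {D : ℕ → Finset ℕ} {g : ℕ → ℕ → ℝ} {c v : ℕ} (x : ℕ → ℕ)
    (hD : ∀ u, v ≤ u → u < v + c → (D u).Nonempty)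
    (hg : ∀ u, v ≤ u → u < v + c → avg (D u) (g u) = 0) :
    mav D (fun x => (∑ u ∈ range (v + c), g u (x u)) ^ 2) c v x =
      (∑ u ∈ range v, g u (x u)) ^ 2 +
        ∑ u ∈ Ico v (v + c), avg (D u) (fun s => g u s ^ 2) := by
  induction c generalizing v x with
  | zero => simp [mav]
  | succ c ih =>
    have e : v + (c + 1) = v + 1 + c := by omega
    have h : ∀ y, mav D (fun x => (∑ u ∈ range (v + (c + 1)), g u (x u)) ^ 2) c (v + 1) y =
        (∑ u ∈ range (v + 1), g u (y u)) ^ 2 +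
          ∑ u ∈ Ico (v + 1) (v + (c + 1)), avg (D u) (fun s => g u s ^ 2) := by
      intro y
      rw [e]
      exact ih y (fun u h1 h2 => hD u (by omega) (by omega))
        fun u h1 h2 => hg u (by omega) (by omega)
    have hs : ∀ s, ∑ u ∈ range (v + 1), g u (Function.update x v s u) =
        ∑ u ∈ range v, g u (x u) + g v s := by
      intro s
      rw [sum_range_succ]
      congr 1
      · refine sum_congr rfl fun u hu => ?_
        rw [Function.update_of_ne (by simp at hu; omega)]
      · simp
    simp only [mav, h, hs]
    rw [sum_eq_sum_Ico_succ_bot (by omega : v < v + (c + 1))]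
    set S := ∑ u ∈ range v, g u (x u)
    set T := ∑ u ∈ Ico (v + 1) (v + (c + 1)), avg (D u) (fun s => g u s ^ 2)
    have h2 : (fun s => (S + g v s) ^ 2 + T) =
        fun s => (g v s ^ 2 + (2 * S) * g v s) + (S ^ 2 + T) := by
      funext s; ring
    -- The cross term vanishes because the newly averaged summand is centered.
    rw [h2, avg_add, avg_add, avg_const_mul, hg v le_rfl (by omega),
      avg_const (hD v le_rfl (by omega))]
    ring

/-- Restricting the range of the coordinates of a nonnegative function. -/
theorem mav_restrict {D E : ℕ → Finset ℕ} {F : (ℕ → ℕ) → ℝ} (hF : ∀ x, 0 ≤ F x) {q : ℝ}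
    (hq : 0 ≤ q) {c v : ℕ} (x : ℕ → ℕ) (hDE : ∀ u, v ≤ u → u < v + c → D u ⊆ E u)
    (hc : ∀ u, v ≤ u → u < v + c → q * (E u).card ≤ (D u).card)
    (hD : ∀ u, v ≤ u → u < v + c → (D u).Nonempty) :
    q ^ c * mav D F c v x ≤ mav E F c v x := by
  induction c generalizing v x with
  | zero => simp [mav]
  | succ c ih =>
    have hm : ∀ c v x, 0 ≤ mav D F c v x := by
      intro c
      induction c with
      | zero => intro v x; exact hF x
      | succ c ih => intro v x; exact avg_nonneg fun s _ => ih _ _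
    have h1 := hc v le_rfl (by omega)
    have hDn := hD v le_rfl (by omega)
    have hDv := hDE v le_rfl (by omega)
    have hDpos : (0 : ℝ) < (D v).card := by exact_mod_cast hDn.card_pos
    have hEpos : (0 : ℝ) < (E v).card := by exact_mod_cast (hDn.mono hDv).card_pos
    simp only [mav]
    calc q ^ (c + 1) * avg (D v) (fun u => mav D F c (v + 1) (Function.update x v u))
        = (q * (E v).card / (D v).card) *
          ((∑ u ∈ D v, q ^ c * mav D F c (v + 1) (Function.update x v u)) / (E v).card) := by
          rw [avg, ← mul_sum, pow_succ]; field_simp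
      _ ≤ 1 * ((∑ u ∈ D v, q ^ c * mav D F c (v + 1) (Function.update x v u)) / (E v).card) := by
          apply mul_le_mul_of_nonneg_right
          · rw [div_le_one hDpos]; exact h1
          · refine div_nonneg (sum_nonneg fun u _ => ?_) hEpos.le
            exact mul_nonneg (pow_nonneg hq _) (hm _ _ _)
      _ = (∑ u ∈ D v, q ^ c * mav D F c (v + 1) (Function.update x v u)) / (E v).card := one_mul _
      _ ≤ (∑ u ∈ D v, mav E F c (v + 1) (Function.update x v u)) / (E v).card := by
          gcongr with u hu
          exact ih _ (fun u h1 h2 => hDE u (by omega) (by omega))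
            (fun u h1 h2 => hc u (by omega) (by omega)) (fun u h1 h2 => hD u (by omega) (by omega))
      _ ≤ (∑ u ∈ E v, mav E F c (v + 1) (Function.update x v u)) / (E v).card := by
          have hmE : ∀ c v x, 0 ≤ mav E F c v x := by
            intro c
            induction c with
            | zero => intro v x; exact hF x
            | succ c ih => intro v x; exact avg_nonneg fun s _ => ih _ _
          exact div_le_div_of_nonneg_right
            (sum_le_sum_of_subset_of_nonneg hDv fun u _ _ => hmE _ _ _) hEpos.le

/-! ### The sampling lemma -/

/-- A binary distribution with probability `p` of a one: the variance of the difference of two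
losses, each of which is nonzero for at least one of the bits. -/
theorem binary_variance_le {p p0 p1 q0 q1 : ℝ} (h0 : 0 ≤ p) (h1 : p ≤ 1)
    (hp0 : p0 = 0 ∨ p0 = 1) (hp1 : p1 = 0 ∨ p1 = 1) (hq0 : q0 = 0 ∨ q0 = 1)
    (hq1 : q1 = 0 ∨ q1 = 1) (hp : 1 ≤ p0 + p1) (hq : 1 ≤ q0 + q1) :
    ((p1 - q1) - (p0 - q0)) ^ 2 * (p * (1 - p)) ≤
      4 * (q0 * (1 - p) + q1 * p) *
        ((p0 * (1 - p) + p1 * p) + (q0 * (1 - p) + q1 * p)) := by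
  -- If the two losses differ as functions of the bit, one of them is constantly `1` or they are
  -- complementary, so their means add up to at least `1`. Moreover the mean of `q` is at least `min
  -- p (1 - p)`, hence at least `p * (1 - p)`, and the square on the left is at most `4`.
  rcases hp0 with rfl | rfl <;> rcases hp1 with rfl | rfl <;> rcases hq0 with rfl | rfl <;>
    rcases hq1 with rfl | rfl <;>
    first | (exfalso; linarith) | nlinarith [mul_nonneg h0 (sub_nonneg.2 h1)]

/-- Data for one row: `mis x y b` tells whether the row vector `x` and the column vector `y`
mispredict the bit `b`. -/
structure IsMis (mis : ℕ → ℕ → ℕ → ℕ) : Prop where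
  le_one : ∀ x y b, mis x y b ≤ 1
  one_le : ∀ x y, 1 ≤ mis x y 0 + mis x y 1

theorem IsMis.zero_or_one {mis : ℕ → ℕ → ℕ → ℕ} (h : IsMis mis) (x y b : ℕ) :
    (mis x y b : ℝ) = 0 ∨ (mis x y b : ℝ) = 1 := by
  have := h.le_one x y b
  interval_cases mis x y b <;> simp

/-- A function of a bit is affine in the bit, so all averages depend only on the frequency `p` of
ones, and the claim becomes `binary_variance_le`. The factor with the loss of the reference label
`x0` is what later turns the deviation into a multiple of the target cost. -/
theorem variance_le {mis : ℕ → ℕ → ℕ → ℕ} (hmis : IsMis mis) {D : Finset ℕ} (hD : D.Nonempty)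
    {b : ℕ → ℕ} (hb : ∀ s, b s ≤ 1) (x x0 y : ℕ) :
    avg D (fun s => (((mis x y (b s) : ℝ) - mis x0 y (b s)) -
      avg D (fun s => (mis x y (b s) : ℝ) - mis x0 y (b s))) ^ 2) ≤
      4 * avg D (fun s => (mis x0 y (b s) : ℝ)) *
        (avg D (fun s => (mis x y (b s) : ℝ)) + avg D (fun s => (mis x0 y (b s) : ℝ))) := by
  set p := avg D (fun s => (b s : ℝ)) with hp
  have hb' : ∀ s, (b s : ℝ) = 0 ∨ (b s : ℝ) = 1 := by
    intro s
    have := hb s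
    interval_cases b s <;> simp
  have h0 : 0 ≤ p := avg_nonneg fun s _ => Nat.cast_nonneg _
  have h1 : p ≤ 1 := by
    rw [hp, ← avg_const hD (1 : ℝ)]
    exact avg_mono fun s _ => by exact_mod_cast hb s
  have key : ∀ c0 c1 : ℝ, ∀ f : ℕ → ℝ, (∀ s, f s = c0 + (c1 - c0) * b s) →
      avg D f = c0 * (1 - p) + c1 * p := by
    intro c0 c1 f hf
    rw [show f = fun s => c0 + (c1 - c0) * (b s : ℝ) from funext hf, avg_add, avg_const hD,
      avg_const_mul]
    ring
  have hx : ∀ x s, (mis x y (b s) : ℝ) =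
      (mis x y 0 : ℝ) + ((mis x y 1 : ℝ) - (mis x y 0 : ℝ)) * b s := by
    intro x s
    have := hb s
    interval_cases b s <;> simp
  have e1 := key _ _ _ (hx x)
  have e0 := key _ _ _ (hx x0)
  rw [avg_sub, e1, e0]
  have e2 : avg D (fun s => (((mis x y (b s) : ℝ) - mis x0 y (b s)) -
      ((mis x y 0 : ℝ) * (1 - p) + mis x y 1 * p - (mis x0 y 0 * (1 - p) + mis x0 y 1 * p))) ^ 2) =
      (((mis x y 1 : ℝ) - mis x0 y 1) - (mis x y 0 - mis x0 y 0)) ^ 2 * (p * (1 - p)) := by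
    rw [key ((((mis x y 1 : ℝ) - mis x0 y 1) - (mis x y 0 - mis x0 y 0)) ^ 2 * p ^ 2)
      ((((mis x y 1 : ℝ) - mis x0 y 1) - (mis x y 0 - mis x0 y 0)) ^ 2 * (1 - p) ^ 2)]
    · ring
    · intro s
      rw [hx x s, hx x0 s]
      rcases hb' s with h | h <;> rw [h] <;> ring
  rw [e2]
  refine binary_variance_le h0 h1 (hmis.zero_or_one _ _ _) (hmis.zero_or_one _ _ _)
    (hmis.zero_or_one _ _ _) (hmis.zero_or_one _ _ _) ?_ ?_
  · exact_mod_cast hmis.one_le x y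
  · exact_mod_cast hmis.one_le x0 y

/-- The weighted mean loss of the row vector `x`. -/
noncomputable def meanLoss (mis : ℕ → ℕ → ℕ → ℕ) (D : ℕ → Finset ℕ) (W : ℕ → ℕ) (y : ℕ → ℕ)
    (b : ℕ → ℕ → ℕ) (N x : ℕ) : ℝ :=
  ∑ v ∈ range N, (W v : ℝ) * avg (D v) fun s => (mis x (y v) (b v s) : ℝ)

theorem meanLoss_nonneg (mis : ℕ → ℕ → ℕ → ℕ) (D : ℕ → Finset ℕ) (W y : ℕ → ℕ)
    (b : ℕ → ℕ → ℕ) (N x : ℕ) : 0 ≤ meanLoss mis D W y b N x :=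
  sum_nonneg fun _ _ => mul_nonneg (Nat.cast_nonneg _) (avg_nonneg fun _ _ => Nat.cast_nonneg _)

/-- Chebyshev's inequality for each competing label. A label whose mean loss exceeds that of `x0` by
a gap can be chosen only if its weighted sample loss deviates from the mean by at least the gap. The
hypothesis `hblock` says that no single sample carries more than a `1 / t` share of a mean loss; it
holds because each cluster is sampled `t` times. It makes the variance small compared with (target
loss) times (sum of the two losses). -/
theorem row_excess {mis : ℕ → ℕ → ℕ → ℕ} (hmis : IsMis mis) {K N t m : ℕ} (hK : 1 ≤ K)
    (hm : 1 ≤ m) (ht : 12 * K * m ^ 2 ≤ t) {D : ℕ → Finset ℕ} (hD : ∀ v < N, (D v).Nonempty)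
    {W y : ℕ → ℕ} {b : ℕ → ℕ → ℕ} (hb : ∀ v s, b v s ≤ 1)
    (hblock : ∀ x, ∀ v < N, (t : ℝ) * (W v * avg (D v) fun s => (mis x (y v) (b v s) : ℝ)) ≤
      meanLoss mis D W y b N x)
    (x0 : ℕ) (ch : (ℕ → ℕ) → ℕ) (hch : ∀ s, ch s < K)
    (hopt : ∀ s, ∑ v ∈ range N, W v * mis (ch s) (y v) (b v (s v)) ≤
      ∑ v ∈ range N, W v * mis x0 (y v) (b v (s v))) (s0 : ℕ → ℕ) :
    mav D (fun s => max 0 (meanLoss mis D W y b N (ch s) - meanLoss mis D W y b N x0)) N 0 s0 ≤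
      2 / m * meanLoss mis D W y b N x0 := by
  set μ := meanLoss mis D W y b N with hμ
  have hD' : ∀ u, 0 ≤ u → u < 0 + N → (D u).Nonempty := fun u _ h => hD u (by omega)
  have hm0 : (0 : ℝ) < m := by exact_mod_cast hm
  have hK0 : (0 : ℝ) < K := by exact_mod_cast hK
  have hμ0 : 0 ≤ μ x0 := meanLoss_nonneg ..
  set A : ℕ → ℕ → ℝ := fun x v =>
    avg (D v) (fun s => (mis x (y v) (b v s) : ℝ) - mis x0 (y v) (b v s)) with hA
  set g : ℕ → ℕ → ℕ → ℝ := fun x v s =>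
    (W v : ℝ) * (((mis x (y v) (b v s) : ℝ) - mis x0 (y v) (b v s)) - A x v) with hg
  have hΔ : ∀ x, ∑ v ∈ range N, (W v : ℝ) * A x v = μ x - μ x0 := by
    intro x
    rw [hμ]; unfold meanLoss
    rw [← sum_sub_distrib]
    refine sum_congr rfl fun v _ => ?_
    rw [hA]; simp only; rw [avg_sub]; ring
  have hsum0 : ∑ u ∈ range N, (W u : ℝ) * avg (D u) (fun s => (mis x0 (y u) (b u s) : ℝ)) =
      μ x0 := rfl
  clear_value μ
  have hdiv : 0 ≤ μ x0 / m := div_nonneg hμ0 hm0.le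
  -- Gaps up to `μ x0 / m` are paid by the first term. A larger gap `Δ` of the chosen label forces a
  -- deviation of at least `Δ`, so `Δ ≤ deviation² / Δ`. Summing over all labels with a large gap
  -- removes the dependence on the choice, so the expectation can be taken term by term.
  have hpt : ∀ s : ℕ → ℕ, max 0 (μ (ch s) - μ x0) ≤ μ x0 / m + ∑ x ∈ range K,
      (if μ x0 / m < μ x - μ x0 then 1 / (μ x - μ x0) else 0) *
        (∑ v ∈ range (0 + N), g x v (s v)) ^ 2 := by
    intro s
    have hnn : ∀ x ∈ range K, 0 ≤ (if μ x0 / m < μ x - μ x0 then 1 / (μ x - μ x0) else 0) *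
        (∑ v ∈ range (0 + N), g x v (s v)) ^ 2 := by
      intro x _
      refine mul_nonneg ?_ (sq_nonneg _)
      split_ifs with h
      · exact one_div_nonneg.2 (hdiv.trans h.le)
      · exact le_rfl
    have hsum := sum_nonneg hnn
    refine max_le (add_nonneg hdiv hsum) ?_
    by_cases h : μ x0 / m < μ (ch s) - μ x0
    · have hpos : 0 < μ (ch s) - μ x0 := lt_of_le_of_lt hdiv h
      have h1 := single_le_sum hnn (mem_range.2 (hch s))
      rw [if_pos h, zero_add] at h1
      have h2 : ∑ v ∈ range N, g (ch s) v (s v) ≤ -(μ (ch s) - μ x0) := by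
        rw [← hΔ (ch s), ← sum_neg_distrib, ← sub_nonpos, ← sum_sub_distrib]
        have h3 : (∑ v ∈ range N, ((W v : ℝ) * mis (ch s) (y v) (b v (s v)) -
            W v * mis x0 (y v) (b v (s v)))) ≤ 0 := by
          rw [sum_sub_distrib, sub_nonpos]; exact_mod_cast hopt s
        refine le_trans (le_of_eq (sum_congr rfl fun v _ => ?_)) h3
        simp only [hg]; ring
      have h4 : (μ (ch s) - μ x0) ≤ 1 / (μ (ch s) - μ x0) *
          (∑ v ∈ range N, g (ch s) v (s v)) ^ 2 := by
        rw [one_div, inv_mul_eq_div, le_div_iff₀ hpos]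
        nlinarith
      simp only [zero_add] at h1 h4 ⊢
      linarith
    · have := not_lt.1 h
      linarith
  refine (mav_mono (G := _) fun s _ _ => hpt s).trans ?_
  rw [mav_add, mav_const _ _ hD', mav_sum _ _ _ hD']
  have hx : ∀ x ∈ range K, mav D (fun s =>
      (if μ x0 / m < μ x - μ x0 then 1 / (μ x - μ x0) else 0) *
        (∑ v ∈ range (0 + N), g x v (s v)) ^ 2) N 0 s0 ≤ μ x0 / m / K := by
    intro x _
    rw [mav_const_mul, mav_sq s0 hD' fun u _ hu => ?_]
    swap
    · simp only [hg]
      rw [avg_const_mul, avg_sub, avg_const (hD u (by omega))]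
      simp [hA]
    split_ifs with h
    swap
    · rw [zero_mul]; positivity
    have hpos : 0 < μ x - μ x0 := lt_of_le_of_lt hdiv h
    have hmx : μ x0 ≤ m * (μ x - μ x0) := by
      rw [div_lt_iff₀ hm0] at h; linarith
    have ht0 : (12 : ℝ) * K * m ^ 2 ≤ t := by exact_mod_cast ht
    have htpos : (0 : ℝ) < t := lt_of_lt_of_le (by positivity) ht0
    -- In each product of two mean losses from `variance_le` one factor is bounded by its `1 / t`
    -- share of the total; the remaining factor, the loss of `x0`, is summed.
    have hvar : ∑ u ∈ range N, avg (D u) (fun s => g x u s ^ 2) ≤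
        4 / t * μ x0 * (μ x + μ x0) := by
      have hterm : ∀ u ∈ range N, avg (D u) (fun s => g x u s ^ 2) ≤
          4 / t * (μ x + μ x0) *
            (W u * avg (D u) fun s => (mis x0 (y u) (b u s) : ℝ)) := by
        intro u hu
        have hu := mem_range.1 hu
        have h1 := variance_le hmis (hD u hu) (hb u) x x0 (y u)
        have h2 := hblock x u hu
        have h3 := hblock x0 u hu
        have hn : 0 ≤ avg (D u) fun s => (mis x0 (y u) (b u s) : ℝ) :=
          avg_nonneg fun _ _ => Nat.cast_nonneg _
        have hW : (0 : ℝ) ≤ W u := Nat.cast_nonneg _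
        simp only [hg, mul_pow]
        rw [avg_const_mul]
        calc (W u : ℝ) ^ 2 * _ ≤ (W u : ℝ) ^ 2 * _ := mul_le_mul_of_nonneg_left h1 (sq_nonneg _)
          _ = (4 / t) * (t * (W u * avg (D u) fun s => (mis x (y u) (b u s) : ℝ)) +
              t * (W u * avg (D u) fun s => (mis x0 (y u) (b u s) : ℝ))) *
                (W u * avg (D u) fun s => (mis x0 (y u) (b u s) : ℝ)) := by
              field_simp
          _ ≤ _ := by gcongr
      refine (sum_le_sum hterm).trans (le_of_eq ?_)
      rw [← mul_sum]
      rw [hsum0]; ring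
    simp only [range_zero, sum_empty, zero_add, Nat.Ico_zero_eq_range]
    -- The gap exceeds `μ x0 / m`, so `μ x + μ x0` is at most `2 m + 1 ≤ 3 m` gaps; then `t ≥ 12 K
    -- m²` leaves `μ x0 / (m K)` for each of the `K` labels.
    calc 1 / (μ x - μ x0) * (0 ^ 2 + ∑ u ∈ range N, avg (D u) (fun s => g x u s ^ 2))
        ≤ 1 / (μ x - μ x0) * (4 / t * μ x0 * (μ x + μ x0)) := by
          have : 0 ≤ 1 / (μ x - μ x0) := by positivity
          refine mul_le_mul_of_nonneg_left ?_ this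
          simpa using hvar
      _ ≤ 1 / (μ x - μ x0) * (4 / t * μ x0 * (3 * m * (μ x - μ x0))) := by
          have : 0 ≤ 1 / (μ x - μ x0) := by positivity
          refine mul_le_mul_of_nonneg_left ?_ this
          refine mul_le_mul_of_nonneg_left ?_ (by positivity)
          have : (1 : ℝ) ≤ m := by exact_mod_cast hm
          nlinarith
      _ = 12 * m / t * μ x0 := by field_simp; ring
      _ ≤ 12 * m / (12 * K * m ^ 2) * μ x0 := by gcongr
      _ = μ x0 / m / K := by field_simp
  refine (add_le_add le_rfl (sum_le_sum hx)).trans (le_of_eq ?_)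
  rw [sum_const, card_range, nsmul_eq_mul]
  field_simp; ring

/-- With probability at least one half the total loss of all rows is nearly optimal. -/
theorem half_le_mav_good {mis : ℕ → ℕ → ℕ → ℕ} (hmis : IsMis mis) {n K N t m : ℕ} (hK : 1 ≤ K)
    (hm : 1 ≤ m) (ht : 12 * K * m ^ 2 ≤ t) {D : ℕ → Finset ℕ} (hD : ∀ v < N, (D v).Nonempty)
    {W y : ℕ → ℕ} {b : ℕ → ℕ → ℕ → ℕ} (hb : ∀ i v s, b i v s ≤ 1)
    (hblock : ∀ i x, ∀ v < N, (t : ℝ) * (W v * avg (D v) fun s => (mis x (y v) (b i v s) : ℝ)) ≤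
      meanLoss mis D W y (b i) N x)
    (x0 : ℕ → ℕ) (ch : (ℕ → ℕ) → ℕ → ℕ) (hch : ∀ s i, ch s i < K)
    (hopt : ∀ s i, ∑ v ∈ range N, W v * mis (ch s i) (y v) (b i v (s v)) ≤
      ∑ v ∈ range N, W v * mis (x0 i) (y v) (b i v (s v))) (s0 : ℕ → ℕ) {δ : ℝ} (hδ : 0 < δ)
    (P : (ℕ → ℕ) → Prop) [DecidablePred P]
    (hP : ∀ s, (∀ v < N, s v ∈ D v) → ∑ i ∈ range n, meanLoss mis D W y (b i) N (ch s i) ≤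
      ∑ i ∈ range n, meanLoss mis D W y (b i) N (x0 i) +
        4 / m * (∑ i ∈ range n, meanLoss mis D W y (b i) N (x0 i) + δ) → P s) :
    1 / 2 ≤ mav D (fun s => if P s then 1 else 0) N 0 s0 := by
  have hD' : ∀ u, 0 ≤ u → u < 0 + N → (D u).Nonempty := fun u _ h => hD u (by omega)
  have hm0 : (0 : ℝ) < m := by exact_mod_cast hm
  set S := ∑ i ∈ range n, meanLoss mis D W y (b i) N (x0 i) with hS
  have hS0 : 0 ≤ S := sum_nonneg fun i _ => meanLoss_nonneg ..
  set X : (ℕ → ℕ) → ℝ := fun s => ∑ i ∈ range n,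
    max 0 (meanLoss mis D W y (b i) N (ch s i) - meanLoss mis D W y (b i) N (x0 i)) with hX
  have hE : mav D X N 0 s0 ≤ 2 / m * S := by
    rw [hX, mav_sum _ _ _ hD', hS, mul_sum]
    exact sum_le_sum fun i _ => row_excess hmis hK hm ht hD (hb i) (hblock i) (x0 i)
      (fun s => ch s i) (fun s => hch s i) (fun s => hopt s i) s0
  -- Markov's inequality as a pointwise lower bound for the indicator: if `P` fails, the excess `X`
  -- is larger than `4 / m * (S + δ)`, while its mean is at most half of that. The term `δ` keeps
  -- the denominator positive when the target loss `S` is zero.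
  have hpt : ∀ s, (∀ u, 0 ≤ u → u < 0 + N → s u ∈ D u) → (∀ u, u < 0 → s u = s0 u) →
      1 + (-(m / (4 * (S + δ)))) * X s ≤ (if P s then 1 else 0 : ℝ) := by
    intro s hs _
    have hX0 : 0 ≤ X s := sum_nonneg fun i _ => le_max_left _ _
    split_ifs with h
    · have : 0 ≤ m / (4 * (S + δ)) * X s := by positivity
      linarith
    · have h1 : 4 / m * (S + δ) < X s := by
        by_contra hcon
        refine h (hP s (fun v hv => hs v (by omega) (by omega)) ?_)
        have h2 : ∑ i ∈ range n, meanLoss mis D W y (b i) N (ch s i) - S ≤ X s := by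
          rw [hS, ← sum_sub_distrib]
          exact sum_le_sum fun i _ => le_max_right _ _
        linarith [not_lt.1 hcon]
      have h3 : 1 ≤ m / (4 * (S + δ)) * X s := by
        rw [div_mul_eq_mul_div, le_div_iff₀ (by positivity)]
        rw [div_mul_eq_mul_div, div_lt_iff₀ hm0] at h1
        linarith
      linarith
  refine le_trans ?_ (mav_mono hpt)
  rw [mav_add, mav_const _ _ hD', mav_const_mul]
  have : m / (4 * (S + δ)) * mav D X N 0 s0 ≤ m / (4 * (S + δ)) * (2 / m * S) :=
    mul_le_mul_of_nonneg_left hE (by positivity)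
  have h2 : m / (4 * (S + δ)) * (2 / m * S) ≤ 1 / 2 := by
    have : m / (4 * (S + δ)) * (2 / m * S) = S / (2 * (S + δ)) := by field_simp; ring
    rw [this, div_le_div_iff₀ (by positivity) (by norm_num)]
    linarith
  linarith

/-! ### Minimizers -/

/-- An index below `N` that minimizes `f` (`0` if `N = 0`). -/
def aminf : ℕ → (ℕ → ℕ) → ℕ
  | 0, _ => 0
  | N + 1, f => if f N < f (aminf N f) then N else aminf N f

theorem aminf_lt {N : ℕ} (hN : 0 < N) (f : ℕ → ℕ) : aminf N f < N := by
  induction N with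
  | zero => omega
  | succ N ih =>
    unfold aminf
    split_ifs
    · omega
    · rcases Nat.eq_zero_or_pos N with rfl | h
      · simp [aminf]
      · exact (ih h).trans (by omega)

theorem aminf_le {N i : ℕ} (f : ℕ → ℕ) (hi : i < N) : f (aminf N f) ≤ f i := by
  induction N with
  | zero => omega
  | succ N ih =>
    unfold aminf
    rcases eq_or_lt_of_le (Nat.lt_succ_iff.1 hi) with rfl | h
    · split_ifs <;> omega
    · have := ih h
      split_ifs <;> omega

theorem aminf_congr {N : ℕ} {f g : ℕ → ℕ} (h : ∀ i < N, f i = g i) (h0 : f 0 = g 0) :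
    aminf N f = aminf N g := by
  induction N with
  | zero => rfl
  | succ N ih =>
    have e := ih fun i hi => h i (by omega)
    have hm : f (aminf N f) = g (aminf N g) := by
      rw [← e]
      rcases Nat.eq_zero_or_pos N with rfl | hN
      · exact h0
      · exact h _ ((aminf_lt hN f).trans (by omega))
    unfold aminf
    rw [h N (by omega), hm, e]

/-! ### Comparing sums by their level sets -/

/-- Layer-cake formula: a sum of natural numbers is the sum over the thresholds `τ ≥ 1` of the sizes
of the level sets. -/
theorem mul_sum_le_sum_of_levels {A B : Finset ℕ} {h : ℕ → ℕ} {N : ℕ}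
    (H : ∀ τ, 1 ≤ τ → N * (A.filter fun j => τ ≤ h j).card ≤ (B.filter fun j => τ ≤ h j).card) :
    N * ∑ j ∈ A, h j ≤ ∑ j ∈ B, h j := by
  obtain ⟨T, hT⟩ : ∃ T, ∀ j ∈ A ∪ B, h j ≤ T :=
    ⟨(A ∪ B).sup h, fun j hj => le_sup (f := h) hj⟩
  have key : ∀ S ⊆ A ∪ B, ∑ j ∈ S, h j =
      ∑ τ ∈ range T, (S.filter fun j => τ + 1 ≤ h j).card := by
    intro S hS
    have : ∀ j ∈ S, h j = ∑ τ ∈ range T, if τ + 1 ≤ h j then 1 else 0 := by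
      intro j hj
      have hjT := hT j (hS hj)
      rw [← card_filter]
      have : (range T).filter (fun τ => τ + 1 ≤ h j) = range (h j) := by
        ext τ; simp only [mem_filter, mem_range]; omega
      rw [this, card_range]
    rw [sum_congr rfl this, sum_comm]
    exact sum_congr rfl fun τ _ => (card_filter _ _).symm
  rw [key A subset_union_left, key B subset_union_right, mul_sum]
  exact sum_le_sum fun τ _ => H _ (by omega)

theorem sum_biUnion_le' (S : Finset ℕ) (C : ℕ → Finset ℕ) (f : ℕ → ℕ) :
    ∑ j ∈ S.biUnion C, f j ≤ ∑ i ∈ S, ∑ j ∈ C i, f j := by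
  induction S using Finset.induction_on with
  | empty => simp
  | insert a S ha ih =>
    rw [biUnion_insert, sum_insert ha]
    have := sum_union_inter (s₁ := C a) (s₂ := S.biUnion C) (f := f)
    omega

/-- A permutation of `{0, …, d - 1}`. -/
def IsPos (d : ℕ) (pos : ℕ → ℕ) : Prop :=
  (∀ j < d, pos j < d) ∧ ∀ j < d, ∀ j' < d, pos j = pos j' → j = j'

theorem IsPos.surj {d : ℕ} {pos : ℕ → ℕ} (h : IsPos d pos) {s : ℕ} (hs : s < d) :
    ∃ j < d, pos j = s := by
  have hi : Set.InjOn pos (range d) := fun a ha b hb e =>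
    h.2 a (by simpa using ha) b (by simpa using hb) e
  have : (range d).image pos = range d := by
    refine eq_of_subset_of_card_le ?_ ?_
    · intro x hx
      obtain ⟨j, hj, rfl⟩ := mem_image.1 hx
      exact mem_range.2 (h.1 j (mem_range.1 hj))
    · rw [card_image_of_injOn hi]
  have h1 : s ∈ (range d).image pos := by rw [this]; exact mem_range.2 hs
  obtain ⟨j, hj, e⟩ := mem_image.1 h1
  exact ⟨j, mem_range.1 hj, e⟩

theorem IsPos.card_prefix {d : ℕ} {pos : ℕ → ℕ} (h : IsPos d pos) {P : ℕ} (hP : P ≤ d) :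
    ((range d).filter fun j => pos j < P).card = P := by
  have hi : Set.InjOn pos ((range d).filter fun j => pos j < P) := by
    intro a ha b hb e
    simp only [coe_filter, mem_range, Set.mem_ofPred_eq] at ha hb
    exact h.2 a ha.1 b hb.1 e
  rw [← card_image_of_injOn hi]
  have : ((range d).filter fun j => pos j < P).image pos = range P := by
    ext s
    simp only [mem_image, mem_filter, mem_range]
    constructor
    · rintro ⟨j, ⟨_, hj⟩, rfl⟩; exact hj
    · intro hs
      obtain ⟨j, hj, rfl⟩ := h.surj (hs.trans_le hP)
      exact ⟨j, ⟨hj, hs⟩, rfl⟩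
  rw [this, card_range]

/-! ### The peeling argument -/

/-- An instance: a matrix `a`, a target solution `(us, vs)`, and the parameters of the analysis. -/
structure Inst where
  mis : ℕ → ℕ → ℕ → ℕ
  hmis : IsMis mis
  a : ℕ → ℕ → ℕ
  ha : ∀ i j, a i j ≤ 1
  n : ℕ
  d : ℕ
  hd : 1 ≤ d
  K : ℕ
  hK : 1 ≤ K
  us : ℕ → ℕ
  vs : ℕ → ℕ
  hus : ∀ i, us i < K
  hvs : ∀ j, vs j < K
  m : ℕ
  hm : 10 ≤ m

namespace Inst

variable (I : Inst)

/-- The trade-off parameter of the peeling. -/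
def N : ℕ := 6 * I.K * I.m
/-- The ratio of consecutive cluster densities. -/
def Q : ℕ := 2 * I.K * (I.N + 1)
/-- A bound for the inverse of all cluster densities. -/
def B : ℕ := I.K * I.Q ^ I.K
/-- The granularity of the guessed cluster sizes. -/
def G : ℕ := I.m * I.B
/-- The number of powers of two that are guessed from. -/
def I1 : ℕ := Nat.clog 2 I.d + 1

theorem Q_pos : 0 < I.Q := by have := I.hK; unfold Q; positivity

/-- The distance of column `j` from the column of label `y`. -/
def dist (U : ℕ → ℕ) (y j : ℕ) : ℕ := ∑ i ∈ range I.n, I.mis (U i) y (I.a i j)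

/-- The cost of the target solution. -/
def opt : ℕ := ∑ j ∈ range I.d, I.dist I.us (I.vs j) j

/-- The sampled part of the `i`-th cluster. -/
def core (pos R y : ℕ → ℕ) (i : ℕ) : Finset ℕ :=
  (range I.d).filter fun j => pos j < R i ∧ I.vs j = y i

/-- The cost of `U` on the sampled parts of the first `l` clusters. -/
def cc (pos R y : ℕ → ℕ) (l : ℕ) (U : ℕ → ℕ) : ℕ :=
  ∑ i ∈ range l, ∑ j ∈ I.core pos R y i, I.dist U (y i) j

/-- The distance of column `j` from the nearest of the first `l` labels. -/
def near (y : ℕ → ℕ) (l : ℕ) (U : ℕ → ℕ) (j : ℕ) : ℕ :=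
  I.dist U (y (aminf l fun i => I.dist U (y i) j)) j

/-- The size of the current list of columns. -/
def cur (R : ℕ → ℕ) (l : ℕ) : ℕ := if l = 0 then I.d else R (l - 1)

/-- The columns outside the first `c` positions that belong to no core. -/
def lost (pos R y : ℕ → ℕ) (l c : ℕ) : Finset ℕ :=
  (range I.d).filter fun j => c ≤ pos j ∧ ∀ i < l, ¬ (pos j < R i ∧ I.vs j = y i)

/-- The columns at the positions from `c` to `c' - 1` whose label has not been found. -/
def unfound (pos y : ℕ → ℕ) (l c c' : ℕ) : Finset ℕ :=
  (range I.d).filter fun j => (c ≤ pos j ∧ pos j < c') ∧ ∀ i < l, I.vs j ≠ y i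

/-- The first `l` guesses are consistent with the target solution. -/
structure Valid (pos R y w : ℕ → ℕ) (l : ℕ) : Prop where
  isPos : IsPos I.d pos
  anti : ∀ i i', i ≤ i' → i' < l → R i' ≤ R i
  pow : ∀ i < l, ∃ e < I.I1, R i = min (2 ^ e) I.d
  lab : ∀ i < l, y i < I.K
  inj : ∀ i < l, ∀ i' < l, y i = y i' → i = i'
  -- The cores are dense, which bounds from below the chance of hitting them by uniform samples. The
  -- density may drop by a factor `Q` per stage, and `B` bounds its inverse for all stages.
  size : ∀ i < l, R i ≤ (I.core pos R y i).card * (I.K * I.Q ^ (i + 1))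
  -- Up to the common factor `G` the weight is the size of the core, overestimated by a factor of at
  -- most `1 + 1 / m`.
  le_weight : ∀ i < l, (I.core pos R y i).card * I.G ≤ w i
  weight_le : ∀ i < l, I.m * w i ≤ (I.m + 1) * ((I.core pos R y i).card * I.G)
  -- Demanded of every `U` that is good on the cores: each stage draws all samples anew, so the
  -- final `U` is not the one for which columns were given up.
  lost_le : ∀ U, I.cc pos R y l U ≤ 2 * I.opt →
    I.N * ∑ j ∈ I.lost pos R y l (I.cur R l), I.near y l U j ≤ 4 * l * I.opt

/-- Some choice of the next guesses is consistent with the target solution. -/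
def Ready (pos R y w : ℕ → ℕ) (l : ℕ) : Prop :=
  ∃ e < I.I1, ∃ y0 < I.K, ∃ a < I.G,
    I.Valid pos (Function.update R l (min (2 ^ e) I.d)) (Function.update y l y0)
      (Function.update w l ((a + 1) * min (2 ^ e) I.d)) (l + 1)

variable {I}

/-- If the bits agree, the last term suffices; otherwise `x` mispredicts one of the two bits and the
first two terms add up to at least `1`. -/
theorem mis_triangle (x x' y : ℕ) {b b' : ℕ} (hb : b ≤ 1) (hb' : b' ≤ 1) :
    I.mis x' y b ≤ I.mis x y b + I.mis x y b' + I.mis x' y b' := by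
  have h1 := I.hmis.le_one x' y b
  have h2 := I.hmis.one_le x y
  interval_cases b <;> interval_cases b' <;> omega

/-- Replaces `U` by `U'` for a column `j` at the price of the costs of both on another column `j'`,
to be averaged over a core. -/
theorem dist_triangle (U U' : ℕ → ℕ) (y j j' : ℕ) :
    I.dist U' y j ≤ I.dist U y j + I.dist U y j' + I.dist U' y j' := by
  unfold dist
  rw [← sum_add_distrib, ← sum_add_distrib]
  exact sum_le_sum fun i _ => mis_triangle _ _ _ (I.ha _ _) (I.ha _ _)

theorem near_le (y : ℕ → ℕ) {l i : ℕ} (hi : i < l) (U : ℕ → ℕ) (j : ℕ) :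
    I.near y l U j ≤ I.dist U (y i) j := aminf_le (fun i => I.dist U (y i) j) hi

theorem core_congr {pos R y R' y' : ℕ → ℕ} {i : ℕ} (hR : R' i = R i) (hy : y' i = y i) :
    I.core pos R' y' i = I.core pos R y i := by simp only [core, hR, hy]

theorem cc_congr {pos R y R' y' : ℕ → ℕ} {l : ℕ} (hR : ∀ i < l, R' i = R i)
    (hy : ∀ i < l, y' i = y i) (U : ℕ → ℕ) : I.cc pos R' y' l U = I.cc pos R y l U := by
  refine sum_congr rfl fun i hi => ?_
  have hi := mem_range.1 hi
  rw [core_congr (hR i hi) (hy i hi), hy i hi]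

/-- Cores with distinct labels are disjoint, and on a core the label of the cluster is the one that
the target solution uses. -/
theorem cc_us_le {pos R y : ℕ → ℕ} {l : ℕ}
    (inj : ∀ i < l, ∀ i' < l, y i = y i' → i = i') : I.cc pos R y l I.us ≤ I.opt := by
  unfold cc opt
  have h1 : ∑ i ∈ range l, ∑ j ∈ I.core pos R y i, I.dist I.us (y i) j =
      ∑ i ∈ range l, ∑ j ∈ I.core pos R y i, I.dist I.us (I.vs j) j := by
    refine sum_congr rfl fun i _ => sum_congr rfl fun j hj => ?_
    rw [(mem_filter.1 hj).2.2]
  rw [h1, ← sum_biUnion]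
  · refine sum_le_sum_of_subset fun j hj => ?_
    obtain ⟨i, _, hj⟩ := mem_biUnion.1 hj
    exact (mem_filter.1 hj).1
  · intro i hi i' hi' hne
    refine disjoint_left.2 fun j hj hj' => hne ?_
    exact inj i (by simpa using hi) i' (by simpa using hi')
      ((mem_filter.1 hj).2.2.symm.trans (mem_filter.1 hj').2.2)

/-- Rearranging the current list preserves consistency. -/
theorem Valid.repos {pos pos' R y w : ℕ → ℕ} {l : ℕ} (h : I.Valid pos R y w l) (hl : 0 < l)
    (hp : IsPos I.d pos')
    (h1 : ∀ j < I.d, R (l - 1) ≤ pos j → pos' j = pos j)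
    (h2 : ∀ j < I.d, pos j < R (l - 1) → pos' j < R (l - 1)) :
    I.Valid pos' R y w l ∧ ∀ U, I.cc pos' R y l U = I.cc pos R y l U := by
  -- Only the first `R (l - 1)` entries move among themselves, and the other sampled prefixes
  -- contain this one, so every prefix keeps its set of columns.
  have hlt : ∀ i < l, ∀ j < I.d, (pos' j < R i ↔ pos j < R i) := by
    intro i hi j hj
    have ha := h.anti i (l - 1) (by omega) (by omega)
    rcases lt_or_ge (pos j) (R (l - 1)) with h3 | h3
    · have := h2 j hj h3; omega
    · rw [h1 j hj h3]
  have hc : ∀ i < l, I.core pos' R y i = I.core pos R y i := by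
    intro i hi
    refine filter_congr fun j hj => ?_
    rw [hlt i hi j (mem_range.1 hj)]
  have hcc : ∀ U, I.cc pos' R y l U = I.cc pos R y l U := by
    intro U
    refine sum_congr rfl fun i hi => ?_
    rw [hc i (mem_range.1 hi)]
  refine ⟨⟨hp, h.anti, h.pow, h.lab, h.inj, ?_, ?_, ?_, ?_⟩, hcc⟩
  · intro i hi; rw [hc i hi]; exact h.size i hi
  · intro i hi; rw [hc i hi]; exact h.le_weight i hi
  · intro i hi; rw [hc i hi]; exact h.weight_le i hi
  · intro U hU
    rw [hcc] at hU
    convert h.lost_le U hU using 3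
    refine filter_congr fun j hj => ?_
    have hj := mem_range.1 hj
    have hcur : I.cur R l = R (l - 1) := by simp [cur, hl.ne']
    have h5 := hlt (l - 1) (by omega) j hj
    rw [hcur]
    refine and_congr (by omega) (forall₂_congr fun i hi => ?_)
    rw [hlt i hi j hj]

theorem Valid.le_K {pos R y w : ℕ → ℕ} {l : ℕ} (h : I.Valid pos R y w l) : l ≤ I.K := by
  have : (range l).card ≤ (range I.K).card :=
    card_le_card_of_injOn y (fun i hi => by simpa using h.lab i (by simpa using hi))
      fun i hi i' hi' e => h.inj i (by simpa using hi) i' (by simpa using hi') e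
  simpa using this

/-- The labels found are distinct, so there is no stage after the `K`-th. Hence "won or ready" after
`K` stages means "won". -/
theorem not_ready_K {pos R y w : ℕ → ℕ} : ¬ I.Ready pos R y w I.K := by
  rintro ⟨e, _, y0, _, a, _, h⟩
  have := h.le_K
  omega

/-- A sufficiently dense prefix of the current list yields consistent next guesses. -/
theorem Valid.ready {pos R y w : ℕ → ℕ} {l e : ℕ} (h : I.Valid pos R y w l) (he : e < I.I1)
    (hcur : min (2 ^ e) I.d ≤ I.cur R l)
    (hdense : min (2 ^ e) I.d ≤ (I.unfound pos y l 0 (min (2 ^ e) I.d)).card * I.Q ^ (l + 1))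
    (hlK : l < I.K)
    (hlost : ∀ U, I.cc pos R y l U ≤ 2 * I.opt →
      I.N * ∑ j ∈ I.lost pos R y l (min (2 ^ e) I.d), I.near y l U j ≤ 4 * (l + 1) * I.opt)
    (hlost0 : l = 0 → I.lost pos R y l (min (2 ^ e) I.d) = ∅) :
    I.Ready pos R y w l := by
  set c := min (2 ^ e) I.d with hc
  have hc1 : 1 ≤ c := le_min Nat.one_le_two_pow I.hd
  have hcd : c ≤ I.d := min_le_right _ _
  have hQ : 1 ≤ I.Q := I.Q_pos
  have hK := I.hK
  -- a popular label
  obtain ⟨y0, hy0K, hy0⟩ : ∃ y0 < I.K, (I.unfound pos y l 0 c).card ≤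
      ((I.unfound pos y l 0 c).filter fun j => I.vs j = y0).card * I.K := by
    by_contra! hcon
    have h1 : (I.unfound pos y l 0 c).card =
        ∑ y0 ∈ range I.K, ((I.unfound pos y l 0 c).filter fun j => I.vs j = y0).card :=
      card_eq_sum_card_fiberwise fun j _ => by simpa using I.hvs j
    have h2 : ∑ y0 ∈ range I.K,
        ((I.unfound pos y l 0 c).filter fun j => I.vs j = y0).card * I.K <
          ∑ y0 ∈ range I.K, (I.unfound pos y l 0 c).card :=
      sum_lt_sum_of_nonempty ⟨0, mem_range.2 (by omega)⟩ fun y0 hy => hcon y0 (mem_range.1 hy)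
    rw [← sum_mul, ← h1, sum_const, card_range, smul_eq_mul, mul_comm] at h2
    exact lt_irrefl _ h2
  have hne : 0 < ((I.unfound pos y l 0 c).filter fun j => I.vs j = y0).card := by
    rcases Nat.eq_zero_or_pos
      ((I.unfound pos y l 0 c).filter fun j => I.vs j = y0).card with h0 | h0
    · rw [h0, zero_mul] at hy0
      have : (I.unfound pos y l 0 c).card = 0 := by omega
      rw [this, zero_mul] at hdense
      omega
    · exact h0
  obtain ⟨j0, hj0⟩ := card_pos.1 hne
  have hnew : ∀ i < l, y0 ≠ y i := by
    intro i hi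
    have h1 := mem_filter.1 hj0
    rw [← h1.2]
    exact (mem_filter.1 h1.1).2.2 i hi
  have hcoreq : ((I.unfound pos y l 0 c).filter fun j => I.vs j = y0) =
      (range I.d).filter fun j => pos j < c ∧ I.vs j = y0 := by
    ext j
    simp only [unfound, mem_filter, mem_range]
    constructor
    · rintro ⟨⟨h1, h2, _⟩, h3⟩; exact ⟨h1, h2.2, h3⟩
    · rintro ⟨h1, h2, h3⟩
      exact ⟨⟨h1, ⟨Nat.zero_le _, h2⟩, fun i hi => h3 ▸ hnew i hi⟩, h3⟩
  rw [hcoreq] at hy0 hne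
  set D := ((range I.d).filter fun j => pos j < c ∧ I.vs j = y0).card with hD
  have hsize : c ≤ D * (I.K * I.Q ^ (l + 1)) := by
    calc c ≤ (I.unfound pos y l 0 c).card * I.Q ^ (l + 1) := hdense
      _ ≤ D * I.K * I.Q ^ (l + 1) := Nat.mul_le_mul_right _ hy0
      _ = _ := by ring
  have hDc : D ≤ c := by
    refine le_of_le_of_eq ?_ (h.isPos.card_prefix hcd)
    exact card_le_card fun j hj => by
      simp only [mem_filter] at hj ⊢; exact ⟨hj.1, hj.2.1⟩
  have hmG : I.m * c ≤ D * I.G := by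
    have : c ≤ D * I.B := hsize.trans (by
      unfold B; gcongr
      omega)
    calc I.m * c ≤ I.m * (D * I.B) := Nat.mul_le_mul_left _ this
      _ = D * I.G := by unfold G; ring
  have hm := I.hm
  -- The weight is `D * G` rounded up to a multiple of `c`. Rounding adds less than `c`, which is at
  -- most `D * G / m` by the density of the core, and `D ≤ c` keeps the quotient at most `G`, so
  -- that `q - 1` is among the guessed values.
  obtain ⟨q, hq⟩ : ∃ q, q = (D * I.G + (c - 1)) / c := ⟨_, rfl⟩
  have hq1 : D * I.G ≤ q * c := by
    have h1 := Nat.div_add_mod (D * I.G + (c - 1)) c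
    have h2 := Nat.mod_lt (D * I.G + (c - 1)) hc1
    rw [← hq] at h1
    have h3 : q * c = c * q := mul_comm _ _
    omega
  have hq2 : q * c ≤ D * I.G + (c - 1) := by rw [hq]; exact Nat.div_mul_le_self _ _
  have hqpos : 1 ≤ q := by
    rcases Nat.eq_zero_or_pos q with h0 | h0
    · rw [h0, zero_mul] at hq1
      have : 10 * 1 ≤ I.m * c := Nat.mul_le_mul hm hc1
      omega
    · exact h0
  have hqG : q ≤ I.G := by
    by_contra hcon
    have h1 : (I.G + 1) * c ≤ q * c := Nat.mul_le_mul_right _ (by omega)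
    have h2 : D * I.G ≤ c * I.G := Nat.mul_le_mul_right _ hDc
    have h3 : (I.G + 1) * c = c * I.G + c := by ring
    omega
  refine ⟨e, he, y0, hy0K, q - 1, by omega, ?_⟩
  rw [← hc, Nat.sub_add_cancel hqpos]
  have uR : ∀ i < l, Function.update R l c i = R i := fun i hi => Function.update_of_ne hi.ne _ _
  have uy : ∀ i < l, Function.update y l y0 i = y i := fun i hi => Function.update_of_ne hi.ne _ _
  have uw : ∀ i < l, Function.update w l (q * c) i = w i :=
    fun i hi => Function.update_of_ne hi.ne _ _
  have hcl : I.core pos (Function.update R l c) (Function.update y l y0) l =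
      (range I.d).filter fun j => pos j < c ∧ I.vs j = y0 := by
    simp [core]
  have split : ∀ i < l + 1, i < l ∨ i = l := fun i hi => by omega
  refine ⟨h.isPos, ?_, ?_, ?_, ?_, ?_, ?_, ?_, ?_⟩
  · intro i i' hii hi'
    rcases split i' hi' with h1 | rfl
    · rw [uR i (by omega), uR i' h1]; exact h.anti i i' hii h1
    · rcases hii.eq_or_lt with rfl | h1
      · exact le_rfl
      · rw [uR i h1, Function.update_self]
        have h2 : I.cur R i' = R (i' - 1) := by simp [cur, (show i' ≠ 0 by omega)]
        rw [h2] at hcur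
        exact hcur.trans (h.anti i (i' - 1) (by omega) (by omega))
  · intro i hi
    rcases split i hi with h1 | rfl
    · rw [uR i h1]; exact h.pow i h1
    · rw [Function.update_self]; exact ⟨e, he, hc⟩
  · intro i hi
    rcases split i hi with h1 | rfl
    · rw [uy i h1]; exact h.lab i h1
    · rw [Function.update_self]; exact hy0K
  · intro i hi i' hi'
    rcases split i hi with h1 | rfl <;> rcases split i' hi' with h2 | rfl
    · rw [uy i h1, uy i' h2]; exact h.inj i h1 i' h2
    · rw [uy i h1, Function.update_self]; exact fun e => absurd e.symm (hnew i h1)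
    · rw [uy i' h2, Function.update_self]; exact fun e => absurd e (hnew i' h2)
    · exact fun _ => rfl
  · intro i hi
    rcases split i hi with h1 | rfl
    · rw [core_congr (uR i h1) (uy i h1), uR i h1]; exact h.size i h1
    · rw [hcl, Function.update_self]; exact hsize
  · intro i hi
    rcases split i hi with h1 | rfl
    · rw [core_congr (uR i h1) (uy i h1), uw i h1]; exact h.le_weight i h1
    · rw [hcl, Function.update_self]; exact hq1
  · intro i hi
    rcases split i hi with h1 | rfl
    · rw [core_congr (uR i h1) (uy i h1), uw i h1]; exact h.weight_le i h1
    · rw [hcl, Function.update_self]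
      calc I.m * (q * c) ≤ I.m * (D * I.G + c) := Nat.mul_le_mul_left _ (by omega)
        _ = I.m * (D * I.G) + I.m * c := by ring
        _ ≤ I.m * (D * I.G) + D * I.G := by omega
        _ = _ := by ring
  · intro U hU
    have hcurl : I.cur (Function.update R l c) (l + 1) = c := by simp [cur]
    -- The new core lies within the first `c` positions, so it saves none of the columns beyond
    -- them; the additional label can only bring these columns nearer.
    have hlosteq : I.lost pos (Function.update R l c) (Function.update y l y0) (l + 1) c =
        I.lost pos R y l c := by
      refine filter_congr fun j _ => and_congr_right fun hj => ?_
      constructor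
      · intro h1 i hi
        have := h1 i (by omega)
        rwa [uR i hi, uy i hi] at this
      · intro h1 i hi
        rcases split i hi with h2 | rfl
        · rw [uR i h2, uy i h2]; exact h1 i h2
        · rw [Function.update_self]; omega
    rw [hcurl, hlosteq]
    rcases Nat.eq_zero_or_pos l with rfl | hl
    · rw [hlost0 rfl]; simp
    have hcc : I.cc pos R y l U ≤ 2 * I.opt := by
      refine le_trans ?_ hU
      rw [← cc_congr uR uy U]
      exact sum_le_sum_of_subset (range_subset_range.2 (by omega))
    refine le_trans (Nat.mul_le_mul_left _ (sum_le_sum fun j _ => ?_)) (hlost U hcc)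
    have h1 := aminf_lt hl fun i => I.dist U (y i) j
    have h2 := near_le (I := I) (Function.update y l y0)
      (i := aminf l fun i => I.dist U (y i) j) (l := l + 1) (by omega) U j
    rw [uy _ h1] at h2
    exact h2

/-- At the start of a trial consistent guesses exist. -/
theorem ready_zero {pos R y w : ℕ → ℕ} (hp : IsPos I.d pos) : I.Ready pos R y w 0 := by
  have hpow : I.d ≤ 2 ^ Nat.clog 2 I.d := Nat.le_pow_clog (by norm_num) _
  have hmin : min (2 ^ Nat.clog 2 I.d) I.d = I.d := min_eq_right hpow
  have hl : ∀ R y : ℕ → ℕ, I.lost pos R y 0 I.d = ∅ := by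
    intro R y
    refine filter_eq_empty_iff.2 fun j hj h => ?_
    have := hp.1 j (mem_range.1 hj)
    omega
  have hv : I.Valid pos R y w 0 :=
    ⟨hp, by omega, by omega, by omega, by omega, by omega, by omega, by omega, fun U _ => by
      simp [cur, hl]⟩
  refine hv.ready (e := Nat.clog 2 I.d) (by unfold I1; omega) ?_ ?_ I.hK ?_ ?_
  · simp [cur]
  · rw [hmin]
    have : I.unfound pos y 0 0 I.d = range I.d := by
      refine filter_true_of_mem fun j hj => ⟨⟨Nat.zero_le _, hp.1 j (mem_range.1 hj)⟩, by omega⟩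
    rw [this, card_range]
    exact Nat.le_mul_of_pos_right _ (pow_pos I.Q_pos _)
  · intro U _; rw [hmin, hl]; simp
  · intro _; rw [hmin, hl]

/-- The transition between two stages: after sorting the current list by decreasing distance
from the found labels, either the found labels suffice, or consistent next guesses exist. -/
theorem Valid.advance {pos R y w : ℕ → ℕ} {l : ℕ} (h : I.Valid pos R y w l) (hl : 0 < l)
    {U : ℕ → ℕ} (hU : I.m * I.cc pos R y l U ≤ (I.m + 9) * I.cc pos R y l I.us)
    (hsort : ∀ j < I.d, ∀ j' < I.d, pos j < pos j' → pos j' < R (l - 1) →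
      I.near y l U j' ≤ I.near y l U j) :
    I.m * ∑ j ∈ range I.d, I.near y l U j ≤ (I.m + 10) * I.opt ∨ I.Ready pos R y w l := by
  have hm := I.hm
  have hK := I.hK
  have hcur : I.cur R l = R (l - 1) := by simp [cur, hl.ne']
  set R' := R (l - 1) with hR'
  obtain ⟨e', he', hRe⟩ := h.pow (l - 1) (by omega)
  rw [← hR'] at hRe
  have hRd : R' ≤ I.d := hRe ▸ min_le_right _ _
  have hR1 : 1 ≤ R' := hRe ▸ le_min Nat.one_le_two_pow I.hd
  have hopt := cc_us_le (I := I) (pos := pos) (R := R) h.inj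
  have hU2 : I.cc pos R y l U ≤ 2 * I.opt := by
    -- Here `10 ≤ m` is used, in the form `m + 9 ≤ 2 m`.
    have h1 : (I.m + 9) * I.cc pos R y l I.us ≤ (2 * I.m) * I.opt :=
      Nat.mul_le_mul (by omega) hopt
    refine Nat.le_of_mul_le_mul_left (c := I.m) ?_ (by omega)
    calc _ ≤ _ := hU
      _ ≤ _ := h1
      _ = _ := by ring
  have hQ := I.Q_pos
  have hlt : ∀ i < l, ∀ j, pos j < R' → pos j < R i :=
    fun i hi j hj => hj.trans_le (h.anti i (l - 1) (by omega) (by omega))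
  -- the cut position
  obtain ⟨c0, hc0R, hc0, hbig⟩ : ∃ c0 ≤ R', (c0 = 0 ∨ ((∃ e < I.I1, c0 = min (2 ^ e) I.d) ∧
      c0 ≤ (I.unfound pos y l 0 c0).card * I.Q ^ (l + 1))) ∧
      ∀ c, (∃ e < I.I1, c = min (2 ^ e) I.d) → c0 < c → c ≤ R' →
        (I.unfound pos y l 0 c).card * I.Q ^ (l + 1) < c := by
    classical
    let p : ℕ → Prop := fun c0 => c0 = 0 ∨ ((∃ e < I.I1, c0 = min (2 ^ e) I.d) ∧
      c0 ≤ (I.unfound pos y l 0 c0).card * I.Q ^ (l + 1))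
    -- The value `0` is admitted as a default, so a greatest cut always exists; it means that no
    -- admissible prefix is dense.
    refine ⟨Nat.findGreatest p R', Nat.findGreatest_le _,
      Nat.findGreatest_spec (P := p) (Nat.zero_le _) (Or.inl rfl), fun c hc h1 h2 => ?_⟩
    by_contra hcon
    exact Nat.findGreatest_is_greatest h1 h2 (Or.inr ⟨hc, not_lt.1 hcon⟩)
  -- few columns among the first `P` positions are unfound
  have hfew : ∀ P, c0 < P → P ≤ R' →
      (I.N + 1) * (I.unfound pos y l 0 P).card ≤ P := by
    intro P hP hPR
    have hP2 : 2 ^ Nat.clog 2 P ≤ 2 * P := by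
      rcases (show 1 ≤ P by omega).eq_or_lt with rfl | h1
      · simp
      · have := Nat.pow_pred_clog_lt_self (b := 2) (by norm_num) h1
        have h3 : 0 < Nat.clog 2 P := Nat.clog_pos (by norm_num) h1
        obtain ⟨z, hz⟩ : ∃ z, Nat.clog 2 P = z + 1 := ⟨_, (Nat.succ_pred_eq_of_pos h3).symm⟩
        rw [hz] at this ⊢
        simp only [Nat.pred_succ] at this
        rw [pow_succ]; omega
    have hP1 : P ≤ 2 ^ Nat.clog 2 P := Nat.le_pow_clog (by norm_num) _
    -- Rounding `P` up to an admissible length at most doubles it, and the factor `2` in `Q` absorbs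
    -- this. The bound `R'` does no harm since it is itself an admissible length.
    have hcand := hbig (min (2 ^ Nat.clog 2 P) R') ?_ (by omega) (min_le_right _ _)
    · have hmono : (I.unfound pos y l 0 P).card ≤
          (I.unfound pos y l 0 (min (2 ^ Nat.clog 2 P) R')).card := by
        refine card_le_card fun j hj => ?_
        simp only [unfound, mem_filter] at hj ⊢
        refine ⟨hj.1, ⟨hj.2.1.1, ?_⟩, hj.2.2⟩
        have : P ≤ min (2 ^ Nat.clog 2 P) R' := le_min hP1 hPR
        omega
      have hQl : 2 * (I.N + 1) ≤ I.Q ^ (l + 1) := by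
        calc 2 * (I.N + 1) = 2 * 1 * (I.N + 1) := by ring
          _ ≤ I.Q := by unfold Q; gcongr
          _ ≤ I.Q ^ (l + 1) := Nat.le_self_pow (by omega) _
      have h1 : (I.unfound pos y l 0 P).card * (2 * (I.N + 1)) ≤
          (I.unfound pos y l 0 (min (2 ^ Nat.clog 2 P) R')).card * I.Q ^ (l + 1) :=
        Nat.mul_le_mul hmono hQl
      have h2 : min (2 ^ Nat.clog 2 P) R' ≤ 2 * P := (min_le_left _ _).trans hP2
      have h3 : (I.unfound pos y l 0 P).card * (2 * (I.N + 1)) =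
        2 * ((I.N + 1) * (I.unfound pos y l 0 P).card) := by ring
      omega
    · refine ⟨min (Nat.clog 2 P) e', lt_of_le_of_lt (min_le_right _ _) he', ?_⟩
      rw [hRe, ← min_assoc]
      congr 1
      exact ((pow_right_mono₀ (by norm_num : (1 : ℕ) ≤ 2)).map_min).symm
  set L := I.unfound pos y l c0 R' with hL
  -- the number of newly lost columns
  have hLcard : L.card * I.Q ^ (l + 1) ≤ R' := by
    rcases hc0R.eq_or_lt with h1 | h1
    · have : L = ∅ := by
        refine filter_eq_empty_iff.2 fun j _ hj => ?_
        omega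
      rw [this]; simp
    · refine le_trans (Nat.mul_le_mul_right _ (card_le_card fun j hj => ?_))
        (hbig R' ⟨e', he', hRe⟩ h1 le_rfl).le
      simp only [hL, unfound, mem_filter] at hj ⊢
      exact ⟨hj.1, ⟨Nat.zero_le _, hj.2.1.2⟩, hj.2.2⟩
  -- their cost with respect to `U`
  have hLcost : I.N * ∑ j ∈ L, I.near y l U j ≤ 2 * I.opt := by
    set F := (range I.d).filter fun j => pos j < R' ∧ ∃ i < l, I.vs j = y i with hF
    -- This is the use of the sorting: the columns of the list with distance at least `τ` form a
    -- prefix of some length `P`. If `P ≤ c0` the level set of `L` is empty; otherwise at most a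
    -- fraction `1 / (N + 1)` of the prefix is unfound and all the rest lies in `F`.
    have h1 : I.N * ∑ j ∈ L, I.near y l U j ≤ ∑ j ∈ F, I.near y l U j := by
      refine mul_sum_le_sum_of_levels fun τ _ => ?_
      set S := (range I.d).filter fun j => pos j < R' ∧ τ ≤ I.near y l U j with hS
      set P := S.sup fun j => pos j + 1 with hP
      have hPR : P ≤ R' := Finset.sup_le fun j hj => by
        have := (mem_filter.1 hj).2.1; omega
      have hmem : ∀ j < I.d, (pos j < P ↔ pos j < R' ∧ τ ≤ I.near y l U j) := by
        intro j hj
        constructor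
        · intro hjP
          refine ⟨hjP.trans_le hPR, ?_⟩
          obtain ⟨j', hj', h3⟩ := (Finset.lt_sup_iff).1 hjP
          have h4 := mem_filter.1 hj'
          have h5 := mem_range.1 h4.1
          rcases (Nat.lt_succ_iff.1 h3).eq_or_lt with h6 | h6
          · rw [h.isPos.2 j hj j' h5 h6]; exact h4.2.2
          · exact h4.2.2.trans (hsort j hj j' h5 h6 h4.2.1)
        · intro hj2
          have : pos j + 1 ≤ P := le_sup (f := fun j => pos j + 1)
            (mem_filter.2 ⟨mem_range.2 hj, hj2⟩)
          omega
      rcases le_or_gt P c0 with hPc | hPc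
      · have : (L.filter fun j => τ ≤ I.near y l U j) = ∅ := by
          refine filter_eq_empty_iff.2 fun j hj h3 => ?_
          have h4 := mem_filter.1 hj
          have := (hmem j (mem_range.1 h4.1)).2 ⟨h4.2.1.2, h3⟩
          omega
        rw [this]; simp
      · have h3 := hfew P hPc hPR
        have h4 : (L.filter fun j => τ ≤ I.near y l U j).card ≤
            (I.unfound pos y l 0 P).card := by
          refine card_le_card fun j hj => ?_
          obtain ⟨h5, h6⟩ := mem_filter.1 hj
          have h5 := mem_filter.1 h5
          exact mem_filter.2 ⟨h5.1, ⟨Nat.zero_le _,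
            (hmem j (mem_range.1 h5.1)).2 ⟨h5.2.1.2, h6⟩⟩, h5.2.2⟩
        have h5 : P ≤ (I.unfound pos y l 0 P).card +
            (F.filter fun j => τ ≤ I.near y l U j).card := by
          refine le_trans (h.isPos.card_prefix (hPR.trans hRd)).ge ?_
          refine le_trans (card_le_card fun j hj => ?_) (card_union_le _ _)
          have hj := mem_filter.1 hj
          have h6 := (hmem j (mem_range.1 hj.1)).1 hj.2
          by_cases h7 : ∃ i < l, I.vs j = y i
          · exact mem_union_right _ (mem_filter.2 ⟨mem_filter.2 ⟨hj.1, h6.1, h7⟩, h6.2⟩)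
          · push Not at h7
            exact mem_union_left _ (mem_filter.2 ⟨hj.1, ⟨Nat.zero_le _, hj.2⟩, h7⟩)
        have h6 : I.N * (L.filter fun j => τ ≤ I.near y l U j).card ≤
            I.N * (I.unfound pos y l 0 P).card := Nat.mul_le_mul_left _ h4
        have h7 : (I.N + 1) * (I.unfound pos y l 0 P).card =
            I.N * (I.unfound pos y l 0 P).card + (I.unfound pos y l 0 P).card := by ring
        omega
    refine h1.trans (le_trans ?_ hU2)
    have h2 : F ⊆ (range l).biUnion fun i => I.core pos R y i := by
      intro j hj
      obtain ⟨h3, h4, i, hi, h5⟩ := mem_filter.1 hj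
      exact mem_biUnion.2 ⟨i, mem_range.2 hi, mem_filter.2 ⟨h3, hlt i hi j h4, h5⟩⟩
    refine (sum_le_sum_of_subset h2).trans ?_
    refine (sum_biUnion_le' _ _ _).trans ?_
    exact sum_le_sum fun i hi => sum_le_sum fun j _ => near_le _ (mem_range.1 hi) _ _
  -- their cost with respect to any good `U'`
  have hLcost' : ∀ U', I.cc pos R y l U' ≤ 2 * I.opt →
      I.N * ∑ j ∈ L, I.near y l U' j ≤ 4 * I.opt := by
    intro U' hU'
    rcases Nat.eq_zero_or_pos L.card with h0 | hLpos
    · rw [card_eq_zero.1 h0]; simp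
    -- The triangle inequality is averaged over the core of the label nearest to `j` under `U`. Both
    -- `U` and `U'` cost at most `2 * opt` on that core, so `j` pays at most `4 * opt / D` extra.
    have hterm : ∀ j ∈ L, L.card * I.N * I.near y l U' j ≤
        L.card * I.N * I.near y l U j + 2 * I.opt := by
      intro j _
      set i := aminf l fun i => I.dist U (y i) j with hi
      have hil : i < l := aminf_lt hl _
      set D := (I.core pos R y i).card with hD
      have h1 : D * I.near y l U' j ≤ D * I.near y l U j + 4 * I.opt := by
        have h2 : ∀ j' ∈ I.core pos R y i, I.near y l U' j ≤
            I.near y l U j + (I.dist U (y i) j' + I.dist U' (y i) j') := by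
          intro j' _
          have h3 := near_le (I := I) y hil U' j
          have h4 := dist_triangle (I := I) U U' (y i) j j'
          have h5 : I.near y l U j = I.dist U (y i) j := rfl
          omega
        have h3 := sum_le_sum h2
        rw [sum_const, smul_eq_mul, sum_add_distrib, sum_const, smul_eq_mul,
          sum_add_distrib, ← hD] at h3
        have h4 : ∑ j' ∈ I.core pos R y i, I.dist U (y i) j' ≤ I.cc pos R y l U :=
          single_le_sum (f := fun i => ∑ j' ∈ I.core pos R y i, I.dist U (y i) j')
            (fun _ _ => Nat.zero_le _) (mem_range.2 hil)
        have h5 : ∑ j' ∈ I.core pos R y i, I.dist U' (y i) j' ≤ I.cc pos R y l U' :=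
          single_le_sum (f := fun i => ∑ j' ∈ I.core pos R y i, I.dist U' (y i) j')
            (fun _ _ => Nat.zero_le _) (mem_range.2 hil)
        omega
      -- The reason for geometrically decreasing densities: `L` is sparser than any earlier core by
      -- the factor `Q / K = 2 (N + 1)`.
      have h2 : L.card * (2 * (I.N + 1)) ≤ D := by
        have h3 : L.card * I.Q ^ (l + 1) ≤ D * (I.K * I.Q ^ l) := by
          calc _ ≤ R' := hLcard
            _ ≤ R i := h.anti i (l - 1) (by omega) (by omega)
            _ ≤ D * (I.K * I.Q ^ (i + 1)) := h.size i hil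
            _ ≤ _ := by gcongr; omega
        have h4 : 0 < I.K * I.Q ^ l := by positivity
        refine Nat.le_of_mul_le_mul_right (c := I.K * I.Q ^ l) ?_ h4
        refine le_trans (le_of_eq ?_) h3
        rw [pow_succ]
        conv_rhs => rw [show I.Q ^ l * I.Q = I.Q ^ l * (2 * I.K * (I.N + 1)) from rfl]
        ring
      rcases le_total (I.near y l U' j) (I.near y l U j) with h3 | h3
      · exact (Nat.mul_le_mul_left _ h3).trans (Nat.le_add_right _ _)
      · obtain ⟨z, hz⟩ := Nat.exists_eq_add_of_le h3
        rw [hz] at h1 ⊢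
        have h4 : D * z ≤ 4 * I.opt := by
          rw [mul_add] at h1; omega
        have h5 : L.card * (2 * (I.N + 1)) * z ≤ 4 * I.opt :=
          (Nat.mul_le_mul_right _ h2).trans h4
        have h6 : L.card * (2 * (I.N + 1)) * z = 2 * (L.card * I.N * z) + 2 * (L.card * z) := by
          ring
        rw [mul_add]
        omega
    have h1 := sum_le_sum hterm
    rw [← mul_sum, sum_add_distrib, ← mul_sum, sum_const, smul_eq_mul] at h1
    refine Nat.le_of_mul_le_mul_left (c := L.card) ?_ hLpos
    have h2 : L.card * (I.N * ∑ j ∈ L, I.near y l U j) ≤ L.card * (2 * I.opt) :=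
      Nat.mul_le_mul_left _ hLcost
    calc L.card * (I.N * ∑ j ∈ L, I.near y l U' j)
        = L.card * I.N * ∑ j ∈ L, I.near y l U' j := by ring
      _ ≤ _ := h1
      _ = L.card * (I.N * ∑ j ∈ L, I.near y l U j) + L.card * (2 * I.opt) := by ring
      _ ≤ L.card * (2 * I.opt) + L.card * (2 * I.opt) := Nat.add_le_add_right h2 _
      _ = _ := by ring
  -- all lost columns
  have hsplit : I.lost pos R y l c0 ⊆ I.lost pos R y l (I.cur R l) ∪ L := by
    intro j hj
    obtain ⟨h1, h2, h3⟩ := mem_filter.1 hj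
    rcases lt_or_ge (pos j) R' with h4 | h4
    · exact mem_union_right _ (mem_filter.2 ⟨h1, ⟨h2, h4⟩, fun i hi e =>
        h3 i hi ⟨hlt i hi j h4, e⟩⟩)
    · exact mem_union_left _ (mem_filter.2 ⟨h1, by rw [hcur]; exact h4, h3⟩)
  have hlostsum : ∀ U', I.N * ∑ j ∈ I.lost pos R y l c0, I.near y l U' j ≤
      I.N * ∑ j ∈ I.lost pos R y l (I.cur R l), I.near y l U' j +
        I.N * ∑ j ∈ L, I.near y l U' j := by
    intro U'
    rw [← mul_add]
    refine Nat.mul_le_mul_left _ ((sum_le_sum_of_subset hsplit).trans ?_)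
    rw [← sum_union_inter]
    exact Nat.le_add_right _ _
  rcases hc0 with h0 | ⟨⟨e, he, hce⟩, hdense⟩
  · left
    have hall : range I.d ⊆ ((range l).biUnion fun i => I.core pos R y i) ∪
        I.lost pos R y l c0 := by
      intro j hj
      by_cases h1 : ∀ i < l, ¬ (pos j < R i ∧ I.vs j = y i)
      · exact mem_union_right _ (mem_filter.2 ⟨hj, by omega, h1⟩)
      · push Not at h1
        obtain ⟨i, hi, h2⟩ := h1
        exact mem_union_left _ (mem_biUnion.2 ⟨i, mem_range.2 hi, mem_filter.2 ⟨hj, h2⟩⟩)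
    have htot : ∑ j ∈ range I.d, I.near y l U j ≤
        I.cc pos R y l U + ∑ j ∈ I.lost pos R y l c0, I.near y l U j := by
      refine (sum_le_sum_of_subset hall).trans ?_
      have h1 := sum_union_inter (s₁ := (range l).biUnion fun i => I.core pos R y i)
        (s₂ := I.lost pos R y l c0) (f := fun j => I.near y l U j)
      have h2 : ∑ j ∈ (range l).biUnion (fun i => I.core pos R y i), I.near y l U j ≤
          I.cc pos R y l U := by
        refine (sum_biUnion_le' _ _ _).trans ?_
        exact sum_le_sum fun i hi => sum_le_sum fun j _ => near_le _ (mem_range.1 hi) _ _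
      omega
    have h1 := hlostsum U
    have h2 := h.lost_le U hU2
    -- Earlier stages contribute `4 l * opt` and the present one `2 * opt`; with `l ≤ K` the total
    -- is at most `6 K * opt`. This explains `N = 6 K m`, which leaves `opt / m`.
    have h3 : I.N * ∑ j ∈ I.lost pos R y l c0, I.near y l U j ≤ 6 * I.K * I.opt := by
      have h4 : 4 * l * I.opt ≤ 4 * I.K * I.opt :=
        Nat.mul_le_mul_right _ (Nat.mul_le_mul_left _ h.le_K)
      have h5 : 2 * 1 * I.opt ≤ 2 * I.K * I.opt :=
        Nat.mul_le_mul_right _ (Nat.mul_le_mul_left _ hK)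
      have h6 : 6 * I.K * I.opt = 4 * I.K * I.opt + 2 * I.K * I.opt := by ring
      omega
    have hNpos : 0 < 6 * I.K := by omega
    have h4 : I.m * ∑ j ∈ I.lost pos R y l c0, I.near y l U j ≤ I.opt := by
      refine Nat.le_of_mul_le_mul_left (c := 6 * I.K) ?_ hNpos
      calc 6 * I.K * (I.m * ∑ j ∈ I.lost pos R y l c0, I.near y l U j)
          = I.N * ∑ j ∈ I.lost pos R y l c0, I.near y l U j := by unfold N; ring
        _ ≤ _ := h3
    calc I.m * ∑ j ∈ range I.d, I.near y l U j
        ≤ I.m * I.cc pos R y l U + I.m * ∑ j ∈ I.lost pos R y l c0, I.near y l U j := by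
          rw [← mul_add]; exact Nat.mul_le_mul_left _ htot
      _ ≤ (I.m + 9) * I.opt + I.opt := add_le_add (hU.trans (Nat.mul_le_mul_left _ hopt)) h4
      _ = _ := by ring
  · right
    -- If all `K` labels were found, no column would be unfound and no nonempty prefix could be
    -- dense.
    have hlK : l < I.K := by
      by_contra hcon
      have hlK : l = I.K := le_antisymm h.le_K (not_lt.1 hcon)
      have hsurj : (range l).image y = range I.K := by
        refine eq_of_subset_of_card_le (fun x hx => ?_) ?_
        · obtain ⟨i, hi, rfl⟩ := mem_image.1 hx
          exact mem_range.2 (h.lab i (mem_range.1 hi))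
        · rw [card_image_of_injOn fun i hi i' hi' e =>
            h.inj i (by simpa using hi) i' (by simpa using hi') e]
          simp [hlK]
      have : I.unfound pos y l 0 c0 = ∅ := by
        refine filter_eq_empty_iff.2 fun j _ hj => ?_
        have h1 : I.vs j ∈ (range l).image y := by rw [hsurj]; exact mem_range.2 (I.hvs j)
        obtain ⟨i, hi, h2⟩ := mem_image.1 h1
        exact hj.2 i (mem_range.1 hi) h2.symm
      rw [this] at hdense
      have h1 : 1 ≤ c0 := hce ▸ le_min Nat.one_le_two_pow I.hd
      simp at hdense
      omega
    subst hce
    refine h.ready he (by rw [hcur]; exact hc0R) hdense hlK (fun U' hU' => ?_)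
      (fun h0 => absurd h0 hl.ne')
    refine (hlostsum U').trans ?_
    refine (add_le_add (h.lost_le U' hU') (hLcost' U' hU')).trans (le_of_eq ?_)
    ring

end Inst

/-! ### Sampling from the lists -/

theorem sum_range_mul_div (f : ℕ → ℝ) (L : ℕ) {t : ℕ} (ht : 0 < t) :
    ∑ v ∈ range (L * t), f (v / t) = t * ∑ i ∈ range L, f i := by
  induction L with
  | zero => simp
  | succ L ih =>
    rw [Nat.succ_mul, sum_range_add, ih, sum_range_succ, mul_add]
    congr 1
    rw [← nsmul_eq_mul, ← card_range t, ← sum_const, card_range]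
    refine sum_congr rfl fun v hv => ?_
    congr 1
    rw [mul_comm, Nat.mul_add_div ht, Nat.div_eq_of_lt (mem_range.1 hv), add_zero]

namespace Inst

variable {I : Inst}

/-- Uniform samples from the lists give, with a probability bounded from below, row vectors that
are nearly optimal on the cores. -/
theorem Valid.sampling {pos R y w : ℕ → ℕ} {L : ℕ} (h : I.Valid pos R y w L)
    {t : ℕ} (ht : t = 12 * I.K * I.m ^ 2) {col : ℕ → ℕ}
    (hcol : ∀ s < I.d, col s < I.d ∧ pos (col s) = s)
    (ch : (ℕ → ℕ) → ℕ → ℕ) (hch : ∀ s i, ch s i < I.K)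
    (hopt : ∀ s i, ∀ x < I.K,
      ∑ v ∈ range (L * t), w (v / t) * I.mis (ch s i) (y (v / t)) (I.a i (col (s v))) ≤
      ∑ v ∈ range (L * t), w (v / t) * I.mis x (y (v / t)) (I.a i (col (s v)))) (s0 : ℕ → ℕ)
    (P : (ℕ → ℕ) → Prop) [DecidablePred P]
    (hP : ∀ s, I.m * I.cc pos R y L (ch s) ≤ (I.m + 9) * I.cc pos R y L I.us → P s) :
    (1 / I.B : ℝ) ^ (L * t) * (1 / 2) ≤
      mav (fun v => range (R (v / t))) (fun s => if P s then 1 else 0) (L * t) 0 s0 := by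
  have hK := I.hK
  have hm := I.hm
  have htpos : 0 < t := by rw [ht]; positivity
  have hQ := I.Q_pos
  have hBpos : 0 < I.B := by unfold B; positivity
  have hG : 0 < I.G := by unfold G; positivity
  -- Sample `v` serves cluster `v / t`; `D v` consists of the positions in its prefix that hold a
  -- column of the core. Conditioned on `D`, the samples are uniform in the cores.
  set D : ℕ → Finset ℕ := fun v => (range (R (v / t))).filter fun s => I.vs (col s) = y (v / t)
    with hD
  have hvL : ∀ {v}, v < L * t → v / t < L := fun hv => (Nat.div_lt_iff_lt_mul htpos).2 hv
  have hRd : ∀ i < L, R i ≤ I.d := by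
    intro i hi
    obtain ⟨e, _, he⟩ := h.pow i hi
    rw [he]; exact min_le_right _ _
  have hR1 : ∀ i < L, 1 ≤ R i := by
    intro i hi
    obtain ⟨e, _, he⟩ := h.pow i hi
    rw [he]; exact le_min Nat.one_le_two_pow I.hd
  -- ranks and columns correspond
  have hbij : ∀ i < L, ∀ f : ℕ → ℝ,
      ∑ s ∈ (range (R i)).filter (fun s => I.vs (col s) = y i), f (col s) =
        ∑ j ∈ I.core pos R y i, f j := by
    intro i hi f
    refine sum_bij (fun s _ => col s) ?_ ?_ ?_ (fun _ _ => rfl)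
    · intro s hs
      obtain ⟨h1, h2⟩ := mem_filter.1 hs
      have h1 := mem_range.1 h1
      have h3 := hcol s (h1.trans_le (hRd i hi))
      exact mem_filter.2 ⟨mem_range.2 h3.1, by rw [h3.2]; exact h1, h2⟩
    · intro s hs s' hs' e
      have h1 := mem_range.1 (mem_filter.1 hs).1
      have h2 := mem_range.1 (mem_filter.1 hs').1
      rw [← (hcol s (h1.trans_le (hRd i hi))).2, ← (hcol s' (h2.trans_le (hRd i hi))).2, e]
    · intro j hj
      obtain ⟨h1, h2, h3⟩ := mem_filter.1 hj
      have h4 := hcol (pos j) (h2.trans_le (hRd i hi))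
      have h5 := h.isPos.2 _ h4.1 j (mem_range.1 h1) h4.2
      exact ⟨pos j, mem_filter.2 ⟨mem_range.2 h2, by rw [h5]; exact h3⟩, h5⟩
  have hcard : ∀ i < L,
      ((range (R i)).filter (fun s => I.vs (col s) = y i)).card = (I.core pos R y i).card := by
    intro i hi
    have := hbij i hi fun _ => 1
    simpa using this
  have hcorepos : ∀ i < L, 0 < (I.core pos R y i).card := by
    intro i hi
    rcases Nat.eq_zero_or_pos (I.core pos R y i).card with h0 | h0
    · have h1 := h.size i hi
      have h2 := hR1 i hi
      rw [h0, zero_mul] at h1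
      omega
    · exact h0
  have hDne : ∀ v < L * t, (D v).Nonempty := by
    intro v hv
    rw [← card_pos, hD, hcard _ (hvL hv)]
    exact hcorepos _ (hvL hv)
  have havg : ∀ v < L * t, ∀ f : ℕ → ℝ, avg (D v) (fun s => f (col s)) =
      (∑ j ∈ I.core pos R y (v / t), f j) / (I.core pos R y (v / t)).card := by
    intro v hv f
    unfold avg
    rw [hbij _ (hvL hv), hcard _ (hvL hv)]
  have hmean : ∀ r x, meanLoss I.mis D (fun v => w (v / t)) (fun v => y (v / t))
      (fun _ s => I.a r (col s)) (L * t) x = t * ∑ i ∈ range L, (w i : ℝ) *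
        ((∑ j ∈ I.core pos R y i, (I.mis x (y i) (I.a r j) : ℝ)) /
          (I.core pos R y i).card) := by
    intro r x
    rw [← sum_range_mul_div (fun i => (w i : ℝ) *
        ((∑ j ∈ I.core pos R y i, (I.mis x (y i) (I.a r j) : ℝ)) /
          (I.core pos R y i).card)) L htpos]
    refine sum_congr rfl fun v hv => ?_
    rw [havg v (mem_range.1 hv) fun j => (I.mis x (y (v / t)) (I.a r j) : ℝ)]
  set S : (ℕ → ℕ) → ℝ := fun U => ∑ r ∈ range I.n, meanLoss I.mis D (fun v => w (v / t))
    (fun v => y (v / t)) (fun _ s => I.a r (col s)) (L * t) (U r) with hS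
  have hSU : ∀ U, S U = t * ∑ i ∈ range L, (w i : ℝ) *
        ((∑ j ∈ I.core pos R y i, (I.dist U (y i) j : ℝ)) / (I.core pos R y i).card) := by
    intro U
    rw [hS]
    simp only [hmean]
    rw [← mul_sum, sum_comm]
    congr 1
    refine sum_congr rfl fun i _ => ?_
    rw [← mul_sum, ← sum_div, sum_comm]
    simp only [dist, Nat.cast_sum]
  have hccR : ∀ U, (I.cc pos R y L U : ℝ) =
      ∑ i ∈ range L, ∑ j ∈ I.core pos R y i, (I.dist U (y i) j : ℝ) := by
    intro U; simp [cc]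
  -- The weight cancels the size of the core in the average, so `S` equals `t * G` times the cost on
  -- the cores, up to the factor `1 + 1 / m` in `hup`.
  have hlow : ∀ U, (t * I.G : ℝ) * I.cc pos R y L U ≤ S U := by
    intro U
    rw [hSU, hccR, mul_assoc, mul_sum]
    refine mul_le_mul_of_nonneg_left (sum_le_sum fun i hi => ?_) (Nat.cast_nonneg _)
    have hi := mem_range.1 hi
    have h1 : (0 : ℝ) < (I.core pos R y i).card := by exact_mod_cast hcorepos i hi
    have h2 : ((I.core pos R y i).card : ℝ) * I.G ≤ w i := by exact_mod_cast h.le_weight i hi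
    rw [← mul_div_assoc, le_div_iff₀ h1]
    have h3 : (0 : ℝ) ≤ ∑ j ∈ I.core pos R y i, (I.dist U (y i) j : ℝ) := by positivity
    nlinarith
  have hmR : (10 : ℝ) ≤ I.m := by exact_mod_cast hm
  have hup : ∀ U, I.m * S U ≤ (I.m + 1) * ((t * I.G : ℝ) * I.cc pos R y L U) := by
    intro U
    rw [hSU, hccR]
    have : (I.m + 1) * ((t * I.G : ℝ) *
        ∑ i ∈ range L, ∑ j ∈ I.core pos R y i, (I.dist U (y i) j : ℝ)) =
        t * ∑ i ∈ range L, ((I.m + 1) * I.G *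
          ∑ j ∈ I.core pos R y i, (I.dist U (y i) j : ℝ)) := by
      rw [← mul_sum]; ring
    rw [this, ← mul_assoc, mul_comm (I.m : ℝ) t, mul_assoc, mul_sum (range L) _ (I.m : ℝ)]
    refine mul_le_mul_of_nonneg_left (sum_le_sum fun i hi => ?_) (Nat.cast_nonneg _)
    have hi := mem_range.1 hi
    have h1 : (0 : ℝ) < (I.core pos R y i).card := by exact_mod_cast hcorepos i hi
    have h2 : (I.m : ℝ) * w i ≤ (I.m + 1) * ((I.core pos R y i).card * I.G) := by
      exact_mod_cast h.weight_le i hi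
    rw [← mul_assoc, ← mul_div_assoc, div_le_iff₀ h1]
    have h3 : (0 : ℝ) ≤ ∑ j ∈ I.core pos R y i, (I.dist U (y i) j : ℝ) := by positivity
    nlinarith
  have htG : (0 : ℝ) < t * I.G := by positivity
  have hhalf : 1 / 2 ≤ mav D (fun s => if P s then 1 else 0) (L * t) 0 s0 := by
    refine half_le_mav_good (mis := I.mis) (n := I.n) (K := I.K) (t := t) (m := I.m) I.hmis I.hK
      (by omega) ht.ge hDne
      (W := fun v => w (v / t)) (y := fun v => y (v / t)) (b := fun r _ s => I.a r (col s))
      (fun _ _ _ => I.ha _ _) ?_ I.us ch hch (fun s i => hopt s i _ (I.hus i)) s0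
      (δ := t * I.G / 8) (by positivity) P ?_
    · intro r x v hv
      rw [hmean, havg v hv fun j => (I.mis x (y (v / t)) (I.a r j) : ℝ)]
      gcongr
      exact single_le_sum (f := fun i => (w i : ℝ) *
        ((∑ j ∈ I.core pos R y i, (I.mis x (y i) (I.a r j) : ℝ)) / (I.core pos R y i).card))
        (fun i _ => by positivity) (mem_range.2 (hvL hv))
    · intro s _ hs
      refine hP s ?_
      change S (ch s) ≤ S I.us + 4 / I.m * (S I.us + t * I.G / 8) at hs
      have h1 := hlow (ch s)
      have h2 := hup I.us
      set c := I.cc pos R y L I.us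
      set c' := I.cc pos R y L (ch s)
      have hm0 : (0 : ℝ) < I.m := by linarith
      have h3 : I.m * S (ch s) ≤ (I.m + 4) * S I.us + t * I.G / 2 := by
        have := mul_le_mul_of_nonneg_left hs hm0.le
        refine this.trans (le_of_eq ?_)
        field_simp
        ring
      have h4 : (I.m : ℝ) * ((I.m + 4) * S I.us) ≤
          I.m * ((I.m + 6) * ((t * I.G : ℝ) * c)) := by
        calc (I.m : ℝ) * ((I.m + 4) * S I.us) = (I.m + 4) * (I.m * S I.us) := by ring
          _ ≤ (I.m + 4) * ((I.m + 1) * ((t * I.G : ℝ) * c)) := by gcongr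
          _ = ((I.m + 4) * (I.m + 1)) * ((t * I.G : ℝ) * c) := by ring
          _ ≤ (I.m * (I.m + 6)) * ((t * I.G : ℝ) * c) := by
            refine mul_le_mul_of_nonneg_right ?_ (by positivity)
            nlinarith
          _ = _ := by ring
      have h5 := le_of_mul_le_mul_left h4 hm0
      have h6 : (t * I.G : ℝ) * (I.m * c') ≤ (t * I.G : ℝ) * ((I.m + 6) * c + 1 / 2) := by
        have := mul_le_mul_of_nonneg_left h1 hm0.le
        linarith
      have h7 := le_of_mul_le_mul_left h6 htG
      -- The choice `δ = t * G / 8` contributes only `1 / 2` after scaling, and disappears because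
      -- both sides are integers. Thus optimal cost `0` needs no separate treatment.
      have h8 : ((I.m * c' : ℕ) : ℝ) < (((I.m + 6) * c + 1 : ℕ) : ℝ) := by
        push_cast; linarith
      have h9 : I.m * c' < (I.m + 6) * c + 1 := by exact_mod_cast h8
      have h10 : (I.m + 6) * c ≤ (I.m + 9) * c := Nat.mul_le_mul_right _ (by omega)
      omega
  -- From samples in the cores to samples from whole prefixes: each of the `L * t` samples lands in
  -- its core with probability at least `1 / B`.
  refine le_trans (mul_le_mul_of_nonneg_left hhalf (by positivity)) ?_
  refine mav_restrict (D := D) (E := fun v => range (R (v / t))) (fun x => by split_ifs <;> simp)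
    (by positivity) s0 (fun v _ _ => filter_subset _ _) (fun v _ hv => ?_)
    (fun v _ hv => hDne v (by omega))
  have hvl := hvL (show v < L * t by omega)
  have h1 := h.size _ hvl
  have h2 : I.core pos R y (v / t) = I.core pos R y (v / t) := rfl
  rw [card_range, hD, hcard _ hvl, one_div, inv_mul_le_iff₀ (by exact_mod_cast hBpos)]
  have h3 : I.K * I.Q ^ (v / t + 1) ≤ I.B := by
    unfold B
    gcongr
    have := h.le_K
    omega
  calc (R (v / t) : ℝ) ≤ ((I.core pos R y (v / t)).card * (I.K * I.Q ^ (v / t + 1)) : ℕ) := by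
        exact_mod_cast h1
    _ ≤ ((I.core pos R y (v / t)).card * I.B : ℕ) := by
        exact_mod_cast Nat.mul_le_mul_left _ h3
    _ = _ := by push_cast; ring

end Inst

/-! ### Deterministic runs -/

/-- `p` halts without random choices within time `B`, in a state satisfying `Φ`. -/
def DRun {k : ℕ} (M : Machine k) (p : Prog) (σ : State) (B : ℕ) (Φ : State → Prop) : Prop :=
  ∃ σ' t, Exec M p σ (PMF.pure (σ', t)) ∧ t ≤ B ∧ Φ σ'

theorem Op.lt_eval_le (a b : ℕ) : Op.lt.eval a b ≤ 1 := by
  simp only [Op.eval]; split_ifs <;> omega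

namespace DRun

variable {k : ℕ} {M : Machine k} {p q : Prog} {σ : State} {B B' : ℕ} {Φ Ψ : State → Prop}

theorem mono (h : DRun M p σ B Φ) (hB : B ≤ B') (hΦ : ∀ σ', Φ σ' → Ψ σ') : DRun M p σ B' Ψ := by
  obtain ⟨σ', t, h1, h2, h3⟩ := h
  exact ⟨σ', t, h1, h2.trans hB, hΦ _ h3⟩

theorem seq (hp : DRun M p σ B Φ) (hq : ∀ σ', Φ σ' → DRun M q σ' B' Ψ) :
    DRun M (.seq p q) σ (B + B') Ψ := by
  obtain ⟨σ1, t1, h1, h2, h3⟩ := hp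
  obtain ⟨σ2, t2, h4, h5, h6⟩ := hq σ1 h3
  refine ⟨σ2, t1 + t2, ?_, by omega, h6⟩
  have := Exec.seq (q := q) (ν := fun _ => PMF.pure (σ2, t2)) h1 (by
    intro s hs
    rw [PMF.support_pure, Set.mem_singleton_iff] at hs
    subst hs; exact h4)
  simpa [PMF.pure_bind, PMF.pure_map] using this

theorem const {dst v : ℕ} (h : v < M.word) :
    DRun M (.const dst v) σ 1 (· = σ.setReg dst v) := ⟨_, _, .const h, le_rfl, rfl⟩

theorem arith {op : Op} {dst a b : ℕ} (h : op.eval (σ.reg a) (σ.reg b) < M.word) :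
    DRun M (.arith op dst a b) σ 1 (· = σ.setReg dst (op.eval (σ.reg a) (σ.reg b))) :=
  ⟨_, _, .arith h, le_rfl, rfl⟩

theorem load {dst addr : ℕ} :
    DRun M (.load dst addr) σ 1 (· = σ.setReg dst (σ.mem (σ.reg addr))) :=
  ⟨_, _, .load, le_rfl, rfl⟩

theorem store {addr src : ℕ} :
    DRun M (.store addr src) σ 1 (· = σ.setMem (σ.reg addr) (σ.reg src)) :=
  ⟨_, _, .store, le_rfl, rfl⟩

theorem query {dst x y v : ℕ} (hx : σ.reg x < 2 ^ k) (hy : σ.reg y < 2 ^ k) :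
    DRun M (.query dst x y v) σ (1 + M.queryTime)
      (· = σ.setReg dst (M.answer (σ.reg x) (σ.reg y) (σ.reg v))) :=
  ⟨_, _, .query hx hy, le_rfl, rfl⟩

theorem seq_eq {σ1 : State} (hp : DRun M p σ B (· = σ1)) (hq : DRun M q σ1 B' Ψ) :
    DRun M (.seq p q) σ (B + B') Ψ := hp.seq fun _ h => h ▸ hq

theorem ite {r : ℕ} (h1 : σ.reg r ≠ 0 → DRun M p σ B Φ) (h2 : σ.reg r = 0 → DRun M q σ B Φ) :
    DRun M (.ite r p q) σ (1 + B) Φ := by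
  by_cases h : σ.reg r = 0
  · obtain ⟨σ', t, h3, h4, h5⟩ := h2 h
    refine ⟨σ', 1 + t, ?_, by omega, h5⟩
    simpa [PMF.pure_map] using Exec.ite_false (p := p) h h3
  · obtain ⟨σ', t, h3, h4, h5⟩ := h1 h
    refine ⟨σ', 1 + t, ?_, by omega, h5⟩
    simpa [PMF.pure_map] using Exec.ite_true (q := q) h h3

theorem loop_aux {r N : ℕ} (Inv : ℕ → State → Prop) (b : ℕ → ℕ)
    (hbody : ∀ v < N, ∀ σ, Inv v σ → σ.reg r ≠ 0 ∧ DRun M p σ (b v) (Inv (v + 1)))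
    (hzero : ∀ σ, Inv N σ → σ.reg r = 0) (c : ℕ) :
    ∀ v σ, v + c = N → Inv v σ →
      DRun M (.loop r p) σ (∑ u ∈ Ico v N, (b u + 1) + 1) (Inv N) := by
  induction c with
  | zero =>
    intro v σ hv hI
    have hv : v = N := by omega
    subst hv
    exact ⟨σ, 1, Exec.loop_stop (hzero σ hI), by simp, hI⟩
  | succ c ih =>
    intro v σ hv hI
    obtain ⟨h1, σ1, t1, h2, h3, h4⟩ := hbody v (by omega) σ hI
    obtain ⟨σ2, t2, h5, h6, h7⟩ := ih (v + 1) σ1 (by omega) h4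
    refine ⟨σ2, 1 + t1 + t2, ?_, ?_, h7⟩
    · have := Exec.loop_step (ν := fun _ => PMF.pure (σ2, t2)) h1 h2 (by
        intro s hs
        rw [PMF.support_pure, Set.mem_singleton_iff] at hs
        subst hs; exact h5)
      simpa [PMF.pure_bind, PMF.pure_map] using this
    · rw [sum_eq_sum_Ico_succ_bot (by omega : v < N)]
      omega

theorem loop {r N : ℕ} (Inv : ℕ → State → Prop) (b : ℕ → ℕ)
    (hbody : ∀ v < N, ∀ σ, Inv v σ → σ.reg r ≠ 0 ∧ DRun M p σ (b v) (Inv (v + 1)))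
    (hzero : ∀ σ, Inv N σ → σ.reg r = 0) (h0 : Inv 0 σ) :
    DRun M (.loop r p) σ (∑ u ∈ range N, (b u + 1) + 1) (Inv N) := by
  have := loop_aux Inv b hbody hzero N 0 σ (by omega) h0
  rwa [Nat.Ico_zero_eq_range] at this

end DRun

/-! ### Expressions -/

/-- Expressions over named variables, interleaved arrays and the input.  `fold` and `amin` bind
the next free variable. -/
inductive Ex
  | lit (v : ℕ)
  | var (r : ℕ)
  | op (o : Op) (a b : Ex)
  | arr (id : ℕ) (e : Ex)
  | inp (e : Ex)
  | mis (x y v : Ex)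
  | fold (o : Op) (z : ℕ) (lim body : Ex)
  | amin (lim body : Ex)

/-- The variables and arrays represented by a machine state. -/
@[ext]
structure Gh where
  v : ℕ → ℕ
  a : ℕ → ℕ → ℕ

/-- Assignment to a variable. -/
def Gh.setv (s : Gh) (r x : ℕ) : Gh := ⟨Function.update s.v r x, s.a⟩

/-- Assignment to an array. -/
def Gh.seta (s : Gh) (id : ℕ) (f : ℕ → ℕ) : Gh := ⟨s.v, Function.update s.a id f⟩

@[simp] theorem Gh.setv_a (s : Gh) (r x : ℕ) : (s.setv r x).a = s.a := rfl
@[simp] theorem Gh.seta_v (s : Gh) (id : ℕ) (f : ℕ → ℕ) : (s.seta id f).v = s.v := rfl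
@[simp] theorem Gh.setv_v_self (s : Gh) (r x : ℕ) : (s.setv r x).v r = x := by simp [setv]
theorem Gh.setv_v_of_ne (s : Gh) {r r' : ℕ} (x : ℕ) (h : r' ≠ r) :
    (s.setv r x).v r' = s.v r' := by simp [setv, h]
theorem Gh.setv_v (s : Gh) (r r' x : ℕ) :
    (s.setv r x).v r' = if r' = r then x else s.v r' := by simp [setv, Function.update_apply]
theorem Gh.seta_a (s : Gh) (id id' : ℕ) (f : ℕ → ℕ) :
    (s.seta id f).a id' = if id' = id then f else s.a id' := by
  simp [seta, Function.update_apply]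

/-- The environment of a computation: the machine, the size of the input and its contents. -/
structure Ctx (k : ℕ) where
  M : Machine k
  base : ℕ
  inp : ℕ → ℕ

/-- Iterated application of an operation. -/
def foldv (o : Op) (z : ℕ) (f : ℕ → ℕ) : ℕ → ℕ
  | 0 => z
  | N + 1 => o.eval (foldv o z f N) (f N)

theorem foldv_add (f : ℕ → ℕ) (N : ℕ) : foldv .add 0 f N = ∑ v ∈ range N, f v := by
  induction N with
  | zero => rfl
  | succ N ih => rw [sum_range_succ, ← ih]; rfl

theorem foldv_mul (f : ℕ → ℕ) (N : ℕ) : foldv .mul 1 f N = ∏ v ∈ range N, f v := by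
  induction N with
  | zero => rfl
  | succ N ih => rw [prod_range_succ, ← ih]; rfl

namespace Ex

variable {k : ℕ}

/-- The value of an expression in which the variables below `D` may occur. -/
noncomputable def eval (C : Ctx k) : ℕ → Gh → Ex → ℕ
  | _, _, lit v => v
  | D, s, var r => if r < D then s.v r else 0
  | D, s, op o a b => o.eval (eval C D s a) (eval C D s b)
  | D, s, arr id e => s.a id (eval C D s e)
  | D, s, inp e => C.inp (eval C D s e)
  | D, s, mis x y v => 1 - C.M.answer (eval C D s x) (eval C D s y) (eval C D s v)
  | D, s, fold o z lim body =>
      foldv o z (fun v => eval C (D + 1) (s.setv D v) body) (eval C D s lim)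
  | D, s, amin lim body =>
      aminf (eval C D s lim) fun v => eval C (D + 1) (s.setv D v) body

/-- The evaluation produces only words. -/
def safe (C : Ctx k) : ℕ → Gh → Ex → Prop
  | _, _, lit v => v < C.M.word
  | D, s, var r => r < D → s.v r < C.M.word
  | D, s, op o a b =>
      safe C D s a ∧ safe C D s b ∧ o.eval (eval C D s a) (eval C D s b) < C.M.word
  | D, s, arr id e => safe C D s e ∧ id < 16 ∧ C.base + id + 16 * eval C D s e < C.M.word
  | D, s, inp e => safe C D s e ∧ eval C D s e < C.base
  | D, s, mis x y v => safe C D s x ∧ safe C D s y ∧ safe C D s v ∧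
      eval C D s x < 2 ^ k ∧ eval C D s y < 2 ^ k
  | D, s, fold o z lim body => safe C D s lim ∧ eval C D s lim < C.M.word ∧ z < C.M.word ∧
      ∀ v < eval C D s lim, safe C (D + 1) (s.setv D v) body ∧
        foldv o z (fun v => eval C (D + 1) (s.setv D v) body) (v + 1) < C.M.word
  | D, s, amin lim body => safe C D s lim ∧ eval C D s lim < C.M.word ∧
      safe C (D + 1) (s.setv D 0) body ∧
      ∀ v < eval C D s lim, safe C (D + 1) (s.setv D v) body ∧
        eval C (D + 1) (s.setv D v) body < C.M.word

/-- A bound for the evaluation time. -/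
noncomputable def cst (C : Ctx k) : ℕ → Gh → Ex → ℕ
  | _, _, lit _ => 1
  | _, _, var _ => 2
  | D, s, op _ a b => cst C D s a + cst C D s b + 1
  | D, s, arr _ e => cst C D s e + 6
  | D, s, inp e => cst C D s e + 1
  | D, s, mis x y v => cst C D s x + cst C D s y + cst C D s v + 3 + C.M.queryTime
  | D, s, fold _ _ lim body => cst C D s lim + 4 +
      ∑ v ∈ range (eval C D s lim), (cst C (D + 1) (s.setv D v) body + 5)
  | D, s, amin lim body => cst C D s lim + 4 + cst C (D + 1) (s.setv D 0) body +
      ∑ v ∈ range (eval C D s lim), (cst C (D + 1) (s.setv D v) body + 10)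

/-- Two states agree on the arrays and on the variables below `D`. -/
def Agree (D : ℕ) (s s' : Gh) : Prop := s.a = s'.a ∧ ∀ r < D, s.v r = s'.v r

theorem Agree.setv {D : ℕ} {s s' : Gh} (h : Agree D s s') (v : ℕ) :
    Agree (D + 1) (s.setv D v) (s'.setv D v) := by
  refine ⟨h.1, fun r hr => ?_⟩
  rw [Gh.setv_v, Gh.setv_v]
  split_ifs with h1
  · rfl
  · exact h.2 r (by omega)

theorem eval_congr (C : Ctx k) (e : Ex) : ∀ {D : ℕ} {s s' : Gh}, Agree D s s' →
    eval C D s e = eval C D s' e := by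
  induction e with
  | lit v => intros; rfl
  | var r =>
    intro D s s' h
    simp only [eval]
    split_ifs with h1
    · exact h.2 r h1
    · rfl
  | op o a b iha ihb => intro D s s' h; simp only [eval, iha h, ihb h]
  | arr id e ih => intro D s s' h; simp only [eval, ih h, h.1]
  | inp e ih => intro D s s' h; simp only [eval, ih h]
  | mis x y v ihx ihy ihv => intro D s s' h; simp only [eval, ihx h, ihy h, ihv h]
  | fold o z lim body ihl ihb =>
    intro D s s' h
    simp only [eval, ihl h, fun v => ihb (h.setv v)]
  | amin lim body ihl ihb =>
    intro D s s' h
    simp only [eval, ihl h, fun v => ihb (h.setv v)]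

theorem safe_congr (C : Ctx k) (e : Ex) : ∀ {D : ℕ} {s s' : Gh}, Agree D s s' →
    (safe C D s e ↔ safe C D s' e) := by
  induction e with
  | lit v => intros; rfl
  | var r =>
    intro D s s' h
    simp only [safe]
    exact forall_congr' fun h1 => by rw [h.2 r h1]
  | op o a b iha ihb =>
    intro D s s' h; simp only [safe, iha h, ihb h, eval_congr C a h, eval_congr C b h]
  | arr id e ih => intro D s s' h; simp only [safe, ih h, eval_congr C e h]
  | inp e ih => intro D s s' h; simp only [safe, ih h, eval_congr C e h]
  | mis x y v ihx ihy ihv =>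
    intro D s s' h
    simp only [safe, ihx h, ihy h, ihv h, eval_congr C x h, eval_congr C y h]
  | fold o z lim body ihl ihb =>
    intro D s s' h
    simp only [safe, ihl h, fun v => ihb (h.setv v), eval_congr C lim h,
      fun v => eval_congr C body (h.setv v)]
  | amin lim body ihl ihb =>
    intro D s s' h
    simp only [safe, ihl h, fun v => ihb (h.setv v), eval_congr C lim h,
      fun v => eval_congr C body (h.setv v)]

theorem cst_congr (C : Ctx k) (e : Ex) : ∀ {D : ℕ} {s s' : Gh}, Agree D s s' →
    cst C D s e = cst C D s' e := by
  induction e with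
  | lit v => intros; rfl
  | var r => intros; rfl
  | op o a b iha ihb => intro D s s' h; simp only [cst, iha h, ihb h]
  | arr id e ih => intro D s s' h; simp only [cst, ih h]
  | inp e ih => intro D s s' h; simp only [cst, ih h]
  | mis x y v ihx ihy ihv => intro D s s' h; simp only [cst, ihx h, ihy h, ihv h]
  | fold o z lim body ihl ihb =>
    intro D s s' h
    simp only [cst, ihl h, fun v => ihb (h.setv v), eval_congr C lim h]
  | amin lim body ihl ihb =>
    intro D s s' h
    simp only [cst, ihl h, fun v => ihb (h.setv v), eval_congr C lim h]

end Ex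

/-! ### Compilation of expressions

Variables live in the even registers, temporary values in the odd ones. -/

/-- The register of a variable. -/
def vR (r : ℕ) : ℕ := 2 * r
/-- The register of a temporary value. -/
def tR (j : ℕ) : ℕ := 2 * j + 1

@[simp] theorem vR_inj {r r' : ℕ} : vR r = vR r' ↔ r = r' := by unfold vR; omega
@[simp] theorem tR_inj {r r' : ℕ} : tR r = tR r' ↔ r = r' := by unfold tR; omega
@[simp] theorem vR_ne_tR {r r' : ℕ} : vR r = tR r' ↔ False :=
  iff_false_intro (by unfold tR vR; omega)
@[simp] theorem tR_ne_vR {r r' : ℕ} : tR r = vR r' ↔ False :=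
  iff_false_intro (by unfold tR vR; omega)

@[simp] theorem State.setReg_mem (σ : State) (r v : ℕ) : (σ.setReg r v).mem = σ.mem := rfl
@[simp] theorem State.setMem_reg (σ : State) (a v : ℕ) : (σ.setMem a v).reg = σ.reg := rfl
@[simp] theorem State.setReg_reg (σ : State) (r v r' : ℕ) :
    (σ.setReg r v).reg r' = if r' = r then v else σ.reg r' := by
  simp [setReg, Function.update_apply]
@[simp] theorem State.setMem_mem (σ : State) (a v a' : ℕ) :
    (σ.setMem a v).mem a' = if a' = a then v else σ.mem a' := by
  simp [setMem, Function.update_apply]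

/-- The program that computes an expression into the temporary register `j`. -/
def Ex.comp : ℕ → ℕ → Ex → Prog
  | _, j, .lit v => .const (tR j) v
  -- A copy is an addition to `0`, since no instruction moves registers. A variable that is out of
  -- scope reads as `0`, as in `eval`; the repeated constant keeps the cost of both cases equal.
  | D, j, .var r =>
      .seq (.const (tR j) 0)
        (if r < D then .arith .add (tR j) (tR j) (vR r) else .const (tR j) 0)
  | D, j, .op o a b =>
      .seq (comp D j a) (.seq (comp D (j + 1) b) (.arith o (tR j) (tR j) (tR (j + 1))))
  | D, j, .arr id e =>
      .seq (comp D j e) <| .seq (.const (tR (j + 1)) 16) <|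
      .seq (.arith .mul (tR j) (tR (j + 1)) (tR j)) <|
      .seq (.const (tR (j + 1)) id) <|
      .seq (.arith .add (tR (j + 1)) (vR 3) (tR (j + 1))) <|
      .seq (.arith .add (tR j) (tR (j + 1)) (tR j)) (.load (tR j) (tR j))
  | D, j, .inp e => .seq (comp D j e) (.load (tR j) (tR j))
  | D, j, .mis x y v =>
      .seq (comp D j x) <| .seq (comp D (j + 1) y) <| .seq (comp D (j + 2) v) <|
      .seq (.query (tR j) (tR j) (tR (j + 1)) (tR (j + 2))) <|
      .seq (.const (tR (j + 1)) 1) (.arith .sub (tR j) (tR (j + 1)) (tR j))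
  | D, j, .fold o z lim body =>
      .seq (comp D (j + 1) lim) <| .seq (.const (tR j) z) <| .seq (.const (vR D) 0) <|
      .seq (.arith .lt (tR (j + 2)) (vR D) (tR (j + 1))) <|
      .loop (tR (j + 2)) <|
        .seq (comp (D + 1) (j + 3) body) <|
        .seq (.arith o (tR j) (tR j) (tR (j + 3))) <|
        .seq (.const (tR (j + 3)) 1) <|
        .seq (.arith .add (vR D) (vR D) (tR (j + 3))) <|
        .arith .lt (tR (j + 2)) (vR D) (tR (j + 1))
  | D, j, .amin lim body =>
      .seq (comp D (j + 1) lim) <| .seq (.const (vR D) 0) <| .seq (.const (tR j) 0) <|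
      .seq (comp (D + 1) (j + 3) body) <|
      .seq (.arith .lt (tR (j + 2)) (vR D) (tR (j + 1))) <|
      .loop (tR (j + 2)) <|
        .seq (comp (D + 1) (j + 4) body) <|
        .seq (.arith .lt (tR (j + 5)) (tR (j + 4)) (tR (j + 3))) <|
        .seq (.ite (tR (j + 5))
          (.seq (.const (tR j) 0) <| .seq (.arith .add (tR j) (tR j) (vR D)) <|
            .seq (.const (tR (j + 3)) 0) (.arith .add (tR (j + 3)) (tR (j + 3)) (tR (j + 4))))
          (.const (tR (j + 5)) 0)) <|
        .seq (.const (tR (j + 5)) 1) <|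
        .seq (.arith .add (vR D) (vR D) (tR (j + 5))) <|
        .arith .lt (tR (j + 2)) (vR D) (tR (j + 1))

variable {k : ℕ}

/-- The variables and arrays of a machine state. -/
def Ctx.gh (C : Ctx k) (σ : State) : Gh :=
  ⟨fun r => σ.reg (vR r), fun id idx => if id < 16 then σ.mem (C.base + id + 16 * idx) else 0⟩

/-- The state holds the input and its size. -/
def Ctx.Good (C : Ctx k) (σ : State) : Prop :=
  σ.reg (vR 3) = C.base ∧ ∀ x < C.base, σ.mem x = C.inp x

/-- The memory, the variables below `D` and the temporary values below `j` are preserved. -/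
def Pres (D j : ℕ) (σ σ' : State) : Prop :=
  σ'.mem = σ.mem ∧ (∀ r < D, σ'.reg (vR r) = σ.reg (vR r)) ∧
    ∀ r < j, σ'.reg (tR r) = σ.reg (tR r)

theorem Pres.trans {D j D' j' : ℕ} {σ σ1 σ2 : State} (h : Pres D j σ σ1) (h' : Pres D' j' σ1 σ2)
    (hD : D ≤ D') (hj : j ≤ j') : Pres D j σ σ2 :=
  ⟨h'.1.trans h.1, fun r hr => (h'.2.1 r (by omega)).trans (h.2.1 r hr),
    fun r hr => (h'.2.2 r (by omega)).trans (h.2.2 r hr)⟩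

theorem Pres.setT {D j i : ℕ} {σ σ1 : State} (h : Pres D j σ σ1) (hi : j ≤ i) (v : ℕ) :
    Pres D j σ (σ1.setReg (tR i) v) := by
  refine ⟨h.1, fun r hr => ?_, fun r hr => ?_⟩
  · simpa using h.2.1 r hr
  · simpa [show ¬ r = i by omega] using h.2.2 r hr

theorem Pres.setV {D j i : ℕ} {σ σ1 : State} (h : Pres D j σ σ1) (hi : D ≤ i) (v : ℕ) :
    Pres D j σ (σ1.setReg (vR i) v) := by
  refine ⟨h.1, fun r hr => ?_, fun r hr => ?_⟩
  · simpa [show ¬ r = i by omega] using h.2.1 r hr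
  · simpa using h.2.2 r hr

theorem Pres.refl (D j : ℕ) (σ : State) : Pres D j σ σ := ⟨rfl, fun _ _ => rfl, fun _ _ => rfl⟩

theorem Pres.good {C : Ctx k} {D j : ℕ} {σ σ1 : State} (h : Pres D j σ σ1) (hD : 4 ≤ D)
    (hg : C.Good σ) : C.Good σ1 :=
  ⟨(h.2.1 3 (by omega)).trans hg.1, fun x hx => by rw [h.1]; exact hg.2 x hx⟩

theorem Pres.agree (C : Ctx k) {D j : ℕ} {σ σ1 : State} (h : Pres D j σ σ1) :
    Ex.Agree D (C.gh σ1) (C.gh σ) :=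
  ⟨by simp only [Ctx.gh, h.1], fun r hr => h.2.1 r hr⟩

/-- After additionally assigning the next variable. -/
theorem Pres.agree_setv (C : Ctx k) {D j v : ℕ} {σ σ1 : State} (h : Pres D j σ σ1)
    (hv : σ1.reg (vR D) = v) : Ex.Agree (D + 1) (C.gh σ1) ((C.gh σ).setv D v) := by
  refine ⟨by simp only [Ctx.gh, h.1, Gh.setv_a], fun r hr => ?_⟩
  rw [Gh.setv_v]
  split_ifs with h1
  · rw [h1]; exact hv
  · exact h.2.1 r (by omega)

/-- Structural induction with a calling convention: code compiled at `(D, j)` changes only variables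
from `D` on and temporaries from `j` on, so intermediate results and loop counters survive the
subexpressions, which are compiled at larger `j` or `D`. The condition `4 ≤ D` protects variable
`3`, which holds the start of the arrays. -/
theorem Ex.comp_ok {C : Ctx k} (hW : 16 < C.M.word) (e : Ex) : ∀ {D j : ℕ} {σ : State},
    4 ≤ D → C.Good σ → e.safe C D (C.gh σ) →
    DRun C.M (e.comp D j) σ (e.cst C D (C.gh σ))
      fun σ' => Pres D j σ σ' ∧ σ'.reg (tR j) = e.eval C D (C.gh σ) := by
  induction e with
  | lit v =>
    intro D j σ hD hg hs
    refine (DRun.const hs).mono le_rfl ?_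
    rintro σ' rfl
    exact ⟨(Pres.refl D j σ).setT le_rfl v, by simp [eval]⟩
  | var r =>
    intro D j σ hD hg hs
    simp only [comp]
    split_ifs with h
    · refine ((DRun.const (by omega)).seq_eq (DRun.arith ?_)).mono le_rfl ?_
      · simpa [Op.eval, Ctx.gh] using hs h
      · rintro σ' rfl
        exact ⟨((Pres.refl D j σ).setT le_rfl _).setT le_rfl _, by
          simp [eval, h, Op.eval, Ctx.gh]⟩
    · refine ((DRun.const (by omega)).seq_eq (DRun.const (by omega))).mono le_rfl ?_
      rintro σ' rfl
      exact ⟨((Pres.refl D j σ).setT le_rfl _).setT le_rfl _, by simp [eval, h]⟩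
  | op o a b iha ihb =>
    intro D j σ hD hg hs
    obtain ⟨ha, hb, ho⟩ := hs
    refine DRun.mono ((iha hD hg ha).seq fun σ1 h1 => ?_ :
      DRun _ _ _ (_ + (cst C D (C.gh σ) b + 1)) _)
      (by simp only [cst]; omega) fun _ h => h
    have ag := h1.1.agree C
    have hrun := ihb (j := j + 1) hD (h1.1.good hD hg) ((safe_congr C b ag).2 hb)
    rw [cst_congr C b ag, eval_congr C b ag] at hrun
    refine hrun.seq fun σ2 h2 => ?_
    have e1 : σ2.reg (tR j) = eval C D (C.gh σ) a := by
      rw [h2.1.2.2 j (by omega), h1.2]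
    refine (DRun.arith ?_).mono le_rfl ?_
    · rw [e1, h2.2]; exact ho
    · rintro σ' rfl
      exact ⟨(h1.1.trans h2.1 le_rfl (by omega)).setT le_rfl _, by simp [e1, h2.2, eval]⟩
  | arr id e ih =>
    intro D j σ hD hg hs
    obtain ⟨he, hid, ha⟩ := hs
    refine DRun.mono ((ih hD hg he).seq fun σ1 h1 => ?_ : DRun _ _ _ (_ + 6) _)
      (by simp only [cst]; omega) fun _ h => h
    have hb : σ1.reg (vR 3) = C.base := (h1.1.good hD hg).1
    refine ((DRun.const (by omega)).seq_eq ((DRun.arith ?_).seq_eq ((DRun.const (by omega)).seq_eq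
      ((DRun.arith ?_).seq_eq ((DRun.arith ?_).seq_eq DRun.load))))).mono le_rfl ?_
    · simp [Op.eval, h1.2]; omega
    · simp [Op.eval, hb]; omega
    · simp [Op.eval, h1.2, hb]; omega
    · rintro σ' rfl
      refine ⟨(((((h1.1.setT (by omega) _).setT (by omega) _).setT (by omega) _).setT
        (by omega) _).setT (by omega) _).setT (by omega) _, ?_⟩
      simp [Op.eval, h1.2, hb, eval, Ctx.gh, hid, h1.1.1]
  | inp e ih =>
    intro D j σ hD hg hs
    obtain ⟨he, ha⟩ := hs
    refine DRun.mono ((ih hD hg he).seq fun σ1 h1 => DRun.load.mono le_rfl ?_)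
      (by simp only [cst]; omega) fun _ h => h
    rintro σ' rfl
    refine ⟨h1.1.setT (by omega) _, ?_⟩
    simp only [State.setReg_reg, if_true, h1.2, h1.1.1, eval]
    exact hg.2 _ ha
  | mis x y v ihx ihy ihv =>
    intro D j σ hD hg hs
    obtain ⟨hx, hy, hv, hxk, hyk⟩ := hs
    refine DRun.mono ((ihx hD hg hx).seq fun σ1 h1 => ?_ :
      DRun _ _ _ (_ + (cst C D (C.gh σ) y + (cst C D (C.gh σ) v + (1 + C.M.queryTime + 2)))) _)
      (by simp only [cst]; omega) fun _ h => h
    have ag := h1.1.agree C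
    have hrun1 := ihy (j := j + 1) hD (h1.1.good hD hg) ((safe_congr C y ag).2 hy)
    rw [cst_congr C y ag, eval_congr C y ag] at hrun1
    refine hrun1.seq fun σ2 h2 => ?_
    have h12 := h1.1.trans h2.1 le_rfl (by omega)
    have ag2 := h12.agree C
    have hrun2 := ihv (j := j + 2) hD (h12.good hD hg) ((safe_congr C v ag2).2 hv)
    rw [cst_congr C v ag2, eval_congr C v ag2] at hrun2
    refine hrun2.seq fun σ3 h3 => ?_
    have h13 := h12.trans h3.1 le_rfl (by omega)
    have ex : σ3.reg (tR j) = eval C D (C.gh σ) x := by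
      rw [h3.1.2.2 j (by omega), h2.1.2.2 j (by omega), h1.2]
    have ey : σ3.reg (tR (j + 1)) = eval C D (C.gh σ) y := by
      rw [h3.1.2.2 (j + 1) (by omega), h2.2]
    refine ((DRun.query (by rw [ex]; exact hxk) (by rw [ey]; exact hyk)).seq_eq
      ((DRun.const (by omega)).seq_eq (DRun.arith ?_))).mono (by omega) ?_
    · simp [Op.eval]; omega
    · rintro σ' rfl
      refine ⟨((h13.setT (by omega) _).setT (by omega) _).setT (by omega) _, ?_⟩
      simp [Op.eval, eval, ex, ey, h3.2]
  | fold o z lim body ihl ihb =>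
    intro D j σ hD hg hs
    obtain ⟨hl, hlW, hz, hbody⟩ := hs
    set N := eval C D (C.gh σ) lim with hN
    set f := fun v => eval C (D + 1) ((C.gh σ).setv D v) body with hf
    have hl' := ihl (j := j + 1) hD hg hl
    rw [← hN] at hl'
    refine DRun.mono (hl'.seq fun σ1 h1 => ?_ : DRun _ _ _ (_ + (1 + (1 + (1 +
      (∑ v ∈ range N, (cst C (D + 1) ((C.gh σ).setv D v) body + 5) + 1))))) _)
      (by simp only [cst, ← hN]; omega) fun _ h => h
    have hp1 : Pres D j σ σ1 := ⟨h1.1.1, h1.1.2.1, fun r hr => h1.1.2.2 r (by omega)⟩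
    refine (DRun.const hz).seq_eq ((DRun.const (by omega)).seq_eq ((DRun.arith ?_).seq_eq
      ((DRun.loop (N := N) (fun v σ' => Pres D j σ σ' ∧ σ'.reg (vR D) = v ∧
        σ'.reg (tR j) = foldv o z f v ∧ σ'.reg (tR (j + 1)) = N ∧
        σ'.reg (tR (j + 2)) = if v < N then 1 else 0)
        (fun v => cst C (D + 1) ((C.gh σ).setv D v) body + 4) ?_ ?_ ?_).mono le_rfl ?_)))
    · exact (Op.lt_eval_le _ _).trans_lt (by omega)
    · rintro v hv σ2 ⟨hp, h2, h3, h4, h5⟩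
      refine ⟨by rw [h5, if_pos hv]; exact one_ne_zero, ?_⟩
      have ag := hp.agree_setv C h2
      obtain ⟨hb1, hb2⟩ := hbody v hv
      have hb := ihb (j := j + 3) (by omega) (hp.good hD hg) ((safe_congr C body ag).2 hb1)
      rw [cst_congr C body ag, eval_congr C body ag] at hb
      refine DRun.mono (hb.seq fun σ3 h6 => ?_ : DRun _ _ _ (_ + 4) _) le_rfl fun _ h => h
      have e1 : σ3.reg (tR j) = foldv o z f v := by rw [h6.1.2.2 j (by omega), h3]
      have e2 : σ3.reg (tR (j + 1)) = N := by rw [h6.1.2.2 (j + 1) (by omega), h4]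
      have e3 : σ3.reg (vR D) = v := by rw [h6.1.2.1 D (by omega), h2]
      have e4 : o.eval (foldv o z f v) (eval C (D + 1) ((C.gh σ).setv D v) body) =
        foldv o z f (v + 1) := rfl
      have hp3 := hp.trans h6.1 (by omega) (by omega)
      refine ((DRun.arith ?_).seq_eq ((DRun.const (by omega)).seq_eq ((DRun.arith ?_).seq_eq
        (DRun.arith ?_)))).mono le_rfl ?_
      · rw [e1, h6.2, e4]; exact hb2
      · simp [Op.eval, e3]; omega
      · exact (Op.lt_eval_le _ _).trans_lt (by omega)
      · rintro σ' rfl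
        refine ⟨(((hp3.setT (by omega) _).setT (by omega) _).setV (by omega) _).setT
          (by omega) _, ?_, ?_, ?_, ?_⟩
        · simp [Op.eval, e3]
        · simp [e1, h6.2, e4]
        · simp [e2]
        · simp [Op.eval, e2, e3]
    · rintro σ2 ⟨_, _, _, _, h5⟩
      rw [h5, if_neg (by omega)]
    · refine ⟨((hp1.setT (by omega) _).setV (by omega) _).setT (by omega) _, ?_, ?_, ?_, ?_⟩
      · simp
      · simp [foldv]
      · simp [h1.2]
      · simp [Op.eval, h1.2]
    · rintro σ' ⟨h2, _, h3, _, _⟩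
      exact ⟨h2, by rw [h3]; simp only [eval]; rw [← hN]⟩
  | amin lim body ihl ihb =>
    intro D j σ hD hg hs
    obtain ⟨hl, hlW, hb0, hbody⟩ := hs
    set N := eval C D (C.gh σ) lim with hN
    set f := fun v => eval C (D + 1) ((C.gh σ).setv D v) body with hf
    have hl' := ihl (j := j + 1) hD hg hl
    rw [← hN] at hl'
    refine DRun.mono (hl'.seq fun σ1 h1 => ?_ : DRun _ _ _ (_ + (1 + (1 +
      (cst C (D + 1) ((C.gh σ).setv D 0) body + (1 +
      (∑ v ∈ range N, (cst C (D + 1) ((C.gh σ).setv D v) body + 10) + 1)))))) _)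
      (by simp only [cst, ← hN]; omega) fun _ h => h
    have hp1 : Pres D j σ σ1 := ⟨h1.1.1, h1.1.2.1, fun r hr => h1.1.2.2 r (by omega)⟩
    refine (DRun.const (by omega)).seq_eq ((DRun.const (by omega)).seq_eq ?_)
    set σ2 := (σ1.setReg (vR D) 0).setReg (tR j) 0 with hσ2
    have hp2 : Pres D j σ σ2 := (hp1.setV le_rfl _).setT le_rfl _
    have ag := hp2.agree_setv C (v := 0) (by simp [hσ2])
    -- The body is evaluated once at `0` before the loop because `aminf 0 f = 0`, so the recorded
    -- minimum has to start as `f 0`.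
    have hbz := ihb (j := j + 3) (by omega) (hp2.good hD hg) ((safe_congr C body ag).2 hb0)
    rw [cst_congr C body ag, eval_congr C body ag] at hbz
    refine hbz.seq fun σ3 h3 => ?_
    have hp3 := hp2.trans h3.1 (by omega) (by omega)
    have e1 : σ3.reg (tR j) = 0 := by rw [h3.1.2.2 j (by omega)]; simp [hσ2]
    have e2 : σ3.reg (tR (j + 1)) = N := by
      rw [h3.1.2.2 (j + 1) (by omega)]; simp [hσ2, h1.2]
    have e3 : σ3.reg (vR D) = 0 := by rw [h3.1.2.1 D (by omega)]; simp [hσ2]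
    refine (DRun.arith ?_).seq_eq
      ((DRun.loop (N := N) (fun v σ' => Pres D j σ σ' ∧ σ'.reg (vR D) = v ∧
        σ'.reg (tR j) = aminf v f ∧ σ'.reg (tR (j + 3)) = f (aminf v f) ∧
        σ'.reg (tR (j + 1)) = N ∧ σ'.reg (tR (j + 2)) = if v < N then 1 else 0)
        (fun v => cst C (D + 1) ((C.gh σ).setv D v) body + 9) ?_ ?_ ?_).mono le_rfl ?_)
    · exact (Op.lt_eval_le _ _).trans_lt (by omega)
    · rintro v hv σ4 ⟨hp, h4, h5, h6, h7, h8⟩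
      refine ⟨by rw [h8, if_pos hv]; exact one_ne_zero, ?_⟩
      have ag := hp.agree_setv C h4
      obtain ⟨hb1, hb2⟩ := hbody v hv
      have hb := ihb (j := j + 4) (by omega) (hp.good hD hg) ((safe_congr C body ag).2 hb1)
      rw [cst_congr C body ag, eval_congr C body ag] at hb
      refine DRun.mono (hb.seq fun σ5 h9 => ?_ : DRun _ _ _ (_ + (1 + ((1 + 4) + 3))) _)
        (by omega) fun _ h => h
      have e1 : σ5.reg (tR j) = aminf v f := by rw [h9.1.2.2 j (by omega), h5]
      have e2 : σ5.reg (tR (j + 1)) = N := by rw [h9.1.2.2 (j + 1) (by omega), h7]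
      have e3 : σ5.reg (vR D) = v := by rw [h9.1.2.1 D (by omega), h4]
      have e5 : σ5.reg (tR (j + 3)) = f (aminf v f) := by rw [h9.1.2.2 (j + 3) (by omega), h6]
      have e4 : σ5.reg (tR (j + 4)) = f v := h9.2
      have hp5 := hp.trans h9.1 (by omega) (by omega)
      refine (DRun.arith ?_).seq_eq (DRun.seq (Φ := fun σ' => Pres D j σ σ' ∧
        σ'.reg (vR D) = v ∧ σ'.reg (tR j) = aminf (v + 1) f ∧
        σ'.reg (tR (j + 3)) = f (aminf (v + 1) f) ∧ σ'.reg (tR (j + 1)) = N) (DRun.ite ?_ ?_) ?_)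
      · exact (Op.lt_eval_le _ _).trans_lt (by omega)
      · intro hc
        have hc : f v < f (aminf v f) := by
          by_contra hcon
          simp [Op.eval, e4, e5, hcon] at hc
        have hm : aminf (v + 1) f = v := by simp [aminf, hc]
        refine ((DRun.const (by omega)).seq_eq ((DRun.arith ?_).seq_eq
          ((DRun.const (by omega)).seq_eq (DRun.arith ?_)))).mono le_rfl ?_
        · simp [Op.eval, e3]; omega
        · simp [Op.eval, e4]; exact hb2
        · rintro σ' rfl
          refine ⟨((((hp5.setT (by omega) _).setT (by omega) _).setT (by omega) _).setT
            (by omega) _).setT (by omega) _, ?_, ?_, ?_, ?_⟩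
          · simp [e3]
          · simp [Op.eval, e3, hm]
          · simp [Op.eval, e4, hm]
          · simp [e2]
      · intro hc
        have hc : ¬ f v < f (aminf v f) := by
          intro hcon
          simp [Op.eval, e4, e5, hcon] at hc
        have hm : aminf (v + 1) f = aminf v f := by simp [aminf, hc]
        refine (DRun.const (by omega)).mono (by omega) ?_
        rintro σ' rfl
        refine ⟨(hp5.setT (by omega) _).setT (by omega) _, ?_, ?_, ?_, ?_⟩
        · simp [e3]
        · simp [e1, hm]
        · simp [e5, hm]
        · simp [e2]
      · rintro σ6 ⟨hp6, g1, g2, g3, g4⟩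
        refine ((DRun.const (by omega)).seq_eq ((DRun.arith ?_).seq_eq
          (DRun.arith ?_))).mono le_rfl ?_
        · simp [Op.eval, g1]; omega
        · exact (Op.lt_eval_le _ _).trans_lt (by omega)
        · rintro σ' rfl
          refine ⟨((hp6.setT (by omega) _).setV (by omega) _).setT (by omega) _, ?_, ?_, ?_,
            ?_, ?_⟩
          · simp [Op.eval, g1]
          · simp [g2]
          · simp [g3]
          · simp [g4]
          · simp [Op.eval, g1, g4]
    · rintro σ4 ⟨_, _, _, _, _, h5⟩
      rw [h5, if_neg (by omega)]
    · refine ⟨hp3.setT (by omega) _, ?_, ?_, ?_, ?_, ?_⟩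
      · simp [e3]
      · simp [e1, aminf]
      · simp [h3.2, aminf, hf]
      · simp [e2]
      · simp [Op.eval, e2, e3]
    · rintro σ' ⟨h2, _, h3, _⟩
      exact ⟨h2, by rw [h3]; simp only [eval]; rw [← hN]⟩

end GenBinary

namespace GenBinary

open Finset
open scoped ENNReal

/-! ### Expectations -/

/-- The expectation of a nonnegative function. -/
noncomputable def expect {α : Type*} (μ : PMF α) (f : α → ℝ≥0∞) : ℝ≥0∞ := ∑' x, μ x * f x

theorem expect_pure {α : Type*} (a : α) (f : α → ℝ≥0∞) : expect (PMF.pure a) f = f a := by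
  unfold expect
  rw [tsum_eq_single a]
  · simp
  · intro b hb; simp [PMF.pure_apply, hb]

theorem expect_bind {α β : Type*} (μ : PMF α) (ν : α → PMF β) (f : β → ℝ≥0∞) :
    expect (μ.bind ν) f = expect μ fun a => expect (ν a) f := by
  unfold expect
  simp only [PMF.bind_apply, ← ENNReal.tsum_mul_right, ← ENNReal.tsum_mul_left]
  rw [ENNReal.tsum_comm]
  simp only [mul_assoc]

theorem expect_map {α β : Type*} (μ : PMF α) (g : α → β) (f : β → ℝ≥0∞) :
    expect (μ.map g) f = expect μ fun a => f (g a) := by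
  rw [← PMF.bind_pure_comp, expect_bind]
  simp only [Function.comp_apply, expect_pure]

theorem expect_mono {α : Type*} (μ : PMF α) {f g : α → ℝ≥0∞} (h : ∀ x ∈ μ.support, f x ≤ g x) :
    expect μ f ≤ expect μ g := by
  refine ENNReal.tsum_le_tsum fun x => ?_
  by_cases hx : μ x = 0
  · simp [hx]
  · exact mul_le_mul_right (h x ((PMF.mem_support_iff _ _).2 hx)) _

theorem expect_const {α : Type*} (μ : PMF α) (c : ℝ≥0∞) : expect μ (fun _ => c) = c := by
  unfold expect; rw [ENNReal.tsum_mul_right, μ.tsum_coe, one_mul]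

theorem expect_add {α : Type*} (μ : PMF α) (f g : α → ℝ≥0∞) :
    expect μ (fun x => f x + g x) = expect μ f + expect μ g := by
  unfold expect; simp only [mul_add]; exact ENNReal.tsum_add

theorem expect_const_mul {α : Type*} (μ : PMF α) (c : ℝ≥0∞) (f : α → ℝ≥0∞) :
    expect μ (fun x => c * f x) = c * expect μ f := by
  unfold expect; rw [← ENNReal.tsum_mul_left]
  exact tsum_congr fun x => mul_left_comm _ _ _

theorem expect_uniformOfFinset {α : Type*} (S : Finset α) (hS : S.Nonempty) (f : α → ℝ≥0∞) :
    expect (PMF.uniformOfFinset S hS) f = (∑ x ∈ S, f x) / S.card := by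
  unfold expect
  rw [tsum_eq_sum (s := S)]
  · rw [div_eq_mul_inv, sum_mul]
    refine sum_congr rfl fun x hx => ?_
    rw [PMF.uniformOfFinset_apply_of_mem hS hx, mul_comm]
  · intro x hx
    rw [PMF.uniformOfFinset_apply_of_notMem hS hx, zero_mul]

/-! ### Randomized runs -/

/-- `p` halts within time `B`, always in a state satisfying `Φ`, and the expectation of `f` in the
final state is at least `q`. -/
def SRun {k : ℕ} (M : Machine k) (p : Prog) (σ : State) (B : ℕ) (Φ : State → Prop)
    (f : State → ℝ≥0∞) (q : ℝ≥0∞) : Prop :=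
  ∃ μ, Exec M p σ μ ∧ (∀ x ∈ μ.support, x.2 ≤ B ∧ Φ x.1) ∧ q ≤ expect μ fun x => f x.1

namespace SRun

variable {k : ℕ} {M : Machine k} {p q : Prog} {σ : State} {B B' : ℕ} {Φ Ψ : State → Prop}
  {f g : State → ℝ≥0∞} {a a' : ℝ≥0∞}

theorem mono (h : SRun M p σ B Φ f a) (hB : B ≤ B') (hΦ : ∀ σ', Φ σ' → Ψ σ' ∧ f σ' ≤ g σ')
    (ha : a' ≤ a) : SRun M p σ B' Ψ g a' := by
  obtain ⟨μ, h1, h2, h3⟩ := h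
  refine ⟨μ, h1, fun x hx => ⟨(h2 x hx).1.trans hB, (hΦ _ (h2 x hx).2).1⟩, ?_⟩
  exact (ha.trans h3).trans (expect_mono _ fun x hx => (hΦ _ (h2 x hx).2).2)

theorem of_dRun (h : DRun M p σ B Φ) (ha : ∀ σ', Φ σ' → a ≤ f σ') : SRun M p σ B Φ f a := by
  obtain ⟨σ', t, h1, h2, h3⟩ := h
  refine ⟨_, h1, fun x hx => ?_, ?_⟩
  · rw [PMF.support_pure, Set.mem_singleton_iff] at hx
    subst hx; exact ⟨h2, h3⟩
  · rw [expect_pure]; exact ha _ h3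

/-- The function `g` plays the role of a weakest pre-expectation: a lower bound, state by state, for
what `q` achieves. The distributions for `q` are chosen per intermediate state; outside the support
any choice will do. -/
theorem seq (hp : SRun M p σ B Φ g a) (hq : ∀ σ', Φ σ' → SRun M q σ' B' Ψ f (g σ')) :
    SRun M (.seq p q) σ (B + B') Ψ f a := by
  obtain ⟨μ, h1, h2, h3⟩ := hp
  have hq' : ∀ s : State × ℕ, ∃ ν : PMF (State × ℕ), s ∈ μ.support → (Exec M q s.1 ν ∧
      (∀ x ∈ ν.support, x.2 ≤ B' ∧ Ψ x.1) ∧ g s.1 ≤ expect ν fun x => f x.1) := by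
    intro s
    by_cases hs : s ∈ μ.support
    · obtain ⟨ν, h⟩ := hq s.1 (h2 s hs).2
      exact ⟨ν, fun _ => h⟩
    · exact ⟨PMF.pure s, fun h => absurd h hs⟩
  choose ν hν using hq'
  refine ⟨_, .seq h1 fun s hs => (hν s hs).1, ?_, ?_⟩
  · intro x hx
    obtain ⟨s, hs, hx⟩ := (PMF.mem_support_bind_iff _ _ _).1 hx
    obtain ⟨y, hy, rfl⟩ := (PMF.mem_support_map_iff _ _ _).1 hx
    have h4 := (hν s hs).2.1 y hy
    exact ⟨add_le_add (h2 s hs).1 h4.1, h4.2⟩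
  · refine h3.trans ?_
    rw [expect_bind]
    refine expect_mono _ fun s hs => ?_
    rw [expect_map]
    exact (hν s hs).2.2

theorem rand {dst r : ℕ} (h : 0 < σ.reg r) :
    SRun M (.rand dst r) σ 1 (fun σ' => ∃ v < σ.reg r, σ' = σ.setReg dst v) f
      ((∑ v ∈ range (σ.reg r), f (σ.setReg dst v)) / σ.reg r) := by
  have hne : (range (σ.reg r)).Nonempty := ⟨0, mem_range.2 h⟩
  refine ⟨_, .rand hne, ?_, ?_⟩
  · intro x hx
    obtain ⟨v, hv, rfl⟩ := (PMF.mem_support_map_iff _ _ _).1 hx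
    rw [PMF.mem_support_uniformOfFinset_iff] at hv
    exact ⟨le_rfl, v, mem_range.1 hv, rfl⟩
  · rw [expect_map, expect_uniformOfFinset, card_range]

theorem loop_aux {r N b : ℕ} (Inv : ℕ → State → Prop) (g : ℕ → State → ℝ≥0∞)
    (hbody : ∀ v < N, ∀ σ, Inv v σ →
      σ.reg r ≠ 0 ∧ SRun M p σ b (Inv (v + 1)) (g (v + 1)) (g v σ))
    (hzero : ∀ σ, Inv N σ → σ.reg r = 0) (c : ℕ) :
    ∀ v σ, v + c = N → Inv v σ →
      SRun M (.loop r p) σ (c * (b + 1) + 1) (Inv N) (g N) (g v σ) := by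
  induction c with
  | zero =>
    intro v σ hv hI
    have hv : v = N := by omega
    subst hv
    exact of_dRun ⟨σ, 1, Exec.loop_stop (hzero σ hI), by omega, rfl⟩ (Φ := (· = σ))
      (by rintro _ rfl; exact le_rfl) |>.mono le_rfl (by rintro _ rfl; exact ⟨hI, le_rfl⟩) le_rfl
  | succ c ih =>
    intro v σ hv hI
    obtain ⟨h1, μ, h2, h3, h4⟩ := hbody v (by omega) σ hI
    have hq' : ∀ s : State × ℕ, ∃ ν : PMF (State × ℕ), s ∈ μ.support →
        (Exec M (.loop r p) s.1 ν ∧ (∀ x ∈ ν.support, x.2 ≤ c * (b + 1) + 1 ∧ Inv N x.1) ∧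
          g (v + 1) s.1 ≤ expect ν fun x => g N x.1) := by
      intro s
      by_cases hs : s ∈ μ.support
      · obtain ⟨ν, h⟩ := ih (v + 1) s.1 (by omega) (h3 s hs).2
        exact ⟨ν, fun _ => h⟩
      · exact ⟨PMF.pure s, fun h => absurd h hs⟩
    choose ν hν using hq'
    refine ⟨_, .loop_step h1 h2 fun s hs => (hν s hs).1, ?_, ?_⟩
    · intro x hx
      obtain ⟨s, hs, hx⟩ := (PMF.mem_support_bind_iff _ _ _).1 hx
      obtain ⟨y, hy, rfl⟩ := (PMF.mem_support_map_iff _ _ _).1 hx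
      have h5 := (hν s hs).2.1 y hy
      refine ⟨?_, h5.2⟩
      have h6 := (h3 s hs).1
      have h7 : (c + 1) * (b + 1) = c * (b + 1) + (b + 1) := by ring
      simp only
      omega
    · refine h4.trans ?_
      rw [expect_bind]
      refine expect_mono _ fun s hs => ?_
      rw [expect_map]
      exact (hν s hs).2.2

theorem loop {r N b : ℕ} (Inv : ℕ → State → Prop) (g : ℕ → State → ℝ≥0∞)
    (hbody : ∀ v < N, ∀ σ, Inv v σ →
      σ.reg r ≠ 0 ∧ SRun M p σ b (Inv (v + 1)) (g (v + 1)) (g v σ))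
    (hzero : ∀ σ, Inv N σ → σ.reg r = 0) (h0 : Inv 0 σ) :
    SRun M (.loop r p) σ (N * (b + 1) + 1) (Inv N) (g N) (g 0 σ) :=
  loop_aux Inv g hbody hzero N 0 σ (by omega) h0

end SRun

/-! ### Runs on variables and arrays -/

variable {k : ℕ}

/-- The named variables and the arrays of a machine state. -/
def Ctx.abs (C : Ctx k) (σ : State) : Gh :=
  ⟨fun r => if r < 32 then σ.reg (vR r) else 0, (C.gh σ).a⟩

theorem Ctx.agree_abs (C : Ctx k) (σ : State) : Ex.Agree 32 (C.gh σ) (C.abs σ) :=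
  ⟨rfl, fun r hr => by simp [Ctx.abs, Ctx.gh, hr]⟩

theorem Pres.abs_eq {C : Ctx k} {j : ℕ} {σ σ1 : State} (h : Pres 32 j σ σ1) :
    C.abs σ1 = C.abs σ := by
  unfold Ctx.abs Ctx.gh
  rw [h.1]
  congr 1
  funext r
  split_ifs with hr
  · exact h.2.1 r hr
  · rfl

theorem Ctx.Good.abs {C : Ctx k} {σ : State} (h : C.Good σ) : (C.abs σ).v 3 = C.base := by
  simpa [Ctx.abs] using h.1

/-- A randomized run from the represented state `s`. -/
def Tri (C : Ctx k) (p : Prog) (s : Gh) (B : ℕ) (Φ : Gh → Prop) (f : Gh → ℝ≥0∞) (q : ℝ≥0∞) :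
    Prop :=
  ∀ σ, C.Good σ → C.abs σ = s →
    SRun C.M p σ B (fun σ' => C.Good σ' ∧ Φ (C.abs σ')) (fun σ' => f (C.abs σ')) q

/-- A deterministic run from the represented state `s` to `s'`. -/
def DTri (C : Ctx k) (p : Prog) (s : Gh) (B : ℕ) (s' : Gh) : Prop :=
  ∀ f : Gh → ℝ≥0∞, Tri C p s B (· = s') f (f s')

theorem Tri.seq {C : Ctx k} {p q : Prog} {s : Gh} {B B' : ℕ} {Φ Ψ : Gh → Prop}
    {f g : Gh → ℝ≥0∞} {a : ℝ≥0∞} (hp : Tri C p s B Φ g a)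
    (hq : ∀ s', Φ s' → Tri C q s' B' Ψ f (g s')) : Tri C (.seq p q) s (B + B') Ψ f a :=
  fun σ hg hs => (hp σ hg hs).seq fun σ' h => hq _ h.2 σ' h.1 rfl

theorem Tri.mono {C : Ctx k} {p : Prog} {s : Gh} {B B' : ℕ} {Φ Ψ : Gh → Prop}
    {f g : Gh → ℝ≥0∞} {a a' : ℝ≥0∞} (h : Tri C p s B Φ f a) (hB : B ≤ B')
    (hΦ : ∀ s', Φ s' → Ψ s' ∧ f s' ≤ g s') (ha : a' ≤ a) : Tri C p s B' Ψ g a' :=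
  fun σ hg hs => (h σ hg hs).mono hB
    (fun _ h' => ⟨⟨h'.1, (hΦ _ h'.2).1⟩, (hΦ _ h'.2).2⟩) ha

theorem DTri.seq_tri {C : Ctx k} {p q : Prog} {s s1 : Gh} {B B' : ℕ} {Φ : Gh → Prop}
    {f : Gh → ℝ≥0∞} {a : ℝ≥0∞} (hp : DTri C p s B s1) (hq : Tri C q s1 B' Φ f a) :
    Tri C (.seq p q) s (B + B') Φ f a :=
  Tri.seq (hp fun _ => a) fun s' h => by subst h; exact hq

theorem DTri.seq {C : Ctx k} {p q : Prog} {s s1 s2 : Gh} {B B' : ℕ} (hp : DTri C p s B s1)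
    (hq : DTri C q s1 B' s2) : DTri C (.seq p q) s (B + B') s2 :=
  fun f => hp.seq_tri (hq f)

theorem DTri.mono {C : Ctx k} {p : Prog} {s s1 s2 : Gh} {B B' : ℕ} (hp : DTri C p s B s1)
    (hB : B ≤ B') (h : s1 = s2) : DTri C p s B' s2 := by
  subst h
  exact fun f => (hp f).mono hB (fun _ h => ⟨h, le_rfl⟩) le_rfl

theorem DTri.tri {C : Ctx k} {p : Prog} {s s1 : Gh} {B : ℕ} (hp : DTri C p s B s1)
    {Φ : Gh → Prop} {f : Gh → ℝ≥0∞} {q : ℝ≥0∞} (hΦ : Φ s1) (hf : q ≤ f s1) :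
    Tri C p s B Φ f q :=
  (hp f).mono le_rfl (fun _ h => ⟨h ▸ hΦ, le_rfl⟩) hf

theorem DTri.of_dRun {C : Ctx k} {p : Prog} {s s' : Gh} {B : ℕ}
    (h : ∀ σ, C.Good σ → C.abs σ = s → DRun C.M p σ B fun σ' => C.Good σ' ∧ C.abs σ' = s') :
    DTri C p s B s' :=
  fun f σ hg hs => SRun.of_dRun (h σ hg hs) (f := fun σ' => f (C.abs σ')) (a := f s')
    fun σ' h => by rw [h.2]

/-- Evaluation of an expression into a temporary register. -/
theorem comp_abs {C : Ctx k} (hW : 16 < C.M.word) {e : Ex} {s : Gh} {j : ℕ} {σ : State}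
    (hg : C.Good σ) (hs : C.abs σ = s) (hsafe : e.safe C 32 s) :
    DRun C.M (e.comp 32 j) σ (e.cst C 32 s)
      fun σ' => Pres 32 j σ σ' ∧ σ'.reg (tR j) = e.eval C 32 s := by
  subst hs
  have ag := C.agree_abs σ
  have := Ex.comp_ok hW e (D := 32) (j := j) (by omega) hg ((Ex.safe_congr C e ag).2 hsafe)
  rwa [Ex.cst_congr C e ag, Ex.eval_congr C e ag] at this

/-! ### Commands -/

/-- Assignment to a variable. -/
def assign (r : ℕ) (e : Ex) : Prog :=
  .seq (e.comp 32 0) (.seq (.const (vR r) 0) (.arith .add (vR r) (vR r) (tR 0)))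

theorem abs_setReg {C : Ctx k} {σ : State} {r v : ℕ} (hr : r < 32) :
    C.abs (σ.setReg (vR r) v) = (C.abs σ).setv r v := by
  ext r' : 2
  · rw [Gh.setv_v]
    simp only [Ctx.abs, State.setReg_reg, vR_inj]
    split_ifs with h1 h2 h2 <;> first | rfl | omega
  · rfl

theorem DTri.assign {C : Ctx k} (hW : 16 < C.M.word) {r : ℕ} {e : Ex} {s : Gh} (hr : r < 32)
    (hr3 : r ≠ 3) (hsafe : e.safe C 32 s) (hw : e.eval C 32 s < C.M.word) :
    DTri C (assign r e) s (e.cst C 32 s + 2) (s.setv r (e.eval C 32 s)) := by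
  refine DTri.of_dRun fun σ hg hs => ?_
  refine DRun.seq (comp_abs hW hg hs hsafe) fun σ1 h1 => ?_
  refine ((DRun.const (by omega)).seq_eq (DRun.arith ?_)).mono le_rfl ?_
  · simpa [Op.eval, h1.2] using hw
  · rintro σ' rfl
    have hg1 := h1.1.good (by omega) hg
    refine ⟨⟨?_, ?_⟩, ?_⟩
    · simpa [Ne.symm hr3] using hg1.1
    · simpa using hg1.2
    · rw [abs_setReg hr, abs_setReg hr, h1.1.abs_eq, hs]
      ext x y
      · simp only [Gh.setv_v]
        split_ifs <;> simp [Op.eval, h1.2]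
      · rfl

/-- Assignment of a uniformly random number to a variable. -/
def rnd (r : ℕ) (e : Ex) : Prog :=
  .seq (e.comp 32 0) (.rand (vR r) (tR 0))

theorem Tri.rnd {C : Ctx k} (hW : 16 < C.M.word) {r : ℕ} {e : Ex} {s : Gh} (hr : r < 32)
    (hr3 : r ≠ 3) (hsafe : e.safe C 32 s) (hpos : 0 < e.eval C 32 s) (f : Gh → ℝ≥0∞) :
    Tri C (rnd r e) s (e.cst C 32 s + 1) (fun s' => ∃ v < e.eval C 32 s, s' = s.setv r v) f
      ((∑ v ∈ range (e.eval C 32 s), f (s.setv r v)) / e.eval C 32 s) := by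
  intro σ hg hs
  refine SRun.seq (SRun.of_dRun (comp_abs hW hg hs hsafe)
    (f := fun _ => ((∑ v ∈ range (e.eval C 32 s), f (s.setv r v)) / e.eval C 32 s))
    fun _ _ => le_rfl) fun σ1 h1 => ?_
  have habs : C.abs σ1 = s := h1.1.abs_eq.trans hs
  have hg1 := h1.1.good (by omega) hg
  refine (SRun.rand (f := fun σ' => f (C.abs σ')) (by rw [h1.2]; exact hpos)).mono le_rfl ?_ ?_
  · rintro σ' ⟨v, hv, rfl⟩
    rw [h1.2] at hv
    refine ⟨⟨⟨?_, ?_⟩, v, hv, ?_⟩, le_rfl⟩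
    · simpa [Ne.symm hr3] using hg1.1
    · simpa using hg1.2
    · rw [abs_setReg hr, habs]
  · rw [h1.2]
    simp only [abs_setReg hr, habs, le_refl]

/-- The address of an array element. -/
def addrE (id : ℕ) (e : Ex) : Ex :=
  .op .add (.op .add (.var 3) (.lit id)) (.op .mul (.lit 16) e)

/-- The sixteen arrays are interleaved with stride `16`, so addresses of different cells never
coincide and no array needs a length bound fixed in advance. -/
theorem abs_setMem {C : Ctx k} {σ : State} {id i v : ℕ} (hid : id < 16) :
    C.abs (σ.setMem (C.base + id + 16 * i) v) =
      (C.abs σ).seta id (Function.update ((C.abs σ).a id) i v) := by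
  refine Gh.ext rfl ?_
  funext id' i'
  rw [Gh.seta_a]
  simp only [Ctx.abs, Ctx.gh, State.setMem_mem]
  by_cases h : id' = id
  · subst h
    simp only [hid, if_true, Function.update_apply]
    by_cases h2 : i' = i
    · simp [h2]
    · rw [if_neg (by omega), if_neg h2]
  · simp only [h, if_false]
    split_ifs <;> first | rfl | omega

theorem good_setMem {C : Ctx k} {σ : State} {a v : ℕ} (h : C.Good σ) (ha : C.base ≤ a) :
    C.Good (σ.setMem a v) := by
  refine ⟨h.1, fun x hx => ?_⟩
  rw [State.setMem_mem, if_neg (by omega)]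
  exact h.2 x hx

/-- Assignment to an array element. -/
def put (id : ℕ) (idx e : Ex) : Prog :=
  .seq ((addrE id idx).comp 32 0) (.seq (e.comp 32 1) (.store (tR 0) (tR 1)))

theorem addrE_safe {C : Ctx k} (hW : 16 < C.M.word) {D : ℕ} {id : ℕ} {e : Ex} {s : Gh}
    (hD : 3 < D) (hid : id < 16) (h3 : s.v 3 = C.base) (hsafe : e.safe C D s)
    (hw : C.base + id + 16 * e.eval C D s < C.M.word) :
    (addrE id e).safe C D s ∧ (addrE id e).eval C D s = C.base + id + 16 * e.eval C D s := by
  unfold addrE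
  simp only [Ex.safe, Ex.eval, Op.eval, hD, if_true, h3]
  refine ⟨⟨⟨fun _ => ?_, ?_, ?_⟩, ⟨?_, hsafe, ?_⟩, ?_⟩, trivial⟩ <;> omega

theorem DTri.put {C : Ctx k} (hW : 16 < C.M.word) {id : ℕ} {idx e : Ex} {s : Gh} (hid : id < 16)
    (hidx : idx.safe C 32 s) (hw : C.base + id + 16 * idx.eval C 32 s < C.M.word)
    (hsafe : e.safe C 32 s) :
    DTri C (put id idx e) s (idx.cst C 32 s + e.cst C 32 s + 8)
      (s.seta id (Function.update (s.a id) (idx.eval C 32 s) (e.eval C 32 s))) := by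
  refine DTri.of_dRun fun σ hg hs => ?_
  have h3 : s.v 3 = C.base := hs ▸ hg.abs
  obtain ⟨ha1, ha2⟩ := addrE_safe hW (by omega) hid h3 hidx hw
  refine DRun.mono (DRun.seq (B' := e.cst C 32 s + 1) (comp_abs hW hg hs ha1) fun σ1 h1 => ?_)
    (by simp only [addrE, Ex.cst]; omega) fun _ h => h
  have hg1 := h1.1.good (by omega) hg
  refine DRun.seq (comp_abs hW hg1 (h1.1.abs_eq.trans hs) hsafe) fun σ2 h2 => ?_
  have hg2 := h2.1.good (by omega) hg1
  refine DRun.store.mono le_rfl ?_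
  rintro σ' rfl
  rw [h2.1.2.2 0 (by omega), h1.2, ha2, h2.2]
  refine ⟨good_setMem hg2 (by omega), ?_⟩
  rw [abs_setMem hid, h2.1.abs_eq, h1.1.abs_eq, hs]

/-- The common part of the loops that write to memory: `pre` leaves a value in the temporary
register `3` (depending on the loop variable `32`), which is stored at the address `addr`. -/
def storeLoop (lim addr : Ex) (pre : Prog) : Prog :=
  .seq (lim.comp 32 1) <| .seq (.const (vR 32) 0) <|
  .seq (.arith .lt (tR 2) (vR 32) (tR 1)) <|
  .loop (tR 2) <|
    .seq pre <| .seq (addr.comp 33 4) <| .seq (.store (tR 4) (tR 3)) <|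
    .seq (.const (tR 5) 1) <| .seq (.arith .add (vR 32) (vR 32) (tR 5)) <|
    .arith .lt (tR 2) (vR 32) (tR 1)

/-- The loop invariant of `storeLoop`. -/
def StoreInv (σ : State) (N v : ℕ) (σ' : State) : Prop :=
  (∀ r < 32, σ'.reg (vR r) = σ.reg (vR r)) ∧ σ'.reg (vR 32) = v ∧ σ'.reg (tR 1) = N ∧
    σ'.reg (tR 2) = if v < N then 1 else 0

/-- One loop rule for filling an array, filling it at random and writing the output. The invariant
`Ph` and the potential `g` depend on the memory only, since apart from the loop variable and
temporaries the loop changes nothing else. -/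
theorem storeLoop_run {C : Ctx k} (hW : 16 < C.M.word) {lim addr : Ex} {pre : Prog} {s : Gh}
    {σ : State} (hg : C.Good σ) (hs : C.abs σ = s) (hlim : lim.safe C 32 s) {N b ca : ℕ}
    (hN : lim.eval C 32 s = N) (hNW : N < C.M.word) (A : ℕ → ℕ)
    (haddr : ∀ v < N, ∀ σ1, StoreInv σ N v σ1 → C.Good σ1 → addr.safe C 33 (C.gh σ1) ∧
      addr.eval C 33 (C.gh σ1) = A v ∧ C.base ≤ A v ∧ addr.cst C 33 (C.gh σ1) ≤ ca)
    (Ph : ℕ → (ℕ → ℕ) → Prop) (g : ℕ → (ℕ → ℕ) → ℝ≥0∞) (h0 : Ph 0 σ.mem)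
    (hbody : ∀ v < N, ∀ σ1, StoreInv σ N v σ1 → C.Good σ1 → Ph v σ1.mem →
      SRun C.M pre σ1 b (fun σ2 => Pres 33 3 σ1 σ2 ∧
          Ph (v + 1) (Function.update σ1.mem (A v) (σ2.reg (tR 3))))
        (fun σ2 => g (v + 1) (Function.update σ1.mem (A v) (σ2.reg (tR 3)))) (g v σ1.mem)) :
    SRun C.M (storeLoop lim addr pre) σ (lim.cst C 32 s + 3 + N * (b + ca + 5))
      (fun σ' => C.Good σ' ∧ (∀ r < 32, σ'.reg (vR r) = σ.reg (vR r)) ∧ Ph N σ'.mem)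
      (fun σ' => g N σ'.mem) (g 0 σ.mem) := by
  have hlim' := comp_abs hW (j := 1) hg hs hlim
  rw [hN] at hlim'
  refine SRun.mono (SRun.seq (B' := 1 + (1 + (N * (b + (ca + (1 + (1 + (1 + 1)))) + 1) + 1)))
    (Φ := fun σ1 => Pres 32 1 σ σ1 ∧ σ1.reg (tR 1) = N) (g := fun _ => g 0 σ.mem)
    (SRun.of_dRun hlim' fun _ _ => le_rfl) fun σ1 h1 => ?_) (le_of_eq (by ring))
    (fun _ h => ⟨h, le_rfl⟩) le_rfl
  have hg1 := h1.1.good (by omega) hg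
  refine SRun.seq (g := fun _ => g 0 σ.mem)
    (SRun.of_dRun (DRun.const (by omega)) fun _ _ => le_rfl) ?_
  rintro _ rfl
  refine SRun.seq (g := fun _ => g 0 σ.mem)
    (SRun.of_dRun (DRun.arith ((Op.lt_eval_le _ _).trans_lt (by omega))) fun _ _ => le_rfl) ?_
  rintro _ rfl
  refine (SRun.loop (N := N) (b := b + (ca + (1 + (1 + (1 + 1)))))
    (fun v σ' => StoreInv σ N v σ' ∧ C.Good σ' ∧ Ph v σ'.mem) (fun v σ' => g v σ'.mem)
    ?_ ?_ ?_).mono le_rfl ?_ ?_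
  · rintro v hv σ2 ⟨hI, hg2, hPh⟩
    refine ⟨by rw [hI.2.2.2, if_pos hv]; exact one_ne_zero, ?_⟩
    refine (hbody v hv σ2 hI hg2 hPh).seq ?_
    rintro σ3 ⟨hp3, hP3⟩
    obtain ⟨ha1, ha2, ha3, ha4⟩ := haddr v hv σ2 hI hg2
    have ag := hp3.agree C
    have hg3 := hp3.good (by omega) hg2
    have hrun := Ex.comp_ok hW addr (D := 33) (j := 4) (by omega) hg3
      ((Ex.safe_congr C addr ag).2 ha1)
    rw [Ex.cst_congr C addr ag, Ex.eval_congr C addr ag, ha2] at hrun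
    set X := σ3.reg (tR 3) with hX
    refine SRun.seq (g := fun _ => g (v + 1) (Function.update σ2.mem (A v) X))
      (SRun.of_dRun (hrun.mono ha4 fun _ h => h) fun _ _ => le_rfl) fun σ4 h4 => ?_
    have hg4 := h4.1.good (by omega) hg3
    have e0 : ∀ r < 32, σ4.reg (vR r) = σ.reg (vR r) := fun r hr => by
      rw [h4.1.2.1 r (by omega), hp3.2.1 r (by omega), hI.1 r hr]
    have e1 : σ4.reg (vR 32) = v := by
      rw [h4.1.2.1 32 (by omega), hp3.2.1 32 (by omega), hI.2.1]
    have e2 : σ4.reg (tR 1) = N := by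
      rw [h4.1.2.2 1 (by omega), hp3.2.2 1 (by omega), hI.2.2.1]
    have e3 : σ4.reg (tR 3) = X := by rw [h4.1.2.2 3 (by omega)]
    have e4 : σ4.mem = σ2.mem := by rw [h4.1.1, hp3.1]
    refine (SRun.of_dRun (Φ := fun σ' => (StoreInv σ N (v + 1) σ' ∧ C.Good σ') ∧
      σ'.mem = Function.update σ2.mem (A v) X) (f := fun σ' => g (v + 1) σ'.mem) ?_
      fun σ' h => by rw [h.2]).mono le_rfl (fun σ' h => ?_) le_rfl
    · refine (DRun.store.seq_eq ((DRun.const (by omega)).seq_eq ((DRun.arith ?_).seq_eq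
        (DRun.arith ((Op.lt_eval_le _ _).trans_lt (by omega)))))).mono le_rfl ?_
      · simp [Op.eval, e1]; omega
      · rintro σ' rfl
        have hgm := good_setMem (v := X) hg4 ha3
        refine ⟨⟨⟨fun r hr => ?_, ?_, ?_, ?_⟩, ⟨?_, ?_⟩⟩, ?_⟩
        · simp [e0 r hr, show ¬ r = 32 by omega]
        · simp [Op.eval, e1]
        · simp [e2]
        · simp [Op.eval, e1, e2]
        · simpa using hg4.1
        · simpa [h4.2, e3] using hgm.2
        · funext x
          simp [h4.2, e3, e4, Function.update_apply]
    · refine ⟨⟨h.1.1, h.1.2, ?_⟩, le_rfl⟩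
      rw [h.2]; exact hP3
  · rintro σ2 ⟨hI, _⟩
    rw [hI.2.2.2, if_neg (by omega)]
  · refine ⟨⟨fun r hr => ?_, ?_, ?_, ?_⟩, ⟨?_, ?_⟩, ?_⟩
    · simp [h1.1.2.1 r hr, show ¬ r = 32 by omega]
    · simp
    · simp [h1.2]
    · simp [Op.eval, h1.2]
    · simpa using hg1.1
    · simpa using hg1.2
    · simpa [h1.1.1] using h0
  · rintro σ' ⟨hI, hg', hP⟩
    exact ⟨⟨hg', hI.1, hP⟩, le_rfl⟩
  · simp [h1.1.1]

/-- Filling an array. -/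
def fill (id : ℕ) (lim body : Ex) : Prog :=
  storeLoop lim (addrE id (.var 32)) (body.comp 33 3)

/-- The arrays stored in a memory. -/
def Ctx.arrs (C : Ctx k) (m : ℕ → ℕ) : ℕ → ℕ → ℕ :=
  fun id idx => if id < 16 then m (C.base + id + 16 * idx) else 0

theorem StoreInv.agree {C : Ctx k} {σ σ1 : State} {N v : ℕ} {s : Gh} (h : StoreInv σ N v σ1)
    (hs : C.abs σ = s) : Ex.Agree 33 (C.gh σ1) ((⟨s.v, C.arrs σ1.mem⟩ : Gh).setv 32 v) := by
  refine ⟨rfl, fun r hr => ?_⟩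
  rw [Gh.setv_v]
  split_ifs with h1
  · rw [h1]; exact h.2.1
  · have hr : r < 32 := by omega
    have := h.1 r hr
    simp only [Ctx.gh, this, ← hs, Ctx.abs, hr, if_true]

theorem addrE_agree {C : Ctx k} (hW : 16 < C.M.word) {id : ℕ} (hid : id < 16) {v : ℕ} {s : Gh}
    {σ1 : State} {a : ℕ → ℕ → ℕ} (h : Ex.Agree 33 (C.gh σ1) ((⟨s.v, a⟩ : Gh).setv 32 v))
    (h3 : s.v 3 = C.base) (hw : C.base + id + 16 * v < C.M.word) :
    (addrE id (.var 32)).safe C 33 (C.gh σ1) ∧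
      (addrE id (.var 32)).eval C 33 (C.gh σ1) = C.base + id + 16 * v ∧
      (addrE id (.var 32)).cst C 33 (C.gh σ1) ≤ 9 := by
  have hv : (Ex.var 32).eval C 33 (C.gh σ1) = v := by
    rw [Ex.eval_congr C _ h]; simp [Ex.eval]
  have hv3 : (C.gh σ1).v 3 = C.base := by
    rw [h.2 3 (by omega), Gh.setv_v_of_ne _ _ (by omega)]; exact h3
  have := addrE_safe hW (D := 33) (s := C.gh σ1) (e := .var 32) (by omega) hid hv3
    (fun _ => by
      rw [h.2 32 (by omega)]
      simp; omega) (by rw [hv]; exact hw)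
  rw [hv] at this
  exact ⟨this.1, this.2, by simp [addrE, Ex.cst]⟩

theorem arrs_update {C : Ctx k} {m : ℕ → ℕ} {id i x : ℕ} (hid : id < 16) :
    C.arrs (Function.update m (C.base + id + 16 * i) x) =
      Function.update (C.arrs m) id (Function.update (C.arrs m id) i x) := by
  funext id' i'
  rw [Function.update_apply]
  by_cases h : id' = id
  · subst h
    rw [if_pos rfl, Function.update_apply]
    simp only [Ctx.arrs, hid, if_true, Function.update_apply]
    by_cases h2 : i' = i
    · simp [h2]
    · rw [if_neg (by omega), if_neg h2]
  · rw [if_neg h]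
    simp only [Ctx.arrs, Function.update_apply]
    split_ifs <;> first | rfl | omega

/-- The state in the course of filling an array. -/
def partFill (s : Gh) (id : ℕ) (val : ℕ → ℕ) (v : ℕ) : Gh :=
  s.seta id fun i => if i < v then val i else s.a id i

theorem abs_of_regs {C : Ctx k} {σ σ' : State} (h : ∀ r < 32, σ'.reg (vR r) = σ.reg (vR r)) :
    C.abs σ' = ⟨(C.abs σ).v, C.arrs σ'.mem⟩ := by
  refine Gh.ext (funext fun r => ?_) rfl
  simp only [Ctx.abs]
  split_ifs with hr
  · exact h r hr
  · rfl

theorem partFill_succ (s : Gh) (id : ℕ) (val : ℕ → ℕ) (v : ℕ) :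
    (partFill s id val (v + 1)).a =
      Function.update (partFill s id val v).a id
        (Function.update ((partFill s id val v).a id) v (val v)) := by
  funext id' i
  unfold partFill
  rw [Gh.seta_a, Function.update_apply]
  split_ifs with h
  · rw [Gh.seta_a, if_pos rfl, Function.update_apply]
    by_cases h4 : i = v
    · simp [h4]
    · rw [if_neg h4]
      exact if_congr (by omega) rfl rfl
  · rw [Gh.seta_a, if_neg h]

theorem partFill_zero (s : Gh) (id : ℕ) (val : ℕ → ℕ) : (partFill s id val 0).a = s.a := by
  funext id' i
  unfold partFill
  rw [Gh.seta_a]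
  split_ifs with h
  · subst h; simp
  · rfl

/-- The body is evaluated in the partly filled state: it may read the array being overwritten, as
`selE` does, provided that the values come out as `val`. -/
theorem DTri.fill {C : Ctx k} (hW : 16 < C.M.word) {id : ℕ} {lim body : Ex} {s : Gh}
    (hid : id < 16) (hlim : lim.safe C 32 s) {N b : ℕ} (hN : lim.eval C 32 s = N)
    (hw : C.base + 16 + 16 * N < C.M.word) (val : ℕ → ℕ)
    (hbody : ∀ v < N, body.safe C 33 ((partFill s id val v).setv 32 v) ∧
      body.eval C 33 ((partFill s id val v).setv 32 v) = val v ∧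
      body.cst C 33 ((partFill s id val v).setv 32 v) ≤ b) :
    DTri C (fill id lim body) s (lim.cst C 32 s + 3 + N * (b + 14))
      (s.seta id fun i => if i < N then val i else s.a id i) := by
  intro f σ hg hs
  have h3 : s.v 3 = C.base := hs ▸ hg.abs
  have hsa : C.arrs σ.mem = s.a := by rw [← hs]; rfl
  refine (storeLoop_run hW (pre := body.comp 33 3) hg hs hlim (b := b) (ca := 9)
    hN (by omega) (fun v => C.base + id + 16 * v) (addr := addrE id (.var 32))
    (fun v hv σ1 hI hg1 => by
      have := addrE_agree hW hid (hI.agree hs) h3 (by omega)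
      exact ⟨this.1, this.2.1, by omega, this.2.2⟩)
    (fun v m => C.arrs m = (partFill s id val v).a)
    (fun _ _ => f (s.seta id fun i => if i < N then val i else s.a id i))
    (by rw [hsa, partFill_zero])
    (fun v hv σ1 hI hg1 hP => by
      have ag : Ex.Agree 33 (C.gh σ1) ((partFill s id val v).setv 32 v) := by
        have := hI.agree hs
        rw [hP] at this
        exact this
      obtain ⟨b1, b2, b3⟩ := hbody v hv
      have hrun := Ex.comp_ok hW body (D := 33) (j := 3) (by omega) hg1
        ((Ex.safe_congr C body ag).2 b1)
      rw [Ex.cst_congr C body ag, Ex.eval_congr C body ag, b2] at hrun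
      refine SRun.of_dRun (hrun.mono b3 ?_) fun _ _ => le_rfl
      rintro σ2 ⟨hp, hval⟩
      exact ⟨hp, by rw [arrs_update hid, hval, hP, partFill_succ]⟩)).mono le_rfl ?_ le_rfl
  rintro σ' ⟨hg', hr, hP⟩
  have : C.abs σ' = s.seta id fun i => if i < N then val i else s.a id i := by
    rw [abs_of_regs hr, hs]
    exact Gh.ext rfl hP
  exact ⟨⟨hg', this⟩, by rw [this]⟩

/-- Filling an array with random numbers from given ranges. -/
def rfill (id : ℕ) (lim md : Ex) : Prog :=
  storeLoop lim (addrE id (.var 32)) (.seq (md.comp 33 3) (.rand (tR 3) (tR 3)))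

theorem mav_nonneg {D : ℕ → Finset ℕ} {F : (ℕ → ℕ) → ℝ} (hF : ∀ x, 0 ≤ F x) (c v : ℕ)
    (x : ℕ → ℕ) : 0 ≤ mav D F c v x := by
  induction c generalizing v x with
  | zero => exact hF x
  | succ c ih => exact avg_nonneg fun s _ => ih _ _

/-- After `v` draws the potential is the average of `F` over the coordinates still to be drawn, with
the drawn ones read off from the array; one more draw is one step of the recursion of `mav`. The
ranges must not depend on the contents of the array being filled. -/
theorem Tri.rfill {C : Ctx k} (hW : 16 < C.M.word) {id : ℕ} {lim md : Ex} {s : Gh}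
    (hid : id < 16) (hlim : lim.safe C 32 s) {N b : ℕ} (hN : lim.eval C 32 s = N)
    (hw : C.base + 16 + 16 * N < C.M.word) (rg : ℕ → ℕ)
    (hmd : ∀ v < N, ∀ x, 0 < rg v ∧ md.safe C 33 ((s.seta id x).setv 32 v) ∧
      md.eval C 33 ((s.seta id x).setv 32 v) = rg v ∧
      md.cst C 33 ((s.seta id x).setv 32 v) ≤ b) (F : (ℕ → ℕ) → ℝ) (hF : ∀ x, 0 ≤ F x)
    (f : Gh → ℝ≥0∞) (hf : ∀ x, ENNReal.ofReal (F x) ≤ f (s.seta id x)) :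
    Tri C (rfill id lim md) s (lim.cst C 32 s + 3 + N * (b + 15))
      (fun s' => ∃ x, (∀ v < N, x v < rg v) ∧ s' = s.seta id x) f
      (ENNReal.ofReal (mav (fun v => range (rg v)) F N 0 (s.a id))) := by
  intro σ hg hs
  have h3 : s.v 3 = C.base := hs ▸ hg.abs
  have hsa : C.arrs σ.mem = s.a := by rw [← hs]; rfl
  have hself : s.seta id (s.a id) = s := by
    refine Gh.ext rfl ?_
    simp [Gh.seta]
  refine (storeLoop_run hW (pre := .seq (md.comp 33 3) (.rand (tR 3) (tR 3))) hg hs hlim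
    (b := b + 1) (ca := 9)
    hN (by omega) (fun v => C.base + id + 16 * v) (addr := addrE id (.var 32))
    (fun v hv σ1 hI hg1 => by
      have := addrE_agree hW hid (hI.agree hs) h3 (by omega)
      exact ⟨this.1, this.2.1, by omega, this.2.2⟩)
    (fun v m => ∃ x, (∀ u < v, x u < rg u) ∧ C.arrs m = (s.seta id x).a)
    (fun v m => ENNReal.ofReal (mav (fun v => range (rg v)) F (N - v) v (C.arrs m id)))
    ⟨s.a id, by omega, by rw [hsa, hself]⟩
    (fun v hv σ1 hI hg1 hP => by
      obtain ⟨x, hx, hP⟩ := hP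
      have ag : Ex.Agree 33 (C.gh σ1) ((s.seta id x).setv 32 v) := by
        have := hI.agree hs
        rw [hP] at this
        exact this
      obtain ⟨b0, b1, b2, b3⟩ := hmd v hv x
      have hrun := Ex.comp_ok hW md (D := 33) (j := 3) (by omega) hg1
        ((Ex.safe_congr C md ag).2 b1)
      rw [Ex.cst_congr C md ag, Ex.eval_congr C md ag, b2] at hrun
      have hxid : C.arrs σ1.mem id = x := by rw [hP]; simp [Gh.seta]
      refine SRun.seq (SRun.of_dRun (hrun.mono b3 fun _ h => h)
        (f := fun _ => ENNReal.ofReal (mav (fun v => range (rg v)) F (N - v) v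
          (C.arrs σ1.mem id))) fun _ _ => le_rfl) ?_
      rintro σ2 ⟨hp, hval⟩
      refine (SRun.rand (f := fun σ' => ENNReal.ofReal (mav (fun v => range (rg v)) F
        (N - (v + 1)) (v + 1) (C.arrs (Function.update σ1.mem (C.base + id + 16 * v)
          (σ'.reg (tR 3))) id))) (by rw [hval]; exact b0)).mono le_rfl ?_ ?_
      · rintro σ' ⟨u, hu, rfl⟩
        refine ⟨⟨hp.setT le_rfl _, Function.update x v u, ?_, ?_⟩, le_rfl⟩
        · intro w hw
          rw [Function.update_apply]
          split_ifs with h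
          · rw [h, ← hval]; exact hu
          · exact hx w (by omega)
        · rw [arrs_update hid, hxid, hP]
          simp [Gh.seta]
      · rw [hval, hxid, show N - v = N - (v + 1) + 1 by omega]
        simp only [mav, avg, arrs_update hid, hxid, State.setReg_reg, if_true,
          Function.update_self, card_range]
        rw [ENNReal.ofReal_div_of_pos (by exact_mod_cast b0),
          ENNReal.ofReal_sum_of_nonneg fun u _ => mav_nonneg hF _ _ _,
              ENNReal.ofReal_natCast])).mono
      (le_of_eq (by ring)) ?_ ?_
  · rintro σ' ⟨hg', hr, x, hx, hP⟩
    have : C.abs σ' = s.seta id x := by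
      rw [abs_of_regs hr, hs]
      exact Gh.ext rfl hP
    refine ⟨⟨hg', x, hx, this⟩, ?_⟩
    rw [this, Nat.sub_self, hP]
    simpa [mav, Gh.seta] using hf x
  · rw [hsa, Nat.sub_zero]

/-- A loop whose counter `r` runs from `0` to the value of the variable `rl`. -/
def rep (r rl : ℕ) (body : Prog) : Prog :=
  .seq (assign r (.lit 0)) <|
  .seq ((Ex.op .lt (.var r) (.var rl)).comp 32 0) <|
  .loop (tR 0) <|
    .seq body <| .seq (assign r (.op .add (.var r) (.lit 1))) <|
      (Ex.op .lt (.var r) (.var rl)).comp 32 0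

/-- The loop itself sets and increments the counter `r`, so `hset` asks that the invariant and the
potential do not react to it; the body, in turn, has to leave the counter alone. -/
theorem Tri.rep {C : Ctx k} (hW : 16 < C.M.word) {r rl N b : ℕ} {body : Prog} (hr : r < 32)
    (hr3 : r ≠ 3) (hrl : rl < 32) (hN : N < C.M.word) (P : ℕ → Gh → Prop)
    (g : ℕ → Gh → ℝ≥0∞)
    (hset : ∀ v s x, P v s → P v (s.setv r x) ∧ g v s = g v (s.setv r x))
    (hPN : ∀ v s, P v s → s.v rl = N)
    (hbody : ∀ v < N, ∀ s, P v s → s.v r = v →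
      Tri C body s b (fun s' => P (v + 1) s' ∧ s'.v r = v) (g (v + 1)) (g v s))
    {s : Gh} (hs : P 0 s) : Tri C (rep r rl body) s (N * (b + 12) + 9) (P N) (g N) (g 0 s) := by
  have hcmp : ∀ v ≤ N, ∀ s σ, P v s → s.v r = v → C.Good σ → C.abs σ = s →
      DRun C.M ((Ex.op .lt (.var r) (.var rl)).comp 32 0) σ 5
        fun σ' => C.Good σ' ∧ C.abs σ' = s ∧ σ'.reg (tR 0) = if v < N then 1 else 0 := by
    intro v hv s σ hP hsv hg hσ
    have h1 := hPN v s hP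
    refine (comp_abs hW (j := 0) hg hσ (e := .op .lt (.var r) (.var rl)) ?_).mono ?_ ?_
    · simp only [Ex.safe, Ex.eval, hr, hrl, if_true, h1, hsv]
      exact ⟨fun _ => by omega, fun _ => by omega, (Op.lt_eval_le _ _).trans_lt (by omega)⟩
    · simp [Ex.cst]
    · rintro σ' ⟨hp, hv'⟩
      refine ⟨hp.good (by omega) hg, hp.abs_eq.trans hσ, ?_⟩
      rw [hv']
      simp only [Ex.eval, hr, hrl, if_true, h1, hsv, Op.eval]
  have hasg := DTri.assign (C := C) hW (s := s) (e := .lit 0) hr hr3 (by simp only [Ex.safe]; omega)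
    (by simp only [Ex.eval]; omega)
  refine (hasg.seq_tri (B' := 5 + (N * (b + ((2 + 1 + 1 + 2) + 5) + 1) + 1)) (Φ := P N) (f := g N)
    (a := g 0 s) ?_).mono (by simp only [Ex.cst]; exact le_of_eq (by ring)) (fun _ h => ⟨h, le_rfl⟩)
        le_rfl
  simp only [Ex.eval]
  obtain ⟨hP0, hg0⟩ := hset 0 s 0 hs
  intro σ hg hσ
  refine SRun.seq (SRun.of_dRun (hcmp 0 (by omega) _ σ hP0 (by simp) hg hσ)
    (f := fun σ' => g 0 (C.abs σ')) (a := g 0 s) ?_) ?_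
  · rintro σ' ⟨_, h, _⟩
    rw [h, hg0]
  rintro σ1 ⟨hg1, hσ1, hc⟩
  refine (SRun.loop (N := N) (b := b + ((2 + 1 + 1 + 2) + 5)) (fun v σ => C.Good σ ∧ P v (C.abs σ) ∧
      (C.abs σ).v r = v ∧
    σ.reg (tR 0) = if v < N then 1 else 0) (fun v σ => g v (C.abs σ)) ?_ ?_ ?_).mono le_rfl ?_
        le_rfl
  · rintro v hv σ2 ⟨hg2, hP2, hr2, hc2⟩
    refine ⟨by rw [hc2, if_pos hv]; exact one_ne_zero, ?_⟩
    refine SRun.seq (hbody v hv _ hP2 hr2 σ2 hg2 rfl) ?_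
    rintro σ3 ⟨hg3, hP3, hr3'⟩
    have hev : Ex.eval C 32 (C.abs σ3) (.op .add (.var r) (.lit 1)) = v + 1 := by
      simp [Ex.eval, hr, hr3', Op.eval]
    have hasg := DTri.assign (C := C) hW (s := C.abs σ3) (e := .op .add (.var r) (.lit 1)) hr hr3
      (by
        simp only [Ex.safe, Ex.eval, hr, if_true, hr3', Op.eval]
        exact ⟨fun _ => by omega, by omega, by omega⟩)
      (by rw [hev]; omega)
    rw [hev] at hasg
    obtain ⟨hP4, hg4⟩ := hset (v + 1) _ (v + 1) hP3
    refine SRun.seq (g := fun σ' => g (v + 1) (C.abs σ')) ((hasg (g (v + 1)) σ3 hg3 rfl).mono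
      (by simp [Ex.cst]) (fun σ' h => ⟨h, le_rfl⟩) (by rw [hg4])) ?_
    rintro σ4 ⟨hg5, hσ4⟩
    refine (SRun.of_dRun (hcmp (v + 1) (by omega) _ σ4 hP4 (by simp) hg5 hσ4)
      (f := fun σ' => g (v + 1) (C.abs σ')) (a := g (v + 1) (C.abs σ4)) ?_).mono le_rfl ?_ le_rfl
    · rintro σ' ⟨_, h, _⟩
      rw [h, hσ4]
    · rintro σ' ⟨h1, h2, h3⟩
      exact ⟨⟨h1, by rw [h2]; exact hP4, by rw [h2]; simp, h3⟩, le_rfl⟩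
  · rintro σ2 ⟨_, _, _, h⟩
    rw [h, if_neg (by omega)]
  · exact ⟨hg1, by rw [hσ1]; exact hP0, by rw [hσ1]; simp, hc⟩
  · rintro σ' ⟨h1, h2, _⟩
    exact ⟨⟨h1, h2⟩, le_rfl⟩

/-! ### Success probabilities -/

/-- An invariant that implies success turns into success probability `1`. This serves the runs that
start from a state that has already won. -/
theorem Tri.sure {C : Ctx k} {p : Prog} {s : Gh} {B : ℕ} {Φ : Gh → Prop} {f g : Gh → ℝ≥0∞}
    {q : ℝ≥0∞} (h : Tri C p s B Φ f q) (hg : ∀ s', Φ s' → 1 ≤ g s') : Tri C p s B Φ g 1 := by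
  intro σ h1 h2
  obtain ⟨μ, h3, h4, _⟩ := h σ h1 h2
  refine ⟨μ, h3, h4, ?_⟩
  rw [← expect_const μ 1]
  exact expect_mono _ fun x hx => hg _ (h4 x hx).2.2

theorem Tri.affine {C : Ctx k} {p : Prog} {s : Gh} {B : ℕ} {Φ : Gh → Prop} {f : Gh → ℝ≥0∞}
    {q : ℝ≥0∞} (h : Tri C p s B Φ f q) (a b : ℝ≥0∞) :
    Tri C p s B Φ (fun s' => a + b * f s') (a + b * q) := by
  intro σ h1 h2
  obtain ⟨μ, h3, h4, h5⟩ := h σ h1 h2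
  refine ⟨μ, h3, h4, ?_⟩
  rw [expect_add μ (fun _ => a) (fun x => b * f (C.abs x.1)), expect_const, expect_const_mul]
  gcongr

open Classical in
/-- The indicator function of a set of states. -/
noncomputable def ind (J : Gh → Prop) (s : Gh) : ℝ≥0∞ := if J s then 1 else 0

theorem ind_of {J : Gh → Prop} {s : Gh} (h : J s) : ind J s = 1 := if_pos h
theorem ind_of_not {J : Gh → Prop} {s : Gh} (h : ¬ J s) : ind J s = 0 := if_neg h
theorem ind_le_ind {J J' : Gh → Prop} {s s' : Gh} (h : J s → J' s') : ind J s ≤ ind J' s' := by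
  by_cases h1 : J s
  · rw [ind_of h1, ind_of (h h1)]
  · rw [ind_of_not h1]; exact zero_le

/-- Success probabilities multiply: `a` for reaching `J`, and `b` for what follows from there. -/
theorem Tri.seq_ind {C : Ctx k} {p q : Prog} {s : Gh} {B B' : ℕ} {Φ Ψ : Gh → Prop}
    {J : Gh → Prop} {f : Gh → ℝ≥0∞} {a b : ℝ≥0∞} (hp : Tri C p s B Φ (ind J) a)
    (hq : ∀ s', Φ s' → Tri C q s' B' Ψ f (b * ind J s')) :
    Tri C (.seq p q) s (B + B') Ψ f (b * a) := by
  have := hp.affine 0 b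
  simp only [zero_add] at this
  exact this.seq hq

/-- A random guess among `N` values replaces an existential quantifier at the price of a factor `1 /
N`. -/
theorem Tri.rnd_of_exists {C : Ctx k} (hW : 16 < C.M.word) {r : ℕ} {e : Ex} {s : Gh} (hr : r < 32)
    (hr3 : r ≠ 3) (hsafe : e.safe C 32 s) {N : ℕ} (hN : e.eval C 32 s = N) (hpos : 0 < N)
    {J H : Gh → Prop} (hJ : H s → ∃ v < N, J (s.setv r v)) :
    Tri C (GenBinary.rnd r e) s (e.cst C 32 s + 1) (fun s' => ∃ v < N, s' = s.setv r v) (ind J)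
      ((N : ℝ≥0∞)⁻¹ * ind H s) := by
  subst hN
  refine (Tri.rnd (C := C) hW hr hr3 hsafe hpos (ind J)).mono le_rfl (fun _ h => ⟨h, le_rfl⟩) ?_
  rw [ENNReal.div_eq_inv_mul]
  by_cases hH : H s
  · obtain ⟨v, hv, h⟩ := hJ hH
    rw [ind_of hH]
    gcongr
    rw [← ind_of h]
    exact single_le_sum (f := fun v => ind J (s.setv r v)) (fun _ _ => zero_le)
      (mem_range.2 hv)
  · rw [ind_of_not hH]; simp

/-! ### Sorting the current list -/

/-- The number of list entries that precede column `j` when the list is sorted by decreasing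
values of `h`. -/
def rank (d : ℕ) (h pos : ℕ → ℕ) (R j : ℕ) : ℕ :=
  ∑ j' ∈ range d, (if pos j' < R then 1 else 0) *
    ((if h j < h j' then 1 else 0) + (if h j = h j' then 1 else 0) * (if j' < j then 1 else 0))

/-- The positions after sorting the first `R` entries by decreasing values of `h`. -/
def newPos (d : ℕ) (h pos : ℕ → ℕ) (R j : ℕ) : ℕ :=
  if j < d ∧ pos j < R then rank d h pos R j else pos j

/-- The list entries that precede column `j`. -/
def before (d : ℕ) (h pos : ℕ → ℕ) (R j : ℕ) : Finset ℕ :=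
  (range d).filter fun j' => pos j' < R ∧ (h j < h j' ∨ h j = h j' ∧ j' < j)

theorem rank_eq_card (d : ℕ) (h pos : ℕ → ℕ) (R j : ℕ) :
    rank d h pos R j = (before d h pos R j).card := by
  unfold rank before
  rw [card_filter]
  refine sum_congr rfl fun j' _ => ?_
  split_ifs <;> first | rfl | omega

theorem rank_lt_rank {d : ℕ} {h pos : ℕ → ℕ} {R j j' : ℕ} (hj : j < d) (hp : pos j < R)
    (hlt : h j' < h j ∨ h j' = h j ∧ j < j') : rank d h pos R j < rank d h pos R j' := by
  rw [rank_eq_card, rank_eq_card]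
  refine card_lt_card ⟨fun x hx => ?_, fun hcon => ?_⟩
  · simp only [before, mem_filter] at hx ⊢
    exact ⟨hx.1, hx.2.1, by omega⟩
  · have : j ∈ before d h pos R j := hcon (by simp [before, hj, hp, hlt])
    simp only [before, mem_filter] at this
    omega

/-- Ties are broken by the column index, so on the first `R` entries `newPos` is the rank in a
strict total order: injective, below `R`, and decreasing in `h`. The other entries stay in place, so
a permutation results. -/
theorem newPos_spec {d : ℕ} {h pos : ℕ → ℕ} {R : ℕ} (hpos : IsPos d pos) (hR : R ≤ d) :
    IsPos d (newPos d h pos R) ∧ (∀ j < d, R ≤ pos j → newPos d h pos R j = pos j) ∧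
      (∀ j < d, pos j < R → newPos d h pos R j < R) ∧
      ∀ j < d, ∀ j' < d, newPos d h pos R j < newPos d h pos R j' → newPos d h pos R j' < R →
        h j' ≤ h j := by
  have h1 : ∀ j < d, R ≤ pos j → newPos d h pos R j = pos j := fun j hj hp => by
    unfold newPos; rw [if_neg (by omega)]
  have h1' : ∀ j < d, pos j < R → newPos d h pos R j = rank d h pos R j := fun j hj hp => by
    unfold newPos; rw [if_pos ⟨hj, hp⟩]
  have h2 : ∀ j < d, pos j < R → newPos d h pos R j < R := fun j hj hp => by
    rw [h1' j hj hp, rank_eq_card]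
    refine (card_lt_card (t := (range d).filter fun j' => pos j' < R) ?_).trans_eq
      (hpos.card_prefix hR)
    refine ⟨fun x hx => ?_, fun hcon => ?_⟩
    · simp only [before, mem_filter] at hx ⊢
      exact ⟨hx.1, hx.2.1⟩
    · have : j ∈ before d h pos R j := hcon (by simp [hj, hp])
      simp only [before, mem_filter] at this
      omega
  refine ⟨⟨fun j hj => ?_, fun j hj j' hj' he => ?_⟩, h1, h2, fun j hj j' hj' hlt hR' => ?_⟩
  · rcases lt_or_ge (pos j) R with hp | hp
    · exact (h2 j hj hp).trans_le hR
    · rw [h1 j hj hp]; exact hpos.1 j hj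
  · rcases lt_or_ge (pos j) R with hp | hp <;> rcases lt_or_ge (pos j') R with hp' | hp'
    · rw [h1' j hj hp, h1' j' hj' hp'] at he
      by_contra hne
      rcases lt_trichotomy (h j) (h j') with h3 | h3 | h3
      · exact (rank_lt_rank (pos := pos) hj' hp' (Or.inl h3)).ne' he
      · rcases Nat.lt_or_gt_of_ne hne with h4 | h4
        · exact (rank_lt_rank (pos := pos) hj hp (Or.inr ⟨h3.symm, h4⟩)).ne he
        · exact (rank_lt_rank (pos := pos) hj' hp' (Or.inr ⟨h3, h4⟩)).ne' he
      · exact (rank_lt_rank (pos := pos) hj hp (Or.inl h3)).ne he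
    · have := h2 j hj hp
      rw [he, h1 j' hj' hp'] at this
      omega
    · have := h2 j' hj' hp'
      rw [← he, h1 j hj hp] at this
      omega
    · rw [h1 j hj hp, h1 j' hj' hp'] at he
      exact hpos.2 j hj j' hj' he
  · have hp' : pos j' < R := by
      by_contra hcon
      rw [h1 j' hj' (by omega)] at hR'
      omega
    have hp : pos j < R := by
      by_contra hcon
      rw [h1 j hj (by omega)] at hlt
      omega
    by_contra hcon
    rw [h1' j hj hp, h1' j' hj' hp'] at hlt
    exact absurd (rank_lt_rank (h := h) (pos := pos) (j' := j) hj' hp' (Or.inl (by omega)))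
        (by omega)

/-! ### Evaluation of expressions, with safety and cost -/

instance : Add Ex := ⟨.op .add⟩
instance : Sub Ex := ⟨.op .sub⟩
instance : Mul Ex := ⟨.op .mul⟩
instance : Div Ex := ⟨.op .div⟩

namespace Ex

/-- The expression `e` is safe, has the value `x` and costs at most `b`. -/
def Ok (C : Ctx k) (D : ℕ) (s : Gh) (e : Ex) (x b : ℕ) : Prop :=
  e.safe C D s ∧ e.eval C D s = x ∧ e.cst C D s ≤ b

namespace Ok

variable {C : Ctx k} {D : ℕ} {s : Gh} {e a b : Ex} {x y z c c' c'' N β : ℕ}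

theorem mono (h : Ok C D s e x c) (hc : c ≤ c') : Ok C D s e x c' := ⟨h.1, h.2.1, h.2.2.trans hc⟩

theorem lit (h : x < C.M.word) : Ok C D s (.lit x) x 1 := ⟨h, rfl, le_rfl⟩

theorem var {r : ℕ} (hr : r < D) (hv : s.v r = x) (hx : x < C.M.word) :
    Ok C D s (.var r) x 2 :=
  ⟨fun _ => hv ▸ hx, by simp [eval, hr, hv], le_rfl⟩

theorem op {o : Op} (ha : Ok C D s a x c) (hb : Ok C D s b y c') (h : o.eval x y < C.M.word) :
    Ok C D s (.op o a b) (o.eval x y) (c + c' + 1) := by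
  obtain ⟨h1, rfl, h3⟩ := ha
  obtain ⟨h4, rfl, h6⟩ := hb
  exact ⟨⟨h1, h4, h⟩, rfl, by simp only [cst]; omega⟩

theorem add (ha : Ok C D s a x c) (hb : Ok C D s b y c') (h : x + y < C.M.word) :
    Ok C D s (a + b) (x + y) (c + c' + 1) := op ha hb h

theorem mul (ha : Ok C D s a x c) (hb : Ok C D s b y c') (h : x * y < C.M.word) :
    Ok C D s (a * b) (x * y) (c + c' + 1) := op ha hb h

theorem lt_word (h : Ok C D s e x c) (hx : x < C.M.word) : e.eval C D s < C.M.word := h.2.1 ▸ hx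

theorem sub (ha : Ok C D s a x c) (hb : Ok C D s b y c') (h : x < C.M.word) :
    Ok C D s (a - b) (x - y) (c + c' + 1) := op ha hb ((Nat.sub_le _ _).trans_lt h)

theorem div (ha : Ok C D s a x c) (hb : Ok C D s b y c') (h : x < C.M.word) :
    Ok C D s (a / b) (x / y) (c + c' + 1) := op ha hb ((Nat.div_le_self _ _).trans_lt h)

theorem lt (ha : Ok C D s a x c) (hb : Ok C D s b y c') (h : 1 < C.M.word) :
    Ok C D s (.op .lt a b) (if x < y then 1 else 0) (c + c' + 1) :=
  op ha hb ((Op.lt_eval_le _ _).trans_lt h)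

theorem eq (ha : Ok C D s a x c) (hb : Ok C D s b y c') (h : 1 < C.M.word) :
    Ok C D s (.op .eq a b) (if x = y then 1 else 0) (c + c' + 1) :=
  op ha hb (by simp only [Op.eval]; split_ifs <;> omega)

theorem arr {id : ℕ} (h : Ok C D s e x c) (hid : id < 16) (hv : s.a id x = y)
    (hw : C.base + 16 + 16 * x < C.M.word) : Ok C D s (.arr id e) y (c + 6) := by
  obtain ⟨h1, rfl, h3⟩ := h
  exact ⟨⟨h1, hid, by omega⟩, hv, by simp only [cst]; omega⟩

theorem inp (h : Ok C D s e x c) (hx : x < C.base) (hv : C.inp x = y) :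
    Ok C D s (.inp e) y (c + 1) := by
  obtain ⟨h1, rfl, h3⟩ := h
  exact ⟨⟨h1, hx⟩, hv, by simp only [cst]; omega⟩

theorem mis {v : Ex} (ha : Ok C D s a x c) (hb : Ok C D s b y c') (hv : Ok C D s v z c'')
    (hx : x < 2 ^ k) (hy : y < 2 ^ k) :
    Ok C D s (.mis a b v) (1 - C.M.answer x y z) (c + c' + c'' + 3 + C.M.queryTime) := by
  obtain ⟨h1, rfl, h3⟩ := ha
  obtain ⟨h4, rfl, h6⟩ := hb
  obtain ⟨h7, rfl, h9⟩ := hv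
  exact ⟨⟨h1, h4, h7, hx, hy⟩, rfl, by simp only [cst]; omega⟩

theorem foldv_congr {o : Op} {f g : ℕ → ℕ} (h : ∀ v < N, f v = g v) :
    foldv o z f N = foldv o z g N := by
  induction N with
  | zero => rfl
  | succ N ih =>
    simp only [foldv]
    rw [ih fun v hv => h v (by omega), h N (by omega)]

theorem fold {o : Op} {lim body : Ex} {f : ℕ → ℕ} (hl : Ok C D s lim N c') (hN : N < C.M.word)
    (hz : z < C.M.word) (hb : ∀ v < N, Ok C (D + 1) (s.setv D v) body (f v) c)
    (hw : ∀ v < N, foldv o z f (v + 1) < C.M.word) :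
    Ok C D s (.fold o z lim body) (foldv o z f N) (c' + 4 + N * (c + 5)) := by
  obtain ⟨h1, rfl, h3⟩ := hl
  refine ⟨⟨h1, hN, hz, fun v hv => ⟨(hb v hv).1, ?_⟩⟩, ?_, ?_⟩
  · rw [foldv_congr fun u hu => (hb u (by omega)).2.1]
    exact hw v hv
  · exact foldv_congr fun u hu => (hb u hu).2.1
  · simp only [cst]
    refine add_le_add (by omega) ?_
    calc _ ≤ ∑ v ∈ range (eval C D s lim), (c + 5) :=
          sum_le_sum fun v hv => by have := (hb v (mem_range.1 hv)).2.2; omega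
      _ = _ := by rw [sum_const, card_range, smul_eq_mul]

/-- Costs are kept in the form of a numeral times a product of loop lengths, so that nested loops
simply multiply the lengths. -/
theorem sum {lim body : Ex} {f : ℕ → ℕ} (hl : Ok C D s lim N 2) (hN : N < C.M.word)
    (hb : ∀ v < N, Ok C (D + 1) (s.setv D v) body (f v) (c * β))
    (hw : ∑ v ∈ range N, f v < C.M.word) (hN1 : 1 ≤ N) (hβ : 1 ≤ β) :
    Ok C D s (.fold .add 0 lim body) (∑ v ∈ range N, f v) ((c + 11) * (N * β)) := by
  have := fold (o := .add) (z := 0) hl hN (by omega) hb fun v hv => by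
    rw [foldv_add]
    exact (sum_le_sum_of_subset (range_subset_range.2 (by omega))).trans_lt hw
  rw [foldv_add] at this
  refine this.mono ?_
  have : 1 ≤ N * β := Nat.one_le_iff_ne_zero.2 (by positivity)
  nlinarith [Nat.mul_le_mul_left N hβ]

theorem prod {lim body : Ex} {f : ℕ → ℕ} (hl : Ok C D s lim N c') (hN : N < C.M.word)
    (hb : ∀ v < N, Ok C (D + 1) (s.setv D v) body (f v) c)
    (hw : ∀ v ≤ N, ∏ u ∈ range v, f u < C.M.word) :
    Ok C D s (.fold .mul 1 lim body) (∏ v ∈ range N, f v) (c' + 4 + N * (c + 5)) := by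
  have := fold (o := .mul) (z := 1) hl hN (by simpa using hw 0 (by omega)) hb fun v hv => by
    rw [foldv_mul]
    exact hw _ hv
  rwa [foldv_mul] at this

/-- Powers. -/
theorem pow {lim body : Ex} (hl : Ok C D s lim N c') (hN : N < C.M.word)
    (hb : ∀ v < N, Ok C (D + 1) (s.setv D v) body x c) (hx : 1 ≤ x) (hw : x ^ N < C.M.word) :
    Ok C D s (.fold .mul 1 lim body) (x ^ N) (c' + 4 + N * (c + 5)) := by
  have := prod (f := fun _ => x) hl hN hb fun v hv => by
    rw [prod_const, card_range]
    exact (Nat.pow_le_pow_right hx hv).trans_lt hw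
  rwa [prod_const, card_range] at this

theorem amin {lim body : Ex} {f : ℕ → ℕ} (hl : Ok C D s lim N 2) (hN : N < C.M.word)
    (hb : ∀ v < N, Ok C (D + 1) (s.setv D v) body (f v) (c * β))
    (hw : ∀ v < N, f v < C.M.word) (hN1 : 1 ≤ N) (hβ : 1 ≤ β) :
    Ok C D s (.amin lim body) (aminf N f) ((2 * c + 16) * (N * β)) := by
  obtain ⟨h1, rfl, h3⟩ := hl
  refine ⟨⟨h1, hN, (hb 0 (by omega)).1, fun v hv => ⟨(hb v hv).1, (hb v hv).lt_word (hw v hv)⟩⟩,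
    aminf_congr (fun u hu => (hb u hu).2.1) (hb 0 (by omega)).2.1, ?_⟩
  simp only [cst]
  have h0 := (hb 0 (by omega)).2.2
  have h4 : ∑ v ∈ range (eval C D s lim), (cst C (D + 1) (s.setv D v) body + 10) ≤
      eval C D s lim * (c * β + 10) :=
    calc _ ≤ ∑ v ∈ range (eval C D s lim), (c * β + 10) :=
          sum_le_sum fun v hv => by have := (hb v (mem_range.1 hv)).2.2; omega
      _ = _ := by rw [sum_const, card_range, smul_eq_mul]
  set N := eval C D s lim
  have h5 : β ≤ N * β := Nat.le_mul_of_pos_left _ hN1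
  have h6 : N ≤ N * β := Nat.le_mul_of_pos_right _ hβ
  have h7 : c * β ≤ c * (N * β) := Nat.mul_le_mul_left _ h5
  have h8 : N * (c * β + 10) = c * (N * β) + 10 * N := by ring
  have h9 : (2 * c + 16) * (N * β) = 2 * (c * (N * β)) + 16 * (N * β) := by ring
  omega

end Ok

end Ex

theorem DTri.fill_ok {C : Ctx k} (hW : 16 < C.M.word) {id : ℕ} {lim body : Ex} {s : Gh}
    (hid : id < 16) {N c β : ℕ} (hlim : lim.Ok C 32 s N 2)
    (hw : C.base + 16 + 16 * N < C.M.word) (val : ℕ → ℕ)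
    (hbody : ∀ v < N, body.Ok C 33 ((partFill s id val v).setv 32 v) (val v) (c * β))
    (hN1 : 1 ≤ N) (hβ : 1 ≤ β) :
    DTri C (GenBinary.fill id lim body) s ((c + 19) * (N * β))
      (s.seta id fun i => if i < N then val i else s.a id i) := by
  refine (DTri.fill hW hid hlim.1 hlim.2.1 hw val hbody).mono ?_ rfl
  have h0 := hlim.2.2
  have h5 : β ≤ N * β := Nat.le_mul_of_pos_left _ hN1
  have h6 : N ≤ N * β := Nat.le_mul_of_pos_right _ hβ
  have h8 : N * (c * β + 14) = c * (N * β) + 14 * N := by ring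
  have h9 : (c + 19) * (N * β) = c * (N * β) + 19 * (N * β) := by ring
  omega

theorem DTri.assign_ok {C : Ctx k} (hW : 16 < C.M.word) {r : ℕ} {e : Ex} {s : Gh} {x c : ℕ}
    (hr : r < 32) (hr3 : r ≠ 3) (he : e.Ok C 32 s x c) (hx : x < C.M.word) :
    DTri C (GenBinary.assign r e) s (c + 2) (s.setv r x) := by
  obtain ⟨h1, rfl, h3⟩ := he
  exact (DTri.assign hW hr hr3 h1 hx).mono (by omega) rfl

theorem DTri.put_ok {C : Ctx k} (hW : 16 < C.M.word) {id : ℕ} {idx e : Ex} {s : Gh} {i x c c' : ℕ}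
    (hid : id < 16) (hi : idx.Ok C 32 s i c) (hw : C.base + 16 + 16 * i < C.M.word)
    (he : e.Ok C 32 s x c') :
    DTri C (GenBinary.put id idx e) s (c + c' + 8) (s.seta id (Function.update (s.a id) i x)) := by
  obtain ⟨h1, rfl, h3⟩ := he
  obtain ⟨h4, rfl, h6⟩ := hi
  exact (DTri.put hW hid h4 (by omega) h1).mono (by omega) rfl

/-! ### Parameters -/

namespace Inst

variable (I : Inst)

/-- The number of columns sampled per cluster. -/
def t : ℕ := 12 * I.K * I.m ^ 2

/-- The inverse of the success probability of one stage. -/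
def stageInv : ℕ := I.I1 * I.K * I.G * 2 * I.B ^ (I.K * I.t)

/-- The number of trials. -/
def trials : ℕ := 2 * I.stageInv ^ I.K

theorem B_ge : 2 ≤ I.B := by
  have hK := I.hK
  have h1 : 2 ≤ I.Q := by
    unfold Q
    calc 2 = 2 * 1 * 1 := rfl
      _ ≤ 2 * I.K * (I.N + 1) := by gcongr; omega
  calc 2 ≤ I.Q := h1
    _ = I.Q ^ 1 := (pow_one _).symm
    _ ≤ I.Q ^ I.K := Nat.pow_le_pow_right (by omega) hK
    _ ≤ I.B := Nat.le_mul_of_pos_left _ hK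

theorem t_pos : 0 < I.t := by have := I.hK; have := I.hm; unfold t; positivity

theorem G_pos : 0 < I.G := by have := I.B_ge; have := I.hm; unfold G; positivity

theorem I1_pos : 0 < I.I1 := by unfold I1; omega

theorem stageInv_pos : 0 < I.stageInv := by
  have := I.hK; have := I.G_pos; have := I.I1_pos; have := I.B_ge
  unfold stageInv; positivity

theorem stageInv_le : 2 * I.stageInv ≤ I.trials := by
  unfold trials
  have := Nat.pow_le_pow_right I.stageInv_pos I.hK
  rw [pow_one] at this
  omega

/-- All the sizes together are bounded by the number of trials. -/
theorem sizes_le : I.I1 * I.K * I.G * (I.K * I.t) ≤ I.trials := by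
  refine le_trans ?_ I.stageInv_le
  unfold stageInv
  have h1 : I.K * I.t ≤ I.B ^ (I.K * I.t) :=
    (Nat.lt_pow_self (by have := I.B_ge; omega)).le
  calc I.I1 * I.K * I.G * (I.K * I.t) ≤ I.I1 * I.K * I.G * I.B ^ (I.K * I.t) :=
        Nat.mul_le_mul_left _ h1
    _ ≤ 4 * (I.I1 * I.K * I.G * I.B ^ (I.K * I.t)) := Nat.le_mul_of_pos_left _ (by norm_num)
    _ = 2 * (I.I1 * I.K * I.G * 2 * I.B ^ (I.K * I.t)) := by ring

end Inst

/-! ### The stage program: expressions -/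

/-- A column at the sampled position. -/
def colE : Ex := .amin (.var 1) (.lit 1 - .op .eq (.arr 0 (.var 33)) (.arr 10 (.var 32)))

/-- The best label of a row on the weighted sample. -/
def choiceE : Ex :=
  .amin (.var 4) (.fold .add 0 (.var 15) (.arr 9 (.var 34 / .var 5) *
    .mis (.var 33) (.arr 8 (.var 34 / .var 5)) (.inp (.var 32 * .var 1 + .arr 11 (.var 34)))))

/-- The index of the nearest label of a column. -/
def labE : Ex :=
  .amin (.var 16) (.fold .add 0 (.var 0)
    (.mis (.arr 4 (.var 34)) (.arr 8 (.var 33)) (.inp (.var 34 * .var 1 + .var 32))))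

/-- The distance of a column from its nearest label. -/
def nearE : Ex :=
  .fold .add 0 (.var 0)
    (.mis (.arr 4 (.var 33)) (.arr 8 (.arr 3 (.var 32))) (.inp (.var 33 * .var 1 + .var 32)))

/-- Choosing between a new value and an array element. -/
def selE (e : Ex) (id : ℕ) : Ex := .var 17 * e + (.lit 1 - .var 17) * .arr id (.var 32)

/-- The position of a column in the sorted list. -/
def posE : Ex :=
  .op .lt (.arr 0 (.var 32)) (.var 18) * .fold .add 0 (.var 1)
      (.op .lt (.arr 0 (.var 33)) (.var 18) *
        (.op .lt (.arr 2 (.var 32)) (.arr 2 (.var 33)) +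
          .op .eq (.arr 2 (.var 32)) (.arr 2 (.var 33)) * .op .lt (.var 33) (.var 32))) +
    (.lit 1 - .op .lt (.arr 0 (.var 32)) (.var 18)) * .arr 0 (.var 32)

namespace Inst

variable (I : Inst)

/-- The column at position `r`. -/
def col (pos : ℕ → ℕ) (r : ℕ) : ℕ := aminf I.d fun j => 1 - (if pos j = r then 1 else 0)

/-- The index of the nearest of the first `l` labels. -/
def lab (y : ℕ → ℕ) (l : ℕ) (U : ℕ → ℕ) (j : ℕ) : ℕ := aminf l fun i => I.dist U (y i) j

/-- The best label of row `i` on the weighted sample `sm`. -/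
def choice (y w : ℕ → ℕ) (Lt : ℕ) (sm : ℕ → ℕ) (i : ℕ) : ℕ :=
  aminf I.K fun x =>
    ∑ v ∈ range Lt, w (v / I.t) * I.mis x (y (v / I.t)) (I.a i (sm v))

variable {I}

theorem col_lt (pos : ℕ → ℕ) (r : ℕ) : I.col pos r < I.d := aminf_lt I.hd _

/-- The minimized quantity is `0` exactly at the columns in position `r`, and such a column exists.
The list is thus inverted by a search, without storing the inverse permutation. -/
theorem pos_col {pos : ℕ → ℕ} (h : IsPos I.d pos) {r : ℕ} (hr : r < I.d) :
    pos (I.col pos r) = r := by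
  obtain ⟨j, hj, e⟩ := h.surj hr
  have := aminf_le (fun j => 1 - (if pos j = r then 1 else 0)) hj
  simp only [e, if_true, Nat.sub_self] at this
  by_contra hcon
  unfold col at hcon
  rw [if_neg hcon] at this
  omega

theorem choice_lt (y w : ℕ → ℕ) (Lt : ℕ) (sm : ℕ → ℕ) (i : ℕ) : I.choice y w Lt sm i < I.K :=
  aminf_lt I.hK _

theorem lab_lt (y : ℕ → ℕ) {l : ℕ} (hl : 0 < l) (U : ℕ → ℕ) (j : ℕ) : I.lab y l U j < l :=
  aminf_lt hl _

theorem dist_le (U : ℕ → ℕ) (y j : ℕ) : I.dist U y j ≤ I.n := by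
  unfold dist
  calc _ ≤ ∑ i ∈ range I.n, 1 := sum_le_sum fun i _ => I.hmis.le_one _ _ _
    _ = I.n := by simp

theorem dist_congr {U U' : ℕ → ℕ} (h : ∀ i < I.n, U i = U' i) (y j : ℕ) :
    I.dist U y j = I.dist U' y j :=
  sum_congr rfl fun i hi => by rw [h i (mem_range.1 hi)]

end Inst

/-- The environment is large enough for the instance and presents it. -/
structure Fits (C : Ctx k) (I : Inst) : Prop where
  K_eq : I.K = 2 ^ k
  base : C.base = I.n * I.d
  inp : ∀ i j, C.inp (i * I.d + j) = I.a i j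
  mis : ∀ x y b, 1 - C.M.answer x y b = I.mis x y b
  le : I.d ≤ I.n
  word : 1000 * (I.trials * (I.n * I.d)) < C.M.word

/-- Elementary size estimates. -/
structure Sizes (C : Ctx k) (I : Inst) (Z : ℕ) : Prop where
  word : 1000 * Z < C.M.word
  base : C.base ≤ Z
  trials : I.trials ≤ Z
  n : I.n ≤ Z
  d : I.d ≤ Z
  K : I.K ≤ Z
  t : I.t ≤ Z
  I1 : I.I1 ≤ Z
  G : I.G ≤ Z
  Gd : I.G * I.d ≤ Z
  Kt : ∀ l < I.K, (l + 1) * I.t ≤ Z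
  KtGd : ∀ l < I.K, (l + 1) * I.t * (I.G * I.d) ≤ Z
  nKKt : ∀ l < I.K, I.n * (I.K * ((l + 1) * I.t)) ≤ Z
  Ktd : ∀ l < I.K, (l + 1) * I.t * I.d ≤ Z
  dKn : ∀ l < I.K, I.d * ((l + 1) * I.n) ≤ Z
  dn : I.d * I.n ≤ Z
  dd : I.d * I.d ≤ Z
  n1 : 1 ≤ I.n
  K1 : 1 ≤ I.K
  t1 : 1 ≤ I.t
  Kt1 : ∀ l, 1 ≤ (l + 1) * I.t
  d1 : 1 ≤ I.d
  hW : 16 < C.M.word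

theorem mul4_le {a b c d a' b' c' d' : ℕ} (ha : a ≤ a') (hb : b ≤ b') (hc : c ≤ c') (hd : d ≤ d') :
    a * b * c * d ≤ a' * b' * c' * d' :=
  Nat.mul_le_mul (Nat.mul_le_mul (Nat.mul_le_mul ha hb) hc) hd

/-- Each quantity is bounded by the product of a part of `I1 * K * G * (K * t)`, which is at most
`trials`, and a part of `n * d`. With this single bound `Z` and `1000 * Z < word`, the conditions on
word sizes in the program become linear. The bound on `d * d` uses `d ≤ n`. -/
theorem Fits.sizes {C : Ctx k} {I : Inst} (h : Fits C I) : Sizes C I (I.trials * (I.n * I.d)) := by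
  have hd := I.hd
  have hK := I.hK
  have hn : 1 ≤ I.n := hd.trans h.le
  have hG := I.G_pos
  have hI := I.I1_pos
  have ht := I.t_pos
  have hs := I.sizes_le
  set X := I.trials
  set Y := I.n * I.d with hY
  have hKt : 1 ≤ I.K * I.t := Nat.mul_pos hK ht
  -- a product of parts of the sizes and of parts of the input size is small
  have key : ∀ {p q : ℕ}, p ≤ I.I1 * I.K * I.G * (I.K * I.t) → q ≤ Y → p * q ≤ X * Y :=
    fun hp hq => Nat.mul_le_mul (hp.trans hs) hq
  have p1 : 1 ≤ I.I1 * I.K * I.G * (I.K * I.t) := mul4_le (a := 1) (b := 1) (c := 1) (d := 1) hI hK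
      hG hKt
  have pI : I.I1 ≤ I.I1 * I.K * I.G * (I.K * I.t) := by
    simpa using mul4_le (b := 1) (c := 1) (d := 1) le_rfl hK hG hKt
  have pK : I.K ≤ I.I1 * I.K * I.G * (I.K * I.t) := by
    simpa using mul4_le (a := 1) (c := 1) (d := 1) hI (le_refl I.K) hG hKt
  have pG : I.G ≤ I.I1 * I.K * I.G * (I.K * I.t) := by
    simpa using mul4_le (a := 1) (b := 1) (d := 1) hI hK (le_refl I.G) hKt
  have pt : ∀ l < I.K, (l + 1) * I.t ≤ I.I1 * I.K * I.G * (I.K * I.t) := fun l hl => by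
    simpa using mul4_le (a := 1) (b := 1) (c := 1) hI hK hG (Nat.mul_le_mul_right I.t hl)
  have pGt : ∀ l < I.K, I.G * ((l + 1) * I.t) ≤ I.I1 * I.K * I.G * (I.K * I.t) := fun l hl => by
    simpa using mul4_le (a := 1) (b := 1) hI hK le_rfl (Nat.mul_le_mul_right I.t hl)
  have pKt : ∀ l < I.K, I.K * ((l + 1) * I.t) ≤ I.I1 * I.K * I.G * (I.K * I.t) := fun l hl => by
    simpa using mul4_le (a := 1) (c := 1) hI (le_refl I.K) hG (Nat.mul_le_mul_right I.t hl)
  have q1 : 1 ≤ Y := Nat.mul_pos hn hd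
  have qn : I.n ≤ Y := Nat.le_mul_of_pos_right _ hd
  have qd : I.d ≤ Y := Nat.le_mul_of_pos_left _ hn
  have qdd : I.d * I.d ≤ Y := Nat.mul_le_mul_right _ h.le
  have hZ1 : 1 ≤ X * Y := by simpa using key p1 q1
  have hw := h.word
  refine ⟨hw, ?_, Nat.le_mul_of_pos_right _ q1, ?_, ?_, ?_, ?_, ?_, ?_, key pG qd, fun l hl => ?_,
    fun l hl => ?_, fun l hl => ?_, fun l hl => key (pt l hl) qd, fun l hl => ?_, ?_, ?_,
    hn, hK, ht, fun l => Nat.mul_pos (by omega) ht, hd, ?_⟩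
  · rw [h.base]; simpa using key p1 le_rfl
  · simpa using key p1 qn
  · simpa using key p1 qd
  · simpa using key pK q1
  · simpa using key (pt 0 hK) q1
  · simpa using key pI q1
  · simpa using key pG q1
  · simpa using key (pt l hl) q1
  · exact le_trans (le_of_eq (by ring)) (key (pGt l hl) qd)
  · exact le_trans (le_of_eq (by ring)) (key (pKt l hl) qn)
  · exact le_trans (le_of_eq (by rw [hY]; ring)) (key (p := l + 1) (Nat.le_trans hl pK) (le_refl Y))
  · exact le_trans (le_of_eq (by ring)) (key p1 (le_refl Y))
  · simpa using key p1 qdd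
  · change 1000 * (X * Y) < _ at hw
    omega

/-- The variables that hold the parameters of the instance. -/
structure Env (I : Inst) (s : Gh) : Prop where
  n : s.v 0 = I.n
  d : s.v 1 = I.d
  k : 2 ^ s.v 2 = I.K
  base : s.v 3 = I.n * I.d
  K : s.v 4 = I.K
  t : s.v 5 = I.t
  I1 : s.v 6 = I.I1
  G : s.v 7 = I.G
  trials : s.v 8 = I.trials

theorem Env.of_eq {I : Inst} {s s' : Gh} (h : Env I s) (he : ∀ r < 9, s'.v r = s.v r) :
    Env I s' := by
  obtain ⟨h0, h1, h2, h3, h4, h5, h6, h7, h8⟩ := h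
  constructor <;> rw [he _ (by omega)] <;> assumption

/-! ### The stage program: runs -/

section runs

variable {C : Ctx k} {I : Inst} {Z : ℕ} {s : Gh}

theorem Fits.ok_mis (h : Fits C I) {D : ℕ} {a b v : Ex} {x y z c c' c'' : ℕ}
    (ha : a.Ok C D s x c) (hb : b.Ok C D s y c') (hv : v.Ok C D s z c'') (hx : x < I.K)
    (hy : y < I.K) :
    (Ex.mis a b v).Ok C D s (I.mis x y z) (c + c' + c'' + 3 + C.M.queryTime) := by
  rw [← h.mis]
  exact ha.mis hb hv (h.K_eq ▸ hx) (h.K_eq ▸ hy)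

theorem Fits.ok_inp (h : Fits C I) {D : ℕ} {a b : Ex} {i j c c' : ℕ}
    (ha : a.Ok C D s i c) (hb : b.Ok C D s j c') (hd : s.v 1 = I.d) (hD : 1 < D) (hi : i < I.n)
    (hj : j < I.d) : (Ex.inp (a * .var 1 + b)).Ok C D s (I.a i j) (c + c' + 5) := by
  have hz := h.sizes
  have hlt : i * I.d + j < I.n * I.d := by
    calc i * I.d + j < i * I.d + I.d := by omega
      _ = (i + 1) * I.d := by ring
      _ ≤ _ := Nat.mul_le_mul_right _ hi
  have hb' := hz.base
  have hw := hz.word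
  rw [h.base] at hb'
  refine (((ha.mul (.var hD hd (by have := hz.d; omega)) (by omega)).add hb (by omega)).inp
    (by rw [h.base]; exact hlt) (h.inp i j)).mono (by omega)

theorem run_col (h : Fits C I) (e : Env I s) {Lt : ℕ} (hv : s.v 15 = Lt)
    (hLt : Lt ≤ I.trials * (I.n * I.d)) (h1 : 1 ≤ Lt) :
    DTri C (fill 11 (.var 15) colE) s (80 * (Lt * (I.d * 1)))
      (s.seta 11 fun i => if i < Lt then I.col (s.a 0) (s.a 10 i) else s.a 11 i) := by
  have hz := h.sizes
  obtain ⟨hw, hb⟩ := And.intro hz.word hz.base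
  have hd := hz.d
  refine DTri.mono (DTri.fill_ok hz.hW (by omega) (.var (by omega) hv (by omega)) (by omega) _
    (fun i hi => Ex.Ok.amin (c := 20) (β := 1)
        (f := fun j => 1 - (if s.a 0 j = s.a 10 i then 1 else 0))
      (.var (by omega) e.d (by omega)) (by omega) (fun j hj => ?_) (fun j hj => ?_) I.hd le_rfl) h1
      (Nat.mul_pos I.hd one_pos)) (Nat.mul_le_mul_right _ (by norm_num)) rfl
  · exact .mono (.sub (.lit (by omega)) (.eq (.arr (.var (x := j) (by omega) rfl (by omega))
      (by omega) rfl (by omega)) (.arr (.var (x := i) (by omega) rfl (by omega)) (by omega) rfl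
      (by omega)) (by omega)) (by omega)) (by norm_num)
  · exact (Nat.sub_le _ _).trans_lt (by omega)

theorem run_choice (h : Fits C I) (e : Env I s) {l : ℕ} (hl : l < I.K)
    (hv : s.v 15 = (l + 1) * I.t) (hy : ∀ i < l + 1, s.a 8 i < I.K)
    (hw : ∀ i < l + 1, s.a 9 i ≤ I.G * I.d) (hs : ∀ v < (l + 1) * I.t, s.a 11 v < I.d) :
    DTri C (fill 4 (.var 0) choiceE) s (200 * (I.n * (I.K * ((l + 1) * I.t * (C.M.queryTime + 1)))))
      (s.seta 4 fun i => if i < I.n then I.choice (s.a 8) (s.a 9) ((l + 1) * I.t) (s.a 11) i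
        else s.a 4 i) := by
  have hz := h.sizes
  obtain ⟨hW, hb⟩ := And.intro hz.word hz.base
  have hn := hz.n
  have hK := hz.K
  have ht := hz.t
  have hLt := hz.Kt l hl
  have hLt1 := hz.Kt1 l
  have hsum : ∀ x i, ∑ v ∈ range ((l + 1) * I.t), s.a 9 (v / I.t) *
      I.mis x (s.a 8 (v / I.t)) (I.a i (s.a 11 v)) ≤ I.trials * (I.n * I.d) := by
    intro x i
    refine le_trans ?_ (hz.KtGd l hl)
    calc _ ≤ ∑ v ∈ range ((l + 1) * I.t), I.G * I.d := by
          refine sum_le_sum fun v hv => ?_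
          have h2 := hw (v / I.t) ((Nat.div_lt_iff_lt_mul I.t_pos).2 (mem_range.1 hv))
          exact (Nat.mul_le_mul h2 (I.hmis.le_one _ _ _)).trans_eq (mul_one _)
      _ = _ := by rw [sum_const, card_range, smul_eq_mul]
  have hGd := hz.Gd
  refine DTri.mono (DTri.fill_ok hz.hW (by omega) (.var (by omega) e.n (by omega)) (by omega) _
    (fun i hi => Ex.Ok.amin (β := (l + 1) * I.t * (C.M.queryTime + 1))
      (f := fun x => ∑ v ∈ range ((l + 1) * I.t), s.a 9 (v / I.t) *
        I.mis x (s.a 8 (v / I.t)) (I.a i (s.a 11 v)))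
      (.var (by omega) e.K (by omega)) (by omega) (fun x hx => Ex.Ok.sum (c := 50)
        (β := C.M.queryTime + 1) (.var (by omega) hv (by omega)) (by omega) (fun v hv => ?_)
        ((hsum x i).trans_lt (by omega)) hLt1 (by omega))
            (fun x hx => (hsum x i).trans_lt (by omega))
      hz.K1 (Nat.mul_pos hLt1 (by omega))) hz.n1
      (Nat.mul_pos hz.K1 (Nat.mul_pos hLt1 (by omega))))
      (Nat.mul_le_mul_right _ (by norm_num)) rfl
  have hvt : v / I.t < l + 1 := (Nat.div_lt_iff_lt_mul I.t_pos).2 hv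
  have hvt' : v / I.t ≤ v := Nat.div_le_self _ _
  have hdiv : ∀ id y, id < 16 → s.a id (v / I.t) = y → (id ≠ 4) →
      (Ex.arr id (.var 34 / .var 5)).Ok C 35 ((((partFill s 4 (fun i => I.choice (s.a 8) (s.a 9)
        ((l + 1) * I.t) (s.a 11) i) i).setv 32 i).setv 33 x).setv 34 v) y 11 := by
    intro id y hid hy hne
    refine Ex.Ok.arr (x := v / I.t) (.div (c := 2) (c' := 2) (.var (by omega) rfl (by omega))
      (.var (by omega) e.t (by omega)) (by omega)) hid ?_ (by omega)
    simp [partFill, Gh.seta_a, hne, hy]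
  refine .mono (.mul (hdiv 9 _ (by omega) rfl (by omega))
      (h.ok_mis (.var (x := x) (by omega) rfl (by omega)) (hdiv 8 _ (by omega) rfl (by omega))
    (h.ok_inp (.var (x := i) (by omega) rfl (by omega))
        (.arr (.var (x := v) (by omega) rfl (by omega))
      (by omega) (y := s.a 11 v) rfl (by omega)) e.d (by omega) hi (hs v hv)) hx (hy _ hvt)) ?_)
          (by omega)
  have h1 := Nat.mul_le_mul (hw _ hvt) (I.hmis.le_one x (s.a 8 (v / I.t)) (I.a i (s.a 11 v)))
  omega

theorem run_lab (h : Fits C I) (e : Env I s) {l : ℕ} (hl : l < I.K) (hv : s.v 16 = l + 1)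
    (hU : ∀ i < I.n, s.a 4 i < I.K) (hy : ∀ i < l + 1, s.a 8 i < I.K) :
    DTri C (fill 3 (.var 1) labE) s (200 * (I.d * ((l + 1) * (I.n * (C.M.queryTime + 1)))))
      (s.seta 3 fun j => if j < I.d then I.lab (s.a 8) (l + 1) (s.a 4) j else s.a 3 j) := by
  have hz := h.sizes
  obtain ⟨hW, hb⟩ := And.intro hz.word hz.base
  have hn := hz.n
  have hK := hz.K
  have hd := hz.d
  refine DTri.mono (DTri.fill_ok hz.hW (by omega) (.var (by omega) e.d (by omega)) (by omega) _
    (fun j hj => Ex.Ok.amin (β := I.n * (C.M.queryTime + 1))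
      (f := fun i => I.dist (s.a 4) (s.a 8 i) j)
      (.var (by omega) hv (by omega)) (by omega) (fun y hy' => Ex.Ok.sum (c := 50)
        (β := C.M.queryTime + 1) (.var (by omega) e.n (by omega)) (by omega) (fun i hi => ?_)
        ((I.dist_le _ _ _).trans_lt (by omega)) hz.n1 (by omega))
      (fun x hx => (I.dist_le _ _ _).trans_lt (by omega))
      (by omega) (Nat.mul_pos hz.n1 (by omega))) I.hd
      (Nat.mul_pos (by omega) (Nat.mul_pos hz.n1 (by omega))))
      (Nat.mul_le_mul_right _ (by norm_num)) rfl
  exact .mono (h.ok_mis (.arr (.var (x := i) (by omega) rfl (by omega)) (by omega) rfl (by omega))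
    (.arr (.var (x := y) (by omega) rfl (by omega)) (by omega) rfl (by omega))
    (h.ok_inp (.var (x := i) (by omega) rfl (by omega)) (.var (x := j) (by omega) rfl (by omega))
        e.d
      (by omega) hi hj) (hU i hi) (hy y hy')) (by omega)

theorem run_near (h : Fits C I) (e : Env I s) {l : ℕ} (hl : l < I.K)
    (hU : ∀ i < I.n, s.a 4 i < I.K) (hy : ∀ i < l + 1, s.a 8 i < I.K)
    (hlab : ∀ j < I.d, s.a 3 j < l + 1) :
    DTri C (fill 2 (.var 1) nearE) s (200 * (I.d * (I.n * (C.M.queryTime + 1))))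
      (s.seta 2 fun j => if j < I.d then I.dist (s.a 4) (s.a 8 (s.a 3 j)) j else s.a 2 j) := by
  have hz := h.sizes
  obtain ⟨hW, hb⟩ := And.intro hz.word hz.base
  have hn := hz.n
  have hK := hz.K
  have hd := hz.d
  refine DTri.mono (DTri.fill_ok hz.hW (by omega) (.var (by omega) e.d (by omega)) (by omega) _
    (fun j hj => Ex.Ok.sum (c := 50) (β := C.M.queryTime + 1)
      (f := fun i => I.mis (s.a 4 i) (s.a 8 (s.a 3 j)) (I.a i j))
      (.var (by omega) e.n (by omega)) (by omega) (fun i hi => ?_)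
        ((I.dist_le (s.a 4) (s.a 8 (s.a 3 j)) j).trans_lt (by omega)) hz.n1 (by omega)) I.hd
      (Nat.mul_pos hz.n1 (by omega)))
      (Nat.mul_le_mul_right _ (by norm_num)) rfl
  have hlj := hlab j hj
  exact .mono (h.ok_mis (.arr (.var (x := i) (by omega) rfl (by omega)) (by omega) rfl (by omega))
    (.arr (.arr (x := j) (.var (by omega) rfl (by omega)) (by omega) (y := s.a 3 j) rfl (by omega))
      (by omega) rfl (by omega))
    (h.ok_inp (.var (x := i) (by omega) rfl (by omega)) (.var (x := j) (by omega) rfl (by omega))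
        e.d
      (by omega) hi hj) (hU i hi) (hy _ hlj)) (by omega)

/-- Sorting by counting predecessors takes time of order `d ^ 2`, which `d ≤ n` keeps within `n *
d`; no faster method is needed. -/
theorem run_newPos (h : Fits C I) (e : Env I s) {R : ℕ} (hR : s.v 18 = R) (hRd : R ≤ I.d)
    (hpos : ∀ j < I.d, s.a 0 j < I.d) :
    DTri C (fill 1 (.var 1) posE) s (200 * (I.d * (I.d * 1)))
      (s.seta 1 fun j => if j < I.d then newPos I.d (s.a 2) (s.a 0) R j else s.a 1 j) := by
  have hz := h.sizes
  obtain ⟨hW, hb⟩ := And.intro hz.word hz.base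
  have hd := hz.d
  have hd1 := I.hd
  have hrank : ∀ j, rank I.d (s.a 2) (s.a 0) R j ≤ I.d := by
    intro j
    rw [rank_eq_card]
    exact (card_le_card (filter_subset _ _)).trans_eq (card_range _)
  refine DTri.mono (DTri.fill_ok hz.hW (by omega) (.var (by omega) e.d (by omega)) (by omega) _
    (c := 110) (β := I.d * 1) (fun j hj => ?_) I.hd (Nat.mul_pos I.hd one_pos))
      (Nat.mul_le_mul_right _ (by norm_num)) rfl
  have hp := hpos j hj
  have hr := hrank j
  have hc : (Ex.op .lt (.arr 0 (.var 32)) (.var 18)).Ok C 33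
      ((partFill s 1 (fun j => newPos I.d (s.a 2) (s.a 0) R j) j).setv 32 j)
      (if s.a 0 j < R then 1 else 0) 11 :=
    Ex.Ok.lt (c := 8) (c' := 2) (.arr (.var (x := j) (by omega) rfl (by omega)) (by omega) rfl
      (by omega)) (.var (by omega) hR (by omega)) (by omega)
  have hs := Ex.Ok.sum (C := C) (D := 33)
    (s := (partFill s 1 (fun j => newPos I.d (s.a 2) (s.a 0) R j) j).setv 32 j)
    (lim := .var 1) (body := .op .lt (.arr 0 (.var 33)) (.var 18) *
        (.op .lt (.arr 2 (.var 32)) (.arr 2 (.var 33)) +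
          .op .eq (.arr 2 (.var 32)) (.arr 2 (.var 33)) * .op .lt (.var 33) (.var 32)))
    (N := I.d) (c := 60) (β := 1)
    (f := fun j' => (if s.a 0 j' < R then 1 else 0) *
      ((if s.a 2 j < s.a 2 j' then 1 else 0) +
        (if s.a 2 j = s.a 2 j' then 1 else 0) * (if j' < j then 1 else 0)))
    (.var (by omega) e.d (by omega)) (by omega) (fun j' hj' => ?_) (hr.trans_lt (by omega)) I.hd
    le_rfl
  · have hval : newPos I.d (s.a 2) (s.a 0) R j = (if s.a 0 j < R then 1 else 0) *
        rank I.d (s.a 2) (s.a 0) R j + (1 - if s.a 0 j < R then 1 else 0) * s.a 0 j := by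
      unfold newPos
      split_ifs with h1 h2 h2 <;> omega
    rw [hval]
    have h0 : (if s.a 0 j < R then 1 else 0) ≤ 1 := by split_ifs <;> omega
    have h1 : (if s.a 0 j < R then 1 else 0) * rank I.d (s.a 2) (s.a 0) R j ≤ I.d :=
      (Nat.mul_le_mul h0 hr).trans_eq (one_mul _)
    have h2 : (1 - if s.a 0 j < R then 1 else 0) * s.a 0 j ≤ I.d :=
      (Nat.mul_le_mul (Nat.sub_le 1 _) hp.le).trans_eq (one_mul _)
    refine .mono (.add (hc.mul hs (h1.trans_lt (by omega)))
        (.mul (.sub (x := 1) (.lit (by omega)) hc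
      (by omega)) (.arr (.var (x := j) (by omega) rfl (by omega)) (by omega) rfl (by omega))
      (by omega)) (by omega)) ?_
    have := I.hd
    omega
  · have ha : ∀ id r x, id < 16 → r < 34 → id ≠ 1 →
      (((partFill s 1 (fun j => newPos I.d (s.a 2) (s.a 0) R j) j).setv 32 j).setv 33 j').v r =
      x → x < I.d →
        (Ex.arr id (.var r)).Ok C 34
            (((partFill s 1 (fun j => newPos I.d (s.a 2) (s.a 0) R j) j).setv 32 j).setv 33 j')
            (s.a id x) 8 := by
      intro id r x hid hr hne hx hxd
      refine .arr (.var (by omega) hx (by omega)) hid ?_ (by omega)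
      simp [partFill, Gh.seta_a, hne]
    have a0 := ha 0 33 j' (by omega) (by omega) (by omega) rfl hj'
    have a2 := ha 2 32 j (by omega) (by omega) (by omega) rfl hj
    have a2' := ha 2 33 j' (by omega) (by omega) (by omega) rfl hj'
    have h0 : ∀ (p : Prop) [Decidable p], (if p then 1 else 0) ≤ 1 := by
      intro p _; split_ifs <;> omega
    have hm : (if s.a 2 j = s.a 2 j' then 1 else 0) * (if j' < j then 1 else 0) ≤ 1 :=
      Nat.mul_le_mul (h0 _) (h0 _)
    have hm2 : (if s.a 2 j < s.a 2 j' then 1 else 0) + (if s.a 2 j = s.a 2 j' then 1 else 0) *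
        (if j' < j then 1 else 0) ≤ 2 := add_le_add (h0 _) hm
    have hm3 := Nat.mul_le_mul (h0 (s.a 0 j' < R)) hm2
    refine .mono (.mul (.lt a0 (.var (by omega) hR (by omega)) (by omega))
        (.add (.lt a2 a2' (by omega))
      (.mul (.eq a2 a2' (by omega))
          (.lt (.var (by omega) rfl (by omega)) (.var (by omega) rfl (by omega))
      (by omega)) (by omega)) (by omega)) (by omega)) (by norm_num)

end runs

/-! ### Evaluating a sample -/

/-- The deterministic part of a stage: the candidate solution for the current sample is computed,
the best solution so far is updated, and the current list is sorted. -/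
def evalStage : Prog :=
  .seq (fill 11 (.var 15) colE) <| .seq (fill 4 (.var 0) choiceE) <|
  .seq (fill 3 (.var 1) labE) <| .seq (fill 2 (.var 1) nearE) <|
  .seq (assign 12 (.fold .add 0 (.var 1) (.arr 2 (.var 32)))) <|
  .seq (assign 17 (.op .lt (.var 12) (.var 9))) <|
  .seq (fill 5 (.var 0) (selE (.arr 4 (.var 32)) 5)) <|
  .seq (fill 6 (.var 1) (selE (.arr 8 (.arr 3 (.var 32))) 6)) <|
  .seq (assign 9 (.var 17 * .var 12 + (.lit 1 - .var 17) * .var 9)) <|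
  .seq (fill 1 (.var 1) posE) (fill 0 (.var 1) (.arr 1 (.var 32)))

/-- The invariant of the search: the best solution so far has cost at most `b`, the list of
columns is a permutation, the first `L` guesses are in range, and `c` is the number of the trial. -/
structure SInv (I : Inst) (b c L : ℕ) (s : Gh) : Prop where
  env : Env I s
  best_le : s.v 9 ≤ b
  sol : ∑ j ∈ range I.d, I.dist (s.a 5) (s.a 6 j) j ≤ s.v 9
  bu : ∀ i < I.n, s.a 5 i < I.K
  bv : ∀ j < I.d, s.a 6 j < I.K
  isPos : IsPos I.d (s.a 0)
  R : ∀ i < L, 1 ≤ s.a 7 i ∧ s.a 7 i ≤ I.d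
  y : ∀ i < L, s.a 8 i < I.K
  w : ∀ i < L, s.a 9 i ≤ I.G * I.d
  trial : s.v 10 = c

theorem newPos_congr {d : ℕ} {h h' pos : ℕ → ℕ} {R : ℕ} (hh : ∀ j < d, h j = h' j) :
    newPos d h pos R = newPos d h' pos R := by
  funext j
  unfold newPos
  split_ifs with hj
  · unfold rank
    refine sum_congr rfl fun j' hj' => ?_
    rw [hh j hj.1, hh j' (mem_range.1 hj')]
  · rfl

section runs

variable {C : Ctx k} {I : Inst} {s : Gh}

/-- Expressions have no conditionals; a choice is made arithmetically with a flag `c` that is `0` or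
`1`. -/
theorem Ex.Ok.sel {D id c x y i cost : ℕ} {e : Ex} (hc : s.v 17 = c) (hc1 : c ≤ 1) (hD : 32 < D)
    (hv : s.v 32 = i) (he : e.Ok C D s x cost) (hid : id < 16) (hy : s.a id i = y)
    (hi : C.base + 16 + 16 * i < C.M.word) (hx : 2 < C.M.word ∧ x + y < C.M.word) :
    (selE e id).Ok C D s (c * x + (1 - c) * y) (cost + 18) := by
  have hvar : (Ex.var 17).Ok C D s c 2 := .var (by omega) hc (by omega)
  have h1 : c * x ≤ x := (Nat.mul_le_mul_right _ hc1).trans_eq (one_mul _)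
  have h2 : (1 - c) * y ≤ y := (Nat.mul_le_mul_right _ (Nat.sub_le 1 c)).trans_eq (one_mul _)
  exact .mono (.add (.mul hvar he (by omega)) (.mul (.sub (.lit (by omega)) hvar (by omega))
    (.arr (.var hD hv (by omega)) hid hy hi) (by omega)) (by omega)) (by omega)

theorem Inst.near_le_n (y : ℕ → ℕ) (l : ℕ) (U : ℕ → ℕ) (j : ℕ) : I.near y l U j ≤ I.n :=
  I.dist_le _ _ _

theorem sel_eq {p : Prop} [Decidable p] {c : ℕ} (hc : c = if p then 1 else 0) (x y : ℕ) :
    c * x + (1 - c) * y = if p then x else y := by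
  subst hc
  split_ifs <;> simp

/-- The effect of `evalStage`. -/
theorem run_evalStage (h : Fits C I) {b ct l : ℕ} (hl : l < I.K) (hb : b ≤ I.n * I.d)
    (hS : SInv I b ct (l + 1) s) (h15 : s.v 15 = (l + 1) * I.t) (h16 : s.v 16 = l + 1)
    (h18 : s.v 18 = s.a 7 l) {U H : ℕ → ℕ}
    (hU : U = I.choice (s.a 8) (s.a 9) ((l + 1) * I.t) fun v => I.col (s.a 0) (s.a 10 v))
    (hH : H = I.near (s.a 8) (l + 1) U) :
    ∃ s', DTri C evalStage s (2000 * (I.trials * (I.n * I.d) * (C.M.queryTime + 1))) s' ∧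
      SInv I b ct (l + 1) s' ∧ s'.v 11 = s.v 11 ∧ s'.v 9 ≤ s.v 9 ∧
      s'.v 9 ≤ ∑ j ∈ range I.d, H j ∧ s'.a 0 = newPos I.d H (s.a 0) (s.a 7 l) ∧
      s'.a 7 = s.a 7 ∧ s'.a 8 = s.a 8 ∧ s'.a 9 = s.a 9 := by
  obtain ⟨Z, hZ⟩ : ∃ Z, Z = I.trials * (I.n * I.d) := ⟨_, rfl⟩
  have hz := h.sizes
  rw [← hZ] at hz
  have e := hS.env
  obtain ⟨hW, hbase⟩ := And.intro hz.word hz.base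
  have hn := hz.n
  have hK := hz.K
  have hd := hz.d
  have hLt := hz.Kt l hl
  have hd1 := hz.d1
  have hn1 := hz.n1
  have hbase' := h.base
  have hvt : ∀ v < (l + 1) * I.t, v / I.t < l + 1 :=
    fun v hv => (Nat.div_lt_iff_lt_mul I.t_pos).2 hv
  -- the columns of the sample
  have r1 := run_col h e h15 (hZ ▸ hLt) (hz.Kt1 l)
  obtain ⟨s1, hs1⟩ : ∃ s1, s1 = s.seta 11 fun i =>
    if i < (l + 1) * I.t then I.col (s.a 0) (s.a 10 i) else s.a 11 i := ⟨_, rfl⟩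
  rw [← hs1] at r1
  have v1 : s1.v = s.v := by rw [hs1]; rfl
  have a1 : ∀ id, id ≠ 11 → s1.a id = s.a id := fun id hid => by rw [hs1, Gh.seta_a, if_neg hid]
  have a1' : ∀ i < (l + 1) * I.t, s1.a 11 i = I.col (s.a 0) (s.a 10 i) := fun i hi => by
    rw [hs1, Gh.seta_a, if_pos rfl, if_pos hi]
  have e1 : Env I s1 := e.of_eq fun r _ => by rw [v1]
  -- the choices
  have r2 := run_choice h e1 hl (by rw [v1, h15]) (by rw [a1 8 (by omega)]; exact hS.y)
    (by rw [a1 9 (by omega)]; exact hS.w) (fun v hv => by rw [a1' v hv]; exact I.col_lt _ _)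
  obtain ⟨s2, hs2⟩ : ∃ s2, s2 = s1.seta 4 fun i => if i < I.n then
    I.choice (s1.a 8) (s1.a 9) ((l + 1) * I.t) (s1.a 11) i else s1.a 4 i := ⟨_, rfl⟩
  rw [← hs2] at r2
  have v2 : s2.v = s.v := by rw [hs2]; exact v1
  have a2 : ∀ id, id ≠ 11 → id ≠ 4 → s2.a id = s.a id := fun id hid hid' => by
    rw [hs2, Gh.seta_a, if_neg hid', a1 id hid]
  have a2' : ∀ i < I.n, s2.a 4 i = U i := fun i hi => by
    rw [hs2, Gh.seta_a, if_pos rfl, if_pos hi, hU, a1 8 (by omega), a1 9 (by omega)]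
    unfold Inst.choice
    congr 1
    funext x
    refine sum_congr rfl fun v hv => ?_
    rw [a1' v (mem_range.1 hv)]
  have e2 : Env I s2 := e.of_eq fun r _ => by rw [v2]
  have hUK : ∀ i < I.n, s2.a 4 i < I.K := fun i hi => by
    rw [a2' i hi, hU]; exact I.choice_lt _ _ _ _ _
  have hy2 : ∀ i < l + 1, s2.a 8 i < I.K := by rw [a2 8 (by omega) (by omega)]; exact hS.y
  -- the labels
  have r3 := run_lab h e2 hl (by rw [v2, h16]) hUK hy2
  obtain ⟨s3, hs3⟩ : ∃ s3, s3 = s2.seta 3 fun j => if j < I.d then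
    I.lab (s2.a 8) (l + 1) (s2.a 4) j else s2.a 3 j := ⟨_, rfl⟩
  rw [← hs3] at r3
  have v3 : s3.v = s.v := by rw [hs3]; exact v2
  have a3 : ∀ id, id ≠ 3 → s3.a id = s2.a id := fun id hid => by
    rw [hs3, Gh.seta_a, if_neg hid]
  have a3' : ∀ j < I.d, s3.a 3 j = I.lab (s2.a 8) (l + 1) (s2.a 4) j := fun j hj => by
    rw [hs3, Gh.seta_a, if_pos rfl, if_pos hj]
  have e3 : Env I s3 := e.of_eq fun r _ => by rw [v3]
  have hlab3 : ∀ j < I.d, s3.a 3 j < l + 1 := fun j hj => by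
    rw [a3' j hj]; exact I.lab_lt _ (by omega) _ _
  -- the distances
  have r4 := run_near h e3 hl (by rw [a3 4 (by omega)]; exact hUK)
    (by rw [a3 8 (by omega)]; exact hy2) hlab3
  obtain ⟨s4, hs4⟩ : ∃ s4, s4 = s3.seta 2 fun j => if j < I.d then
    I.dist (s3.a 4) (s3.a 8 (s3.a 3 j)) j else s3.a 2 j := ⟨_, rfl⟩
  rw [← hs4] at r4
  have v4 : s4.v = s.v := by rw [hs4]; exact v3
  have a4 : ∀ id, id ≠ 2 → s4.a id = s3.a id := fun id hid => by
    rw [hs4, Gh.seta_a, if_neg hid]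
  have hlabU : ∀ j, I.lab (s2.a 8) (l + 1) (s2.a 4) j = I.lab (s.a 8) (l + 1) U j := fun j => by
    unfold Inst.lab
    rw [a2 8 (by omega) (by omega)]
    congr 1
    funext i
    exact I.dist_congr a2' _ _
  have hdistH : ∀ j < I.d, I.dist U (s.a 8 (s3.a 3 j)) j = H j := fun j hj => by
    rw [a3' j hj, hlabU, hH]; rfl
  have a4' : ∀ j < I.d, s4.a 2 j = H j := fun j hj => by
    rw [hs4, Gh.seta_a, if_pos rfl, if_pos hj, a3 4 (by omega), a3 8 (by omega),
      a2 8 (by omega) (by omega), I.dist_congr a2', hdistH j hj]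
  -- the total
  have hT : ∑ j ∈ range I.d, s4.a 2 j = ∑ j ∈ range I.d, H j :=
    sum_congr rfl fun j hj => a4' j (mem_range.1 hj)
  have hTn : ∑ j ∈ range I.d, H j ≤ Z := by
    calc ∑ j ∈ range I.d, H j ≤ ∑ j ∈ range I.d, I.n :=
          sum_le_sum fun j _ => by rw [hH]; exact Inst.near_le_n _ _ _ _
      _ = I.d * I.n := by rw [sum_const, card_range, smul_eq_mul]
      _ ≤ Z := hz.dn
  obtain ⟨T, hTdef⟩ : ∃ T, T = ∑ j ∈ range I.d, H j := ⟨_, rfl⟩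
  rw [← hTdef] at hT hTn
  have r5 : DTri C (assign 12 (.fold .add 0 (.var 1) (.arr 2 (.var 32)))) s4
      ((8 + 11) * (I.d * 1) + 2) (s4.setv 12 T) := by
    refine DTri.assign_ok hz.hW (by omega) (by omega) ?_ (by omega)
    rw [← hT]
    exact Ex.Ok.sum (.var (by omega) (by rw [v4, e.d]) (by omega)) (by omega)
      (fun j hj => .arr (.var (x := j) (by omega) rfl (by omega)) (by omega) rfl (by omega))
      (by omega) hd1 le_rfl
  obtain ⟨s5, hs5⟩ : ∃ s5, s5 = s4.setv 12 T := ⟨_, rfl⟩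
  rw [← hs5] at r5
  have v5 : ∀ r, r ≠ 12 → s5.v r = s.v r := fun r hr => by
    rw [hs5, Gh.setv_v_of_ne _ _ hr, v4]
  have v5' : s5.v 12 = T := by rw [hs5]; simp
  -- the comparison
  have hbest : s.v 9 ≤ Z := hS.best_le.trans (hb.trans (hbase' ▸ hbase))
  obtain ⟨c, hc⟩ : ∃ c, c = if T < s.v 9 then 1 else 0 := ⟨_, rfl⟩
  have hc1 : c ≤ 1 := by rw [hc]; split_ifs <;> omega
  have r6 : DTri C (assign 17 (.op .lt (.var 12) (.var 9))) s5 (5 + 2) (s5.setv 17 c) := by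
    refine DTri.assign_ok hz.hW (by omega) (by omega) ?_ (by omega)
    rw [hc]
    exact .lt (.var (by omega) v5' (by omega)) (.var (by omega) (v5 9 (by omega)) (by omega))
      (by omega)
  obtain ⟨s6, hs6⟩ : ∃ s6, s6 = s5.setv 17 c := ⟨_, rfl⟩
  rw [← hs6] at r6
  have v6 : ∀ r, r ≠ 12 → r ≠ 17 → s6.v r = s.v r := fun r hr hr' => by
    rw [hs6, Gh.setv_v_of_ne _ _ hr', v5 r hr]
  have v6' : s6.v 17 = c := by rw [hs6]; simp
  have v6'' : s6.v 12 = T := by rw [hs6, Gh.setv_v_of_ne _ _ (by omega), v5']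
  have a6 : s6.a = s4.a := by rw [hs6, hs5]; rfl
  have a6' : ∀ id, id ≠ 2 → id ≠ 3 → s6.a id = s2.a id := fun id h1 h2 => by
    rw [a6, a4 id h1, a3 id h2]
  have a63 : s6.a 3 = s3.a 3 := by rw [a6, a4 3 (by omega)]
  -- the rows of the best solution
  have r7 : DTri C (fill 5 (.var 0) (selE (.arr 4 (.var 32)) 5)) s6 ((26 + 19) * (I.n * 1))
      (s6.seta 5 fun i => if i < I.n then (if T < s.v 9 then s6.a 4 i else s6.a 5 i)
        else s6.a 5 i) := by
    refine DTri.fill_ok hz.hW (by omega) (.var (by omega) (by rw [v6 0 (by omega) (by omega), e.n])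
      (by omega)) (by omega) _ (fun i hi => ?_) hn1 le_rfl
    rw [← sel_eq hc]
    have h1 : s6.a 4 i < I.K := by rw [a6' 4 (by omega) (by omega)]; exact hUK i hi
    have h2 : s6.a 5 i < I.K := by
      rw [a6' 5 (by omega) (by omega), a2 5 (by omega) (by omega)]; exact hS.bu i hi
    refine .mono (.sel (i := i) v6' hc1 (by omega) rfl
        (.arr (.var (x := i) (by omega) rfl (by omega))
      (by omega) rfl (by omega)) (by omega) ?_ (by omega) (by omega)) (by norm_num)
    simp [partFill, Gh.seta_a]
  obtain ⟨s7, hs7⟩ : ∃ s7, s7 = s6.seta 5 fun i => if i < I.n then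
    (if T < s.v 9 then s6.a 4 i else s6.a 5 i) else s6.a 5 i := ⟨_, rfl⟩
  rw [← hs7] at r7
  have v7 : s7.v = s6.v := by rw [hs7]; rfl
  have a7 : ∀ id, id ≠ 5 → s7.a id = s6.a id := fun id hid => by
    rw [hs7, Gh.seta_a, if_neg hid]
  have a7' : ∀ i < I.n, s7.a 5 i = if T < s.v 9 then U i else s.a 5 i := fun i hi => by
    rw [hs7, Gh.seta_a, if_pos rfl, if_pos hi, a6' 4 (by omega) (by omega), a2' i hi,
      a6' 5 (by omega) (by omega), a2 5 (by omega) (by omega)]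
  -- the labels of the best solution
  have r8 : DTri C (fill 6 (.var 1) (selE (.arr 8 (.arr 3 (.var 32))) 6)) s7 ((32 + 19) * (I.d * 1))
      (s7.seta 6 fun j => if j < I.d then (if T < s.v 9 then s.a 8 (s3.a 3 j) else s7.a 6 j)
        else s7.a 6 j) := by
    refine DTri.fill_ok hz.hW (by omega) (.var (by omega) (by
      rw [v7, v6 1 (by omega) (by omega), e.d]) (by omega)) (by omega) _ (fun j hj => ?_) hd1 le_rfl
    rw [← sel_eq hc]
    have h3 := hlab3 j hj
    have h1 : s.a 8 (s3.a 3 j) < I.K := hS.y _ h3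
    have h2 : s7.a 6 j < I.K := by
      rw [a7 6 (by omega), a6' 6 (by omega) (by omega), a2 6 (by omega) (by omega)]
      exact hS.bv j hj
    have g3 : s7.a 3 = s3.a 3 := by rw [a7 3 (by omega), a63]
    have g8 : s7.a 8 = s.a 8 := by
      rw [a7 8 (by omega), a6' 8 (by omega) (by omega), a2 8 (by omega) (by omega)]
    refine .mono (.sel (i := j) (by rw [← v6', ← v7]; rfl) hc1 (by omega) rfl
      (.arr (.arr (y := s3.a 3 j) (.var (x := j) (by omega) rfl (by omega))
      (by omega) ?_ (by omega)) (by omega) ?_ (by omega)) (by omega) ?_ (by omega) (by omega))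
      (by norm_num)
    · simp [partFill, Gh.seta_a, g3]
    · simp [partFill, Gh.seta_a, g8]
    · simp [partFill, Gh.seta_a]
  obtain ⟨s8, hs8⟩ : ∃ s8, s8 = s7.seta 6 fun j => if j < I.d then
    (if T < s.v 9 then s.a 8 (s3.a 3 j) else s7.a 6 j) else s7.a 6 j := ⟨_, rfl⟩
  rw [← hs8] at r8
  have v8 : s8.v = s6.v := by rw [hs8]; exact v7
  have a8 : ∀ id, id ≠ 6 → s8.a id = s7.a id := fun id hid => by
    rw [hs8, Gh.seta_a, if_neg hid]
  have a8' : ∀ j < I.d, s8.a 6 j = if T < s.v 9 then s.a 8 (s3.a 3 j) else s.a 6 j :=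
    fun j hj => by
      rw [hs8, Gh.seta_a, if_pos rfl, if_pos hj, a7 6 (by omega), a6' 6 (by omega) (by omega),
        a2 6 (by omega) (by omega)]
  -- the cost of the best solution
  obtain ⟨B, hB⟩ : ∃ B, B = if T < s.v 9 then T else s.v 9 := ⟨_, rfl⟩
  have r9 : DTri C (assign 9 (.var 17 * .var 12 + (.lit 1 - .var 17) * .var 9)) s8 (13 + 2)
      (s8.setv 9 B) := by
    have h1 : c * T ≤ T := (Nat.mul_le_mul_right _ hc1).trans_eq (one_mul _)
    have h2 : (1 - c) * s.v 9 ≤ s.v 9 :=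
      (Nat.mul_le_mul_right _ (Nat.sub_le 1 c)).trans_eq (one_mul _)
    have g17 : (Ex.var 17).Ok C 32 s8 c 2 := .var (by omega) (by rw [v8, v6']) (by omega)
    have g9 : (Ex.var 9).Ok C 32 s8 (s.v 9) 2 :=
      .var (by omega) (by rw [v8, v6 9 (by omega) (by omega)]) (by omega)
    rw [hB, ← sel_eq hc]
    exact DTri.assign_ok hz.hW (by omega) (by omega) (.mono (.add (.mul g17 (.var (by omega)
      (by rw [v8, v6'']) (by omega)) (by omega)) (.mul (.sub (.lit (by omega)) g17 (by omega)) g9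
      (by omega)) (by omega)) (by norm_num)) (by omega)
  obtain ⟨s9, hs9⟩ : ∃ s9, s9 = s8.setv 9 B := ⟨_, rfl⟩
  rw [← hs9] at r9
  have v9 : ∀ r, r ≠ 9 → r ≠ 12 → r ≠ 17 → s9.v r = s.v r := fun r h1 h2 h3 => by
    rw [hs9, Gh.setv_v_of_ne _ _ h1, v8, v6 r h2 h3]
  have v9' : s9.v 9 = B := by rw [hs9]; simp
  have a9 : s9.a = s8.a := by rw [hs9]; rfl
  have e9 : Env I s9 := by
    refine e.of_eq fun r hr => v9 r (by omega) (by omega) (by omega)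
  have a90 : ∀ id, id ≠ 6 → id ≠ 5 → id ≠ 2 → id ≠ 3 → id ≠ 11 → id ≠ 4 → s9.a id = s.a id :=
    fun id h1 h2 h3 h4 h5 h6 => by rw [a9, a8 id h1, a7 id h2, a6' id h3 h4, a2 id h5 h6]
  have a92 : ∀ j < I.d, s9.a 2 j = H j := fun j hj => by
    rw [a9, a8 2 (by omega), a7 2 (by omega), a6, a4' j hj]
  -- the new list
  have hR := hS.R l (by omega)
  have a900 : s9.a 0 = s.a 0 := a90 0 (by omega) (by omega) (by omega) (by omega) (by omega)
      (by omega)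
  have r10 := run_newPos h e9 (R := s.a 7 l)
    (by rw [v9 18 (by omega) (by omega) (by omega), h18]) hR.2
    (by rw [a900]; exact hS.isPos.1)
  rw [newPos_congr a92, a900] at r10
  obtain ⟨s10, hs10⟩ : ∃ s10, s10 = s9.seta 1 fun j => if j < I.d then
    newPos I.d H (s.a 0) (s.a 7 l) j else s9.a 1 j := ⟨_, rfl⟩
  rw [← hs10] at r10
  have v10 : s10.v = s9.v := by rw [hs10]; rfl
  have a10 : ∀ id, id ≠ 1 → s10.a id = s9.a id := fun id hid => by
    rw [hs10, Gh.seta_a, if_neg hid]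
  have a10' : ∀ j < I.d, s10.a 1 j = newPos I.d H (s.a 0) (s.a 7 l) j := fun j hj => by
    rw [hs10, Gh.seta_a, if_pos rfl, if_pos hj]
  have hnp := newPos_spec (h := H) hS.isPos hR.2
  have r11 : DTri C (fill 0 (.var 1) (.arr 1 (.var 32))) s10 ((8 + 19) * (I.d * 1))
      (s10.seta 0 fun j => if j < I.d then newPos I.d H (s.a 0) (s.a 7 l) j else s10.a 0 j) := by
    refine DTri.fill_ok hz.hW (by omega) (.var (by omega) (by
      rw [v10, e9.d]) (by omega)) (by omega) _ (fun j hj => ?_) hd1 le_rfl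
    refine .arr (.var (x := j) (by omega) rfl (by omega)) (by omega) ?_ (by omega)
    rw [← a10' j hj]
    simp [partFill, Gh.seta_a]
  obtain ⟨s11, hs11⟩ : ∃ s11, s11 = s10.seta 0 fun j => if j < I.d then
    newPos I.d H (s.a 0) (s.a 7 l) j else s10.a 0 j := ⟨_, rfl⟩
  rw [← hs11] at r11
  have v11 : s11.v = s9.v := by rw [hs11]; exact v10
  have a11 : ∀ id, id ≠ 0 → id ≠ 1 → s11.a id = s9.a id := fun id h1 h2 => by
    rw [hs11, Gh.seta_a, if_neg h1, a10 id h2]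
  have a110 : s11.a 0 = newPos I.d H (s.a 0) (s.a 7 l) := by
    funext j
    rw [hs11, Gh.seta_a, if_pos rfl]
    split_ifs with hj
    · rfl
    · rw [a10 0 (by omega), a900]
      unfold newPos
      rw [if_neg (by omega)]
  have k7 : s11.a 7 = s.a 7 := by
    rw [a11 7 (by omega) (by omega)]
    exact a90 7 (by omega) (by omega) (by omega) (by omega) (by omega) (by omega)
  have k8 : s11.a 8 = s.a 8 := by
    rw [a11 8 (by omega) (by omega)]
    exact a90 8 (by omega) (by omega) (by omega) (by omega) (by omega) (by omega)
  have k9 : s11.a 9 = s.a 9 := by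
    rw [a11 9 (by omega) (by omega)]
    exact a90 9 (by omega) (by omega) (by omega) (by omega) (by omega) (by omega)
  have k5 : ∀ i < I.n, s11.a 5 i = if T < s.v 9 then U i else s.a 5 i := fun i hi => by
    rw [a11 5 (by omega) (by omega), a9, a8 5 (by omega), a7' i hi]
  have k6 : ∀ j < I.d, s11.a 6 j = if T < s.v 9 then s.a 8 (s3.a 3 j) else s.a 6 j :=
    fun j hj => by rw [a11 6 (by omega) (by omega), a9, a8' j hj]
  have kB : s11.v 9 = B := by rw [v11, v9']
  have hBle : B ≤ s.v 9 := by rw [hB]; split_ifs <;> omega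
  have hBT : B ≤ T := by rw [hB]; split_ifs <;> omega
  refine ⟨s11, ?_, ⟨e9.of_eq fun r _ => by rw [v11], ?_, ?_, ?_, ?_, ?_, ?_, ?_, ?_, ?_⟩, ?_, ?_,
      ?_,
    a110, k7, k8, k9⟩
  · refine (r1.seq (r2.seq (r3.seq (r4.seq (r5.seq (r6.seq (r7.seq (r8.seq (r9.seq
      (r10.seq r11)))))))))).mono ?_ rfl
    rw [← hZ]
    obtain ⟨q, hq⟩ : ∃ q, q = C.M.queryTime + 1 := ⟨_, rfl⟩
    have hq1 : 1 ≤ q := by omega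
    rw [← hq]
    have key : ∀ {x}, x ≤ Z → x * 1 ≤ Z * q ∧ x * q ≤ Z * q :=
      fun hx => ⟨Nat.mul_le_mul hx hq1, Nat.mul_le_mul_right _ hx⟩
    have c1 := (key (hz.Ktd l hl)).1
    have c2 := (key (hz.nKKt l hl)).2
    have c3 := (key (hz.dKn l hl)).2
    have c4 := (key hz.dn).2
    have c5 := (key hn).1
    have c6 := (key hd).1
    have c7 := (key hz.dd).1
    have c8 : 1 ≤ Z * q := Nat.mul_pos (by omega) hq1
    have d1 : (l + 1) * I.t * (I.d * 1) = (l + 1) * I.t * I.d * 1 := by ring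
    have d2 : I.n * (I.K * ((l + 1) * I.t * q)) = I.n * (I.K * ((l + 1) * I.t)) * q := by ring
    have d3 : I.d * ((l + 1) * (I.n * q)) = I.d * ((l + 1) * I.n) * q := by ring
    have d4 : I.d * (I.n * q) = I.d * I.n * q := by ring
    have d5 : I.d * (I.d * 1) = I.d * I.d * 1 := by ring
    rw [d1, d2, d3, d4, d5]
    omega
  · rw [kB]; exact hBle.trans hS.best_le
  · rw [kB, hB]
    split_ifs with hlt
    · rw [hTdef]
      refine le_of_eq (sum_congr rfl fun j hj => ?_)
      rw [k6 j (mem_range.1 hj), if_pos hlt, ← hdistH j (mem_range.1 hj)]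
      exact I.dist_congr (fun i hi => by rw [k5 i hi, if_pos hlt]) _ _
    · refine le_trans (le_of_eq (sum_congr rfl fun j hj => ?_)) hS.sol
      rw [k6 j (mem_range.1 hj), if_neg hlt]
      exact I.dist_congr (fun i hi => by rw [k5 i hi, if_neg hlt]) _ _
  · intro i hi
    rw [k5 i hi]
    split_ifs
    · rw [← a2' i hi]; exact hUK i hi
    · exact hS.bu i hi
  · intro j hj
    rw [k6 j hj]
    split_ifs
    · exact hS.y _ (hlab3 j hj)
    · exact hS.bv j hj
  · rw [a110]; exact hnp.1
  · rw [k7]; exact hS.R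
  · rw [k8]; exact hS.y
  · rw [k9]; exact hS.w
  · rw [v11, v9 10 (by omega) (by omega) (by omega), hS.trial]
  · rw [v11, v9 11 (by omega) (by omega) (by omega)]
  · rw [kB]; exact hBle
  · rw [kB, ← hTdef]; exact hBT

end runs

/-! ### One stage: guessing, sampling, evaluating -/

/-- Guessing the next list size. -/
def pickSize : Prog :=
  .seq (rnd 13 (.var 6)) <|
  .seq (assign 18 (.var 1 - (.var 1 - .fold .mul 1 (.var 13) (.lit 2)))) <|
  put 7 (.var 11) (.var 18)

/-- Guessing the next label. -/
def pickLabel : Prog := .seq (rnd 13 (.var 4)) (put 8 (.var 11) (.var 13))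

/-- Guessing the next weight. -/
def pickWeight : Prog :=
  .seq (rnd 13 (.var 7)) <| .seq (put 9 (.var 11) ((.var 13 + .lit 1) * .var 18)) <|
  .seq (assign 16 (.var 11 + .lit 1)) (assign 15 (.var 16 * .var 5))

/-- One stage of a trial. -/
def stage : Prog :=
  .seq (.seq pickSize (.seq pickLabel pickWeight)) <|
  .seq (rfill 10 (.var 15) (.arr 7 (.var 32 / .var 5))) evalStage

theorem SInv.guess {I : Inst} {b ct l l' : ℕ} {s s' : Gh} (h : SInv I b ct l s)
    (hv : ∀ r < 11, s'.v r = s.v r) (h5 : s'.a 5 = s.a 5) (h6 : s'.a 6 = s.a 6)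
    (h0 : s'.a 0 = s.a 0) (hR : ∀ i < l', 1 ≤ s'.a 7 i ∧ s'.a 7 i ≤ I.d)
    (hy : ∀ i < l', s'.a 8 i < I.K) (hw : ∀ i < l', s'.a 9 i ≤ I.G * I.d) : SInv I b ct l' s' :=
  ⟨h.env.of_eq fun r hr => hv r (by omega), by rw [hv 9 (by omega)]; exact h.best_le,
    by rw [hv 9 (by omega), h5, h6]; exact h.sol, by rw [h5]; exact h.bu, by rw [h6]; exact h.bv,
    by rw [h0]; exact h.isPos, hR, hy, hw,
    by rw [hv 10 (by omega)]; exact h.trial⟩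

/-- Guessed exponents do not exceed `Nat.clog 2 d`, so the powers remain words before they are cut
off at `d`. -/
theorem Inst.two_pow_le (I : Inst) {e : ℕ} (he : e < I.I1) : 2 ^ e ≤ 2 * I.d := by
  have hd := I.hd
  rcases e with _ | e
  · simp; omega
  · unfold Inst.I1 at he
    have := (Nat.lt_clog_iff_pow_lt (b := 2) (by norm_num)).1 (show e < Nat.clog 2 I.d by omega)
    rw [pow_succ]
    omega

section runs

variable {C : Ctx k} {I : Inst} {s : Gh} {b ct l : ℕ}

/-- The current solution is good enough. -/
def Win (I : Inst) (s : Gh) : Prop := I.m * s.v 9 ≤ (I.m + 10) * I.opt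

/-- The guesses so far can be continued consistently with the target solution. -/
def ReadyAt (I : Inst) (l : ℕ) (s : Gh) : Prop := I.Ready (s.a 0) (s.a 7) (s.a 8) (s.a 9) l

/-- `Ready` asserts the existence of a size, a label and a weight. Each of the three guessing steps
removes one of these quantifiers, at the price of the inverse of its range; the invariant holds
whatever is guessed. -/
theorem run_pickSize (h : Fits C I) (hl : l < I.K) (hS : SInv I b ct l s) (h11 : s.v 11 = l) :
    Tri C pickSize s (50 + 6 * I.I1)
      (fun s' => SInv I b ct l s' ∧ s'.v 11 = l ∧ s'.v 18 = s'.a 7 l ∧ 1 ≤ s'.a 7 l ∧ s'.a 7 l ≤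
          I.d)
      (ind fun s' => ∃ y0 < I.K, ∃ a < I.G, I.Valid (s'.a 0) (s'.a 7)
        (Function.update (s'.a 8) l y0) (Function.update (s'.a 9) l ((a + 1) * s'.a 7 l)) (l + 1))
      ((I.I1 : ℝ≥0∞)⁻¹ * ind (ReadyAt I l) s) := by
  obtain ⟨Z, hZ⟩ : ∃ Z, Z = I.trials * (I.n * I.d) := ⟨_, rfl⟩
  have hz := h.sizes
  rw [← hZ] at hz
  have e := hS.env
  obtain ⟨hW, hbase⟩ := And.intro hz.word hz.base
  have hd := hz.d
  have hd1 := hz.d1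
  have hK := hz.K
  have hI1 := hz.I1
  have hr : (Ex.var 6).Ok C 32 s I.I1 2 := .var (by omega) e.I1 (by omega)
  refine ((Tri.rnd_of_exists (r := 13) (J := fun s' => ∃ y0 < I.K, ∃ a < I.G, I.Valid (s'.a 0)
      (Function.update (s'.a 7) l (min (2 ^ s'.v 13) I.d)) (Function.update (s'.a 8) l y0)
      (Function.update (s'.a 9) l ((a + 1) * min (2 ^ s'.v 13) I.d)) (l + 1))
    hz.hW (by omega) (by omega) hr.1 hr.2.1 I.I1_pos (H := ReadyAt I l) ?_).seq_ind
    (b := 1) (B' := 40 + 6 * I.I1) ?_).mono ?_ (fun _ h => ⟨h, le_rfl⟩) (by rw [one_mul])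
  · rintro ⟨e0, he0, y0, hy0, a, ha, hv⟩
    exact ⟨e0, he0, y0, hy0, a, ha, by simpa using hv⟩
  · rintro _ ⟨e0, he0, rfl⟩
    have hpow := I.two_pow_le he0
    obtain ⟨R, hR⟩ : ∃ R, R = min (2 ^ e0) I.d := ⟨_, rfl⟩
    have hR1 : 1 ≤ R := hR ▸ le_min Nat.one_le_two_pow hd1
    have hRd : R ≤ I.d := hR ▸ min_le_right _ _
    -- Two truncated subtractions compute the minimum.
    have hRe : R = I.d - (I.d - 2 ^ e0) := by omega
    have h1 : DTri C (assign 18 (.var 1 - (.var 1 - .fold .mul 1 (.var 13) (.lit 2))))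
        (s.setv 13 e0)
        (12 + (6 + e0 * (1 + 5)) + 2) ((s.setv 13 e0).setv 18 R) := by
      refine DTri.assign_ok hz.hW (by omega) (by omega) ?_ (by omega)
      rw [hRe]
      exact .mono (.sub (.var (by omega) e.d (by omega)) (.sub (.var (by omega) e.d (by omega))
        (.pow (x := 2) (.var (by omega) rfl (by omega)) (by omega) (fun _ _ => .lit (by omega))
        (by omega) (by omega)) (by omega)) (by omega)) (by omega)
    have h2 : DTri C (put 7 (.var 11) (.var 18)) ((s.setv 13 e0).setv 18 R) (2 + 2 + 8) _ :=
      DTri.put_ok hz.hW (by omega) (.var (x := l) (by omega) h11 (by omega)) (by omega)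
        (.var (x := R) (by omega) rfl (by omega))
    refine ((h1.seq h2).mono (B' := 40 + 6 * I.I1) (by omega) rfl).tri ⟨?_, h11, ?_, ?_, ?_⟩ ?_
    · refine hS.guess (fun r hr => ?_) rfl rfl rfl (fun i hi => ?_) hS.y hS.w
      · simp only [Gh.seta_v]
        rw [Gh.setv_v_of_ne _ _ (by omega), Gh.setv_v_of_ne _ _ (by omega)]
      · simp only [Gh.seta_a, if_true, Gh.setv_a]
        rw [Function.update_of_ne (by omega)]
        exact hS.R i hi
    · simp [Gh.seta_a]
    · simpa [Gh.seta_a] using hR1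
    · simpa [Gh.seta_a] using hRd
    · rw [one_mul]
      by_cases hJ : ∃ y0 < I.K, ∃ a < I.G, I.Valid (s.a 0)
        (Function.update (s.a 7) l R) (Function.update (s.a 8) l y0)
        (Function.update (s.a 9) l ((a + 1) * R)) (l + 1)
      · refine le_trans ?_ (ind_of ?_).ge
        · unfold ind; split_ifs <;> simp
        · simpa [Gh.seta_a] using hJ
      · rw [ind_of_not]
        · exact zero_le
        · simpa [hR] using hJ
  · have := hr.2.2
    omega

theorem run_pickLabel (h : Fits C I) (hl : l < I.K) (hS : SInv I b ct l s) (h11 : s.v 11 = l)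
    (h18 : s.v 18 = s.a 7 l) (hR1 : 1 ≤ s.a 7 l) (hRd : s.a 7 l ≤ I.d) :
    Tri C pickLabel s 50
      (fun s' => SInv I b ct l s' ∧ s'.v 11 = l ∧ s'.v 18 = s'.a 7 l ∧ 1 ≤ s'.a 7 l ∧ s'.a 7 l ≤
          I.d ∧
        s'.a 8 l < I.K)
      (ind fun s' => ∃ a < I.G, I.Valid (s'.a 0) (s'.a 7)
        (s'.a 8) (Function.update (s'.a 9) l ((a + 1) * s'.a 7 l)) (l + 1))
      ((I.K : ℝ≥0∞)⁻¹ * ind (fun s' => ∃ y0 < I.K, ∃ a < I.G, I.Valid (s'.a 0) (s'.a 7)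
        (Function.update (s'.a 8) l y0) (Function.update (s'.a 9) l ((a + 1) * s'.a 7 l))
        (l + 1)) s) := by
  obtain ⟨Z, hZ⟩ : ∃ Z, Z = I.trials * (I.n * I.d) := ⟨_, rfl⟩
  have hz := h.sizes
  rw [← hZ] at hz
  have e := hS.env
  obtain ⟨hW, hbase⟩ := And.intro hz.word hz.base
  have hd := hz.d
  have hd1 := hz.d1
  have hK := hz.K
  have hr : (Ex.var 4).Ok C 32 s I.K 2 := .var (by omega) e.K (by omega)
  refine ((Tri.rnd_of_exists (r := 13) (J := fun s' => ∃ a < I.G, I.Valid (s'.a 0) (s'.a 7)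
        (Function.update (s'.a 8) l (s'.v 13)) (Function.update (s'.a 9) l ((a + 1) * s'.a 7 l))
        (l + 1))
    hz.hW (by omega) (by omega) hr.1 hr.2.1 I.hK (H := fun s => ∃ y0 < I.K, ∃ a < I.G,
        I.Valid (s.a 0) (s.a 7)
        (Function.update (s.a 8) l y0) (Function.update (s.a 9) l ((a + 1) * s.a 7 l))
        (l + 1)) ?_).seq_ind
    (b := 1) (B' := 12) ?_).mono ?_ (fun _ h => ⟨h, le_rfl⟩) (by rw [one_mul])
  · rintro ⟨y0, hy0, a, ha, hv⟩
    exact ⟨y0, hy0, a, ha, by simpa using hv⟩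
  · rintro _ ⟨y0, hy0, rfl⟩
    have h2 : DTri C (put 8 (.var 11) (.var 13)) (s.setv 13 y0) (2 + 2 + 8) _ :=
      DTri.put_ok hz.hW (by omega) (.var (x := l) (by omega) h11 (by omega)) (by omega)
        (.var (x := y0) (by omega) rfl (by omega))
    refine h2.tri ⟨?_, h11, h18, hR1, hRd, ?_⟩ ?_
    · refine hS.guess (fun r hr => ?_) rfl rfl rfl hS.R (fun i hi => ?_) hS.w
      · simp only [Gh.seta_v]
        rw [Gh.setv_v_of_ne _ _ (by omega)]
      · simp only [Gh.seta_a, if_true, Gh.setv_a]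
        rw [Function.update_of_ne (by omega)]
        exact hS.y i hi
    · simpa [Gh.seta_a] using hy0
    · rw [one_mul]
      by_cases hJ : ∃ a < I.G, I.Valid (s.a 0) (s.a 7)
        (Function.update (s.a 8) l y0) (Function.update (s.a 9) l ((a + 1) * s.a 7 l)) (l + 1)
      · refine le_trans ?_ (ind_of ?_).ge
        · unfold ind; split_ifs <;> simp
        · simpa [Gh.seta_a] using hJ
      · rw [ind_of_not]
        · exact zero_le
        · simpa using hJ
  · have := hr.2.2
    omega

/-- The guesses up to stage `l` are consistent with the target solution. -/
def ValidAt (I : Inst) (L : ℕ) (s : Gh) : Prop := I.Valid (s.a 0) (s.a 7) (s.a 8) (s.a 9) L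

theorem run_pickWeight (h : Fits C I) (hl : l < I.K) (hS : SInv I b ct l s) (h11 : s.v 11 = l)
    (h18 : s.v 18 = s.a 7 l) (hR1 : 1 ≤ s.a 7 l) (hRd : s.a 7 l ≤ I.d) (hy : s.a 8 l < I.K) :
    Tri C pickWeight s 50
      (fun s' => SInv I b ct (l + 1) s' ∧ s'.v 11 = l ∧ s'.v 18 = s'.a 7 l ∧
        s'.v 16 = l + 1 ∧ s'.v 15 = (l + 1) * I.t)
      (ind (ValidAt I (l + 1)))
      ((I.G : ℝ≥0∞)⁻¹ * ind (fun s' => ∃ a < I.G, I.Valid (s'.a 0) (s'.a 7) (s'.a 8)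
        (Function.update (s'.a 9) l ((a + 1) * s'.a 7 l)) (l + 1)) s) := by
  obtain ⟨Z, hZ⟩ : ∃ Z, Z = I.trials * (I.n * I.d) := ⟨_, rfl⟩
  have hz := h.sizes
  rw [← hZ] at hz
  have e := hS.env
  obtain ⟨hW, hbase⟩ := And.intro hz.word hz.base
  have hd := hz.d
  have hd1 := hz.d1
  have hK := hz.K
  have hG := hz.G
  have ht := hz.t
  have hGd := hz.Gd
  have hKt := hz.Kt l hl
  have hr : (Ex.var 7).Ok C 32 s I.G 2 := .var (by omega) e.G (by omega)
  refine ((Tri.rnd_of_exists (r := 13) (J := fun s' => I.Valid (s'.a 0) (s'.a 7)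
        (s'.a 8) (Function.update (s'.a 9) l ((s'.v 13 + 1) * s'.a 7 l)) (l + 1))
    hz.hW (by omega) (by omega) hr.1 hr.2.1 I.G_pos (H := fun s => ∃ a < I.G, I.Valid (s.a 0)
        (s.a 7)
        (s.a 8) (Function.update (s.a 9) l ((a + 1) * s.a 7 l))
        (l + 1)) ?_).seq_ind
    (b := 1) (B' := 40) ?_).mono ?_ (fun _ h => ⟨h, le_rfl⟩) (by rw [one_mul])
  · rintro ⟨a, ha, hv⟩
    exact ⟨a, ha, by simpa using hv⟩
  · rintro _ ⟨a, ha, rfl⟩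
    have hle : (a + 1) * s.a 7 l ≤ I.G * I.d := Nat.mul_le_mul ha hRd
    have hval : Ex.Ok C 32 (s.setv 13 a) ((.var 13 + .lit 1) * .var 18) ((a + 1) * s.a 7 l)
        7 :=
      .mono (.mul (.add (.var (x := a) (by omega) rfl (by omega)) (.lit (x := 1) (by omega))
        (by omega)) (.var (by omega) h18 (by omega)) (by omega)) (by norm_num)
    have h2 : DTri C (put 9 (.var 11) ((.var 13 + .lit 1) * .var 18)) (s.setv 13 a)
        (2 + 7 + 8) _ :=
      DTri.put_ok hz.hW (by omega) (.var (x := l) (by omega) h11 (by omega)) (by omega) hval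
    have h3 : DTri C (assign 16 (.var 11 + .lit 1)) ((s.setv 13 a).seta 9 (Function.update
        ((s.setv 13 a).a 9) l ((a + 1) * s.a 7 l))) (2 + 1 + 1 + 2) _ :=
      DTri.assign_ok hz.hW (by omega) (by omega) (.add (.var (x := l) (by omega) h11 (by omega))
        (.lit (x := 1) (by omega)) (by omega)) (by omega)
    have h4 : DTri C (assign 15 (.var 16 * .var 5)) (((s.setv 13 a).seta 9 (Function.update
        ((s.setv 13 a).a 9) l ((a + 1) * s.a 7 l))).setv 16 (l + 1)) (2 + 2 + 1 + 2) _ :=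
      DTri.assign_ok hz.hW (by omega) (by omega) (.mul (.var (x := l + 1) (by omega) rfl (by omega))
        (.var (by omega) e.t (by omega)) (by omega)) (by omega)
    refine ((h2.seq (h3.seq h4)).mono (B' := 40) (by omega) rfl).tri
      ⟨?_, h11, h18, rfl, rfl⟩ ?_
    · refine hS.guess (fun r hr => ?_) rfl rfl rfl (fun i hi => ?_) (fun i hi => ?_)
        (fun i hi => ?_)
      · rw [Gh.setv_v_of_ne _ _ (by omega), Gh.setv_v_of_ne _ _ (by omega), Gh.seta_v,
          Gh.setv_v_of_ne _ _ (by omega)]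
      · change 1 ≤ s.a 7 i ∧ s.a 7 i ≤ I.d
        rcases Nat.lt_or_ge i l with hi' | hi'
        · exact hS.R i hi'
        · rw [show i = l by omega]; exact ⟨hR1, hRd⟩
      · change s.a 8 i < I.K
        rcases Nat.lt_or_ge i l with hi' | hi'
        · exact hS.y i hi'
        · rw [show i = l by omega]; exact hy
      · change Function.update (s.a 9) l ((a + 1) * s.a 7 l) i ≤ _
        rw [Function.update_apply]
        split_ifs with hi'
        · exact hle
        · exact hS.w i (by omega)
    · rw [one_mul]
      exact ind_le_ind fun h => h
  · have := hr.2.2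
    omega

theorem natCast_mul_inv (a b : ℕ) : ((a * b : ℕ) : ℝ≥0∞)⁻¹ = (a : ℝ≥0∞)⁻¹ * (b : ℝ≥0∞)⁻¹ := by
  rw [Nat.cast_mul, ENNReal.mul_inv (Or.inr (ENNReal.natCast_ne_top b))
    (Or.inl (ENNReal.natCast_ne_top a))]

/-- Guessing the size, the label and the weight of the next cluster. -/
theorem run_guess (h : Fits C I) (hl : l < I.K) (hS : SInv I b ct l s) (h11 : s.v 11 = l) :
    Tri C (.seq pickSize (.seq pickLabel pickWeight)) s (50 + 6 * I.I1 + (50 + 50))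
      (fun s' => SInv I b ct (l + 1) s' ∧ s'.v 11 = l ∧ s'.v 18 = s'.a 7 l ∧
        s'.v 16 = l + 1 ∧ s'.v 15 = (l + 1) * I.t)
      (ind (ValidAt I (l + 1)))
      ((I.G : ℝ≥0∞)⁻¹ * (I.K : ℝ≥0∞)⁻¹ * ((I.I1 : ℝ≥0∞)⁻¹ * ind (ReadyAt I l) s)) := by
  refine (run_pickSize h hl hS h11).seq_ind fun s1 h1 => ?_
  refine ((run_pickLabel h hl h1.1 h1.2.1 h1.2.2.1 h1.2.2.2.1 h1.2.2.2.2).seq_ind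
    fun s2 h2 => run_pickWeight h hl h2.1 h2.2.1 h2.2.2.1 h2.2.2.2.1 h2.2.2.2.2.1
      h2.2.2.2.2.2).mono le_rfl (fun _ h => ⟨h, le_rfl⟩) (by rw [mul_assoc])

/-- The solution computed from the sampled positions `x` is nearly optimal on the sampled
clusters. -/
def GoodSample (I : Inst) (L : ℕ) (s : Gh) (x : ℕ → ℕ) : Prop :=
  I.m * I.cc (s.a 0) (s.a 7) (s.a 8) L (I.choice (s.a 8) (s.a 9) (L * I.t)
    fun v => I.col (s.a 0) (x v)) ≤ (I.m + 9) * I.cc (s.a 0) (s.a 7) (s.a 8) L I.us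

-- The exponent `L * t` is rounded up to `K * t` so that one bound serves all stages. Optimality of
-- the chosen labels on the sample holds by construction as minimizers.
open Classical in
theorem ValidAt.sampling {L : ℕ} (hv : ValidAt I L s) (hL : L ≤ I.K) (x0 : ℕ → ℕ) :
    ((2 * I.B ^ (I.K * I.t) : ℕ) : ℝ≥0∞)⁻¹ ≤ ENNReal.ofReal (mav (fun v => range (s.a 7 (v / I.t)))
      (fun x => if GoodSample I L s x then 1 else 0) (L * I.t) 0 x0) := by
  have hB : 2 ≤ I.B := I.B_ge
  have h1 := Inst.Valid.sampling hv (t := I.t) rfl (col := I.col (s.a 0))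
    (fun r hr => ⟨I.col_lt _ _, I.pos_col hv.isPos hr⟩)
    (fun x => I.choice (s.a 8) (s.a 9) (L * I.t) fun v => I.col (s.a 0) (x v))
    (fun x i => I.choice_lt _ _ _ _ _) (fun x i y hy => aminf_le (N := I.K) (fun y =>
      ∑ v ∈ range (L * I.t), s.a 9 (v / I.t) * I.mis y (s.a 8 (v / I.t))
        (I.a i (I.col (s.a 0) (x v)))) hy) x0 (GoodSample I L s) (fun x hx => hx)
  have h2 : ((2 * I.B ^ (I.K * I.t) : ℕ) : ℝ)⁻¹ ≤ (1 / I.B : ℝ) ^ (L * I.t) * (1 / 2) := by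
    have hBpos : (0 : ℝ) < I.B := by exact_mod_cast (by omega : 0 < I.B)
    have h3 : (I.B : ℝ) ^ (L * I.t) ≤ (I.B : ℝ) ^ (I.K * I.t) :=
      pow_le_pow_right₀ (by exact_mod_cast (by omega : 1 ≤ I.B)) (Nat.mul_le_mul_right _ hL)
    have h4 : (1 / I.B : ℝ) ^ (L * I.t) * (1 / 2) = (2 * (I.B : ℝ) ^ (L * I.t))⁻¹ := by
      rw [one_div, inv_pow, mul_inv]; ring
    rw [h4]
    push_cast
    gcongr
  calc ((2 * I.B ^ (I.K * I.t) : ℕ) : ℝ≥0∞)⁻¹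
      = ENNReal.ofReal ((2 * I.B ^ (I.K * I.t) : ℕ) : ℝ)⁻¹ := by
        rw [ENNReal.ofReal_inv_of_pos (by exact_mod_cast (by positivity :
          0 < 2 * I.B ^ (I.K * I.t))), ENNReal.ofReal_natCast]
    _ ≤ _ := ENNReal.ofReal_le_ofReal (h2.trans h1)

/-- A good sample leads to a good solution or to a state where the next guess is possible. -/
theorem GoodSample.advance {s' : Gh} (hg : GoodSample I (l + 1) s (s.a 10))
    (hv : ValidAt I (l + 1) s) (hR : s.a 7 l ≤ I.d) {U H : ℕ → ℕ}
    (hU : U = I.choice (s.a 8) (s.a 9) ((l + 1) * I.t) fun v => I.col (s.a 0) (s.a 10 v))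
    (hH : H = I.near (s.a 8) (l + 1) U) (h9 : s'.v 9 ≤ ∑ j ∈ range I.d, H j)
    (h0 : s'.a 0 = newPos I.d H (s.a 0) (s.a 7 l)) (h7 : s'.a 7 = s.a 7) (h8 : s'.a 8 = s.a 8)
    (h9' : s'.a 9 = s.a 9) : Win I s' ∨ ReadyAt I (l + 1) s' := by
  have hnp := newPos_spec (h := H) hv.isPos hR
  obtain ⟨hv', hcc⟩ := Inst.Valid.repos hv (Nat.succ_pos l) hnp.1
    (by simpa using hnp.2.1) (by simpa using hnp.2.2.1)
  rcases hv'.advance (Nat.succ_pos l) (U := U) (by rw [hcc, hcc, hU]; exact hg)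
    (fun j hj j' hj' h1 h2 => by rw [← hH]; exact hnp.2.2.2 j hj j' hj' h1 h2) with h1 | h1
  · left
    rw [← hH] at h1
    exact (Nat.mul_le_mul_left _ h9).trans h1
  · right
    unfold ReadyAt
    rw [h0, h7, h8, h9']
    exact h1

/-- Only the filling of the sample array is random. If the guesses are consistent and the sample is
good, the deterministic rest of the stage ends in a win or in a state from which the next stage can
start. -/
theorem run_sample (h : Fits C I) (hb : b ≤ I.n * I.d) (hl : l < I.K) (hS : SInv I b ct (l + 1) s)
    (h11 : s.v 11 = l) (h18 : s.v 18 = s.a 7 l) (h16 : s.v 16 = l + 1)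
    (h15 : s.v 15 = (l + 1) * I.t) :
    Tri C (.seq (rfill 10 (.var 15) (.arr 7 (.var 32 / .var 5))) evalStage) s
      (2 + 3 + (l + 1) * I.t * (11 + 15) + 2000 * (I.trials * (I.n * I.d) * (C.M.queryTime + 1)))
      (fun s' => SInv I b ct (l + 1) s' ∧ s'.v 11 = l ∧ s'.v 9 ≤ s.v 9)
      (ind fun s' => Win I s' ∨ ReadyAt I (l + 1) s')
      (((2 * I.B ^ (I.K * I.t) : ℕ) : ℝ≥0∞)⁻¹ * ind (ValidAt I (l + 1)) s) := by
  classical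
  obtain ⟨Z, hZ⟩ : ∃ Z, Z = I.trials * (I.n * I.d) := ⟨_, rfl⟩
  have hz := h.sizes
  rw [← hZ] at hz
  have e := hS.env
  obtain ⟨hW, hbase⟩ := And.intro hz.word hz.base
  have hd := hz.d
  have hd1 := hz.d1
  have hK := hz.K
  have ht := hz.t
  have hKt := hz.Kt l hl
  have hlim : (Ex.var 15).Ok C 32 s ((l + 1) * I.t) 2 := .var (by omega) h15 (by omega)
  refine (Tri.seq (B' := 2000 * (I.trials * (I.n * I.d) * (C.M.queryTime + 1)))
    (g := ind fun s' => ValidAt I (l + 1) s' ∧ GoodSample I (l + 1) s' (s'.a 10))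
    (Tri.rfill hz.hW (by omega) hlim.1 hlim.2.1 (b := 11) (by omega) (fun v => s.a 7 (v / I.t))
      ?_ (fun x => if ValidAt I (l + 1) s ∧ GoodSample I (l + 1) s x then 1 else 0) ?_ _ ?_)
    ?_).mono (by have := hlim.2.2; omega) (fun _ h => ⟨h, le_rfl⟩) ?_
  · intro v hv x
    have hvt : v / I.t < l + 1 := (Nat.div_lt_iff_lt_mul I.t_pos).2 hv
    have hvt' : v / I.t ≤ v := Nat.div_le_self _ _
    have hok : (Ex.arr 7 (.var 32 / .var 5)).Ok C 33 ((s.seta 10 x).setv 32 v) (s.a 7 (v / I.t))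
        11 :=
      .mono (.arr (.div (.var (x := v) (by omega) rfl (by omega)) (.var (by omega) e.t (by omega))
        (by omega)) (by omega) rfl (by omega)) (by norm_num)
    exact ⟨(hS.R _ hvt).1, hok⟩
  · intro x; split_ifs <;> simp
  · intro x
    split_ifs with hx
    · rw [ind_of]
      · simp
      · refine ⟨hx.1, ?_⟩
        have := hx.2
        simpa [GoodSample, Gh.seta_a] using this
    · simp
  · rintro s1 ⟨x, hx, rfl⟩
    obtain ⟨s2, h1, h2, h3, h4, h5, h6, h7, h8, h9⟩ := run_evalStage (s := s.seta 10 x) h hl hb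
      (hS.guess (fun _ _ => rfl) rfl rfl rfl hS.R hS.y hS.w) h15 h16 h18 rfl rfl
    refine h1.tri ⟨h2, h3.trans h11, h4⟩ (ind_le_ind fun hJ => ?_)
    exact hJ.2.advance hJ.1 (hS.R l (by omega)).2 rfl rfl h5 h6 h7 h8 h9
  · by_cases hv : ValidAt I (l + 1) s
    · rw [ind_of hv, mul_one]
      refine (hv.sampling (by omega) (s.a 10)).trans (le_of_eq ?_)
      simp only [hv, true_and]
    · rw [ind_of_not hv, mul_zero]
      exact zero_le

/-- The event "won or ready" is handed on from stage to stage. If ready, the probabilities of the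
three guesses and of a good sample multiply to `1 / stageInv`; if already won, the event is certain
because the best cost never increases. -/
theorem run_stage (h : Fits C I) (hb : b ≤ I.n * I.d) (hl : l < I.K) (hS : SInv I b ct l s)
    (h11 : s.v 11 = l) :
    Tri C stage s (4000 * (I.trials * (I.n * I.d) * (C.M.queryTime + 1)))
      (fun s' => SInv I b ct (l + 1) s' ∧ s'.v 11 = l)
      (ind fun s' => Win I s' ∨ ReadyAt I (l + 1) s')
      ((I.stageInv : ℝ≥0∞)⁻¹ * ind (fun s' => Win I s' ∨ ReadyAt I l s') s) := by
  have hz := h.sizes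
  have hLt := hz.Kt l hl
  have hI1 := hz.I1
  have hd := hz.d
  have hd1 := hz.d1
  have hprob : (I.stageInv : ℝ≥0∞)⁻¹ = ((2 * I.B ^ (I.K * I.t) : ℕ) : ℝ≥0∞)⁻¹ *
      ((I.G : ℝ≥0∞)⁻¹ * (I.K : ℝ≥0∞)⁻¹ * (I.I1 : ℝ≥0∞)⁻¹) := by
    rw [← natCast_mul_inv, ← natCast_mul_inv, ← natCast_mul_inv]
    congr 2
    unfold Inst.stageInv
    ring
  -- the number `b'` bounds the cost of the best solution before the stage
  have main : ∀ b', b' ≤ I.n * I.d → SInv I b' ct l s → Tri C stage s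
      (4000 * (I.trials * (I.n * I.d) * (C.M.queryTime + 1)))
      (fun s' => SInv I b' ct (l + 1) s' ∧ s'.v 11 = l)
      (ind fun s' => Win I s' ∨ ReadyAt I (l + 1) s')
      ((I.stageInv : ℝ≥0∞)⁻¹ * ind (ReadyAt I l) s) := by
    intro b' hb' hS'
    refine ((run_guess h hl hS' h11).seq_ind fun s1 h1 =>
      (run_sample h hb' hl h1.1 h1.2.1 h1.2.2.1 h1.2.2.2.1 h1.2.2.2.2).mono le_rfl
        (fun _ h => ⟨⟨h.1, h.2.1⟩, le_rfl⟩) le_rfl).mono ?_ (fun _ h => ⟨h, le_rfl⟩) ?_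
    · have : I.trials * (I.n * I.d) * 1 ≤ I.trials * (I.n * I.d) * (C.M.queryTime + 1) :=
        Nat.mul_le_mul_left _ (by omega)
      omega
    · rw [hprob]; simp only [mul_assoc, le_refl]
  -- With `b'` set to the current best cost, the invariant itself says that the cost does not grow,
  -- so a win persists.
  by_cases hw : Win I s
  · have := (main (s.v 9) (hS.best_le.trans hb) ⟨hS.env, le_rfl, hS.sol, hS.bu, hS.bv, hS.isPos,
      hS.R, hS.y, hS.w, hS.trial⟩).sure (g := ind fun s' => Win I s' ∨ ReadyAt I (l + 1) s') fun s'
          hs' => by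
        rw [ind_of]
        exact Or.inl ((Nat.mul_le_mul_left _ hs'.1.best_le).trans hw)
    refine this.mono le_rfl (fun s' hs' => ⟨⟨⟨hs'.1.env, hs'.1.best_le.trans hS.best_le,
      hs'.1.sol, hs'.1.bu, hs'.1.bv, hs'.1.isPos, hs'.1.R, hs'.1.y, hs'.1.w,
      hs'.1.trial⟩, hs'.2⟩, le_rfl⟩) ?_
    rw [ind_of (Or.inl hw), mul_one]
    exact ENNReal.inv_le_one.2 (by exact_mod_cast I.stageInv_pos)
  · refine (main b hb hS).mono le_rfl (fun _ h => ⟨h, le_rfl⟩) ?_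
    gcongr
    exact ind_le_ind fun h => h.resolve_left hw

end runs

/-! ### Trials and amplification of the success probability -/

/-- One trial: the stages in turn, starting with the list of all columns. -/
def trial : Prog := .seq (fill 0 (.var 1) (.var 32)) (rep 11 4 stage)

/-- Repeated trials. -/
def search : Prog := rep 10 8 trial

/-- To succeed within `j + 1` independent trials means to succeed within `j` of them, or else in the
remaining one. -/
theorem one_sub_pow_step {p : ℝ≥0∞} (hp : p ≤ 1) (j : ℕ) :
    1 - (1 - p) ^ (j + 1) ≤ (1 - (1 - p) ^ j) + (1 - p) ^ j * p := by
  rw [tsub_le_iff_right, pow_succ]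
  have h1 : (1 - p) ^ j * p + (1 - p) ^ j * (1 - p) = (1 - p) ^ j := by
    rw [← mul_add, add_tsub_cancel_of_le hp, mul_one]
  rw [add_assoc, h1]
  exact le_tsub_add

/-- `(1 - 1 / S) ^ (2 S) ≤ exp (-2) ≤ 1 / 3`. This explains the factor `2` in the number of trials.
-/
theorem two_thirds_le {S : ℕ} (hS : 0 < S) :
    (2 / 3 : ℝ≥0∞) ≤ 1 - (1 - (S : ℝ≥0∞)⁻¹) ^ (2 * S) := by
  have hS' : (0 : ℝ) < S := by exact_mod_cast hS
  have hS1 : (1 : ℝ) ≤ S := by exact_mod_cast hS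
  have h1 : (1 - (S : ℝ≥0∞)⁻¹) = ENNReal.ofReal (1 - (S : ℝ)⁻¹) := by
    rw [ENNReal.ofReal_sub _ (by positivity), ENNReal.ofReal_one, ENNReal.ofReal_inv_of_pos hS',
      ENNReal.ofReal_natCast]
  have h2 : 0 ≤ 1 - (S : ℝ)⁻¹ := sub_nonneg.2 (inv_le_one_of_one_le₀ hS1)
  have h3 : (1 - (S : ℝ)⁻¹) ^ (2 * S) ≤ 1 / 3 := by
    have h4 : 1 - (S : ℝ)⁻¹ ≤ Real.exp (-(S : ℝ)⁻¹) := by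
      have := Real.add_one_le_exp (-(S : ℝ)⁻¹); linarith
    have h5 : Real.exp (-(S : ℝ)⁻¹) ^ (2 * S) = (Real.exp 1 ^ 2)⁻¹ := by
      rw [← Real.exp_nat_mul, ← Real.exp_nat_mul, ← Real.exp_neg]
      congr 1
      push_cast
      field_simp
    have h6 : 3 ≤ Real.exp 1 ^ 2 := by nlinarith [Real.exp_one_gt_d9]
    calc _ ≤ Real.exp (-(S : ℝ)⁻¹) ^ (2 * S) := pow_le_pow_left₀ h2 h4 _
      _ = (Real.exp 1 ^ 2)⁻¹ := h5
      _ ≤ 3⁻¹ := inv_anti₀ (by norm_num) h6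
      _ = 1 / 3 := by norm_num
  rw [h1, ← ENNReal.ofReal_pow h2]
  calc (2 / 3 : ℝ≥0∞) = ENNReal.ofReal (2 / 3) := by
        rw [ENNReal.ofReal_div_of_pos (by norm_num)]; simp
    _ ≤ ENNReal.ofReal (1 - (1 - (S : ℝ)⁻¹) ^ (2 * S)) := ENNReal.ofReal_le_ofReal (by linarith)
    _ = _ := by rw [ENNReal.ofReal_sub _ (by positivity), ENNReal.ofReal_one]

section runs

variable {C : Ctx k} {I : Inst} {s : Gh} {b ct : ℕ}

/-- The potential carries one factor `1 / stageInv` for each stage still to come. It starts at a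
ready state by `Inst.ready_zero`, and ready is impossible after `K` stages. A trial resets the list,
so the incoming order of the columns is irrelevant; in the invariant between trials array `0` is
therefore replaced by the identity. -/
theorem run_trial (h : Fits C I) (hb : b ≤ I.n * I.d) (hS : SInv I b ct 0 (s.seta 0 id)) :
    Tri C trial s (5000 * (I.K * (I.trials * (I.n * I.d) * (C.M.queryTime + 1))))
      (fun s' => SInv I b ct 0 (s'.seta 0 id)) (ind (Win I)) ((I.stageInv : ℝ≥0∞)⁻¹ ^ I.K) := by
  obtain ⟨Z, hZ⟩ : ∃ Z, Z = I.trials * (I.n * I.d) := ⟨_, rfl⟩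
  have hz := h.sizes
  rw [← hZ] at hz ⊢
  have e : Env I s := hS.env.of_eq fun _ _ => rfl
  obtain ⟨hW, hbase⟩ := And.intro hz.word hz.base
  have hd := hz.d
  have hd1 := hz.d1
  have hK := hz.K
  have hK1 := hz.K1
  obtain ⟨q, hq⟩ : ∃ q : ℝ≥0∞, q = (I.stageInv : ℝ≥0∞)⁻¹ := ⟨_, rfl⟩
  have h1 : DTri C (fill 0 (.var 1) (.var 32)) s ((2 + 19) * (I.d * 1))
      (s.seta 0 fun i => if i < I.d then i else s.a 0 i) :=
    DTri.fill_ok hz.hW (by omega) (.var (by omega) e.d (by omega)) (by omega) (fun j => j)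
      (fun j hj => .mono (.var (by omega) rfl (by omega)) (by norm_num)) hd1 le_rfl
  have hpos : IsPos I.d fun i => if i < I.d then i else s.a 0 i :=
    ⟨fun j hj => by simp [hj], fun j hj j' hj' he => by simpa [hj, hj'] using he⟩
  have hS1 : SInv I b ct 0 (s.seta 0 fun i => if i < I.d then i else s.a 0 i) :=
    ⟨⟨e.n, e.d, e.k, e.base, e.K, e.t, e.I1, e.G, e.trials⟩, hS.best_le, hS.sol, hS.bu, hS.bv, hpos,
      by omega, by omega, by omega, hS.trial⟩
  have h2 := Tri.rep (C := C) (s := s.seta 0 fun i => if i < I.d then i else s.a 0 i) (r := 11)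
    (rl := 4) (N := I.K) (b := 4000 * (Z * (C.M.queryTime + 1))) (body := stage) hz.hW (by omega)
    (by omega) (by omega) (by omega) (fun v s => SInv I b ct v s)
    (fun v s => q ^ (I.K - v) * ind (fun s' => Win I s' ∨ ReadyAt I v s') s)
    (fun v s x hs => ⟨⟨hs.env.of_eq fun r hr => Gh.setv_v_of_ne _ _ (by omega), hs.best_le, hs.sol,
      hs.bu, hs.bv, hs.isPos, hs.R, hs.y, hs.w, hs.trial⟩, rfl⟩) (fun v s hs => hs.env.K)
    (fun v hv s hs hr => ?_) hS1
  · refine (h1.seq_tri h2).mono ?_ (fun s' hs' => ⟨?_, ?_⟩) ?_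
    · have g1 : Z * 1 ≤ Z * (C.M.queryTime + 1) := Nat.mul_le_mul_left _ (by omega)
      have g2 : 1 * (Z * (C.M.queryTime + 1)) ≤ I.K * (Z * (C.M.queryTime + 1)) :=
        Nat.mul_le_mul_right _ hK1
      have g3 : I.K * 1 ≤ I.K * (Z * (C.M.queryTime + 1)) := Nat.mul_le_mul_left _ (by omega)
      have g4 : I.K * (4000 * (Z * (C.M.queryTime + 1)) + 12) =
        4000 * (I.K * (Z * (C.M.queryTime + 1))) + 12 * I.K := by ring
      omega
    · exact ⟨hs'.env.of_eq fun _ _ => rfl, hs'.best_le, hs'.sol, hs'.bu, hs'.bv,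
        ⟨fun j hj => hj, fun j _ j' _ he => he⟩, by omega, by omega, by omega, hs'.trial⟩
    · simp only [Nat.sub_self, pow_zero, one_mul]
      exact ind_le_ind fun hJ => hJ.resolve_right I.not_ready_K
    · simp only [Nat.sub_zero]
      rw [ind_of (Or.inr (I.ready_zero hpos)), mul_one, hq]
  · have := (run_stage h hb hv hs hr).affine 0 (q ^ (I.K - (v + 1)))
    simp only [zero_add, ← hZ] at this
    refine this.mono le_rfl (fun s' hs' => ⟨hs', le_rfl⟩) (le_of_eq ?_)
    rw [← hq, ← mul_assoc, ← pow_succ]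
    congr 2
    omega

/-- The potential is `1` on a winning state, and otherwise the chance `1 - (1 - p) ^ j` that one of
the `j` remaining trials succeeds. No independence argument is needed, since the bound `p` for one
trial holds from every state that satisfies the invariant. -/
theorem run_search (h : Fits C I) (hS : SInv I (I.n * I.d) ct 0 (s.seta 0 id)) :
    Tri C search s (6000 * (I.trials * (I.K * (I.trials * (I.n * I.d) * (C.M.queryTime + 1)))))
      (fun s' => ∃ c, SInv I (I.n * I.d) c 0 (s'.seta 0 id)) (ind (Win I)) (2 / 3) := by
  have hz := h.sizes
  have hK1 := hz.K1
  have hX1 : 1 ≤ I.trials := by have := I.stageInv_le; have := I.stageInv_pos; omega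
  obtain ⟨Z, hZ⟩ : ∃ Z, Z = I.trials * (I.n * I.d) := ⟨_, rfl⟩
  rw [← hZ] at hz ⊢
  have hW := hz.word
  have hT := hz.trials
  obtain ⟨p, hp⟩ : ∃ p : ℝ≥0∞, p = (I.stageInv : ℝ≥0∞)⁻¹ ^ I.K := ⟨_, rfl⟩
  have hp1 : p ≤ 1 := by
    rw [hp]
    exact pow_le_one₀ zero_le (ENNReal.inv_le_one.2 (by exact_mod_cast I.stageInv_pos))
  obtain ⟨a, ha⟩ : ∃ a : ℕ → ℝ≥0∞, a = fun v => 1 - (1 - p) ^ (I.trials - v) := ⟨_, rfl⟩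
  have hpow1 : ∀ j : ℕ, (1 - p) ^ j ≤ 1 := fun j => pow_le_one₀ zero_le tsub_le_self
  have ha1 : ∀ v, 1 - a v = (1 - p) ^ (I.trials - v) := fun v => by
    rw [ha]
    exact ENNReal.sub_sub_cancel ENNReal.one_ne_top (hpow1 _)
  have hale : ∀ v, a v ≤ 1 := fun v => by rw [ha]; exact tsub_le_self
  have h2 := Tri.rep (C := C) (s := s) (r := 10)
    (rl := 8) (N := I.trials) (b := 5000 * (I.K * (Z * (C.M.queryTime + 1)))) (body := trial) hz.hW
    (by omega) (by omega) (by omega) (by omega)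
    -- The trial number is quantified away because the invariant of `Tri.rep` must not react to the
    -- counter.
    (fun _ s => ∃ c, SInv I (I.n * I.d) c 0 (s.seta 0 id))
    (fun v s => a v + (1 - a v) * ind (Win I) s)
    (fun v s x hs => by
      obtain ⟨c, hs⟩ := hs
      exact ⟨⟨x, ⟨hs.env.of_eq fun r hr => Gh.setv_v_of_ne _ _ (by omega), hs.best_le, hs.sol,
        hs.bu, hs.bv, hs.isPos, hs.R, hs.y, hs.w, by simp⟩⟩, rfl⟩)
    (fun v s ⟨c, hs⟩ => hs.env.trials)
    (fun v hv s hs hr => ?_) ⟨ct, hS⟩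
  · refine h2.mono ?_ (fun s' hs' => ⟨hs', ?_⟩) ?_
    · have g2 : 1 * (I.K * (Z * (C.M.queryTime + 1))) ≤
          I.trials * (I.K * (Z * (C.M.queryTime + 1))) := Nat.mul_le_mul_right _ hX1
      have g1 : 1 * (Z * 1) ≤ I.K * (Z * (C.M.queryTime + 1)) :=
        Nat.mul_le_mul hK1 (Nat.mul_le_mul_left _ (by omega))
      have g3 : I.trials * 17 ≤ I.trials * (I.K * (Z * (C.M.queryTime + 1))) :=
        Nat.mul_le_mul_left _ (by
          have : 1000 * Z < C.M.word := hW
          have h17 : 17 ≤ I.trials := by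
            have h1 := I.stageInv_le
            have h3 : 10 ≤ I.G := by
              unfold Inst.G; have := I.hm; have := I.B_ge; nlinarith
            have h4 : I.G ≤ I.stageInv := by
              unfold Inst.stageInv
              have h5 : 1 ≤ I.I1 * I.K := Nat.mul_pos I.I1_pos I.hK
              have h6 : 1 ≤ 2 * I.B ^ (I.K * I.t) := Nat.mul_pos two_pos (by
                have := I.B_ge; positivity)
              calc I.G = 1 * I.G * 1 := by ring
                _ ≤ I.I1 * I.K * I.G * (2 * I.B ^ (I.K * I.t)) :=
                  Nat.mul_le_mul (Nat.mul_le_mul_right _ h5) h6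
                _ = _ := by ring
            omega
          omega)
      have g4 : I.trials * (5000 * (I.K * (Z * (C.M.queryTime + 1))) + 12) =
        5000 * (I.trials * (I.K * (Z * (C.M.queryTime + 1)))) + 12 * I.trials := by ring
      omega
    · simp only [ha, pow_zero, tsub_self, tsub_zero, zero_add, one_mul, le_refl]
    · refine le_trans ?_ le_self_add
      rw [ha, hp, ← ENNReal.inv_pow]
      simp only [Nat.sub_zero]
      have := two_thirds_le (S := I.stageInv ^ I.K) (pow_pos I.stageInv_pos _)
      rw [Nat.cast_pow] at this
      exact this
  · obtain ⟨c, hs⟩ := hs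
    have hc : c = v := hs.trial.symm.trans hr
    subst hc
    have main : ∀ b', b' ≤ I.n * I.d → SInv I b' c 0 (s.seta 0 id) → Tri C trial s
        (5000 * (I.K * (Z * (C.M.queryTime + 1)))) (fun s' => SInv I b' c 0 (s'.seta 0 id))
        (ind (Win I)) p := by
      intro b' hb' hs'
      have := run_trial h hb' hs'
      rwa [← hZ, ← hp] at this
    by_cases hw : Win I s
    · refine ((main (s.v 9) hs.best_le ⟨hs.env, le_rfl, hs.sol, hs.bu, hs.bv, hs.isPos,
        hs.R, hs.y, hs.w, hs.trial⟩).sure (g := fun s => a (c + 1) + (1 - a (c + 1)) * ind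
            (Win I) s)
        fun s' hs' => ?_).mono le_rfl (fun s' hs' => ⟨⟨⟨c, ⟨hs'.env, hs'.best_le.trans hs.best_le,
        hs'.sol, hs'.bu, hs'.bv, hs'.isPos, hs'.R, hs'.y, hs'.w, hs'.trial⟩⟩, hs'.trial⟩, le_rfl⟩)
            ?_
      · rw [ind_of ((Nat.mul_le_mul_left _ hs'.best_le).trans hw), mul_one,
          add_tsub_cancel_of_le (hale _)]
      · rw [ind_of hw, mul_one, add_tsub_cancel_of_le (hale _)]
    · refine ((main _ le_rfl hs).affine (a (c + 1)) (1 - a (c + 1))).mono le_rfl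
        (fun s' hs' => ⟨⟨⟨c, hs'⟩, hs'.trial⟩, le_rfl⟩) ?_
      rw [ind_of_not hw, mul_zero, add_zero, ha1]
      have := one_sub_pow_step hp1 (I.trials - (c + 1))
      rw [show I.trials - (c + 1) + 1 = I.trials - c by omega] at this
      rw [ha]
      exact this

end runs

/-! ### Set-up and output -/

/-- Moving the parameters of the input into the registers of variables. -/
def prelude : Prog :=
  -- Variable `r` lives in register `2 * r`. So `k` has to leave register `2` before `d` moves
  -- there, and `n * d` goes to variable `3`.
  .seq (.const 4 0) <| .seq (.arith .add 4 4 2) <| .seq (.const 2 0) <|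
  .seq (.arith .add 2 2 1) (.arith .mul 6 0 2)

/-- The computation of the parameters that depend on `n`, `d` and `k`. -/
def setup (m : ℕ) : Prog :=
  .seq (assign 4 (.fold .mul 1 (.var 2) (.lit 2))) <|
  .seq (assign 5 (.lit 12 * .var 4 * .lit (m ^ 2))) <|
  -- The exponent grows by one as long as its power of two is below `d`, so after `v` rounds it is
  -- the minimum of `v` and `Nat.clog 2 d`; `d` rounds are enough.
  .seq (rep 10 1 (assign 6 (.var 6 + .op .lt (.fold .mul 1 (.var 6) (.lit 2)) (.var 1)))) <|
  .seq (assign 6 (.var 6 + .lit 1)) <|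
  .seq (assign 13 (.lit 2 * .var 4 * (.lit 6 * .var 4 * .lit m + .lit 1))) <|
  .seq (assign 14 (.var 4 * .fold .mul 1 (.var 4) (.var 13))) <|
  .seq (assign 7 (.lit m * .var 14)) <|
  .seq (assign 15 (.var 4 * .var 5)) <|
  .seq (assign 16 (.var 6 * .var 4 * .var 7 * .lit 2 * .fold .mul 1 (.var 15) (.var 14))) <|
  .seq (assign 8 (.lit 2 * .fold .mul 1 (.var 4) (.var 16))) (assign 9 (.var 3))

/-- The entries of the left factor, as a function of the loop variable. -/
def bitUE : Ex :=
  .op .mod (.arr 5 (.var 32 / .var 2) /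
    .fold .mul 1 (.var 32 - .var 32 / .var 2 * .var 2) (.lit 2)) (.lit 2)

/-- The entries of the right factor, as a function of the loop variable. -/
def bitVE : Ex :=
  .op .mod (.arr 6 (.var 32 - .var 32 / .var 1 * .var 1) /
    .fold .mul 1 (.var 32 / .var 1) (.lit 2)) (.lit 2)

/-- Writing the output. -/
def output : Prog :=
  .seq (.seq (assign 20 (.var 3 + .lit 16 + .lit 16 * .var 0))
    (assign 21 (.var 20 + .var 0 * .var 2))) <|
  .seq (storeLoop (.var 0 * .var 2) (.var 20 + .var 32) (bitUE.comp 33 3)) <|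
  .seq (storeLoop (.var 2 * .var 1) (.var 21 + .var 32) (bitVE.comp 33 3)) <|
  -- The output convention asks for the two addresses in registers `0` and `1`, which are variable
  -- `0` and temporary `0`.
  .seq (assign 0 (.var 20)) ((Ex.var 21).comp 32 0)

/-- The whole program. -/
def program (m : ℕ) : Prog := .seq prelude (.seq (.seq (setup m) search) output)

/-- Relates the intermediate results of the set-up to quantities already known to be words, so that
the word conditions there become linear. -/
theorem Inst.params_le (I : Inst) : I.m ^ 2 ≤ I.t ∧ I.m ≤ I.G ∧ 12 * I.K ≤ I.t ∧
    I.Q ^ I.K ≤ I.B ∧ I.Q ≤ I.B ∧ I.N ≤ I.Q ∧ I.B ≤ I.G ∧ 2 * I.K ≤ I.Q ∧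
    I.B ^ (I.K * I.t) ≤ I.stageInv ∧ I.I1 * I.K * I.G * 2 ≤ I.stageInv ∧
    I.I1 * I.K ≤ I.stageInv ∧ I.I1 * I.K * I.G ≤ I.stageInv ∧ I.stageInv ^ I.K ≤ I.trials ∧
    I.K * I.t ≤ I.trials ∧ I.G ≤ I.stageInv := by
  have hK := I.hK
  have hm := I.hm
  have hB := I.B_ge
  have hG := I.G_pos
  have hI := I.I1_pos
  have hQ := I.Q_pos
  have hBt : 1 ≤ I.B ^ (I.K * I.t) := Nat.one_le_pow _ _ (by omega)
  have hs : I.stageInv = I.I1 * I.K * I.G * 2 * I.B ^ (I.K * I.t) := rfl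
  have hIKG : 1 ≤ I.I1 * I.K * I.G := Nat.mul_pos (Nat.mul_pos hI hK) hG
  have h1 : I.I1 * I.K * I.G * 2 ≤ I.stageInv := by
    rw [hs]; exact Nat.le_mul_of_pos_right _ hBt
  have h2 : I.I1 * I.K ≤ I.I1 * I.K * I.G := Nat.le_mul_of_pos_right _ hG
  have h3 : I.G ≤ I.I1 * I.K * I.G := Nat.le_mul_of_pos_left _ (Nat.mul_pos hI hK)
  have hQK : I.Q ^ I.K ≤ I.B := Nat.le_mul_of_pos_left _ hK
  have hs1 := I.stageInv_le
  have hKt : I.K * I.t ≤ I.B ^ (I.K * I.t) := (Nat.lt_pow_self (by omega)).le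
  have hBs : I.B ^ (I.K * I.t) ≤ I.stageInv := by
    rw [hs]; exact Nat.le_mul_of_pos_left _ (by omega)
  refine ⟨?_, ?_, ?_, hQK, ?_, ?_, ?_, ?_, hBs, h1, by omega, by omega, ?_, by omega, by omega⟩
  · unfold Inst.t
    exact Nat.le_mul_of_pos_left _ (by omega)
  · exact Nat.le_mul_of_pos_right _ (by omega)
  · unfold Inst.t
    exact Nat.le_mul_of_pos_right _ (by positivity)
  · refine le_trans ?_ hQK
    exact Nat.le_self_pow (by omega) _
  · unfold Inst.Q
    calc I.N ≤ I.N + 1 := by omega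
      _ ≤ _ := Nat.le_mul_of_pos_left _ (by omega)
  · exact Nat.le_mul_of_pos_left _ (by omega)
  · unfold Inst.Q
    exact Nat.le_mul_of_pos_right _ (by omega)
  · unfold Inst.trials; omega

section runs

variable {C : Ctx k} {I : Inst} {s : Gh} {b ct : ℕ}

/-- What `setup` starts from. -/
structure Start (I : Inst) (k : ℕ) (s : Gh) : Prop where
  n : s.v 0 = I.n
  d : s.v 1 = I.d
  k : s.v 2 = k
  base : s.v 3 = I.n * I.d
  log : s.v 6 = 0
  arr : s.a = fun _ _ => 0

theorem run_setup (h : Fits C I) (hS : Start I k s) :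
    Tri C (setup I.m) s (2000 * (I.trials * (I.n * I.d)))
      (fun s' => ∃ c, SInv I (I.n * I.d) c 0 (s'.seta 0 id)) (fun _ => 2 / 3) (2 / 3) := by
  obtain ⟨Z, hZ⟩ : ∃ Z, Z = I.trials * (I.n * I.d) := ⟨_, rfl⟩
  have hz := h.sizes
  obtain ⟨p1, p2, p3, p4, p5, p6, p7, p8, p9, p10, p11, p12, p13, p14, p15⟩ := I.params_le
  have hsi := I.stageInv_le
  rw [← hZ] at hz ⊢
  have hW := hz.word
  have hbase := hz.base
  have hd := hz.d
  have hn := hz.n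
  have hd1 := hz.d1
  have hK := hz.K
  have hK1 := hz.K1
  have ht := hz.t
  have htr := hz.trials
  have hI1 := hz.I1
  have hbase' := h.base
  have hkK : k < I.K := by rw [h.K_eq]; exact Nat.lt_two_pow_self
  have hclog : Nat.clog 2 I.d ≤ I.d := by
    refine Nat.clog_le_of_le_pow Nat.lt_two_pow_self.le
  have e1 : DTri C (assign 4 (.fold .mul 1 (.var 2) (.lit 2))) s (2 + 4 + k * (1 + 5) + 2)
      (s.setv 4 I.K) := by
    refine DTri.assign_ok hz.hW (by omega) (by omega) ?_ (by omega)
    rw [h.K_eq]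
    exact .pow (.var (by omega) hS.k (by omega)) (by omega) (fun _ _ => .lit (by omega)) (by omega)
      (by rw [← h.K_eq]; omega)
  have e2 : DTri C (assign 5 (.lit 12 * .var 4 * .lit (I.m ^ 2))) (s.setv 4 I.K)
      (6 + 2) ((s.setv 4 I.K).setv 5 I.t) := by
    refine DTri.assign_ok hz.hW (by omega) (by omega) ?_ (by omega)
    have : I.t = 12 * I.K * I.m ^ 2 := rfl
    rw [this] at ht p1 p3 ⊢
    exact .mono (.mul (.mul (.lit (by omega)) (.var (by omega) rfl (by omega)) (by omega))
      (.lit (by omega)) (by omega)) (by norm_num)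
  have e3 := Tri.rep (C := C) (s := (s.setv 4 I.K).setv 5 I.t) (r := 10)
    (rl := 1) (N := I.d) (b := 20 + 6 * I.d)
    (body := assign 6 (.var 6 + .op .lt (.fold .mul 1 (.var 6) (.lit 2)) (.var 1))) hz.hW
    (by omega) (by omega) (by omega) (by omega)
    (fun v s => s.v 0 = I.n ∧ s.v 1 = I.d ∧ s.v 2 = k ∧ s.v 3 = I.n * I.d ∧ s.v 4 = I.K ∧
      s.v 5 = I.t ∧ s.v 6 = min v (Nat.clog 2 I.d) ∧ s.a = fun _ _ => 0)
    (fun _ _ => 2 / 3)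
    (fun v s x hs => ⟨hs, rfl⟩) (fun v s hs => hs.2.1)
    (fun v hv s hs hr => ?_) ⟨hS.n, hS.d, hS.k, hS.base, rfl, rfl, by
      simpa [Gh.setv_v] using hS.log, hS.arr⟩
  · refine (e1.seq_tri (e2.seq_tri (e3.seq (B' := 150 + 7 * I.K + 7 * (I.K * I.t) + 7 * I.K)
      fun s1 h1 => ?_))).mono ?_ (fun s' hs' => ⟨hs', le_rfl⟩) le_rfl
    · obtain ⟨f0, f1, f2, f3, f4, f5, f6, f7⟩ := h1
      rw [min_eq_right hclog] at f6
      have hI : I.I1 = Nat.clog 2 I.d + 1 := rfl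
      have hQ : I.Q = 2 * I.K * (6 * I.K * I.m + 1) := rfl
      have hN : I.N = 6 * I.K * I.m := rfl
      have hB : I.B = I.K * I.Q ^ I.K := rfl
      have hG : I.G = I.m * I.B := rfl
      have hSI : I.stageInv = I.I1 * I.K * I.G * 2 * I.B ^ (I.K * I.t) := rfl
      have hTr : I.trials = 2 * I.stageInv ^ I.K := rfl
      have hQ0 := I.Q_pos
      have hB0 := I.B_ge
      have g4 : DTri C (assign 6 (.var 6 + .lit 1)) s1 (2 + 1 + 1 + 2) (s1.setv 6 I.I1) := by
        refine DTri.assign_ok hz.hW (by omega) (by omega) ?_ (by omega)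
        rw [hI]
        exact .add (.var (by omega) f6 (by omega)) (.lit (by omega)) (by omega)
      have g5 : DTri C (assign 13 (.lit 2 * .var 4 * (.lit 6 * .var 4 * .lit I.m + .lit 1)))
          (s1.setv 6 I.I1) (13 + 2) ((s1.setv 6 I.I1).setv 13 I.Q) := by
        refine DTri.assign_ok hz.hW (by omega) (by omega) ?_ (by omega)
        have hv : (Ex.var 4).Ok C 32 (s1.setv 6 I.I1) I.K 2 := .var (by omega) f4 (by omega)
        rw [hQ] at p5 p6 p8 ⊢
        rw [hN] at p6
        exact .mono (.mul (.mul (.lit (by omega)) hv (by omega)) (.add (.mul (.mul (.lit (by omega))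
          hv (by omega)) (.lit (by omega)) (by omega)) (.lit (by omega)) (by omega)) (by omega))
          (by norm_num)
      have g6 : DTri C (assign 14 (.var 4 * .fold .mul 1 (.var 4) (.var 13)))
          ((s1.setv 6 I.I1).setv 13 I.Q) (2 + (2 + 4 + I.K * (2 + 5)) + 1 + 2)
          (((s1.setv 6 I.I1).setv 13 I.Q).setv 14 I.B) := by
        refine DTri.assign_ok hz.hW (by omega) (by omega) ?_ (by omega)
        rw [hB]
        exact .mul (.var (by omega) f4 (by omega)) (.pow (.var (by omega) f4 (by omega)) (by omega)
          (fun _ _ => .var (by omega) rfl (by omega)) hQ0 (by omega)) (by rw [← hB]; omega)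
      have g7 : DTri C (assign 7 (.lit I.m * .var 14))
          (((s1.setv 6 I.I1).setv 13 I.Q).setv 14 I.B) (1 + 2 + 1 + 2)
          ((((s1.setv 6 I.I1).setv 13 I.Q).setv 14 I.B).setv 7 I.G) := by
        refine DTri.assign_ok hz.hW (by omega) (by omega) ?_ (by omega)
        rw [hG]
        exact .mul (.lit (by omega)) (.var (by omega) rfl (by omega)) (by rw [← hG]; omega)
      have g8 : DTri C (assign 15 (.var 4 * .var 5))
          ((((s1.setv 6 I.I1).setv 13 I.Q).setv 14 I.B).setv 7 I.G) (2 + 2 + 1 + 2)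
          (((((s1.setv 6 I.I1).setv 13 I.Q).setv 14 I.B).setv 7 I.G).setv 15 (I.K * I.t)) :=
        DTri.assign_ok hz.hW (by omega) (by omega) (.mul (.var (by omega) f4 (by omega))
          (.var (by omega) f5 (by omega)) (by omega)) (by omega)
      have g9 : DTri C (assign 16 (.var 6 * .var 4 * .var 7 * .lit 2 *
            .fold .mul 1 (.var 15) (.var 14)))
          (((((s1.setv 6 I.I1).setv 13 I.Q).setv 14 I.B).setv 7 I.G).setv 15 (I.K * I.t))
          (10 + (6 + I.K * I.t * (2 + 5)) + 1 + 2)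
          ((((((s1.setv 6 I.I1).setv 13 I.Q).setv 14 I.B).setv 7 I.G).setv 15 (I.K * I.t)).setv 16
            I.stageInv) := by
        refine DTri.assign_ok hz.hW (by omega) (by omega) ?_ (by omega)
        rw [hSI]
        exact .mono (.mul (.mul (.mul (.mul (.var (by omega) rfl (by omega))
          (.var (by omega) f4 (by omega)) (by omega)) (.var (by omega) rfl (by omega)) (by omega))
          (.lit (by omega)) (by omega)) (.pow (.var (by omega) rfl (by omega)) (by omega)
          (fun _ _ => .var (by omega) rfl (by omega)) (by omega) (by omega))
          (by rw [← hSI]; omega)) (by omega)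
      have g10 : DTri C (assign 8 (.lit 2 * .fold .mul 1 (.var 4) (.var 16)))
          ((((((s1.setv 6 I.I1).setv 13 I.Q).setv 14 I.B).setv 7 I.G).setv 15 (I.K * I.t)).setv 16
            I.stageInv) (1 + (2 + 4 + I.K * (2 + 5)) + 1 + 2)
          (((((((s1.setv 6 I.I1).setv 13 I.Q).setv 14 I.B).setv 7 I.G).setv 15 (I.K * I.t)).setv 16
            I.stageInv).setv 8 I.trials) := by
        refine DTri.assign_ok hz.hW (by omega) (by omega) ?_ (by omega)
        rw [hTr]
        exact .mul (.lit (by omega)) (.pow (.var (by omega) f4 (by omega)) (by omega)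
          (fun _ _ => .var (by omega) rfl (by omega)) I.stageInv_pos (by omega)) (by omega)
      have g11 : DTri C (assign 9 (.var 3))
          (((((((s1.setv 6 I.I1).setv 13 I.Q).setv 14 I.B).setv 7 I.G).setv 15 (I.K * I.t)).setv 16
            I.stageInv).setv 8 I.trials) (2 + 2)
          ((((((((s1.setv 6 I.I1).setv 13 I.Q).setv 14 I.B).setv 7 I.G).setv 15 (I.K * I.t)).setv 16
            I.stageInv).setv 8 I.trials).setv 9 (I.n * I.d)) :=
        DTri.assign_ok hz.hW (by omega) (by omega) (.var (by omega) f3 (by omega)) (by omega)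
      refine ((g4.seq (g5.seq (g6.seq (g7.seq (g8.seq (g9.seq (g10.seq g11))))))).mono
        (B' := 150 + 7 * I.K + 7 * (I.K * I.t) + 7 * I.K) (by omega) rfl).tri ⟨s1.v 10, ?_⟩ le_rfl
      have hk2 : 2 ^ s1.v 2 = I.K := by rw [f2, h.K_eq]
      have z5 : s1.a 5 = fun _ => 0 := by rw [f7]
      have z6 : s1.a 6 = fun _ => 0 := by rw [f7]
      refine ⟨⟨f0, f1, hk2, f3, f4, f5, rfl, rfl, rfl⟩, le_rfl, ?_, ?_, ?_,
        ⟨fun j hj => hj, fun j _ j' _ he => he⟩, by omega, by omega, by omega, rfl⟩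
      -- The initial best solution is the all-zero one, present in the cleared memory; its cost is
      -- at most the number of entries.
      · change ∑ j ∈ range I.d, I.dist (s1.a 5) (s1.a 6 j) j ≤ I.n * I.d
        calc _ ≤ ∑ j ∈ range I.d, I.n := sum_le_sum fun j _ => I.dist_le _ _ _
          _ = I.n * I.d := by rw [sum_const, card_range, smul_eq_mul, mul_comm]
      · intro i _
        change s1.a 5 i < _
        rw [z5]; exact hK1
      · intro i _
        change s1.a 6 i < _
        rw [z6]; exact hK1
    · have hdd := hz.dd
      have e7 : I.d * (20 + 6 * I.d + 12) = 32 * I.d + 6 * (I.d * I.d) := by ring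
      omega
  · obtain ⟨f0, f1, f2, f3, f4, f5, f6, f7⟩ := hs
    have hx : 2 ^ min v (Nat.clog 2 I.d) ≤ 2 * I.d := I.two_pow_le (by unfold Inst.I1; omega)
    have hval : min v (Nat.clog 2 I.d) + (if 2 ^ min v (Nat.clog 2 I.d) < I.d then 1 else 0) =
        min (v + 1) (Nat.clog 2 I.d) := by
      have := Nat.lt_clog_iff_pow_lt (b := 2) (by norm_num) (x := I.d)
        (y := min v (Nat.clog 2 I.d))
      split_ifs with hlt
      · have := this.2 hlt; omega
      · have : ¬ _ := fun hh => hlt (this.1 hh)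
        omega
    obtain ⟨x, hxdef⟩ : ∃ x, x = min v (Nat.clog 2 I.d) := ⟨_, rfl⟩
    have hxd : x ≤ I.d := by omega
    rw [← hxdef] at f6 hx hval
    have hlt1 : (if 2 ^ x < I.d then 1 else 0) ≤ 1 := by split_ifs <;> omega
    have := DTri.assign_ok (C := C) (s := s) (r := 6) (x := min (v + 1) (Nat.clog 2 I.d))
      (e := .var 6 + .op .lt (.fold .mul 1 (.var 6) (.lit 2)) (.var 1)) (c := 18 + 6 * I.d) hz.hW
      (by omega) (by omega) (by
        rw [← hval]
        exact .mono (.add (.var (by omega) f6 (by omega)) (.lt (.pow (x := 2) (.var (by omega) f6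
          (by omega)) (by omega) (fun _ _ => .lit (by omega)) (by omega) (by omega))
          (.var (by omega) f1 (by omega)) (by omega)) (by omega)) (by omega)) (by omega)
    exact (this.mono (by omega) rfl).tri ⟨⟨f0, f1, f2, f3, f4, f5, rfl, f7⟩, hr⟩ le_rfl

/-- Writing consecutive memory cells behind the arrays. -/
theorem run_write (hW : 16 < C.M.word) {ra : ℕ} (hra : ra < 32) {lim body : Ex} {σ : State}
    (hg : C.Good σ) (hs : C.abs σ = s) {N A n cl : ℕ} (hA : s.v ra = A)
    (hlim : lim.Ok C 32 s N cl) (hAn : C.base + 16 + 16 * n ≤ A) (hw : A + N < C.M.word)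
    (val : ℕ → ℕ)
    (hbody : ∀ v < N, ∀ a : ℕ → ℕ → ℕ, (∀ id < 16, ∀ i < n, a id i = s.a id i) →
      body.Ok C 33 ((⟨s.v, a⟩ : Gh).setv 32 v) (val v) b) (c : ℝ≥0∞) :
    SRun C.M (storeLoop lim (.var ra + .var 32) (body.comp 33 3)) σ (cl + 3 + N * (b + 5 + 5))
      (fun σ' => C.Good σ' ∧ (∀ r < 32, σ'.reg (vR r) = σ.reg (vR r)) ∧
        (∀ u < N, σ'.mem (A + u) = val u) ∧ ∀ a < A, σ'.mem a = σ.mem a) (fun _ => c) c := by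
  refine (storeLoop_run hW (pre := body.comp 33 3) hg hs hlim.1 (b := b) (ca := 5) hlim.2.1
    (by omega) (fun v => A + v) (addr := .var ra + .var 32) (fun v hv σ1 hI hg1 => ?_)
    (fun v m => (∀ u < v, m (A + u) = val u) ∧ ∀ a < A, m a = σ.mem a) (fun _ _ => c)
    ⟨by omega, fun _ _ => rfl⟩ (fun v hv σ1 hI hg1 hP => ?_)).mono (by
      have := hlim.2.2; omega) (fun _ h => ⟨h, le_rfl⟩) le_rfl
  · have ag := hI.agree hs
    have : (Ex.var ra + .var 32).Ok C 33 ((⟨s.v, C.arrs σ1.mem⟩ : Gh).setv 32 v) (A + v) 5 :=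
      .add (c := 2) (c' := 2) (.var (by omega) (by rw [Gh.setv_v_of_ne _ _ (by omega)]; exact hA)
        (by omega)) (.var (by omega) (by simp) (by omega)) (by omega)
    obtain ⟨h1, h2, h3⟩ := this
    exact ⟨(Ex.safe_congr C _ ag).2 h1, (Ex.eval_congr C _ ag).trans h2, by omega,
      (Ex.cst_congr C _ ag).trans_le h3⟩
  · have ag := hI.agree hs
    obtain ⟨b1, b2, b3⟩ := hbody v hv (C.arrs σ1.mem) (fun id hid i hi => by
      rw [← hs]
      simp only [Ctx.arrs, Ctx.abs, Ctx.gh, hid, if_true]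
      exact hP.2 _ (by omega))
    have hrun := Ex.comp_ok hW body (D := 33) (j := 3) (by omega) hg1
      ((Ex.safe_congr C body ag).2 b1)
    rw [Ex.cst_congr C body ag, Ex.eval_congr C body ag, b2] at hrun
    refine SRun.of_dRun (hrun.mono b3 ?_) fun _ _ => le_rfl
    rintro σ2 ⟨hp, hval⟩
    refine ⟨hp, fun u hu => ?_, fun a ha => ?_⟩
    · rw [Function.update_apply]
      split_ifs with h1
      · rw [hval]; congr 1; omega
      · exact hP.1 u (by omega)
    · rw [Function.update_of_ne (by omega)]
      exact hP.2 a ha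

end runs

section runs

variable {C : Ctx k} {I : Inst} {s : Gh} {σ : State} {b ct : ℕ}

/-- The memory holds the bits of `bu` row by row, and then those of `bv` column by column. -/
def Written (n d k : ℕ) (bu bv : ℕ → ℕ) (σ : State) : Prop :=
  (∀ i < n, ∀ l < k, σ.mem (σ.reg 0 + i * k + l) = bu i / 2 ^ l % 2) ∧
    ∀ l < k, ∀ j < d, σ.mem (σ.reg 1 + l * d + j) = bv j / 2 ^ l % 2

theorem mul_add_lt {i n d j : ℕ} (hi : i < n) (hj : j < d) : i * d + j < n * d :=
  calc i * d + j < i * d + d := by omega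
    _ = (i + 1) * d := by ring
    _ ≤ _ := Nat.mul_le_mul_right _ hi

theorem mul_add_div {i d j : ℕ} (hj : j < d) : (i * d + j) / d = i := by
  rw [mul_comm, Nat.mul_add_div (by omega), Nat.div_eq_of_lt hj, add_zero]

/-- The output starts at address `n * d + 16 + 16 * n`, behind all array cells with index below `n`.
As `d ≤ n`, the arrays `5` and `6` with the best solution are not overwritten while they are read;
the remaining arrays are no longer needed. -/
theorem run_output (h : Fits C I) (hS : SInv I b ct 0 (s.seta 0 id)) (hg : C.Good σ)
    (hs : C.abs σ = s) (x : ℝ≥0∞) :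
    SRun C.M output σ (400 * (I.trials * (I.n * I.d)))
      (Written I.n I.d k (s.a 5) (s.a 6)) (fun _ => x) x := by
  have hz := h.sizes
  have hK2 := h.K_eq
  have hle := h.le
  have hbaseC := h.base
  obtain ⟨Z, hZ⟩ : ∃ Z, Z = I.trials * (I.n * I.d) := ⟨_, rfl⟩
  rw [← hZ] at hz ⊢
  have hW := hz.word
  have hbase := hz.base
  have hn := hz.n
  have hn1 := hz.n1
  have hd := hz.d
  have hd1 := hz.d1
  have hK := hz.K
  have hK1 := hz.K1
  have e := hS.env
  have hv0 : s.v 0 = I.n := e.n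
  have hv1 : s.v 1 = I.d := e.d
  have hv3 : s.v 3 = I.n * I.d := e.base
  have hv2 : s.v 2 = k := by
    have := e.k
    rw [hK2] at this
    exact Nat.pow_right_injective le_rfl this
  have hkK : k < I.K := by rw [hK2]; exact Nat.lt_two_pow_self
  have hnK : I.n * (I.K * I.K) ≤ Z := by
    refine le_trans ?_ (hz.nKKt (I.K - 1) (by omega))
    rw [Nat.sub_add_cancel hK1]
    exact Nat.mul_le_mul_left _ (Nat.mul_le_mul_left _ (Nat.le_mul_of_pos_right _ hz.t1))
  have hnk : I.n * k * (40 + 6 * k) ≤ 46 * Z := by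
    calc I.n * k * (40 + 6 * k) ≤ I.n * k * (46 * I.K) := Nat.mul_le_mul_left _ (by omega)
      _ ≤ I.n * I.K * (46 * I.K) := by gcongr
      _ = 46 * (I.n * (I.K * I.K)) := by ring
      _ ≤ _ := by omega
  have hnk' : I.n * k ≤ Z := by
    refine le_trans (Nat.mul_le_mul_left _ ?_) hnK
    exact hkK.le.trans (Nat.le_mul_of_pos_left _ hK1)
  have hkd : k * I.d ≤ I.n * k := by
    rw [mul_comm]; exact Nat.mul_le_mul_right _ hle
  have hkd' : k * I.d * (40 + 6 * k) ≤ 46 * Z := (Nat.mul_le_mul_right _ hkd).trans hnk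
  obtain ⟨A, hA⟩ : ∃ A, A = I.n * I.d + 16 + 16 * I.n := ⟨_, rfl⟩
  have hA' : A ≤ 33 * Z := by omega
  obtain ⟨s1, hs1⟩ : ∃ s1, s1 = (s.setv 20 A).setv 21 (A + I.n * k) := ⟨_, rfl⟩
  have hpow : ∀ l < k, 2 ^ l < C.M.word := fun l hl => by
    have : 2 ^ l ≤ I.K := by rw [hK2]; exact Nat.pow_le_pow_right (by omega) hl.le
    omega
  have e1 : DTri C (.seq (assign 20 (.var 3 + .lit 16 + .lit 16 * .var 0))
      (assign 21 (.var 20 + .var 0 * .var 2))) s ((9 + 2) + (8 + 2)) s1 := by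
    rw [hs1]
    refine DTri.seq (s1 := s.setv 20 A) (DTri.assign_ok hz.hW (by omega) (by omega) ?_ (by omega))
      (DTri.assign_ok hz.hW (by omega) (by omega) ?_ (by omega))
    · rw [hA]
      exact .mono (.add (.add (.var (by omega) hv3 (by omega)) (.lit (by omega)) (by omega))
        (.mul (.lit (by omega)) (.var (by omega) hv0 (by omega)) (by omega)) (by omega))
        (by norm_num)
    · exact .mono (.add (.var (by omega) rfl (by omega)) (.mul (.var (by omega) hv0 (by omega))
        (.var (by omega) hv2 (by omega)) (by omega)) (by omega)) (by norm_num)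
  have e1' := e1 (fun _ => x) σ hg hs
  refine SRun.mono (B := ((9 + 2) + (8 + 2)) + ((5 + 3 + I.n * k * (30 + 6 * k + 5 + 5)) +
    ((5 + 3 + k * I.d * (30 + 6 * k + 5 + 5)) + (2 + 2 + 2)))) (SRun.seq e1' fun σ1 h1 => ?_)
    ?_ (fun _ h => ⟨h, le_rfl⟩) le_rfl
  swap
  · have e1 : 30 + 6 * k + 5 + 5 = 40 + 6 * k := by ring
    rw [e1]
    omega
  obtain ⟨hg1, ha1⟩ := h1
  have q0 : s1.v 0 = I.n := by rw [hs1]; exact hv0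
  have q1 : s1.v 1 = I.d := by rw [hs1]; exact hv1
  have q2 : s1.v 2 = k := by rw [hs1]; exact hv2
  have q20 : s1.v 20 = A := by rw [hs1]; rfl
  have q21 : s1.v 21 = A + I.n * k := by rw [hs1]; rfl
  have qa : s1.a = s.a := by rw [hs1]; rfl
  have w1 := run_write (b := 30 + 6 * k) (n := I.n) hz.hW (ra := 20) (by omega)
    (lim := .var 0 * .var 2) (body := bitUE) hg1 ha1 q20 (N := I.n * k) (cl := 5)
    (.mul (.var (by omega) q0 (by omega)) (.var (by omega) q2 (by omega)) (by omega))
    (by omega) (by omega) (fun v => s.a 5 (v / k) / 2 ^ (v - v / k * k) % 2)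
    (fun v hv a ha => by
      have hk0 : 0 < k := Nat.pos_of_ne_zero (by rintro rfl; simp at hv)
      have hlt : v / k < I.n := (Nat.div_lt_iff_lt_mul hk0).2 hv
      have hl : v - v / k * k < k := by
        have := Nat.div_add_mod' v k; have := Nat.mod_lt v hk0; omega
      have hvk : v / k * k ≤ v := Nat.div_mul_le_self v k
      have h5 : a 5 (v / k) = s.a 5 (v / k) := by rw [ha 5 (by omega) _ hlt, qa]
      have hbu : s.a 5 (v / k) < I.K := hS.bu _ hlt
      have vv : (Ex.var 32).Ok C 33 ((⟨s1.v, a⟩ : Gh).setv 32 v) v 2 :=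
        .var (by omega) rfl (by omega)
      have vk : (Ex.var 2).Ok C 33 ((⟨s1.v, a⟩ : Gh).setv 32 v) k 2 :=
        .var (by omega) q2 (by omega)
      have vd := vv.div vk (by omega)
      refine Ex.Ok.mono (Ex.Ok.op (o := .mod) (.div (.arr vd (by omega) h5 (by omega))
        (.pow (.sub vv (.mul vd vk (by omega)) (by omega)) (by omega) (fun _ _ => .lit (by omega))
          (by omega) (hpow _ hl)) (by omega)) (.lit (x := 2) (by omega)) ?_) (by omega)
      exact (Nat.mod_lt _ (by omega)).trans (by omega)) x
  refine SRun.seq w1 fun σ2 h2 => ?_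
  obtain ⟨hg2, hr2, hm2, hlow2⟩ := h2
  have ha2 := abs_of_regs (C := C) hr2
  rw [ha1] at ha2
  have h6 : ∀ j < I.d, C.arrs σ2.mem 6 j = s.a 6 j := fun j hj => by
    rw [← qa, ← ha1]
    simp only [Ctx.arrs, Ctx.abs, Ctx.gh]
    rw [if_pos (by omega), if_pos (by omega)]
    exact hlow2 _ (by omega)
  have w2 := run_write (b := 30 + 6 * k) (n := I.n) hz.hW (ra := 21) (by omega)
    (lim := .var 2 * .var 1) (body := bitVE) hg2 ha2 q21 (N := k * I.d) (cl := 5)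
    (.mul (.var (by omega) q2 (by omega)) (.var (by omega) q1 (by omega)) (by omega))
    (by omega) (by omega) (fun v => s.a 6 (v - v / I.d * I.d) / 2 ^ (v / I.d) % 2)
    (fun v hv a ha => by
      have hlt : v / I.d < k := (Nat.div_lt_iff_lt_mul hd1).2 hv
      have hj : v - v / I.d * I.d < I.d := by
        have := Nat.div_add_mod' v I.d; have := Nat.mod_lt v hd1; omega
      have hvk : v / I.d * I.d ≤ v := Nat.div_mul_le_self v I.d
      have h5 : a 6 (v - v / I.d * I.d) = s.a 6 (v - v / I.d * I.d) := by
        rw [ha 6 (by omega) _ (by omega)]; exact h6 _ hj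
      have hbv : s.a 6 (v - v / I.d * I.d) < I.K := hS.bv _ hj
      have vv : (Ex.var 32).Ok C 33 ((⟨s1.v, a⟩ : Gh).setv 32 v) v 2 :=
        .var (by omega) rfl (by omega)
      have vk : (Ex.var 1).Ok C 33 ((⟨s1.v, a⟩ : Gh).setv 32 v) I.d 2 :=
        .var (by omega) q1 (by omega)
      have vd := vv.div vk (by omega)
      refine Ex.Ok.mono (Ex.Ok.op (o := .mod) (.div (.arr (.sub vv (.mul vd vk (by omega))
        (by omega)) (by omega) h5 (by omega)) (.pow vd (by omega) (fun _ _ => .lit (by omega))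
          (by omega) (hpow _ hlt)) (by omega)) (.lit (x := 2) (by omega)) ?_) (by omega)
      exact (Nat.mod_lt _ (by omega)).trans (by omega)) x
  refine SRun.seq w2 fun σ3 h3 => ?_
  obtain ⟨hg3, hr3, hm3, hlow3⟩ := h3
  have ha3 := abs_of_regs (C := C) hr3
  rw [ha2] at ha3
  obtain ⟨o1, o2, o3⟩ := Ex.Ok.var (C := C) (D := 32) (s := C.abs σ3) (r := 21) (x := A + I.n * k)
    (by omega) (by rw [ha3]; exact q21) (by omega)
  obtain ⟨o4, o5, o6⟩ := Ex.Ok.var (C := C) (D := 32) (s := C.abs σ3) (r := 20) (x := A)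
    (by omega) (by rw [ha3]; exact q20) (by omega)
  refine SRun.of_dRun (Φ := Written I.n I.d k (s.a 5) (s.a 6)) ?_ fun _ _ => le_rfl
  refine DRun.seq (Φ := fun σ4 => σ4.mem = σ3.mem ∧ σ4.reg (vR 0) = A ∧ C.Good σ4 ∧
    (C.abs σ4) = (C.abs σ3).setv 0 A) ?_ fun σ4 h4 => ?_
  · refine DRun.seq (comp_abs hz.hW (j := 0) hg3 rfl o4 |>.mono o6 fun _ h => h) fun σ5 h5 => ?_
    refine ((DRun.const (by omega)).seq_eq (DRun.arith ?_)).mono le_rfl ?_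
    · simp only [Op.eval, State.setReg_reg, if_true, tR_ne_vR, if_false, h5.2, o5]
      omega
    · rintro σ' rfl
      have hg5 := h5.1.good (by omega) hg3
      refine ⟨h5.1.1, ?_, ⟨?_, ?_⟩, ?_⟩
      · simp [Op.eval, h5.2, o5]
      · simpa using hg5.1
      · simpa using hg5.2
      · rw [abs_setReg (by omega), abs_setReg (by omega), h5.1.abs_eq]
        ext x y
        · simp only [Gh.setv_v]
          split_ifs <;> simp [Op.eval, h5.2, o5]
        · rfl
  · obtain ⟨m4, r4, g4, a4⟩ := h4
    obtain ⟨o1, o2, o3⟩ := Ex.Ok.var (C := C) (D := 32) (s := (C.abs σ3).setv 0 A) (r := 21)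
      (x := A + I.n * k) (by omega) (by rw [Gh.setv_v_of_ne _ _ (by omega), ha3]; exact q21)
      (by omega)
    refine (comp_abs hz.hW (j := 0) g4 a4 o1).mono o3 fun σ5 h5 => ?_
    have r0 : σ5.reg 0 = A := (h5.1.2.1 0 (by omega)).trans r4
    have r1 : σ5.reg 1 = A + I.n * k := h5.2.trans o2
    unfold Written
    rw [r0, r1, h5.1.1, m4]
    refine ⟨fun i hi l hl => ?_, fun l hl j hj => ?_⟩
    · have := mul_add_lt hi hl
      rw [add_assoc, hlow3 _ (by omega), hm2 _ this, mul_add_div hl, Nat.add_sub_cancel_left]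
    · rw [add_assoc, hm3 _ (mul_add_lt hl hj), mul_add_div hj, Nat.add_sub_cancel_left]

end runs

/-! ### Correctness of the whole program -/

/-- The final state holds a solution that is nearly as good as the target. -/
def Solved (I : Inst) (k : ℕ) (σ : State) : Prop :=
  ∃ bu bv : ℕ → ℕ, (∀ i < I.n, bu i < I.K) ∧ (∀ j < I.d, bv j < I.K) ∧
    I.m * ∑ j ∈ range I.d, I.dist bu (bv j) j ≤ (I.m + 10) * I.opt ∧ Written I.n I.d k bu bv σ

open Classical in
theorem run_program {n d : ℕ} {A : Matrix (Fin n) (Fin d) Bool} {M : Machine k} {I : Inst}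
    (hn : I.n = n) (hd : I.d = d) (h : Fits ⟨M, n * d, (inputState k A).mem⟩ I) :
    SRun M (program I.m) (inputState k A)
      (9000 * (I.trials * (I.K * (I.trials * (I.n * I.d) * (M.queryTime + 1)))))
      (fun _ => True) (fun σ => if Solved I k σ then 1 else 0) (2 / 3) := by
  obtain ⟨C, hC⟩ : ∃ C : Ctx k, C = ⟨M, n * d, (inputState k A).mem⟩ := ⟨_, rfl⟩
  have hM : C.M = M := by rw [hC]
  have hb : C.base = n * d := by rw [hC]
  have hi : C.inp = (inputState k A).mem := by rw [hC]
  rw [← hC] at h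
  rw [← hM]
  have hz := h.sizes
  have hK2 := h.K_eq
  have hkK : k < I.K := by rw [hK2]; exact Nat.lt_two_pow_self
  have hX1 : 1 ≤ I.trials := by have := I.stageInv_le; have := I.stageInv_pos; omega
  obtain ⟨Z, hZ⟩ : ∃ Z, Z = I.trials * (I.n * I.d) := ⟨_, rfl⟩
  have hsetup := fun s hS => run_setup (s := s) h hS
  have hsearch := fun s ct hS => run_search (s := s) (ct := ct) h hS
  have hout := fun σ s ct hS hg hs x => run_output (σ := σ) (s := s) (b := I.n * I.d) (ct := ct)
    h hS hg hs x
  rw [← hZ] at hz hsetup hsearch hout ⊢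
  have hW := hz.word
  have hK := hz.K
  have hdZ := hz.d
  have hbase := hz.base
  have hT1 : Z ≤ I.trials * (I.K * (Z * (C.M.queryTime + 1))) :=
    calc Z ≤ Z * (C.M.queryTime + 1) := Nat.le_mul_of_pos_right _ (by omega)
      _ ≤ I.K * (Z * (C.M.queryTime + 1)) := Nat.le_mul_of_pos_left _ hz.K1
      _ ≤ _ := Nat.le_mul_of_pos_left _ hX1
  have hZ1 := hz.d1
  refine SRun.mono (B := 5 + ((2000 * Z + 6000 * (I.trials * (I.K * (Z * (C.M.queryTime + 1))))) +
    400 * Z)) (Ψ := fun _ => True) (Φ := fun _ => True) ?_ (by omega)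
    (fun _ _ => ⟨trivial, le_rfl⟩) le_rfl
  refine SRun.seq (Φ := fun σ => C.Good σ ∧ Start I k (C.abs σ)) (g := fun _ => 2 / 3)
    (SRun.of_dRun ?_ fun _ _ => le_rfl) fun σ hσ => ?_
  · refine DRun.mono (((DRun.const (by omega)).seq_eq ((DRun.arith ?_).seq_eq
      ((DRun.const (by omega)).seq_eq ((DRun.arith ?_).seq_eq (DRun.arith ?_)))))) le_rfl ?_
    · simp [Op.eval, inputState]; omega
    · simp [Op.eval, inputState]; omega
    · simp [Op.eval, inputState]; omega
    · rintro σ' rfl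
      refine ⟨⟨?_, fun x hx => ?_⟩, ?_, ?_, ?_, ?_, ?_, ?_⟩
      · simp [Op.eval, inputState, vR, hb]
      · simp [hi]
      · simp [Ctx.abs, Op.eval, inputState, vR, hn]
      · simp [Ctx.abs, Op.eval, inputState, vR, hd]
      · simp [Ctx.abs, Op.eval, inputState, vR]
      · simp [Ctx.abs, Op.eval, inputState, vR, hn, hd]
      · simp [Ctx.abs, Op.eval, inputState, vR]
      · funext id idx
        simp only [Ctx.abs, Ctx.gh, State.setReg_mem, inputState]
        split_ifs with h1 h2
        · exact absurd ((Nat.div_lt_iff_lt_mul h2.2).1 h2.1) (by rw [hb]; omega)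
        · rfl
        · rfl
  · have h1 := Tri.seq (hsetup _ hσ.2) fun s' hs' => (hsearch s' hs'.choose hs'.choose_spec)
    refine SRun.seq (h1 σ hσ.1 rfl) fun σ1 h1 => ?_
    obtain ⟨hg, c, hS⟩ := h1
    refine (hout σ1 _ c hS hg rfl (ind (Win I) (C.abs σ1))).mono le_rfl (fun σ2 h2 =>
      ⟨trivial, ?_⟩) le_rfl
    by_cases hw : Win I (C.abs σ1)
    · rw [if_pos]
      · rw [ind_of hw]
      · exact ⟨_, _, hS.bu, hS.bv, (Nat.mul_le_mul_left _ hS.sol).trans hw, h2⟩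
    · rw [ind_of_not hw]
      exact zero_le

theorem exists_bitVec (x : Fin k → Bool) : ∃ a < 2 ^ k, bitVec k a = x :=
  ⟨Nat.ofBits x, Nat.ofBits_lt_two_pow x, funext fun l => Nat.testBit_ofBits_lt x l l.2⟩

/-- The instance belongs to a problem. -/
structure Presents (M : Machine k) {n d : ℕ} (A : Matrix (Fin n) (Fin d) Bool) (I : Inst) :
    Prop where
  n : I.n = n
  d : I.d = d
  K : I.K = 2 ^ k
  a : ∀ i j, (inputState k A).mem (i * I.d + j) = I.a i j
  mis : ∀ x y b, 1 - M.answer x y b = I.mis x y b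

theorem inputState_mem {n d : ℕ} (A : Matrix (Fin n) (Fin d) Bool) (i : Fin n) (j : Fin d) :
    (inputState k A).mem (i * d + j) = (A i j).toNat := by
  have h1 : (i * d + j : ℕ) / d = i := mul_add_div j.2
  have h2 : (i * d + j : ℕ) % d = j := by rw [Nat.mul_add_mod', Nat.mod_eq_of_lt j.2]
  have hd : 0 < d := by have := j.2; omega
  simp [inputState, h1, h2, hd]

theorem inputState_mem_le {n d : ℕ} (A : Matrix (Fin n) (Fin d) Bool) (a : ℕ) :
    (inputState k A).mem a ≤ 1 := by
  simp only [inputState]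
  split_ifs
  · exact Bool.toNat_le _
  · exact zero_le_one

/-- An entry of the difference is nonzero exactly when the query for that bit of `A` is answered by
`0`, that is, when the labels mispredict it. -/
theorem Presents.cost_eq {M : Machine k} {n d : ℕ} {A : Matrix (Fin n) (Fin d) Bool} {I : Inst}
    (h : Presents M A I) (bu bv : ℕ → ℕ) {U : Matrix (Fin n) (Fin k) Bool}
    {V : Matrix (Fin k) (Fin d) Bool} (hU : ∀ i : Fin n, U i = bitVec k (bu i))
    (hV : ∀ j : Fin d, (fun l => V l j) = bitVec k (bv j)) :
    cost M.ip A U V = ∑ j ∈ range I.d, I.dist bu (bv j) j := by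
  classical
  obtain ⟨rfl, rfl, -, ha, hmis⟩ := h
  unfold cost nnz
  rw [Set.ncard_eq_toFinset_card', Set.toFinset_ofPred, card_filter, ← univ_product_univ,
    sum_product_right]
  unfold Inst.dist
  rw [sum_range fun j => ∑ i ∈ range I.n, I.mis (bu i) (bv j) (I.a i j)]
  refine sum_congr rfl fun j _ => ?_
  rw [sum_range fun i => I.mis (bu i) (bv j) (I.a i j)]
  refine sum_congr rfl fun i _ => ?_
  rw [← hmis, ← ha, inputState_mem]
  simp only [Matrix.sub_apply, Matrix.map_apply, genMul, hU, hV, Machine.answer]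
  have : bitVal (A i j) = ((A i j).toNat : ℝ) := by cases A i j <;> simp [bitVal]
  rw [this]
  by_cases he : M.ip (bitVec k (bu i)) (bitVec k (bv j)) = ((A i j).toNat : ℝ)
  · rw [if_pos he, if_neg (not_not.2 (sub_eq_zero.2 he.symm))]
  · rw [if_neg he, if_pos (sub_ne_zero.2 (Ne.symm he))]

/-- The target solution is an optimal pair with its rows and columns encoded as numbers. `IsMis`
holds because a real number cannot equal both `0` and `1`; it may well equal neither. -/
theorem exists_presents (M : Machine k) {n d : ℕ} (A : Matrix (Fin n) (Fin d) Bool) (hd : 1 ≤ d)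
    {m : ℕ} (hm : 10 ≤ m) : ∃ I : Inst, I.m = m ∧ Presents M A I ∧ I.opt = opt M.ip A := by
  classical
  obtain ⟨⟨U, V⟩, hUV⟩ : ∃ UV : Matrix (Fin n) (Fin k) Bool × Matrix (Fin k) (Fin d) Bool,
      cost M.ip A UV.1 UV.2 = opt M.ip A := Nat.sInf_mem (Set.range_nonempty _)
  choose enc henc hbit using exists_bitVec (k := k)
  let I : Inst :=
    { mis := fun x y b => 1 - M.answer x y b
      hmis := ⟨fun _ _ _ => Nat.sub_le _ _, fun x y => by
        by_cases h0 : M.ip (bitVec k x) (bitVec k y) = 0 <;> simp [Machine.answer, h0]⟩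
      a := fun i j => (inputState k A).mem (i * d + j)
      ha := fun i j => inputState_mem_le A _
      n := n
      d := d
      hd := hd
      K := 2 ^ k
      hK := Nat.one_le_two_pow
      us := fun i => if hi : i < n then enc (U ⟨i, hi⟩) else 0
      vs := fun j => if hj : j < d then enc (fun l => V l ⟨j, hj⟩) else 0
      hus := fun i => by
        split_ifs
        · exact henc _
        · exact Nat.two_pow_pos k
      hvs := fun j => by
        split_ifs
        · exact henc _
        · exact Nat.two_pow_pos k
      m := m
      hm := hm }
  have hI : Presents M A I := ⟨rfl, rfl, rfl, fun _ _ => rfl, fun _ _ _ => rfl⟩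
  refine ⟨I, rfl, hI, ?_⟩
  rw [← hUV]
  refine (hI.cost_eq I.us I.vs (fun i => ?_) fun j => ?_).symm
  · simp [I, hbit]
  · simp [I, hbit]

/-- A winning solution is within the factor `1 + 10 / m` of the optimum, and `10 / m ≤ ε`. -/
theorem Presents.isApprox {M : Machine k} {n d : ℕ} {A : Matrix (Fin n) (Fin d) Bool} {I : Inst}
    (h : Presents M A I) (ho : I.opt = opt M.ip A) {ε : ℝ} (hε : 10 ≤ I.m * ε) {σ : State}
    (hσ : Solved I k σ) : IsApprox (1 + ε) M.ip A σ := by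
  obtain ⟨bu, bv, h1, h2, h3, h4, h5⟩ := hσ
  rw [h.n] at h4
  rw [h.d] at h5
  have bit : ∀ x l : ℕ, decide (x / 2 ^ l % 2 ≠ 0) = x.testBit l := fun x l => by
    rw [Nat.testBit_eq_decide_div_mod_eq]
    refine decide_eq_decide.2 ?_
    omega
  have hc := h.cost_eq bu bv (U := outputU n k σ) (V := outputV d k σ)
    (fun i => funext fun l => by
      simp only [outputU, bitVec]
      rw [h4 i i.2 l l.2, bit])
    (fun j => funext fun l => by
      simp only [outputV, bitVec]
      rw [h5 l l.2 j j.2, bit])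
  unfold IsApprox
  rw [hc, ← ho]
  have hm : (0 : ℝ) < I.m := by exact_mod_cast (by have := I.hm; omega : 0 < I.m)
  have h6 : (I.m : ℝ) * ((∑ j ∈ range I.d, I.dist bu (bv j) j : ℕ) : ℝ) ≤ (I.m + 10) * I.opt := by
    exact_mod_cast h3
  have h7 : (0 : ℝ) ≤ I.opt := Nat.cast_nonneg _
  refine le_of_mul_le_mul_left (h6.trans ?_) hm
  calc ((I.m : ℝ) + 10) * I.opt ≤ (I.m + I.m * ε) * I.opt :=
        mul_le_mul_of_nonneg_right (by linarith) h7
    _ = _ := by ring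

theorem expect_indicator {α : Type*} (μ : PMF α) (S : Set α) [DecidablePred (· ∈ S)] :
    expect μ (fun x => if x ∈ S then 1 else 0) = μ.toOuterMeasure S := by
  unfold expect
  rw [PMF.toOuterMeasure_apply]
  refine tsum_congr fun x => ?_
  by_cases hx : x ∈ S <;> simp [hx]

/-- The algorithm is correct if the machine is large enough for it. -/
theorem exists_exec {n d m : ℕ} (hm : 10 ≤ m) (hd : 1 ≤ d) (hdn : d ≤ n) {ε : ℝ} (hε : 10 ≤ m * ε)
    (M : Machine k) (A : Matrix (Fin n) (Fin d) Bool) {T : ℝ}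
    (hT : ∀ I : Inst, I.m = m → I.n = n → I.d = d → I.K = 2 ^ k →
      ((9000 * (I.trials * (I.K * (I.trials * (I.n * I.d) * (M.queryTime + 1)))) : ℕ) : ℝ) ≤ T ∧
        1000 * (I.trials * (I.n * I.d)) < M.word) :
    ∃ μ, Exec M (program m) (inputState k A) μ ∧ (∀ s ∈ μ.support, (s.2 : ℝ) ≤ T) ∧
      2 / 3 ≤ μ.toOuterMeasure {s | IsApprox (1 + ε) M.ip A s.1} := by
  classical
  obtain ⟨I, rfl, hI, ho⟩ := exists_presents M A hd hm
  obtain ⟨h1, h2⟩ := hT I rfl hI.n hI.d hI.K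
  obtain ⟨μ, h3, h4, h5⟩ := run_program (A := A) (M := M) hI.n hI.d
    ⟨hI.K, by rw [hI.n, hI.d], hI.a, hI.mis, by rw [hI.n, hI.d]; exact hdn, h2⟩
  refine ⟨μ, h3, fun s hs => le_trans (by exact_mod_cast (h4 s hs).1) h1, ?_⟩
  rw [← expect_indicator]
  refine h5.trans (expect_mono _ fun s _ => ?_)
  beta_reduce
  by_cases h6 : Solved I k s.1
  · have h7 : s ∈ {s : State × ℕ | IsApprox (1 + ε) M.ip A s.1} := hI.isApprox ho hε h6
    rw [if_pos h6, if_pos h7]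
  · rw [if_neg h6]
    exact zero_le

/-! ### Estimates for the running time -/

section bounds

variable {I : Inst} {E : ℝ}

/-- With `E = 1 / ε ≥ 2` in mind, every parameter is at most a power of `E` by `x ≤ 2 ^ x ≤ E ^ x`.
The factor `I1` is kept apart because it is the only one that depends on `d`. -/
theorem Inst.trials_le_pow (hE : 2 ≤ E) (hm : (I.m : ℝ) ≤ 15 * E) :
    (I.trials : ℝ) ≤ 2 * (I.I1 : ℝ) ^ I.K * E ^ (31 * I.K ^ 3 * (I.K * I.t)) := by
  have hK := I.hK
  have ht := I.t_pos
  have hKt : 1 ≤ I.K * I.t := Nat.mul_pos hK ht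
  have hKK : I.K ≤ I.K ^ 2 := Nat.le_self_pow (by omega) _
  have hE1 : (1 : ℝ) ≤ E := by linarith
  have hE0 : (0 : ℝ) ≤ E := by linarith
  have two : ∀ j : ℕ, (2 : ℝ) ^ j ≤ E ^ j := fun j => pow_le_pow_left₀ (by norm_num) hE j
  have hKE : (I.K : ℝ) ≤ E ^ I.K :=
    le_trans (by exact_mod_cast Nat.lt_two_pow_self.le) (two _)
  have hmE : (I.m : ℝ) ≤ E ^ 5 :=
    calc (I.m : ℝ) ≤ 15 * E := hm
      _ ≤ 2 ^ 4 * E := by nlinarith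
      _ ≤ E ^ 4 * E := by gcongr
      _ = E ^ 5 := by ring
  have hQ : (I.Q : ℝ) ≤ E ^ (11 * I.K) := by
    have h1 : I.Q ≤ 2 ^ 4 * I.K * I.K * I.m := by
      have := I.hm
      unfold Inst.Q Inst.N
      have h2 : 1 ≤ I.K * I.m := Nat.mul_pos hK (by omega)
      calc 2 * I.K * (6 * I.K * I.m + 1) = 2 * I.K * (6 * (I.K * I.m) + 1) := by ring
        _ ≤ 2 * I.K * (8 * (I.K * I.m)) := Nat.mul_le_mul_left _ (by omega)
        _ = _ := by ring
    calc (I.Q : ℝ) ≤ 2 ^ 4 * I.K * I.K * I.m := by exact_mod_cast h1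
      _ ≤ E ^ 4 * E ^ I.K * E ^ I.K * E ^ 5 := by gcongr
      _ = E ^ (4 + I.K + I.K + 5) := by ring
      _ ≤ _ := pow_le_pow_right₀ hE1 (by omega)
  have hB : (I.B : ℝ) ≤ E ^ (12 * I.K ^ 2) := by
    unfold Inst.B
    push_cast
    calc (I.K : ℝ) * (I.Q : ℝ) ^ I.K ≤ E ^ I.K * (E ^ (11 * I.K)) ^ I.K := by gcongr
      _ = E ^ (I.K + 11 * I.K ^ 2) := by ring
      _ ≤ _ := pow_le_pow_right₀ hE1 (by omega)
  have hG : (I.G : ℝ) ≤ E ^ (5 + 12 * I.K ^ 2) := by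
    unfold Inst.G
    push_cast
    rw [pow_add]
    gcongr
  have hS : (I.stageInv : ℝ) ≤ I.I1 * E ^ (31 * I.K ^ 2 * (I.K * I.t)) := by
    unfold Inst.stageInv
    push_cast
    calc (I.I1 : ℝ) * I.K * I.G * 2 * (I.B : ℝ) ^ (I.K * I.t)
        ≤ I.I1 * E ^ I.K * E ^ (5 + 12 * I.K ^ 2) * E * (E ^ (12 * I.K ^ 2)) ^ (I.K * I.t) := by
          gcongr
      _ = I.I1 * E ^ (I.K + (5 + 12 * I.K ^ 2) + 1 + 12 * I.K ^ 2 * (I.K * I.t)) := by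
          rw [← pow_mul, pow_add, pow_add, pow_add, pow_one]; ring
      _ ≤ _ := by
          refine mul_le_mul_of_nonneg_left (pow_le_pow_right₀ hE1 ?_) (Nat.cast_nonneg _)
          have h1 : I.K ^ 2 ≤ I.K ^ 2 * (I.K * I.t) := Nat.le_mul_of_pos_right _ hKt
          have h2 : ∀ a, a * I.K ^ 2 * (I.K * I.t) = a * (I.K ^ 2 * (I.K * I.t)) := fun a =>
            mul_assoc _ _ _
          rw [h2, h2]
          omega
  unfold Inst.trials
  push_cast
  calc 2 * (I.stageInv : ℝ) ^ I.K ≤ 2 * (I.I1 * E ^ (31 * I.K ^ 2 * (I.K * I.t))) ^ I.K := by gcongr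
    _ = _ := by
        rw [mul_pow, ← pow_mul, ← mul_assoc,
          show 31 * I.K ^ 2 * (I.K * I.t) * I.K = 31 * I.K ^ 3 * (I.K * I.t) by ring]

/-- The running time, without the powers of the logarithm of `d` estimated. -/
theorem Inst.time_le_pow (hE : 2 ≤ E) (hm : (I.m : ℝ) ≤ 15 * E) (hk : I.K = 2 ^ k) {c q : ℕ}
    (hq : q ≤ 2 ^ (c * k)) :
    ((9001 * (I.trials * (I.K * (I.trials * (I.n * I.d) * (q + 1)))) : ℕ) : ℝ) ≤
      (I.I1 : ℝ) ^ (2 * I.K) * (I.n * I.d) * E ^ ((80 + c) * (I.K ^ 3 * (I.K * I.t))) := by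
  have hK := I.hK
  have ht := I.t_pos
  have hKt : 1 ≤ I.K * I.t := Nat.mul_pos hK ht
  have hE1 : (1 : ℝ) ≤ E := by linarith
  have hE0 : (0 : ℝ) ≤ E := by linarith
  have two : ∀ j : ℕ, (2 : ℝ) ^ j ≤ E ^ j := fun j => pow_le_pow_left₀ (by norm_num) hE j
  have hKE : (I.K : ℝ) ≤ E ^ I.K :=
    le_trans (by exact_mod_cast Nat.lt_two_pow_self.le) (two _)
  have hqE : ((q + 1 : ℕ) : ℝ) ≤ E ^ (c * I.K + 1) := by
    have h1 : q + 1 ≤ 2 ^ (c * I.K + 1) := by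
      have h2 : 2 ^ (c * k) ≤ 2 ^ (c * I.K) :=
        Nat.pow_le_pow_right (by omega) (Nat.mul_le_mul_left _ (hk ▸ Nat.lt_two_pow_self.le))
      have := Nat.two_pow_pos (c * I.K)
      rw [pow_succ]; omega
    exact le_trans (by exact_mod_cast h1) (two _)
  have hT := I.trials_le_pow hE hm
  obtain ⟨x, hx⟩ : ∃ x, x = 31 * I.K ^ 3 * (I.K * I.t) := ⟨_, rfl⟩
  rw [← hx] at hT
  calc ((9001 * (I.trials * (I.K * (I.trials * (I.n * I.d) * (q + 1)))) : ℕ) : ℝ)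
      = 9001 * (I.trials * (I.K * (I.trials * (I.n * I.d) * ((q + 1 : ℕ) : ℝ)))) :=
          by push_cast; ring
    _ ≤ 9001 * ((2 * (I.I1 : ℝ) ^ I.K * E ^ x) * (E ^ I.K *
        ((2 * (I.I1 : ℝ) ^ I.K * E ^ x) * (I.n * I.d) * E ^ (c * I.K + 1)))) := by gcongr
    _ = 36004 * ((I.I1 : ℝ) ^ (2 * I.K) * (I.n * I.d) * E ^ (x + I.K + x + (c * I.K + 1))) := by
        rw [pow_add, pow_add, pow_add, mul_comm 2 I.K, pow_mul]; ring
    _ ≤ E ^ 16 * ((I.I1 : ℝ) ^ (2 * I.K) * (I.n * I.d) * E ^ (x + I.K + x + (c * I.K + 1))) := by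
        gcongr
        exact le_trans (by norm_num) (two 16)
    _ = (I.I1 : ℝ) ^ (2 * I.K) * (I.n * I.d) * E ^ (16 + (x + I.K + x + (c * I.K + 1))) := by
        rw [pow_add E 16]; ring
    _ ≤ _ := by
        refine mul_le_mul_of_nonneg_left (pow_le_pow_right₀ hE1 ?_) (by positivity)
        have h1 : I.K ≤ I.K ^ 3 * (I.K * I.t) :=
          (Nat.le_self_pow (by omega) _).trans (Nat.le_mul_of_pos_right _ hKt)
        have h2 : c * I.K ≤ c * (I.K ^ 3 * (I.K * I.t)) := Nat.mul_le_mul_left _ h1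
        have h3 : (80 + c) * (I.K ^ 3 * (I.K * I.t)) = 80 * (I.K ^ 3 * (I.K * I.t)) +
          c * (I.K ^ 3 * (I.K * I.t)) := add_mul _ _ _
        rw [mul_assoc] at hx
        omega

/-- Compare `a` with `y ^ 0.1`: if `y ≤ a ^ 10`, the product is at most `a ^ 11`, and otherwise `a`
is at most `y ^ 0.1`. With `y = log log d` this trades a power of `log d` for the exponent `1.1` and
a factor that does not depend on `d`. -/
theorem mul_le_rpow_add_pow {a y : ℝ} (ha : 0 ≤ a) (hy : 0 ≤ y) :
    a * y ≤ y ^ (1.1 : ℝ) + a ^ 11 := by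
  have h1 : 0 ≤ y ^ (1.1 : ℝ) := Real.rpow_nonneg hy _
  rcases le_or_gt y (a ^ 10) with h | h
  · calc a * y ≤ a * a ^ 10 := mul_le_mul_of_nonneg_left h ha
      _ = a ^ 11 := by ring
      _ ≤ _ := by linarith
  · have hy0 : 0 < y := lt_of_le_of_lt (by positivity) h
    have h2 : a ≤ y ^ (0.1 : ℝ) := by
      calc a = (a ^ 10) ^ (0.1 : ℝ) := by
            rw [← Real.rpow_natCast, ← Real.rpow_mul ha]; norm_num
        _ ≤ _ := Real.rpow_le_rpow (by positivity) h.le (by norm_num)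
    have h3 : y ^ (1.1 : ℝ) = y ^ (0.1 : ℝ) * y := by
      rw [show (1.1 : ℝ) = 0.1 + 1 by norm_num, Real.rpow_add hy0, Real.rpow_one]
    rw [h3]
    have := mul_le_mul_of_nonneg_right h2 hy
    have : 0 ≤ a ^ 11 := by positivity
    linarith

/-- Powers of the logarithm of `d`. -/
theorem log_pow_le {d : ℕ} (hd : 1 ≤ d) {C : ℝ} (hC : 1 ≤ C) (N : ℕ) :
    ((Nat.clog 2 d + 1 : ℕ) : ℝ) ^ N * d ≤ 2 ^ (2 * N + N ^ 11) *
      (d : ℝ) ^ (1 + C * (Real.logb 2 (Real.logb 2 d)) ^ (1.1 : ℝ) / Real.logb 2 d) := by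
  have hone : (1 : ℝ) ≤ 2 ^ (2 * N + N ^ 11) := one_le_pow₀ (by norm_num)
  -- For `d = 1` the base of the power on the right is `1`, so the default values of the logarithm
  -- and of division by zero do not matter.
  rcases hd.eq_or_lt with rfl | hd2
  · simpa using hone
  have hd0 : (0 : ℝ) < d := by exact_mod_cast hd
  obtain ⟨x, hx⟩ : ∃ x, x = Real.logb 2 d := ⟨_, rfl⟩
  obtain ⟨y, hy⟩ : ∃ y, y = Real.logb 2 x := ⟨_, rfl⟩
  have hx1 : 1 ≤ x := by
    rw [hx, Real.le_logb_iff_rpow_le (by norm_num) hd0, Real.rpow_one]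
    exact_mod_cast hd2
  have hx0 : 0 < x := by linarith
  have hy0 : 0 ≤ y := by rw [hy]; exact Real.logb_nonneg (by norm_num) hx1
  have hxd : (2 : ℝ) ^ x = d := by rw [hx]; exact Real.rpow_logb (by norm_num) (by norm_num) hd0
  have hyx : (2 : ℝ) ^ y = x := by rw [hy]; exact Real.rpow_logb (by norm_num) (by norm_num) hx0
  have hclog : (Nat.clog 2 d : ℝ) ≤ x + 1 := by
    have h1 := Nat.pow_pred_clog_lt_self (b := 2) (by norm_num) hd2
    have h2 : ((Nat.clog 2 d).pred : ℝ) ≤ x := by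
      rw [hx, Real.le_logb_iff_rpow_le (by norm_num) hd0, Real.rpow_natCast]
      exact_mod_cast h1.le
    have h3 : (Nat.clog 2 d : ℝ) ≤ ((Nat.clog 2 d).pred : ℝ) + 1 := by
      exact_mod_cast (by rw [Nat.pred_eq_sub_one]; omega : Nat.clog 2 d ≤ (Nat.clog 2 d).pred + 1)
    linarith
  -- The left side is at most `x + 2`, and `x + 2 ≤ 4 * x` as `x ≥ 1`.
  have hI : ((Nat.clog 2 d + 1 : ℕ) : ℝ) ≤ 2 ^ (2 + y) := by
    rw [Real.rpow_add (by norm_num), hyx]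
    push_cast
    norm_num
    linarith
  have hmain : (N : ℝ) * y ≤ C * y ^ (1.1 : ℝ) + (N : ℝ) ^ 11 := by
    have h1 := mul_le_rpow_add_pow (Nat.cast_nonneg N) hy0
    have h2 : 0 ≤ y ^ (1.1 : ℝ) := Real.rpow_nonneg hy0 _
    nlinarith
  rw [← hx, ← hy, Real.rpow_add hd0, Real.rpow_one]
  -- As `d = 2 ^ x`, the division by `log d` in the exponent cancels.
  have hpow : (d : ℝ) ^ (C * y ^ (1.1 : ℝ) / x) = 2 ^ (C * y ^ (1.1 : ℝ)) := by
    rw [← hxd, ← Real.rpow_mul (by norm_num)]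
    congr 1
    field_simp
  rw [hpow]
  calc ((Nat.clog 2 d + 1 : ℕ) : ℝ) ^ N * d ≤ (2 ^ (2 + y)) ^ N * d := by gcongr
    _ = (2 : ℝ) ^ ((2 + y) * N) * d := by rw [← Real.rpow_natCast, ← Real.rpow_mul (by norm_num)]
    _ ≤ (2 : ℝ) ^ (((2 * N + N ^ 11 : ℕ) : ℝ) + C * y ^ (1.1 : ℝ)) * d := by
        gcongr
        · norm_num
        · push_cast; linarith
    _ = _ := by rw [Real.rpow_add (by norm_num), Real.rpow_natCast]; ring

/-- The constant in the exponent of the running time. -/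
def timeConst (c : ℕ) : ℕ := 11 + (2700 * (80 + c) + 3000)

theorem Inst.time_le_timeBound {ε : ℝ} (hε0 : 0 < ε) (hε : ε < 1 / 2)
    (hm : (I.m : ℝ) ≤ 15 * (1 / ε)) (hk : I.K = 2 ^ k) (hk1 : 1 ≤ k) {c q : ℕ}
    (hq : q ≤ 2 ^ (c * k)) :
    ((9001 * (I.trials * (I.K * (I.trials * (I.n * I.d) * (q + 1)))) : ℕ) : ℝ) ≤
      timeBound (timeConst c) ε k I.n I.d := by
  obtain ⟨E, hEdef⟩ : ∃ E, E = 1 / ε := ⟨_, rfl⟩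
  have hE : 2 ≤ E := by
    rw [hEdef, le_div_iff₀ hε0]; linarith
  have hE0 : 0 < E := by linarith
  have hE1 : 1 ≤ E := by linarith
  rw [← hEdef] at hm
  have h1 := I.time_le_pow hE hm hk hq
  have h2 := log_pow_le I.hd (C := timeConst c) (by exact_mod_cast (by unfold timeConst; omega))
    (2 * I.K)
  refine h1.trans ?_
  unfold timeBound
  obtain ⟨L, hL⟩ : ∃ L, L = (I.d : ℝ) ^ (1 + (timeConst c : ℝ) *
    (Real.logb 2 (Real.logb 2 I.d)) ^ (1.1 : ℝ) / Real.logb 2 I.d) := ⟨_, rfl⟩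
  rw [← hL] at h2 ⊢
  have hL0 : 0 ≤ L := by rw [hL]; positivity
  have hI1 : I.I1 = Nat.clog 2 I.d + 1 := rfl
  rw [← hEdef]
  obtain ⟨x, hx⟩ : ∃ x, x = (80 + c) * (I.K ^ 3 * (I.K * I.t)) := ⟨_, rfl⟩
  obtain ⟨z, hz⟩ : ∃ z, z = 2 * (2 * I.K) + (2 * I.K) ^ 11 := ⟨_, rfl⟩
  rw [← hx]
  rw [← hz] at h2
  have hKR : (1 : ℝ) ≤ I.K := by exact_mod_cast I.hK
  -- Both exponents are numerical multiples of `K ^ 11 * E ^ 2`. The power `11` stems from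
  -- `log_pow_le`, `2700 = 12 * 15 ^ 2` from `t`, and `3000` covers `4 + 2 ^ 11`.
  have hexp : ((z + x : ℕ) : ℝ) ≤ (2 : ℝ) ^ ((timeConst c : ℝ) * k) / ε ^ 2 := by
    have e1 : (2 : ℝ) ^ ((timeConst c : ℝ) * k) / ε ^ 2 =
        (I.K : ℝ) ^ 11 * (I.K : ℝ) ^ (2700 * (80 + c) + 3000) * E ^ 2 := by
      have : (2 : ℝ) ^ ((timeConst c : ℝ) * k) = (I.K : ℝ) ^ timeConst c := by
        rw [hk, ← Nat.cast_mul, Real.rpow_natCast, Nat.cast_pow, Nat.cast_ofNat, ← pow_mul,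
          mul_comm k]
      rw [this, ← pow_add, hEdef]
      unfold timeConst
      field_simp
    -- The numerical factor is turned into a power of `K`. This needs `K ≥ 2`, hence `k ≥ 1`.
    have hc : ((2700 * (80 + c) + 3000 : ℕ) : ℝ) ≤ (I.K : ℝ) ^ (2700 * (80 + c) + 3000) := by
      have h3 : 2 ≤ I.K := by
        rw [hk]; exact Nat.le_self_pow (by omega) 2
      have h4 : 2700 * (80 + c) + 3000 < I.K ^ (2700 * (80 + c) + 3000) := Nat.lt_pow_self h3
      exact_mod_cast h4.le
    have hx' : (x : ℝ) ≤ (2700 * (80 + c)) * ((I.K : ℝ) ^ 11 * E ^ 2) := by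
      have h3 : (I.m : ℝ) ^ 2 ≤ (15 * E) ^ 2 := by gcongr
      have h4 : (I.K : ℝ) ^ 5 ≤ (I.K : ℝ) ^ 11 := pow_le_pow_right₀ hKR (by norm_num)
      rw [hx]
      unfold Inst.t
      push_cast
      calc (80 + c : ℝ) * ((I.K : ℝ) ^ 3 * (I.K * (12 * I.K * (I.m : ℝ) ^ 2)))
          = (80 + c) * 12 * ((I.K : ℝ) ^ 5 * (I.m : ℝ) ^ 2) := by ring
        _ ≤ (80 + c) * 12 * ((I.K : ℝ) ^ 11 * (15 * E) ^ 2) := by gcongr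
        _ = _ := by ring
    have hz' : (z : ℝ) ≤ 3000 * ((I.K : ℝ) ^ 11 * E ^ 2) := by
      have h3 : (I.K : ℝ) ≤ (I.K : ℝ) ^ 11 := le_self_pow₀ hKR (by norm_num)
      have h4 : (1 : ℝ) ≤ E ^ 2 := one_le_pow₀ hE1
      have h5 : (I.K : ℝ) ^ 11 ≤ (I.K : ℝ) ^ 11 * E ^ 2 := le_mul_of_one_le_right (by positivity) h4
      rw [hz]
      push_cast
      rw [mul_pow]
      norm_num
      linarith
    rw [e1]
    calc ((z + x : ℕ) : ℝ) ≤ ((2700 * (80 + c) + 3000 : ℕ) : ℝ) * ((I.K : ℝ) ^ 11 * E ^ 2) := by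
          push_cast; linarith
      _ ≤ (I.K : ℝ) ^ (2700 * (80 + c) + 3000) * ((I.K : ℝ) ^ 11 * E ^ 2) := by gcongr
      _ = _ := by ring
  calc (I.I1 : ℝ) ^ (2 * I.K) * (I.n * I.d) * E ^ x
      = ((Nat.clog 2 I.d + 1 : ℕ) : ℝ) ^ (2 * I.K) * I.d * I.n * E ^ x := by rw [hI1]; ring
    _ ≤ (2 ^ z * L) * I.n * E ^ x := by gcongr
    _ ≤ (E ^ z * L) * I.n * E ^ x := by gcongr
    _ = E ^ ((z + x : ℕ) : ℝ) * I.n * L := by rw [Real.rpow_natCast, pow_add]; ring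
    _ ≤ _ := by
        gcongr

end bounds

end GenBinary

/-! ### The theorem -/

theorem mainTheorem2 (c : ℕ) :
    ∃ C : ℝ, 0 < C ∧ ∀ ε : ℝ, 0 < ε → ε < 1 / 2 →
      ∃ P : GenBinary.Prog,
        ∀ (n d k : ℕ), 1 ≤ d → d ≤ n → 1 ≤ k →
        ∀ (A : Matrix (Fin n) (Fin d) Bool)
          (ip : (Fin k → Bool) → (Fin k → Bool) → ℝ)
          (queryTime : ℕ), queryTime ≤ 2 ^ (c * k) →
          ∃ μ : PMF (GenBinary.State × ℕ),
            GenBinary.Exec ⟨⌊GenBinary.timeBound C ε k n d⌋₊, ip, queryTime⟩ P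
              (GenBinary.inputState k A) μ ∧
            (∀ s ∈ μ.support, (s.2 : ℝ) ≤ GenBinary.timeBound C ε k n d) ∧
            2 / 3 ≤ μ.toOuterMeasure {s | GenBinary.IsApprox (1 + ε) ip A s.1} := by
  refine ⟨GenBinary.timeConst c, by exact_mod_cast (by unfold GenBinary.timeConst; omega),
    fun ε hε0 hε => ?_⟩
  have hinv : 2 ≤ 1 / ε := by rw [le_div_iff₀ hε0]; linarith
  have hceil : 1 / ε ≤ ⌈1 / ε⌉₊ := Nat.le_ceil _
  have hpos : 1 ≤ ⌈1 / ε⌉₊ := Nat.one_le_iff_ne_zero.2 fun h => by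
    rw [h] at hceil; norm_num at hceil; linarith
  -- The accuracy parameter `m = 10 ⌈1 / ε⌉` satisfies `m ε ≥ 10` for the approximation ratio, and
  -- `m ≤ 15 / ε` for the running time because `1 / ε ≥ 2`. The program depends on `ε` only.
  refine ⟨GenBinary.program (10 * ⌈1 / ε⌉₊), fun n d k hd hdn hk A ip q hq => ?_⟩
  refine GenBinary.exists_exec (by omega) hd hdn ?_ _ A fun I hm hn hId hK => ?_
  · push_cast
    have := (div_le_iff₀ hε0).1 hceil
    linarith
  · have hle := I.time_le_timeBound (k := k) hε0 hε (by
      rw [hm]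
      push_cast
      have := Nat.ceil_lt_add_one (by linarith : 0 ≤ 1 / ε)
      linarith) hK hk hq
    rw [hn, hId] at hle ⊢
    have hX1 : 1 ≤ I.trials := by have := I.stageInv_le; have := I.stageInv_pos; omega
    have hnd : 1 ≤ n * d := Nat.mul_pos (hd.trans hdn) hd
    have h1 : I.trials * (n * d) ≤ I.trials * (I.K * (I.trials * (n * d) * (q + 1))) :=
      calc I.trials * (n * d) ≤ I.trials * (n * d) * (q + 1) := Nat.le_mul_of_pos_right _ (by omega)
        _ ≤ I.K * (I.trials * (n * d) * (q + 1)) := Nat.le_mul_of_pos_left _ I.hK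
        _ ≤ _ := Nat.le_mul_of_pos_left _ hX1
    have h2 : 1 ≤ I.trials * (n * d) := Nat.mul_pos hX1 hnd
    refine ⟨le_trans (by exact_mod_cast Nat.mul_le_mul_right _ (by norm_num)) hle, ?_⟩
    -- The same estimate supplies the word bound: the integer majorant of the running time is at
    -- most `⌊T⌋` and exceeds `1000 * (trials * (n * d))`.
    refine lt_of_lt_of_le ?_ (Nat.le_floor hle)
    omega
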